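/- **Setting.** For even $L\in\mathbb N$ let $\Gamma_L=(\mathbb Z/L\mathbb Z)^2$ with its graph distance, each coordinate being identified with an element of $\{-L/2+1,\dots,L/2\}$. Put $\eta=\{0\le x_2<L/2\}$, $\eta_-=\{x_2=0\}$, $\nu=\{0\le x_1<L/2\}$, $\nu_-=\{x_1=0\}$, $\nu_+=\{x_1=L/2-1\}$, and let $Z_{(r)}$ be the set of points at distance at most $r$ from $Z$. Operators act on the antisymmetric Fock space $\mathcal F_a(\ell^2(\Gamma_L))$; an operator is supported in $X$ if it is an even polynomial in $a_x,a_x^*$, $x\in X$. An extensive observable of range $R$ is given by self-adjoint terms $\Psi(X)$, $X\subset\Gamma_L$, supported in $X$, vanishing if $\mathrm{diam}X>R$, and bounded in norm uniformly in $X$ and $L$. A family $O_L$ is almost supported in $Z_L$ if there are $O_{L,r}$ supported in $(Z_L)_{(r)}$ such that for every $k$ there is $C_k$ with $\|O_L-O_{L,r}\|\le C_k(1+\|O_L\|)|Z_L|r^{-k}$ for all even $L$ and all $r\ge1$. $\mathcal O(L^{-\infty})$ means: bounded by $C_kL^{-k}$ for every $k$, for all even $L>L_0$. Let $q(X)$ be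 an extensive observable of range $R_q$ with mutually commuting terms of integer spectrum, $Q_S=\sum_{Z\subset S}q(Z)$, $Q=Q_\nu$. Let $H=\sum_X\Phi(X)$ be an extensive observable of range $R_\Phi$ with $[\Phi(X),Q_{\Gamma_L}]=0$ for all $X$. Fix an integer $r\ge0$ with $r\ge R_\Phi+R_q-1$. The twist Hamiltonian is $H_\phi=\sum_X\Phi_\phi(X)$, with $\Phi_\phi(X)=e^{i\phi Q_\eta}\Phi(X)e^{-i\phi Q_\eta}$ if $X\cap(\eta_-)_{(r)}\ne\emptyset$ and $\Phi_\phi(X)=\Phi(X)$ otherwise. The twist-antitwist Hamiltonian is $\tilde H_\phi=e^{i\phi Q_\eta}He^{-i\phi Q_\eta}$, and $$(\partial_\phi\tilde H_\phi)_-=\sum_{X\cap(\eta_-)_{(r)}\neq\emptyset}\partial_\phi\big(e^{i\phi Q_\eta}\Phi(X)e^{-i\phi Q_\eta}\big).$$ Let $\phi\in C^\infty$ with $\phi(0)=0$, $\phi(1)=2\pi$, $\phi'\ge0$ compactly supported in $(0,1)$. Assume that there are $\gamma>0$, $p\in\mathbb N$ and $L_0$ such that for all even $L>L_0$ and $s\in[0,1]$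 the lowest eigenvalue of $H_{\phi(s)}$ has multiplicity $p$ and is separated by at least $\gamma$ from the rest of the spectrum. Let $W:\mathbb R\to\mathbb R$ be integrable with $|W(u)|=\mathcal O(|u|^{-\infty})$ as $|u|\to\infty$ and $\int W(u)e^{iuw}du=i/w$ for all $|w|\ge\gamma$. Let $P$ be the ground state projection of $H$, $E_0$ its lowest eigenvalue, and let $$\sigma_{\mathrm H}=\tfrac2p\,\mathrm{Im}\,\mathrm{Tr}\big(P\,J_\eta\,(H-E_0)^{-2}(1-P)\,J_\nu\big)$$ be the Hall conductance at zero flux given by Kubo's formula (in units in which the flux quantum is $2\pi$), where $J_\eta=\partial_\phi H_\phi|_{\phi=0}$ and $J_\nu$ is defined in the same way with $(\nu,\nu_-)$ in place of $(\eta,\eta_-)$. **Proposition.** Let $U_\parallel(s)$ solve $\partial_sU_\parallel(s)=iK_sU_\parallel(s)$, $U_\parallel(0)=1$, on $[0,1]$, where $$K_s=\int W(u)\,e^{iuH_{\phi(s)}}\,\big(\partial_sH_{\phi(s)}\big)\,e^{-iuH_{\phi(s)}}\,du,$$ let $U_\parallel=U_\parallel(1)$, and let $$\tilde K_-=\int W(u)\,e^{iu\tilde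 H_\phi}(\partial_\phi\tilde H_\phi)_-e^{-iu\tilde H_\phi}\,du\,\Big|_{\phi=0}.$$ Then, in operator norm, $$U_\parallel=e^{2\pi i(\tilde K_--Q_\eta)}+\mathcal O(L^{-\infty}).$$ Moreover, the charge transport operator can be written as $U_\parallel^*QU_\parallel-Q=T_{\parallel,-}+T_{\parallel,+}$ with $T_{\parallel,\pm}$ almost supported in $\nu_\pm$ and $\mathrm{Tr}\,T_{\parallel,-}=0$, and for every such decomposition $$\mathrm{Tr}(P\,T_{\parallel,-})=2\pi p\,\sigma_{\mathrm H}+\mathcal O(L^{-\infty}),$$ and $\mathrm{Tr}(P\,T_{\parallel,-})$ is an integer up to $\mathcal O(L^{-\infty})$. -/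

import Mathlib

open scoped ContDiff

noncomputable section

namespace HallPump

/-! ### The discrete torus -/

/-- The vertices of the discrete torus `ℤ_L × ℤ_L`. -/
abbrev Torus (L : ℕ) : Type := ZMod L × ZMod L

/-- The graph distance of the discrete torus. -/
def gdist {L : ℕ} (x y : Torus L) : ℕ :=
  (x.1 - y.1).valMinAbs.natAbs + (x.2 - y.2).valMinAbs.natAbs

section Space

variable {L : ℕ} [NeZero L]

open Classical in
/-- The `r`-fattening `{x : dist(x, Z) ≤ r}`. -/
def fatten (Z : Finset (Torus L)) (r : ℕ) : Finset (Torus L) :=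
  {x | ∃ z ∈ Z, gdist x z ≤ r}

end Space

/-- The horizontal strip `{0 ≤ x₂ < L/2}`. -/
def eta (L : ℕ) [NeZero L] : Finset (Torus L) := {x | x.2.val < L / 2}

/-- The boundary line `{x₂ = 0}` of the horizontal strip. -/
def etaMinus (L : ℕ) [NeZero L] : Finset (Torus L) := {x | x.2.val = 0}

/-- The vertical strip `{0 ≤ x₁ < L/2}`. -/
def nu (L : ℕ) [NeZero L] : Finset (Torus L) := {x | x.1.val < L / 2}

/-- The boundary line `{x₁ = 0}` of the vertical strip. -/
def nuMinus (L : ℕ) [NeZero L] : Finset (Torus L) := {x | x.1.val = 0}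

/-- The boundary line `{x₁ = L/2 - 1}` of the vertical strip. -/
def nuPlus (L : ℕ) [NeZero L] : Finset (Torus L) := {x | x.1.val = L / 2 - 1}

/-! ### Fermions on the torus -/

/-- The antisymmetric Fock space over `ℓ²(Torus L)`, in its occupation number basis: the basis
vector of `S` is the state in which exactly the sites in `S` are occupied. -/
def Fock (L : ℕ) : Type := EuclideanSpace ℂ (Finset (Torus L))

instance (L : ℕ) [NeZero L] : NormedAddCommGroup (Fock L) :=
  inferInstanceAs (NormedAddCommGroup (EuclideanSpace ℂ (Finset (Torus L))))

instance (L : ℕ) [NeZero L] : InnerProductSpace ℂ (Fock L) :=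
  inferInstanceAs (InnerProductSpace ℂ (EuclideanSpace ℂ (Finset (Torus L))))

instance (L : ℕ) [NeZero L] : FiniteDimensional ℂ (Fock L) :=
  inferInstanceAs (FiniteDimensional ℂ (EuclideanSpace ℂ (Finset (Torus L))))

instance (L : ℕ) [NeZero L] : CompleteSpace (Fock L) :=
  inferInstanceAs (CompleteSpace (EuclideanSpace ℂ (Finset (Torus L))))

/-- Operators on Fock space, with the operator norm and the adjoint as `star`. -/
abbrev Obs (L : ℕ) [NeZero L] : Type := Fock L →L[ℂ] Fock L

section Operators

variable {L : ℕ} [NeZero L]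

/-- An enumeration of the sites; it fixes the signs of the annihilation operators. -/
def siteIndex (x : Torus L) : ℕ := x.1.val * L + x.2.val

/-- The fermionic annihilation operator at `x`: it maps the basis vector of `S ∋ x` to
`(-1) ^ #{y ∈ S : y before x}` times the basis vector of `S \ {x}`, and the other basis vectors
to zero. -/
def annihilation (x : Torus L) : Obs L :=
  Matrix.toEuclideanCLM (𝕜 := ℂ) (n := Finset (Torus L))
    (Matrix.of fun T S =>
      if x ∈ S ∧ T = S.erase x then
        (-1 : ℂ) ^ (S.filter fun y => siteIndex y < siteIndex x).card
      else 0)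

/-- The annihilation and creation operators at the sites of `Λ`. -/
def generators (Λ : Finset (Torus L)) : Set (Obs L) :=
  {A | ∃ x ∈ Λ, A = annihilation x ∨ A = star (annihilation x)}

/-- The operators supported in `Λ`: the even polynomials in `a_x`, `a_x^*`, `x ∈ Λ`. -/
def evenAlgebra (Λ : Finset (Torus L)) : Subalgebra ℂ (Obs L) :=
  Algebra.adjoin ℂ {A | ∃ b ∈ generators Λ, ∃ c ∈ generators Λ, A = b * c}

/-- The trace over Fock space. -/
def tr (A : Obs L) : ℂ := LinearMap.trace ℂ (Fock L) (A : Fock L →ₗ[ℂ] Fock L)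

/-- `e^{iθA}` -/
def expI (θ : ℝ) (A : Obs L) : Obs L := NormedSpace.exp ((Complex.I * (θ : ℂ)) • A)

/-- The conjugation `e^{iθA} B e^{-iθA}`. -/
def conjExp (θ : ℝ) (A B : Obs L) : Obs L := expI θ A * B * expI (-θ) A

/-! ### Ground states -/

/-- The lowest eigenvalue of a self-adjoint operator. -/
def groundEnergy (H : Obs L) : ℝ := sInf (spectrum ℝ H)

/-- The eigenspace of the lowest eigenvalue. -/
def groundSpace (H : Obs L) : Submodule ℂ (Fock L) :=
  Module.End.eigenspace (H : Fock L →ₗ[ℂ] Fock L) (groundEnergy H : ℂ)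

/-- The orthogonal projection onto the ground state space. -/
def groundProj (H : Obs L) : Obs L := (groundSpace H).starProjection

/-- The ground state space has dimension `p`, and all other eigenvalues are larger than the
lowest one by at least `γ`. -/
def IsGapped (γ : ℝ) (p : ℕ) (H : Obs L) : Prop :=
  Module.finrank ℂ (groundSpace H) = p ∧
    ∀ e ∈ spectrum ℝ H, e ≠ groundEnergy H → groundEnergy H + γ ≤ e

/-- The reduced resolvent: `(H - E₀)⁻¹` on the orthogonal complement of the ground state space,
and zero on the ground state space. -/
def reducedResolvent (H : Obs L) : Obs L :=
  (1 - groundProj H) * Ring.inverse (H - (groundEnergy H : ℂ) • (1 : Obs L) + groundProj H)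

/-- The quasi-adiabatic generator `∫ W(u) e^{iuH} D e^{-iuH} du`. -/
def quasiAdiabatic (W : ℝ → ℝ) (H D : Obs L) : Obs L :=
  ∫ u : ℝ, (W u : ℂ) • conjExp u H D

/-! ### Twist Hamiltonians

In this section `q` and `Φ` are the local terms of the charge and of the Hamiltonian, `S` is a
strip (`eta` or `nu`) and `l` is one of its boundary lines (`etaMinus` or `nuMinus`). -/

variable (q Φ : Finset (Torus L) → Obs L) (S l : Finset (Torus L)) (r : ℕ)

/-- The charge in `S`. -/
def charge : Obs L := ∑ Z ∈ S.powerset, q Z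

/-- The Hamiltonian without flux. -/
def hamiltonian : Obs L := ∑ X, Φ X

open Classical in
/-- The local terms of the twist Hamiltonian: the terms in the vicinity of the line `l`, namely
those whose set `X` meets the `r`-fattening of `l`, are gauge transformed. -/
def twistTerm (ϕ : ℝ) (X : Finset (Torus L)) : Obs L :=
  if (X ∩ fatten l r).Nonempty then conjExp ϕ (charge q S) (Φ X) else Φ X

/-- The twist Hamiltonian `H_ϕ`, describing a flux `ϕ`. -/
def twistHamiltonian (ϕ : ℝ) : Obs L := ∑ X, twistTerm q Φ S l r ϕ X

/-- The twist-antitwist Hamiltonian `e^{iϕQ_S} H e^{-iϕQ_S}`. -/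
def twistAntitwist (ϕ : ℝ) : Obs L := conjExp ϕ (charge q S) (hamiltonian Φ)

open Classical in
/-- The part near the line `l` of the `ϕ`-derivative of the twist-antitwist Hamiltonian. -/
def twistAntitwistDerivMinus (ϕ : ℝ) : Obs L :=
  ∑ X with (X ∩ fatten l r).Nonempty, deriv (fun t : ℝ => conjExp t (charge q S) (Φ X)) ϕ

/-- The quasi-adiabatic generator built from the part near `l` of the `ϕ`-derivative of the
twist-antitwist Hamiltonian. -/
def twistAntitwistGenMinus (W : ℝ → ℝ) (ϕ : ℝ) : Obs L :=
  quasiAdiabatic W (twistAntitwist q Φ S ϕ) (twistAntitwistDerivMinus q Φ S l r ϕ)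

/-- The generator `K_s` of parallel transport for the driven twist Hamiltonian `H_{φ(s)}`. -/
def parallelGen (W φ : ℝ → ℝ) (s : ℝ) : Obs L :=
  quasiAdiabatic W (twistHamiltonian q Φ S l r (φ s))
    (deriv (fun t => twistHamiltonian q Φ S l r (φ t)) s)

/-- `U` solves `∂_s U(s) = i K_s U(s)` on `[0,1]` with `U(0) = 1`. -/
def IsParallelTransport (W φ : ℝ → ℝ) (U : ℝ → Obs L) : Prop :=
  U 0 = 1 ∧ ∀ s ∈ Set.Icc (0 : ℝ) 1,
    HasDerivWithinAt U (Complex.I • (parallelGen q Φ S l r W φ s * U s)) (Set.Icc 0 1) s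

/-- The current operator `∂_ϕ H_ϕ` at zero flux. -/
def current : Obs L := deriv (twistHamiltonian q Φ S l r) 0

/-- The Hall conductance of the system without flux, given by Kubo's formula
`σ_H = (2/p) Im Tr(P J_η (H - E₀)⁻² J_ν P)` with the inverse taken on the range of `1 - P`. -/
def hallConductance : ℝ :=
  2 / (Module.finrank ℂ (groundSpace (hamiltonian Φ)) : ℝ) *
    (tr (groundProj (hamiltonian Φ) * current q Φ (eta L) (etaMinus L) r *
      reducedResolvent (hamiltonian Φ) * reducedResolvent (hamiltonian Φ) *
      current q Φ (nu L) (nuMinus L) r)).im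

end Operators

/-! ### Families indexed by the size of the system -/

/-- The local terms `Ψ(X)` define, for all even sizes `L`, an extensive observable of range `R`:
they are self-adjoint, supported in `X`, of finite range, and of bounded strength, uniformly
in `L`. -/
structure IsExtensive (R : ℕ) (Ψ : ∀ (L : ℕ) [NeZero L], Finset (Torus L) → Obs L) : Prop where
  selfAdjoint : ∀ (L : ℕ) [NeZero L], Even L → ∀ X, IsSelfAdjoint (Ψ L X)
  supported : ∀ (L : ℕ) [NeZero L], Even L → ∀ X, Ψ L X ∈ evenAlgebra X
  finiteRange : ∀ (L : ℕ) [NeZero L], Even L → ∀ X, (∃ x ∈ X, ∃ y ∈ X, R < gdist x y) → Ψ L X = 0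
  bounded : ∃ m : ℝ, ∀ (L : ℕ) [NeZero L], Even L → ∀ X, ‖Ψ L X‖ ≤ m

/-- The local terms of a charge: an extensive observable whose local terms have integer spectrum
and commute with each other. -/
structure IsCharge (R : ℕ) (q : ∀ (L : ℕ) [NeZero L], Finset (Torus L) → Obs L) : Prop
    extends IsExtensive R q where
  integral : ∀ (L : ℕ) [NeZero L], Even L → ∀ X,
    spectrum ℂ (q L X) ⊆ Set.range fun n : ℤ => (n : ℂ)
  commute : ∀ (L : ℕ) [NeZero L], Even L → ∀ X Y, Commute (q L X) (q L Y)

/-- The local terms commute with the total charge. -/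
def IsChargeConserving (q Ψ : ∀ (L : ℕ) [NeZero L], Finset (Torus L) → Obs L) : Prop :=
  ∀ (L : ℕ) [NeZero L], Even L → ∀ X, Commute (Ψ L X) (charge (q L) Finset.univ)

/-- `f = O(L^{-∞})`, along the even sizes `L > L₀`. -/
def IsRapidlySmall (L₀ : ℕ) (f : ∀ (L : ℕ) [NeZero L], ℝ) : Prop :=
  ∀ k : ℕ, ∃ C : ℝ, ∀ (L : ℕ) [NeZero L], Even L → L₀ < L → |f L| ≤ C / (L : ℝ) ^ k

/-- The family `O` is almost supported in the family of sets `Z`: it can be approximated by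
operators supported in the `r`-fattening of `Z`, up to an error that decays faster than any power
of `r`, uniformly in `L`. -/
def IsAlmostSupported (Z : ∀ (L : ℕ) [NeZero L], Finset (Torus L))
    (O : ∀ (L : ℕ) [NeZero L], Obs L) : Prop :=
  ∃ A : ∀ (L : ℕ) [NeZero L], ℕ → Obs L,
    (∀ (L : ℕ) [NeZero L], Even L → ∀ r, A L r ∈ evenAlgebra (fatten (Z L) r)) ∧
    ∀ k : ℕ, ∃ C : ℝ, ∀ (L : ℕ) [NeZero L], Even L → ∀ r : ℕ, 1 ≤ r →
      ‖O L - A L r‖ ≤ C * (1 + ‖O L‖) * ((Z L).card : ℝ) / (r : ℝ) ^ k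

/-- `T = T₋ + T₊` is the splitting of a charge transport operator into its contributions across
the two boundary lines of the vertical strip. The trace condition fixes the additive constant
that could otherwise be moved from one contribution to the other; it holds for time integrals of
commutators. -/
structure IsTransportSplitting (T Tm Tp : ∀ (L : ℕ) [NeZero L], Obs L) : Prop where
  add : ∀ (L : ℕ) [NeZero L], Even L → T L = Tm L + Tp L
  minus : IsAlmostSupported (fun L => nuMinus L) Tm
  plus : IsAlmostSupported (fun L => nuPlus L) Tp
  traceless : ∀ (L : ℕ) [NeZero L], Even L → tr (Tm L) = 0

/-- A real filter function for quasi-adiabatic evolution with gap `γ`: it is integrable, decays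
faster than any power, and its Fourier transform is `i/w` for `|w| ≥ γ`. -/
structure IsFilterFunction (γ : ℝ) (W : ℝ → ℝ) : Prop where
  integrable : MeasureTheory.Integrable W
  decay : ∀ k : ℕ, ∃ C : ℝ, ∀ u : ℝ, 1 ≤ |u| → |W u| ≤ C / |u| ^ k
  fourier : ∀ w : ℝ, γ ≤ |w| →
    ∫ u : ℝ, (W u : ℂ) * Complex.exp (Complex.I * (u : ℂ) * (w : ℂ)) = Complex.I / (w : ℂ)

/-- A smooth driving protocol that threads one flux quantum, with `φ'` compactly supported
in `(0,1)`. -/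
structure IsDriving (φ : ℝ → ℝ) : Prop where
  smooth : ContDiff ℝ ∞ φ
  zero : φ 0 = 0
  one : φ 1 = 2 * Real.pi
  mono : ∀ s, 0 ≤ deriv φ s
  supp : tsupport (deriv φ) ⊆ Set.Ioo 0 1

end HallPump

end

set_option linter.unusedSectionVars false
set_option linter.unusedSimpArgs false

noncomputable section

open scoped Real Complex
open Finset Complex

/-! The idea is to pass to a rotating frame. Conjugation with $e^{i\phi Q_\eta}$ turns $H_\phi$ into
an operator that is untouched near $\eta_-$ and twisted only near the opposite edge of $\eta$
(`twistHamiltonian_eq`, `plusTwist`); the reason is charge conservation, since a term whose current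
does not vanish must sit at an edge of the strip. The generator at $\eta_-$ does not feel a change
at the distant edge, up to $\mathcal O(L^{-\infty})$ (`rapidEq_minusGen`), so in the rotating frame
parallel transport has the constant generator $G=\tilde K_--Q_\eta$. As $e^{2\pi iQ_\eta}=1$, going
back to the original frame after a full flux quantum costs nothing (`rapidEq_parallel`).

Locality is measured by `osc`, the size of the commutators with the fermion operators at one site.
Averaging over Majorana operators (`twirl`) converts small oscillations into approximation by even
operators with smaller support. Lieb-Robinson bounds propagate the oscillations: with exponential
weights for finite range Hamiltonians, which the filter $W$ turns into polynomial tails, and with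
polynomial weights for the resulting quasi-local generators at bounded times.

The generator is split as $G=G_l+G_r$ with respect to the sites closer to $\nu_-$ or to $\nu_+$. The
commutator $[Q_\nu,G_l]$ lives near $\nu_-$, so conjugating $Q_\nu$ by the flow of $G_l$ produces a
candidate for $T_{\parallel,-}$, traceless because conjugation preserves the trace; the rest lives
near $\nu_+$. Any other admissible splitting differs by an operator localized at both distant lines,
hence nearly a scalar, hence nearly zero by the trace condition (`norm_le_of_traceless`,
`rapid_splitting_sub`).

For Kubo's formula, $\mathrm{Tr}(PT_{\parallel,-})$ is the integral over $[0,2\pi]$ of the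
expectation of $i[Q_\nu,G_l]$ in the flow. This expectation is nearly constant: the flow of $G$
transports the twisted ground state projections (`rapid_groundProj_transport`), and $G$ differs from
an operator preserving them by small and far away terms (`rapid_tr_transport`). At flux zero,
dressing $Q_\nu$ by its quasi-adiabatic generators makes it preserve $P$, which replaces the
commutator by one of two quasi-adiabatic generators; off the diagonal blocks these are the currents
divided by energy differences (`IsGapped.tr_cm_quasiAdiabatic`).

For integrality, let $D_-$ be $Q_\nu$ dressed only at $\nu_-$ and $A=e^{2\pi iD_-}$. Since the bare
exponential is $1$, $A$ is localized at $\nu_-$; an energy argument shows that it preserves $P$,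
because its product with the analogous unitary at $\nu_+$ does. So does $V=e^{2\pi iG}$, since the
twist disappears at flux $2\pi$. The group commutator $V^*AVA^*$ therefore has determinant nearly
$1$ on the ground states. The same determinant is nearly $e^{2\pi i\mathrm{Tr}(PX)}$, where $X$ is
the change of $D_-$ under the flow of $G_l$, whose expectation agrees with that of
$T_{\parallel,-}$. Hence the trace is close to an integer (`rapid_tr_transportMinus_sub_round`). -/

namespace HallPump

/-! ### Fermion operators and the canonical anticommutation relations -/

section Lattice

notation "𝔞" => annihilation
notation:max "Region" L:max => Finset (Torus L)

variable {L : ℕ} [NeZero L]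

/-- The occupation number basis of Fock space. -/
def occ (S : Region L) : Fock L := EuclideanSpace.single S (1 : ℂ)

/-- The sign attached to the site `x` in the configuration `S`. -/
def siteSign (x : Torus L) (S : Region L) : ℂ :=
  (-1 : ℂ) ^ (S.filter fun y => siteIndex y < siteIndex x).card


theorem siteIndex_injective : Function.Injective (siteIndex (L := L)) := by
  rintro ⟨a, b⟩ ⟨c, d⟩ h
  simp only [siteIndex] at h
  have hb := ZMod.val_lt b
  have hd := ZMod.val_lt d
  have h1 : a.val = c.val := by
    have hL := Nat.pos_of_ne_zero (NeZero.ne L)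
    have := congrArg (· / L) h
    simp only [mul_comm _ L, Nat.mul_add_div hL, Nat.div_eq_of_lt hb, Nat.div_eq_of_lt hd] at this
    simpa using this
  have h2 : b.val = d.val := by rw [h1] at h; omega
  exact Prod.ext (ZMod.val_injective L h1) (ZMod.val_injective L h2)

theorem siteSign_mul_self (x : Torus L) (S : Region L) : siteSign x S * siteSign x S = 1 := by
  rw [siteSign, ← mul_pow]; simp

theorem siteSign_insert {x y : Torus L} {S : Region L} (hy : y ∉ S) :
    siteSign x (insert y S) = (if siteIndex y < siteIndex x then -1 else 1) * siteSign x S := by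
  unfold siteSign
  rw [filter_insert]
  split_ifs
  · rw [card_insert_of_notMem (by simp [hy])]; ring
  · simp

theorem siteSign_erase {x y : Torus L} {S : Region L} (hy : y ∈ S) :
    siteSign x (S.erase y) = (if siteIndex y < siteIndex x then -1 else 1) * siteSign x S := by
  conv_rhs => rw [← insert_erase hy, siteSign_insert (notMem_erase y S)]
  split_ifs <;> ring

theorem annihilation_occ (x : Torus L) (S : Region L) :
    𝔞 x (occ S) = if x ∈ S then siteSign x S • occ (S.erase x) else 0 := by
  change (Matrix.toEuclideanCLM (𝕜 := ℂ) (n := Region L) _) (WithLp.toLp 2 (Pi.single S (1:ℂ))) = _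
  rw [Matrix.toEuclideanCLM_toLp, Matrix.mulVec_single_one]
  split_ifs with h
  · refine PiLp.ext fun T => ?_
    change (Matrix.of _).col S T = siteSign x S * (Pi.single (S.erase x) (1:ℂ) : _ → ℂ) T
    simp only [Matrix.col_apply, Matrix.of_apply, Pi.single_apply, siteSign, h, true_and]
    split_ifs <;> simp
  · refine PiLp.ext fun T => ?_
    change (Matrix.of _).col S T = 0
    simp [h]

theorem star_annihilation_occ (x : Torus L) (S : Region L) :
    star (𝔞 x) (occ S) = if x ∈ S then 0 else siteSign x S • occ (insert x S) := by
  have e : star (𝔞 x : Obs L) = (Matrix.toEuclideanCLM (𝕜 := ℂ)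
      (n := Region L) (star (Matrix.of fun T S =>
      if x ∈ S ∧ T = S.erase x then
        (-1 : ℂ) ^ (S.filter fun y => siteIndex y < siteIndex x).card
      else 0)) : Obs L) := by
    rw [map_star]; rfl
  rw [e]
  change (Matrix.toEuclideanCLM (𝕜 := ℂ) (n := Region L) _) (WithLp.toLp 2 (Pi.single S (1:ℂ))) = _
  rw [Matrix.toEuclideanCLM_toLp, Matrix.mulVec_single_one]
  split_ifs with h
  · refine PiLp.ext fun T => ?_
    change (star (Matrix.of _)).col S T = 0
    simp only [Matrix.col_apply, Matrix.star_apply, Matrix.of_apply]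
    rw [if_neg, star_zero]
    rintro ⟨_, rfl⟩
    simp at h
  · refine PiLp.ext fun T => ?_
    change (star (Matrix.of _)).col S T = siteSign x S * (Pi.single (insert x S) (1:ℂ) : _ → ℂ) T
    simp only [Matrix.col_apply, Matrix.star_apply, Matrix.of_apply, Pi.single_apply]
    by_cases hT : T = insert x S
    · subst hT
      have := siteSign_insert (x := x) h
      simp only [lt_irrefl, if_false, one_mul] at this
      simp only [mem_insert, true_or, erase_insert h, and_self, if_true, mul_one]
      rw [← this]; simp [siteSign]
    · rw [if_neg, if_neg hT]
      · simp
      · rintro ⟨h1, h2⟩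
        exact hT (by rw [h2, insert_erase h1])

theorem obs_ext {A B : Obs L} (h : ∀ S, A (occ S) = B (occ S)) : A = B := by
  have := (EuclideanSpace.basisFun (Region L) ℂ).toBasis.ext
    (f₁ := (A : Fock L →ₗ[ℂ] Fock L)) (f₂ := (B : Fock L →ₗ[ℂ] Fock L)) (fun S => by
      rw [OrthonormalBasis.coe_toBasis, EuclideanSpace.basisFun_apply]
      exact h S)
  exact ContinuousLinearMap.coe_injective this

theorem siteIndex_lt_or_gt {x y : Torus L} (h : x ≠ y) :
    (siteIndex x < siteIndex y ∧ ¬ siteIndex y < siteIndex x) ∨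
      (siteIndex y < siteIndex x ∧ ¬ siteIndex x < siteIndex y) := by
  have := siteIndex_injective.ne h
  omega

/-- Of two distinct sites exactly one precedes the other in the enumeration, so removing one site
before the other changes exactly one of the two signs. This is the source of the minus sign. -/
theorem annihilation_anticomm {x y : Torus L} (h : x ≠ y) :
    (𝔞 x : Obs L) * 𝔞 y = -(𝔞 y * 𝔞 x) := by
  refine obs_ext fun S => ?_
  simp only [mul_apply_eq_comp, neg_apply, annihilation_occ]
  by_cases hx : x ∈ S <;> by_cases hy : y ∈ S <;>
    simp [hx, hy, annihilation_occ, h, h.symm, siteSign_erase, erase_right_comm (a := x) (b := y)]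
  rcases siteIndex_lt_or_gt h with ⟨h1, h2⟩ | ⟨h1, h2⟩ <;> simp [h1, h2, smul_smul, mul_comm]

theorem annihilation_star_anticomm {x y : Torus L} (h : x ≠ y) :
    (𝔞 x : Obs L) * star (𝔞 y) = -(star (𝔞 y) * 𝔞 x) := by
  refine obs_ext fun S => ?_
  simp only [mul_apply_eq_comp, neg_apply, annihilation_occ, star_annihilation_occ]
  by_cases hx : x ∈ S <;> by_cases hy : y ∈ S <;>
    simp [hx, hy, annihilation_occ, star_annihilation_occ, h, h.symm, siteSign_erase,
      siteSign_insert]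
  rw [erase_insert_of_ne h.symm]
  rcases siteIndex_lt_or_gt h with ⟨h1, h2⟩ | ⟨h1, h2⟩ <;> simp [h1, h2, smul_smul, mul_comm]

theorem annihilation_sq (x : Torus L) : (𝔞 x : Obs L) * 𝔞 x = 0 := by
  refine obs_ext fun S => ?_
  simp only [mul_apply_eq_comp, annihilation_occ]
  by_cases hx : x ∈ S <;> simp [hx, annihilation_occ]

theorem annihilation_car (x : Torus L) :
    (𝔞 x : Obs L) * star (𝔞 x) + star (𝔞 x) * 𝔞 x = 1 := by
  refine obs_ext fun S => ?_
  simp only [mul_apply_eq_comp, add_apply, annihilation_occ, star_annihilation_occ]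
  by_cases hx : x ∈ S <;> simp [hx, annihilation_occ, star_annihilation_occ, siteSign_insert,
    siteSign_erase, smul_smul, siteSign_mul_self]

theorem mul_mono_left {a b c : ℝ} (h : a ≤ b) (hc : 0 ≤ c := by positivity) : c * a ≤ c * b :=
  mul_le_mul_of_nonneg_left h hc

theorem mul_mono_right {a b c : ℝ} (h : a ≤ b) (hc : 0 ≤ c := by positivity) : a * c ≤ b * c :=
  mul_le_mul_of_nonneg_right h hc

/-! ### Commutators, Majorana operators and oscillations -/

/-- The commutator. -/
def cm (A B : Obs L) : Obs L := A * B - B * A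

theorem add_cm (A B C : Obs L) : cm (A + B) C = cm A C + cm B C := by
  simp only [cm, add_mul, mul_add]; abel

theorem cm_add (A B C : Obs L) : cm A (B + C) = cm A B + cm A C := by
  simp only [cm, add_mul, mul_add]; abel

theorem sub_cm (A B C : Obs L) : cm (A - B) C = cm A C - cm B C := by
  simp only [cm, sub_mul, mul_sub]; abel

theorem cm_sub (A B C : Obs L) : cm A (B - C) = cm A B - cm A C := by
  simp only [cm, sub_mul, mul_sub]; abel

theorem neg_cm (A B : Obs L) : cm (-A) B = -cm A B := by
  simp only [cm, neg_mul, mul_neg]; abel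

theorem cm_neg (A B : Obs L) : cm A (-B) = -cm A B := by
  simp only [cm, neg_mul, mul_neg]; abel

theorem smul_cm (c : ℂ) (A B : Obs L) : cm (c • A) B = c • cm A B := by
  simp only [cm, smul_mul_assoc, mul_smul_comm, smul_sub]

theorem cm_smul (c : ℂ) (A B : Obs L) : cm A (c • B) = c • cm A B := by
  simp only [cm, smul_mul_assoc, mul_smul_comm, smul_sub]

theorem zero_cm (A : Obs L) : cm 0 A = 0 := by simp [cm]

theorem cm_zero (A : Obs L) : cm A 0 = 0 := by simp [cm]

theorem cm_symm (A B : Obs L) : cm A B = -cm B A := by simp [cm]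

theorem cm_eq_zero {A B : Obs L} : cm A B = 0 ↔ Commute A B := by
  rw [cm, sub_eq_zero]; rfl

theorem sum_cm {ι : Type*} (s : Finset ι) (f : ι → Obs L) (B : Obs L) :
    cm (∑ i ∈ s, f i) B = ∑ i ∈ s, cm (f i) B := by
  simp only [cm, sum_mul, mul_sum, sum_sub_distrib]

theorem cm_sum {ι : Type*} (s : Finset ι) (f : ι → Obs L) (B : Obs L) :
    cm B (∑ i ∈ s, f i) = ∑ i ∈ s, cm B (f i) := by
  simp only [cm, sum_mul, mul_sum, sum_sub_distrib]

theorem cm_jacobi (A B C : Obs L) : cm (cm A B) C = cm A (cm B C) - cm B (cm A C) := by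
  simp only [cm]; noncomm_ring

theorem norm_cm_le (A B : Obs L) : ‖(cm A B)‖ ≤ 2 * ‖A‖ * ‖B‖ := by
  rw [cm]
  calc ‖A * B - B * A‖ ≤ ‖A * B‖ + ‖B * A‖ := norm_sub_le _ _
    _ ≤ ‖A‖ * ‖B‖ + ‖B‖ * ‖A‖ := add_le_add (norm_mul_le _ _) (norm_mul_le _ _)
    _ = _ := by ring

/-- The first Majorana operator at `y`. -/
def majorana (y : Torus L) : Obs L := 𝔞 y + star (𝔞 y)

/-- The second Majorana operator at `y`. -/
def majorana' (y : Torus L) : Obs L := I • (𝔞 y - star (𝔞 y))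

theorem star_annihilation_sq (y : Torus L) :
    star (𝔞 y : Obs L) * star (𝔞 y) = 0 := by
  rw [← star_mul, annihilation_sq, star_zero]

theorem majorana_sq (y : Torus L) : majorana y * majorana y = 1 := by
  rw [majorana, ← annihilation_car y]
  simp only [mul_add, add_mul, annihilation_sq, star_annihilation_sq]
  abel

theorem majorana'_sq (y : Torus L) : majorana' y * majorana' y = 1 := by
  rw [majorana', ← annihilation_car y, smul_mul_smul_comm, I_mul_I]
  simp only [mul_sub, sub_mul, annihilation_sq, star_annihilation_sq, neg_smul, one_smul]
  abel

theorem majorana_anticomm (y : Torus L) : majorana' y * majorana y = -(majorana y * majorana' y) := by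
  rw [majorana', majorana, smul_mul_assoc, mul_smul_comm, ← smul_neg]
  congr 1
  simp only [mul_sub, sub_mul, mul_add, add_mul, annihilation_sq, star_annihilation_sq]
  abel

theorem star_majorana (y : Torus L) : star (majorana y) = majorana y := by
  simp [majorana, add_comm]

theorem star_majorana' (y : Torus L) : star (majorana' y) = majorana' y := by
  simp only [majorana', star_smul, star_sub, star_star, star_def, conj_I]
  rw [neg_smul, ← smul_neg, neg_sub]

theorem norm_le_one_of_sq {g : Obs L} (h : star g = g) (h2 : g * g = 1) : ‖g‖ ≤ 1 := by
  have h1 : ‖star g * g‖ = ‖g‖ * ‖g‖ := CStarRing.norm_star_mul_self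
  rw [h, h2] at h1
  have h3 : ‖(1 : Obs L)‖ ≤ 1 := ContinuousLinearMap.norm_id_le
  nlinarith [norm_nonneg g]

theorem norm_majorana_le (y : Torus L) : ‖majorana y‖ ≤ 1 :=
  norm_le_one_of_sq (star_majorana y) (majorana_sq y)

theorem norm_majorana'_le (y : Torus L) : ‖majorana' y‖ ≤ 1 :=
  norm_le_one_of_sq (star_majorana' y) (majorana'_sq y)

theorem annihilation_eq (y : Torus L) :
    𝔞 y = (1 / 2 : ℂ) • (majorana y - I • majorana' y) := by
  rw [majorana, majorana', smul_smul, I_mul_I]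
  module

theorem star_annihilation_eq (y : Torus L) :
    star (𝔞 y) = (1 / 2 : ℂ) • (majorana y + I • majorana' y) := by
  rw [majorana, majorana', smul_smul, I_mul_I]
  module

theorem norm_annihilation_le (y : Torus L) : ‖(𝔞 y : Obs L)‖ ≤ 1 := by
  rw [annihilation_eq, norm_smul]
  have h := norm_sub_le (majorana y) (I • majorana' y)
  rw [norm_smul, norm_I, one_mul] at h
  have := norm_majorana_le y
  have := norm_majorana'_le y
  norm_num
  linarith

theorem norm_star_annihilation_le (y : Torus L) : ‖star (𝔞 y : Obs L)‖ ≤ 1 := by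
  rw [norm_star]; exact norm_annihilation_le y

/-- The oscillation of an operator at the site `y`: the size of its commutators with the
𝔞 and creation operators there. -/
def osc (y : Torus L) (A : Obs L) : ℝ :=
  ‖(cm A (𝔞 y))‖ + ‖(cm A (star (𝔞 y)))‖

theorem osc_nonneg (y : Torus L) (A : Obs L) : 0 ≤ osc y A := by unfold osc; positivity

theorem osc_le_norm (y : Torus L) (A : Obs L) : osc y A ≤ 4 * ‖A‖ := by
  have h1 := norm_cm_le A (𝔞 y)
  have h2 := norm_cm_le A (star (𝔞 y))
  have h3 := norm_annihilation_le y
  have h4 := norm_star_annihilation_le y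
  have h5 := norm_nonneg A
  unfold osc
  nlinarith

theorem osc_add (y : Torus L) (A B : Obs L) : osc y (A + B) ≤ osc y A + osc y B := by
  unfold osc
  rw [add_cm, add_cm]
  have := norm_add_le (cm A (𝔞 y)) (cm B (𝔞 y))
  have := norm_add_le (cm A (star (𝔞 y))) (cm B (star (𝔞 y)))
  linarith

theorem osc_smul (y : Torus L) (c : ℂ) (A : Obs L) : osc y (c • A) = ‖c‖ * osc y A := by
  unfold osc
  rw [smul_cm, smul_cm, norm_smul, norm_smul]; ring

theorem osc_neg (y : Torus L) (A : Obs L) : osc y (-A) = osc y A := by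
  simp [osc, neg_cm]

theorem osc_zero (y : Torus L) : osc y (0 : Obs L) = 0 := by
  simp [osc, zero_cm]

theorem osc_sum {ι : Type*} (y : Torus L) (s : Finset ι) (f : ι → Obs L) :
    osc y (∑ i ∈ s, f i) ≤ ∑ i ∈ s, osc y (f i) := by
  classical
  induction s using Finset.induction_on with
  | empty => simp [osc_zero]
  | insert a s ha ih =>
    rw [sum_insert ha, sum_insert ha]
    linarith [osc_add y (f a) (∑ i ∈ s, f i)]

theorem norm_cm_majorana_le (y : Torus L) (A : Obs L) : ‖(cm A (majorana y))‖ ≤ osc y A := by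
  rw [majorana, cm_add]; exact norm_add_le _ _

theorem norm_cm_majorana'_le (y : Torus L) (A : Obs L) : ‖(cm A (majorana' y))‖ ≤ osc y A := by
  rw [majorana', cm_smul, cm_sub, norm_smul, norm_I, one_mul]; exact norm_sub_le _ _

/-! ### Averaging over the Majorana operators at one site -/

/-- The average over the conjugations by the Majorana operators at `y`. -/
def siteTwirl (y : Torus L) : Obs L →ₗ[ℂ] Obs L where
  toFun A := (1 / 4 : ℂ) • (A + majorana y * A * majorana y + majorana' y * A * majorana' y +
    majorana y * majorana' y * A * (majorana' y * majorana y))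
  map_add' A B := by
    simp only [mul_add, add_mul, ← smul_add]
    congr 1; abel
  map_smul' c A := by
    simp only [mul_smul_comm, smul_mul_assoc, ← smul_add, RingHom.id_apply]
    rw [smul_comm]

theorem siteTwirl_apply (y : Torus L) (A : Obs L) : siteTwirl y A =
    (1 / 4 : ℂ) • (A + majorana y * A * majorana y + majorana' y * A * majorana' y +
    majorana y * majorana' y * A * (majorana' y * majorana y)) := rfl

theorem norm_conj_le {g h : Obs L} (hg : ‖g‖ ≤ 1) (hh : ‖h‖ ≤ 1) (A : Obs L) :
    ‖g * A * h‖ ≤ ‖A‖ := by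
  calc ‖g * A * h‖ ≤ ‖g * A‖ * ‖h‖ := norm_mul_le _ _
    _ ≤ (‖g‖ * ‖A‖) * ‖h‖ := by gcongr; exact norm_mul_le _ _
    _ ≤ (1 * ‖A‖) * 1 := by gcongr
    _ = _ := by ring

theorem norm_mul_majorana_le (y : Torus L) : ‖majorana y * majorana' y‖ ≤ 1 := by
  have := norm_mul_le (majorana y) (majorana' y)
  nlinarith [norm_majorana_le y, norm_majorana'_le y, norm_nonneg (majorana y), norm_nonneg (majorana' y)]

theorem norm_mul_majorana'_le (y : Torus L) : ‖majorana' y * majorana y‖ ≤ 1 := by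
  rw [majorana_anticomm, norm_neg]; exact norm_mul_majorana_le y

theorem norm_siteTwirl_le (y : Torus L) (A : Obs L) : ‖siteTwirl y A‖ ≤ ‖A‖ := by
  rw [siteTwirl_apply, norm_smul]
  have h1 := norm_conj_le (norm_majorana_le y) (norm_majorana_le y) A
  have h2 := norm_conj_le (norm_majorana'_le y) (norm_majorana'_le y) A
  have h3 := norm_conj_le (norm_mul_majorana_le y) (norm_mul_majorana'_le y) A
  have h4 := norm_add_le (A + majorana y * A * majorana y + majorana' y * A * majorana' y)
    (majorana y * majorana' y * A * (majorana' y * majorana y))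
  have h5 := norm_add_le (A + majorana y * A * majorana y) (majorana' y * A * majorana' y)
  have h6 := norm_add_le A (majorana y * A * majorana y)
  have h7 : ‖(1 / 4 : ℂ)‖ = 1 / 4 := by norm_num
  rw [h7]
  linarith

theorem majorana_mul_mul_eq_one (y : Torus L) :
    majorana y * majorana' y * (majorana' y * majorana y) = 1 := by
  rw [mul_assoc, ← mul_assoc (majorana' y), majorana'_sq, one_mul, majorana_sq]

theorem sub_conj_eq {g h : Obs L} (hgh : g * h = 1) (A : Obs L) : A - g * A * h = (cm A g) * h := by
  rw [cm, sub_mul, mul_assoc A, hgh, mul_one]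

theorem norm_mul_le_of_le_one {g h : Obs L} (hh : ‖h‖ ≤ 1) : ‖g * h‖ ≤ ‖g‖ :=
  (norm_mul_le _ _).trans (mul_le_of_le_one_right (norm_nonneg _) hh)

theorem norm_mul_le_of_le_one' {g h : Obs L} (hh : ‖h‖ ≤ 1) : ‖h * g‖ ≤ ‖g‖ :=
  (norm_mul_le _ _).trans (mul_le_of_le_one_left (norm_nonneg _) hh)

/-- Each difference between $A$ and one of its conjugates is a commutator times a unitary. The three
nontrivial conjugations contribute at most 1, 1 and 2 oscillations, and the prefactor 1/4 of the
average turns the total 4 into 1. -/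
theorem norm_sub_siteTwirl_le (y : Torus L) (A : Obs L) : ‖A - siteTwirl y A‖ ≤ osc y A := by
  have e : A - siteTwirl y A = (1 / 4 : ℂ) • ((A - majorana y * A * majorana y) +
      (A - majorana' y * A * majorana' y) +
      (A - majorana y * majorana' y * A * (majorana' y * majorana y))) := by
    rw [siteTwirl_apply]; module
  have h7 : ‖(1 / 4 : ℂ)‖ = 1 / 4 := by norm_num
  rw [e, norm_smul, h7, sub_conj_eq (majorana_sq y), sub_conj_eq (majorana'_sq y),
    sub_conj_eq (majorana_mul_mul_eq_one y)]
  have h1 := (norm_mul_le_of_le_one (g := (cm A (majorana y))) (norm_majorana_le y)).trans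
    (norm_cm_majorana_le y A)
  have h2 := (norm_mul_le_of_le_one (g := (cm A (majorana' y))) (norm_majorana'_le y)).trans
    (norm_cm_majorana'_le y A)
  have e3 : (cm A (majorana y * majorana' y)) = (cm A (majorana y)) * majorana' y +
      majorana y * (cm A (majorana' y)) := by
    simp only [cm]; noncomm_ring
  have h3 : ‖(cm A (majorana y * majorana' y)) * (majorana' y * majorana y)‖ ≤ 2 * osc y A := by
    refine (norm_mul_le_of_le_one (norm_mul_majorana'_le y)).trans ?_
    rw [e3]
    have h4 := (norm_mul_le_of_le_one (g := (cm A (majorana y))) (norm_majorana'_le y)).trans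
      (norm_cm_majorana_le y A)
    have h5 := (norm_mul_le_of_le_one' (g := (cm A (majorana' y))) (norm_majorana_le y)).trans
      (norm_cm_majorana'_le y A)
    linarith [norm_add_le ((cm A (majorana y)) * majorana' y) (majorana y * (cm A (majorana' y)))]
  have h6 := norm_add_le ((cm A (majorana y)) * majorana y + (cm A (majorana' y)) * majorana' y)
    ((cm A (majorana y * majorana' y)) * (majorana' y * majorana y))
  have h8 := norm_add_le ((cm A (majorana y)) * majorana y) ((cm A (majorana' y)) * majorana' y)
  linarith

/-- Conjugation by a Majorana operator permutes the four terms of the average in pairs. -/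
theorem siteTwirl_commute_majorana (y : Torus L) (A : Obs L) :
    Commute (siteTwirl y A) (majorana y) := by
  have h1 := majorana_sq y
  have h2 := majorana'_sq y
  have h3 := majorana_anticomm y
  rw [siteTwirl_apply]
  generalize majorana y = g at *
  generalize majorana' y = h at *
  refine Commute.smul_left ?_ _
  have e : ∀ B : Obs L, Commute (B + g * B * g) g := fun B => by
    rw [commute_iff_eq, add_mul, mul_add]
    have t1 : g * B * g * g = g * B := by rw [mul_assoc, h1, mul_one]
    have t2 : g * (g * B * g) = B * g := by rw [mul_assoc, ← mul_assoc, h1, one_mul]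
    rw [t1, t2, add_comm]
  have e2 : A + g * A * g + h * A * h + g * h * A * (h * g) =
      (A + g * A * g) + (h * A * h + g * (h * A * h) * g) := by noncomm_ring
  rw [e2]
  exact (e A).add_left (e _)

theorem siteTwirl_commute_majorana' (y : Torus L) (A : Obs L) :
    Commute (siteTwirl y A) (majorana' y) := by
  have h1 := majorana_sq y
  have h2 := majorana'_sq y
  have h3 := majorana_anticomm y
  rw [siteTwirl_apply]
  generalize majorana y = g at *
  generalize majorana' y = h at *
  refine Commute.smul_left ?_ _
  have e : ∀ B : Obs L, Commute (B + h * B * h) h := fun B => by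
    rw [commute_iff_eq, add_mul, mul_add]
    have t1 : h * B * h * h = h * B := by rw [mul_assoc, h2, mul_one]
    have t2 : h * (h * B * h) = B * h := by rw [mul_assoc, ← mul_assoc, h2, one_mul]
    rw [t1, t2, add_comm]
  have h4 : g * h = -(h * g) := by rw [h3, neg_neg]
  have e2 : A + g * A * g + h * A * h + g * h * A * (h * g) =
      (A + h * A * h) + (g * A * g + h * (g * A * g) * h) := by
    have : g * h * A * (h * g) = h * (g * A * g) * h := by
      rw [h4, neg_mul, neg_mul, ← mul_neg, ← h4]; simp only [mul_assoc]
    rw [this]; abel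
  rw [e2]
  exact (e A).add_left (e _)

theorem commute_annihilation_of_majorana {y : Torus L} {A : Obs L} (h1 : Commute A (majorana y))
    (h2 : Commute A (majorana' y)) :
    Commute A (𝔞 y) ∧ Commute A (star (𝔞 y)) := by
  rw [star_annihilation_eq, annihilation_eq]
  exact ⟨(h1.sub_right (h2.smul_right _)).smul_right _, (h1.add_right (h2.smul_right _)).smul_right _⟩

theorem osc_eq_zero_iff {y : Torus L} {A : Obs L} : osc y A = 0 ↔
    Commute A (𝔞 y) ∧ Commute A (star (𝔞 y)) := by
  unfold osc
  rw [add_eq_zero_iff_of_nonneg (norm_nonneg _) (norm_nonneg _), norm_eq_zero, norm_eq_zero,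
    ← cm_eq_zero, ← cm_eq_zero]

theorem osc_siteTwirl_self (y : Torus L) (A : Obs L) : osc y (siteTwirl y A) = 0 :=
  osc_eq_zero_iff.2 (commute_annihilation_of_majorana (siteTwirl_commute_majorana y A)
    (siteTwirl_commute_majorana' y A))

theorem siteTwirl_eq_self {y : Torus L} {A : Obs L} (h : osc y A = 0) : siteTwirl y A = A := by
  have := norm_sub_siteTwirl_le y A
  rw [h] at this
  exact (sub_eq_zero.1 (norm_le_zero_iff.1 this)).symm

/-! ### Even algebras, parity, and removal of a site from the support -/

theorem generators_mono {X Y : Region L} (h : X ⊆ Y) : generators X ⊆ generators Y := by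
  rintro A ⟨x, hx, hA⟩
  exact ⟨x, h hx, hA⟩

theorem evenAlgebra_mono {X Y : Region L} (h : X ⊆ Y) : evenAlgebra X ≤ evenAlgebra Y :=
  Algebra.adjoin_mono (by
    rintro A ⟨b, hb, c, hc, rfl⟩
    exact ⟨b, generators_mono h hb, c, generators_mono h hc, rfl⟩)

theorem evenAlgebra_le_adjoin (X : Region L) : evenAlgebra X ≤ Algebra.adjoin ℂ (generators X) :=
  Algebra.adjoin_le (by
    rintro A ⟨b, hb, c, hc, rfl⟩
    exact mul_mem (Algebra.subset_adjoin hb) (Algebra.subset_adjoin hc))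

theorem star_mem_generators {X : Region L} {b : Obs L} (hb : b ∈ generators X) :
    star b ∈ generators X := by
  obtain ⟨x, hx, rfl | rfl⟩ := hb
  · exact ⟨x, hx, Or.inr rfl⟩
  · exact ⟨x, hx, Or.inl (star_star _)⟩

theorem star_mem_evenAlgebra {X : Region L} {A : Obs L} (hA : A ∈ evenAlgebra X) :
    star A ∈ evenAlgebra X := by
  induction hA using Algebra.adjoin_induction with
  | mem A h =>
    obtain ⟨b, hb, c, hc, rfl⟩ := h
    rw [star_mul]
    exact Algebra.subset_adjoin ⟨_, star_mem_generators hc, _, star_mem_generators hb, rfl⟩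
  | algebraMap c =>
    rw [Algebra.algebraMap_eq_smul_one, star_smul, star_one]
    exact Subalgebra.smul_mem _ (one_mem _) _
  | add A B _ _ hA hB => rw [star_add]; exact add_mem hA hB
  | mul A B _ _ hA hB => rw [star_mul]; exact mul_mem hB hA

theorem generators_anticomm {x y : Torus L} (h : x ≠ y) {b c : Obs L}
    (hb : b = 𝔞 x ∨ b = star (𝔞 x))
    (hc : c = 𝔞 y ∨ c = star (𝔞 y)) : b * c = -(c * b) := by
  rcases hb with rfl | rfl <;> rcases hc with rfl | rfl
  · exact annihilation_anticomm h
  · exact annihilation_star_anticomm h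
  · rw [annihilation_star_anticomm h.symm, neg_neg]
  · rw [← star_mul, ← star_mul, annihilation_anticomm h.symm, star_neg]

/-- Generators come in pairs, and moving a pair past a generator at another site produces two minus
signs. This is where evenness enters locality. -/
theorem evenAlgebra_commute {X : Region L} {A : Obs L} (hA : A ∈ evenAlgebra X)
    {y : Torus L} (hy : y ∉ X) {c : Obs L} (hc : c = 𝔞 y ∨ c = star (𝔞 y)) :
    Commute A c := by
  induction hA using Algebra.adjoin_induction with
  | mem A h =>
    obtain ⟨b, ⟨x, hx, hb⟩, b', ⟨x', hx', hb'⟩, rfl⟩ := h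
    have h1 := generators_anticomm (fun h : x = y => hy (h ▸ hx)) hb hc
    have h2 := generators_anticomm (fun h : x' = y => hy (h ▸ hx')) hb' hc
    rw [commute_iff_eq, mul_assoc, h2, mul_neg, ← mul_assoc, h1, neg_mul, neg_neg, mul_assoc]
  | algebraMap c => exact Algebra.commutes _ _
  | add A B _ _ hA hB => exact hA.add_left hB
  | mul A B _ _ hA hB => exact hA.mul_left hB

theorem osc_eq_zero_of_mem {X : Region L} {A : Obs L} (hA : A ∈ evenAlgebra X)
    {y : Torus L} (hy : y ∉ X) : osc y A = 0 :=
  osc_eq_zero_iff.2 ⟨evenAlgebra_commute hA hy (Or.inl rfl), evenAlgebra_commute hA hy (Or.inr rfl)⟩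

theorem commute_of_osc_eq_zero {X : Region L} {A B : Obs L}
    (hB : B ∈ Algebra.adjoin ℂ (generators X)) (h : ∀ y ∈ X, osc y A = 0) : Commute A B := by
  induction hB using Algebra.adjoin_induction with
  | mem B hB =>
    obtain ⟨x, hx, rfl | rfl⟩ := hB
    · exact (osc_eq_zero_iff.1 (h x hx)).1
    · exact (osc_eq_zero_iff.1 (h x hx)).2
  | algebraMap c => exact (Algebra.commutes _ _).symm
  | add B C _ _ hB hC => exact hB.add_right hC
  | mul B C _ _ hB hC => exact hB.mul_right hC

theorem commute_of_disjoint {X Y : Region L} {A B : Obs L} (hA : A ∈ evenAlgebra X)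
    (hB : B ∈ evenAlgebra Y) (h : Disjoint X Y) : Commute A B :=
  commute_of_osc_eq_zero (evenAlgebra_le_adjoin Y hB) fun _ hy =>
    osc_eq_zero_of_mem hA (disjoint_right.1 h hy)

/-- The even (`true`) and odd (`false`) polynomials in the generators at the sites of `X`. -/
def graded (X : Region L) : Bool → Submodule ℂ (Obs L)
  | true => (evenAlgebra X).toSubmodule
  | false => Submodule.span ℂ {A | ∃ b ∈ generators X, ∃ e ∈ evenAlgebra X, A = b * e}

theorem mul_mem_graded {X : Region L} {b : Obs L} (hb : b ∈ generators X) {g : Bool}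
    {A : Obs L} (hA : A ∈ graded X g) : b * A ∈ graded X (!g) := by
  cases g with
  | true => exact Submodule.subset_span ⟨b, hb, A, hA, rfl⟩
  | false =>
    change A ∈ Submodule.span ℂ _ at hA
    induction hA using Submodule.span_induction with
    | mem A h =>
      obtain ⟨c, hc, e, he, rfl⟩ := h
      rw [← mul_assoc]
      exact mul_mem (S := Subalgebra ℂ (Obs L)) (Algebra.subset_adjoin ⟨b, hb, c, hc, rfl⟩) he
    | zero => rw [mul_zero]; exact zero_mem _
    | add A B _ _ hA hB => rw [mul_add]; exact add_mem hA hB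
    | smul c A _ hA => rw [mul_smul_comm]; exact Submodule.smul_mem _ _ hA

/-- The sign of the parity. -/
def paritySign : Bool → ℂ
  | true => 1
  | false => -1

theorem graded_mul_comm {X : Region L} {g : Bool} {A : Obs L} (hA : A ∈ graded X g)
    {y : Torus L} (hy : y ∉ X) {c : Obs L} (hc : c = 𝔞 y ∨ c = star (𝔞 y)) :
    c * A = paritySign g • (A * c) := by
  cases g with
  | true => rw [paritySign, one_smul, (evenAlgebra_commute hA hy hc).eq]
  | false =>
    change A ∈ Submodule.span ℂ _ at hA
    simp only [paritySign, neg_smul, one_smul]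
    induction hA using Submodule.span_induction with
    | mem A h =>
      obtain ⟨b, ⟨x, hx, hb⟩, e, he, rfl⟩ := h
      rw [← mul_assoc, generators_anticomm (fun h : y = x => hy (h ▸ hx)) hc hb, mul_assoc,
        neg_mul, mul_assoc, (evenAlgebra_commute he hy hc).eq]
    | zero => simp
    | add A B _ _ hA hB => rw [mul_add, add_mul, hA, hB, neg_add]
    | smul k A _ hA => rw [mul_smul_comm, smul_mul_assoc, hA, smul_neg]

theorem annihilation_mul_star_mul (y : Torus L) :
    (𝔞 y : Obs L) * (star (𝔞 y) * 𝔞 y) = 𝔞 y := by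
  have := annihilation_car y
  rw [← eq_sub_iff_add_eq'] at this
  rw [this, mul_sub, mul_one, ← mul_assoc, annihilation_sq, zero_mul, sub_zero]

/-- The expansion of a polynomial in powers of the generators at the site `y`. -/
def SiteExpansion (X : Region L) (y : Torus L) (g : Bool) (A : Obs L) : Prop :=
  ∃ c₀ ∈ graded (X.erase y) g, ∃ c₁ ∈ graded (X.erase y) g,
    ∃ c₂ ∈ graded (X.erase y) (!g), ∃ c₃ ∈ graded (X.erase y) (!g),
      A = c₀ + c₁ * (star (𝔞 y) * 𝔞 y) + c₂ * 𝔞 y +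
        c₃ * star (𝔞 y)

theorem SiteExpansion.generator_mul {X : Region L} {y : Torus L} {g : Bool} {A : Obs L}
    (hA : SiteExpansion X y g A) {b : Obs L} (hb : b ∈ generators X) :
    SiteExpansion X y (!g) (b * A) := by
  obtain ⟨c₀, h₀, c₁, h₁, c₂, h₂, c₃, h₃, rfl⟩ := hA
  obtain ⟨x, hx, hb'⟩ := hb
  by_cases hxy : x = y
  · subst hxy
    have hy : x ∉ X.erase x := notMem_erase x X
    have hns : ∀ {c : Obs L} {g : Bool}, c ∈ graded (X.erase x) g →
        ∀ s : ℂ, s • c ∈ graded (X.erase x) g := fun h s => Submodule.smul_mem _ s h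
    have z := zero_mem (graded (X.erase x) (!g))
    have z' := zero_mem (graded (X.erase x) g)
    rcases hb' with rfl | rfl
    · have e₀ := graded_mul_comm h₀ hy (Or.inl rfl : _ ∨ 𝔞 x = star (𝔞 x))
      have e₁ := graded_mul_comm h₁ hy (Or.inl rfl : _ ∨ 𝔞 x = star (𝔞 x))
      have e₂ := graded_mul_comm h₂ hy (Or.inl rfl : _ ∨ 𝔞 x = star (𝔞 x))
      have e₃ := graded_mul_comm h₃ hy (Or.inl rfl : _ ∨ 𝔞 x = star (𝔞 x))
      refine ⟨_, hns h₃ (paritySign !g), _, hns h₃ (-paritySign !g), _,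
        by rw [Bool.not_not]; exact add_mem (hns h₀ (paritySign g)) (hns h₁ (paritySign g)), 0,
        by rw [Bool.not_not]; exact z', ?_⟩
      have car : 𝔞 x * star (𝔞 x) =
        1 - star (𝔞 x) * 𝔞 x := eq_sub_of_add_eq (annihilation_car x)
      rw [mul_add, mul_add, mul_add, ← mul_assoc _ c₁, ← mul_assoc _ c₂, ← mul_assoc _ c₃, e₀, e₁,
        e₂, e₃]
      simp only [smul_mul_assoc, mul_assoc, annihilation_sq, mul_zero, smul_zero, add_zero,
        zero_mul, annihilation_mul_star_mul]
      rw [car]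
      simp only [smul_mul_assoc, mul_sub, mul_one, smul_sub, add_mul, neg_smul]
      abel
    · have e₀ := graded_mul_comm h₀ hy (Or.inr rfl : star (𝔞 x) = 𝔞 x ∨ _)
      have e₁ := graded_mul_comm h₁ hy (Or.inr rfl : star (𝔞 x) = 𝔞 x ∨ _)
      have e₂ := graded_mul_comm h₂ hy (Or.inr rfl : star (𝔞 x) = 𝔞 x ∨ _)
      have e₃ := graded_mul_comm h₃ hy (Or.inr rfl : star (𝔞 x) = 𝔞 x ∨ _)
      refine ⟨0, z, _, hns h₂ (paritySign !g), 0, by rw [Bool.not_not]; exact z', _,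
        by rw [Bool.not_not]; exact hns h₀ (paritySign g), ?_⟩
      have s0 : star (𝔞 x) * (star (𝔞 x) * 𝔞 x : Obs L) = 0 := by
        rw [← mul_assoc, star_annihilation_sq, zero_mul]
      rw [mul_add, mul_add, mul_add, ← mul_assoc _ c₁, ← mul_assoc _ c₂, ← mul_assoc _ c₃, e₀, e₁,
        e₂, e₃]
      simp only [smul_mul_assoc, mul_assoc, star_annihilation_sq, s0, mul_zero, smul_zero, add_zero,
        zero_mul, zero_add]
      abel
  · have hb'' : b ∈ generators (X.erase y) := ⟨x, mem_erase.2 ⟨hxy, hx⟩, hb'⟩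
    exact ⟨_, mul_mem_graded hb'' h₀, _, mul_mem_graded hb'' h₁, _, mul_mem_graded hb'' h₂, _,
      mul_mem_graded hb'' h₃, by simp only [mul_add, mul_assoc]⟩

/-- The even algebra is spanned by words in pairs of generators, so it suffices to follow the
expansion under left multiplication by a single generator. Each such step flips the parity, which is
why expansions of odd polynomials are carried along. -/
theorem siteExpansion_of_mem {X : Region L} (y : Torus L) {A : Obs L}
    (hA : A ∈ evenAlgebra X) : SiteExpansion X y true A := by
  rw [evenAlgebra, ← Subalgebra.mem_toSubmodule, Algebra.adjoin_eq_span] at hA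
  have z := zero_mem (graded (X.erase y) true)
  have z' := zero_mem (graded (X.erase y) false)
  induction hA using Submodule.span_induction with
  | mem A h =>
    induction h using Submonoid.closure_induction_left with
    | one => exact ⟨1, one_mem (evenAlgebra _), 0, z, 0, z', 0, z', by simp⟩
    | mul_left A hA B _ ih =>
      obtain ⟨b, hb, c, hc, rfl⟩ := hA
      rw [mul_assoc]
      exact (ih.generator_mul hc).generator_mul hb
  | zero => exact ⟨0, z, 0, z, 0, z', 0, z', by simp⟩
  | add A B _ _ hA hB =>
    obtain ⟨c₀, h₀, c₁, h₁, c₂, h₂, c₃, h₃, rfl⟩ := hA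
    obtain ⟨d₀, k₀, d₁, k₁, d₂, k₂, d₃, k₃, rfl⟩ := hB
    exact ⟨_, add_mem h₀ k₀, _, add_mem h₁ k₁, _, add_mem h₂ k₂, _, add_mem h₃ k₃, by
      simp only [add_mul]; abel⟩
  | smul k A _ hA =>
    obtain ⟨c₀, h₀, c₁, h₁, c₂, h₂, c₃, h₃, rfl⟩ := hA
    exact ⟨_, Submodule.smul_mem _ k h₀, _, Submodule.smul_mem _ k h₁, _,
      Submodule.smul_mem _ k h₂, _, Submodule.smul_mem _ k h₃, by
      simp only [smul_mul_assoc, smul_add]⟩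

theorem siteTwirl_mul_of_commute {y : Torus L} {A : Obs L} (h : osc y A = 0) (B : Obs L) :
    siteTwirl y (A * B) = A * siteTwirl y B := by
  obtain ⟨h1, h2⟩ := osc_eq_zero_iff.1 h
  have k1 : Commute A (majorana y) := h1.add_right h2
  have k2 : Commute A (majorana' y) := (h1.sub_right h2).smul_right _
  have t1 : ∀ C, majorana y * (A * C) = A * (majorana y * C) := fun C => by
    rw [← mul_assoc, ← k1.eq, mul_assoc]
  have t2 : ∀ C, majorana' y * (A * C) = A * (majorana' y * C) := fun C => by
    rw [← mul_assoc, ← k2.eq, mul_assoc]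
  simp only [siteTwirl_apply, mul_smul_comm, mul_add, mul_assoc, t1, t2]

/-- An odd coefficient anticommutes with both Majorana operators, and conjugation by them sends $b$
to $b^*$ and to $-b^*$. The four terms of the average are therefore $Ab$, $-Ab^*$, $Ab^*$ and $-Ab$,
up to the common factor. -/
theorem siteTwirl_mul_of_odd {X : Region L} {y : Torus L} (hy : y ∉ X) {A : Obs L}
    (hA : A ∈ graded X false) {b : Obs L} (hb : b = 𝔞 y ∨ b = star (𝔞 y)) :
    siteTwirl y (A * b) = 0 := by
  have e1 := graded_mul_comm hA hy (Or.inl rfl : _ ∨ 𝔞 y = star (𝔞 y))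
  have e2 := graded_mul_comm hA hy (Or.inr rfl : star (𝔞 y) = 𝔞 y ∨ _)
  simp only [paritySign, neg_smul, one_smul] at e1 e2
  have t1 : ∀ C, majorana y * (A * C) = -(A * (majorana y * C)) := fun C => by
    rw [← mul_assoc, majorana, add_mul, e1, e2]; noncomm_ring
  have t2 : ∀ C, majorana' y * (A * C) = -(A * (majorana' y * C)) := fun C => by
    rw [← mul_assoc, majorana', smul_mul_assoc, sub_mul, e1, e2]
    simp only [smul_mul_assoc, mul_smul_comm, ← smul_neg]
    congr 1; noncomm_ring
  have q : ∀ C : Obs L, 𝔞 y * (𝔞 y * C) = 0 := fun C => by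
    rw [← mul_assoc, annihilation_sq, zero_mul]
  have q' : ∀ C : Obs L, star (𝔞 y) * (star (𝔞 y) * C) = 0 := fun C => by
    rw [← mul_assoc, star_annihilation_sq, zero_mul]
  have r := annihilation_mul_star_mul y
  have r' : star (𝔞 y : Obs L) * (𝔞 y * star (𝔞 y)) =
      star (𝔞 y) := by
    have := congrArg star r
    simpa [mul_assoc] using this
  have m1 : majorana y * (𝔞 y * majorana y) = star (𝔞 y) := by
    simp only [majorana, mul_add, add_mul, annihilation_sq, q, r', zero_add, add_zero, mul_zero]
  have m2 : majorana y * (star (𝔞 y) * majorana y) = 𝔞 y := by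
    simp only [majorana, mul_add, add_mul, star_annihilation_sq, q', r, zero_add, add_zero, mul_zero]
  have n1 : majorana' y * (𝔞 y * majorana' y) = -star (𝔞 y) := by
    simp only [majorana', mul_sub, sub_mul, annihilation_sq, q, r', zero_add, add_zero, mul_zero,
      smul_mul_assoc, mul_smul_comm, smul_smul, I_mul_I, zero_sub, sub_zero]
    simp [q, r']
  have n2 : majorana' y * (star (𝔞 y) * majorana' y) = -𝔞 y := by
    simp only [majorana', mul_sub, sub_mul, star_annihilation_sq, q', r, zero_add, add_zero,
      mul_zero, smul_mul_assoc, mul_smul_comm, smul_smul, I_mul_I, zero_sub, sub_zero]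
    simp [q', r]
  have w : ∀ C : Obs L, majorana y * (majorana' y * (C * (majorana' y * majorana y))) =
      majorana y * ((majorana' y * (C * majorana' y)) * majorana y) := fun C => by
    simp only [mul_assoc]
  rw [siteTwirl_apply]
  simp only [mul_assoc, t1, t2, mul_neg, neg_mul, neg_neg]
  rcases hb with rfl | rfl
  · rw [w, n1, m1]; simp [m2]
  · rw [w, n2, m2]; simp [m1]

theorem siteTwirl_number (y : Torus L) :
    siteTwirl y (star (𝔞 y) * 𝔞 y) = (1 / 2 : ℂ) • 1 := by
  have h : star (𝔞 y) * 𝔞 y =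
      (1 / 2 : ℂ) • (1 : Obs L) + (I / 2) • (majorana' y * majorana y) := by
    rw [majorana', majorana, smul_mul_assoc, smul_smul, ← annihilation_car y]
    have : I / 2 * I = -(1 / 2) := by
      rw [div_mul_eq_mul_div, I_mul_I]; norm_num
    rw [this]
    simp only [mul_add, sub_mul, annihilation_sq, star_annihilation_sq]
    module
  have h1 := majorana_sq y
  have h2 := majorana'_sq y
  have h3 := majorana_anticomm y
  rw [h, map_add, map_smul, map_smul, siteTwirl_eq_self (A := 1), siteTwirl_apply]
  · have k1 : majorana y * (majorana' y * majorana y) * majorana y = majorana y * majorana' y := by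
      rw [mul_assoc, mul_assoc, h1, mul_one]
    have k2 : majorana' y * (majorana' y * majorana y) * majorana' y = majorana y * majorana' y := by
      rw [← mul_assoc, h2, one_mul]
    have k3 : majorana y * majorana' y * (majorana' y * majorana y) * (majorana' y * majorana y)
        = majorana' y * majorana y := by
      rw [majorana_mul_mul_eq_one, one_mul]
    rw [k1, k2, k3, h3]
    simp
  · exact osc_eq_zero_iff.2 ⟨Commute.one_left _, Commute.one_left _⟩

/-- In the expansion at $y$ the two terms with odd coefficients average to zero and the number
operator averages to 1/2, so only even polynomials in the remaining generators survive. This shows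
that commuting with the operators at $y$ is achieved inside the even algebra of the smaller set. -/
theorem siteTwirl_mem {X : Region L} (y : Torus L) {A : Obs L} (hA : A ∈ evenAlgebra X) :
    siteTwirl y A ∈ evenAlgebra (X.erase y) := by
  obtain ⟨c₀, h₀, c₁, h₁, c₂, h₂, c₃, h₃, rfl⟩ := siteExpansion_of_mem y hA
  have hy := notMem_erase y X
  rw [map_add, map_add, map_add, siteTwirl_mul_of_odd hy h₂ (Or.inl rfl),
    siteTwirl_mul_of_odd hy h₃ (Or.inr rfl), siteTwirl_mul_of_commute (osc_eq_zero_of_mem h₁ hy),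
    siteTwirl_number, siteTwirl_eq_self (osc_eq_zero_of_mem h₀ hy), mul_smul_comm, mul_one,
    add_zero, add_zero]
  exact add_mem h₀ (Subalgebra.smul_mem _ h₁ _)

/-- A Majorana operator at a different site anticommutes with the generators at $z$, so it can be
pulled out of the commutator at the price of a sign. Averaging at one site thus never spoils the
locality at another. -/
theorem osc_conj_eq {y z : Torus L} (h : z ≠ y) {g : Obs L}
    (hg : g = majorana y ∨ g = majorana' y) (A : Obs L) : osc z (g * A * g) ≤ osc z A := by
  have hn : ‖g‖ ≤ 1 := by
    rcases hg with rfl | rfl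
    · exact norm_majorana_le y
    · exact norm_majorana'_le y
  have key : ∀ c : Obs L, (c = 𝔞 z ∨ c = star (𝔞 z)) →
      ‖cm (g * A * g) c‖ ≤ ‖cm A c‖ := by
    intro c hc
    have e1 := generators_anticomm h hc (Or.inl rfl : _ ∨ 𝔞 y = star (𝔞 y))
    have e2 := generators_anticomm h hc (Or.inr rfl : star (𝔞 y) = 𝔞 y ∨ _)
    have e : c * g = -(g * c) := by
      rcases hg with rfl | rfl
      · rw [majorana, mul_add, e1, e2, add_mul, neg_add]
      · rw [majorana', mul_smul_comm, mul_sub, e1, e2, smul_mul_assoc, sub_mul, ← smul_neg]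
        congr 1; abel
    have e' : g * c = -(c * g) := by rw [e, neg_neg]
    have : cm (g * A * g) c = -(g * cm A c * g) := by
      simp only [cm, mul_sub, sub_mul]
      rw [mul_assoc (g * A), e', ← mul_assoc c, ← mul_assoc c, e]
      simp only [mul_assoc, mul_neg, neg_mul]
      rw [e]
      simp only [mul_neg]
      abel
    rw [this, norm_neg]
    exact norm_conj_le hn hn _
  exact add_le_add (key _ (Or.inl rfl)) (key _ (Or.inr rfl))

theorem osc_siteTwirl_le {y z : Torus L} (h : z ≠ y) (A : Obs L) :
    osc z (siteTwirl y A) ≤ osc z A := by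
  rw [siteTwirl_apply, osc_smul]
  have h1 := osc_conj_eq h (Or.inl rfl : _ ∨ majorana y = majorana' y) A
  have h2 := osc_conj_eq h (Or.inr rfl : majorana' y = majorana y ∨ _) A
  have h3 := (osc_conj_eq h (Or.inl rfl : _ ∨ majorana y = majorana' y)
    (majorana' y * A * majorana' y)).trans h2
  have e : majorana y * (majorana' y * A * majorana' y) * majorana y =
    majorana y * majorana' y * A * (majorana' y * majorana y) := by simp only [mul_assoc]
  rw [e] at h3
  have h4 := osc_add z (A + majorana y * A * majorana y + majorana' y * A * majorana' y)
    (majorana y * majorana' y * A * (majorana' y * majorana y))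
  have h5 := osc_add z (A + majorana y * A * majorana y) (majorana' y * A * majorana' y)
  have h6 := osc_add z A (majorana y * A * majorana y)
  have h7 : ‖(1 / 4 : ℂ)‖ = 1 / 4 := by norm_num
  rw [h7]; linarith

/-! ### Averaging over regions -/

/-- The successive averages over the Majorana operators at the sites of a list. -/
def listTwirl : List (Torus L) → Obs L →ₗ[ℂ] Obs L
  | [] => LinearMap.id
  | y :: l => siteTwirl y ∘ₗ listTwirl l

theorem norm_listTwirl_le (l : List (Torus L)) (A : Obs L) : ‖listTwirl l A‖ ≤ ‖A‖ := by
  induction l with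
  | nil => exact le_rfl
  | cons y l ih => exact (norm_siteTwirl_le y _).trans ih

/-- Averages do not increase norms, so the errors of the single sites add up, each measured on the
original operator. -/
theorem norm_sub_listTwirl_le (l : List (Torus L)) (A : Obs L) :
    ‖A - listTwirl l A‖ ≤ (l.map fun y => osc y A).sum := by
  induction l with
  | nil => simp [listTwirl]
  | cons y l ih =>
    have e : A - listTwirl (y :: l) A = (A - siteTwirl y A) + siteTwirl y (A - listTwirl l A) := by
      rw [map_sub]; simp only [listTwirl, LinearMap.comp_apply]; abel
    rw [e, List.map_cons, List.sum_cons]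
    exact (norm_add_le _ _).trans (add_le_add (norm_sub_siteTwirl_le y A)
      ((norm_siteTwirl_le y _).trans ih))

theorem osc_listTwirl_eq_zero (l : List (Torus L)) (A : Obs L) {z : Torus L} (hz : z ∈ l) :
    osc z (listTwirl l A) = 0 := by
  induction l with
  | nil => simp at hz
  | cons y l ih =>
    by_cases h : z = y
    · subst h; exact osc_siteTwirl_self _ _
    · have h1 := ih ((List.mem_cons.1 hz).resolve_left h)
      exact le_antisymm ((osc_siteTwirl_le h _).trans h1.le) (osc_nonneg _ _)

theorem listTwirl_mem (l : List (Torus L)) {X : Region L} {A : Obs L}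
    (hA : A ∈ evenAlgebra X) : listTwirl l A ∈ evenAlgebra (X \ l.toFinset) := by
  induction l with
  | nil => simpa [listTwirl] using hA
  | cons y l ih =>
    have := siteTwirl_mem y ih
    have e : X \ (y :: l).toFinset = (X \ l.toFinset).erase y := by
      ext z; simp only [List.toFinset_cons, mem_sdiff, mem_insert, mem_erase]
      tauto
    rw [e]
    exact this

/-- The average over the Majorana operators at the sites of `Y`: the conditional expectation onto
the operators supported in the complement of `Y`. -/
def twirl (Y : Region L) : Obs L →ₗ[ℂ] Obs L := listTwirl Y.toList

theorem norm_twirl_le (Y : Region L) (A : Obs L) : ‖twirl Y A‖ ≤ ‖A‖ := norm_listTwirl_le _ _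

theorem norm_sub_twirl_le (Y : Region L) (A : Obs L) : ‖A - twirl Y A‖ ≤ ∑ y ∈ Y, osc y A := by
  rw [← sum_map_toList]; exact norm_sub_listTwirl_le _ _

theorem osc_twirl_eq_zero (Y : Region L) (A : Obs L) {z : Torus L} (hz : z ∈ Y) :
    osc z (twirl Y A) = 0 := osc_listTwirl_eq_zero _ _ (by simpa using hz)

theorem twirl_mem (Y : Region L) {X : Region L} {A : Obs L}
    (hA : A ∈ evenAlgebra X) : twirl Y A ∈ evenAlgebra (X \ Y) := by
  have := listTwirl_mem Y.toList hA
  rwa [toList_toFinset] at this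

theorem twirl_eq_self {Y : Region L} {A : Obs L} (h : ∀ y ∈ Y, osc y A = 0) : twirl Y A = A := by
  have := norm_sub_twirl_le Y A
  rw [sum_eq_zero h] at this
  exact (sub_eq_zero.1 (norm_le_zero_iff.1 this)).symm

/-- The commutator with an operator supported in `X` is controlled by the oscillations in `X`. -/
theorem norm_cm_le_sum_osc {X : Region L} {B : Obs L}
    (hB : B ∈ Algebra.adjoin ℂ (generators X)) (A : Obs L) :
    ‖cm A B‖ ≤ 2 * ‖B‖ * ∑ z ∈ X, osc z A := by
  have h := commute_of_osc_eq_zero hB fun y hy => osc_twirl_eq_zero X A hy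
  have e : cm A B = cm (A - twirl X A) B := by rw [sub_cm, cm_eq_zero.2 h, sub_zero]
  rw [e]
  calc _ ≤ 2 * ‖A - twirl X A‖ * ‖B‖ := norm_cm_le _ _
    _ ≤ 2 * (∑ z ∈ X, osc z A) * ‖B‖ := by gcongr; exact norm_sub_twirl_le X A
    _ = _ := by ring

/-- The commutator of two even operators is small if they live in different regions. -/
theorem norm_cm_le_of_split (Y : Region L) {B : Obs L} (hB : B ∈ evenAlgebra univ)
    (A : Obs L) : ‖cm A B‖ ≤ 2 * ‖A‖ * ∑ y ∈ Y, osc y B + 2 * ‖B‖ * ∑ z ∈ Yᶜ, osc z A := by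
  have e : cm A B = cm A (B - twirl Y B) + cm A (twirl Y B) := by rw [← cm_add, sub_add_cancel]
  have h1 : ‖cm A (B - twirl Y B)‖ ≤ 2 * ‖A‖ * ∑ y ∈ Y, osc y B :=
    (norm_cm_le _ _).trans (by gcongr; exact norm_sub_twirl_le Y B)
  have h2 : ‖cm A (twirl Y B)‖ ≤ 2 * ‖B‖ * ∑ z ∈ Yᶜ, osc z A := by
    refine (norm_cm_le_sum_osc (evenAlgebra_le_adjoin _ (twirl_mem Y hB)) A).trans ?_
    rw [← compl_eq_univ_sdiff]
    have := sum_nonneg fun z (_ : z ∈ Yᶜ) => osc_nonneg z A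
    gcongr
    exact norm_twirl_le Y B
  rw [e]
  exact (norm_add_le _ _).trans (add_le_add h1 h2)

/-! ### Traces, and operators localized in two disjoint regions -/

theorem tr_add (A B : Obs L) : tr (A + B) = tr A + tr B := by simp [tr]

theorem tr_sub (A B : Obs L) : tr (A - B) = tr A - tr B := by simp [tr]

theorem tr_smul (c : ℂ) (A : Obs L) : tr (c • A) = c * tr A := by simp [tr]

theorem tr_mul_comm (A B : Obs L) : tr (A * B) = tr (B * A) :=
  LinearMap.trace_mul_comm ℂ (A : Fock L →ₗ[ℂ] Fock L) (B : Fock L →ₗ[ℂ] Fock L)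

theorem tr_siteTwirl (y : Torus L) (A : Obs L) : tr (siteTwirl y A) = tr A := by
  have h : ∀ g h : Obs L, h * g = 1 → tr (g * A * h) = tr A := fun g h hh => by
    rw [tr_mul_comm, ← mul_assoc, hh, one_mul]
  have h3 : majorana' y * majorana y * (majorana y * majorana' y) = 1 := by
    rw [mul_assoc, ← mul_assoc (majorana y), majorana_sq, one_mul, majorana'_sq]
  rw [siteTwirl_apply, tr_smul, tr_add, tr_add, tr_add, h _ _ (majorana_sq y),
    h _ _ (majorana'_sq y), h _ _ h3]
  ring

theorem tr_twirl (Y : Region L) (A : Obs L) : tr (twirl Y A) = tr A := by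
  unfold twirl
  induction Y.toList with
  | nil => rfl
  | cons y l ih => rw [← ih, ← tr_siteTwirl y (listTwirl l A)]; rfl

instance : Nontrivial (Fock L) :=
  inferInstanceAs (Nontrivial (EuclideanSpace ℂ (Region L)))

theorem tr_one_ne_zero : tr (1 : Obs L) ≠ 0 := by
  have : tr (1 : Obs L) = (Module.finrank ℂ (Fock L) : ℂ) := LinearMap.trace_one ℂ (Fock L)
  rw [this]
  exact Nat.cast_ne_zero.2 (Module.finrank_pos (R := ℂ) (M := Fock L)).ne'

/-- An even operator which is close to an operator supported in `X` and to an operator supported in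
the complement of `X` is close to a multiple of the identity, which vanishes if it is traceless. -/
theorem norm_le_of_traceless {X Y : Region L} (hXY : Disjoint X Y) {D A B : Obs L}
    (hD : D ∈ evenAlgebra univ) (htr : tr D = 0) (hA : A ∈ evenAlgebra X)
    (hB : B ∈ evenAlgebra Y) : ‖D‖ ≤ 2 * ‖D - A‖ + 2 * ‖D - B‖ := by
  have hA' : twirl Xᶜ A = A := twirl_eq_self fun y hy => osc_eq_zero_of_mem hA (mem_compl.1 hy)
  have hB' : twirl X B = B := twirl_eq_self fun y hy =>
    osc_eq_zero_of_mem hB (disjoint_left.1 hXY hy)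
  -- Averaging over a region and its complement leaves an even operator with empty support, that is,
  -- a scalar. Averages preserve the trace, so this scalar is zero.
  have h0 : twirl X (twirl Xᶜ D) = 0 := by
    have hm := twirl_mem X (twirl_mem Xᶜ hD)
    have hem : (univ \ Xᶜ) \ X = ∅ := by ext; simp
    rw [hem] at hm
    have : evenAlgebra (∅ : Region L) = ⊥ := by
      rw [evenAlgebra]
      convert Algebra.adjoin_empty ℂ (Obs L)
      ext A
      simp [generators]
    rw [this, Algebra.mem_bot] at hm
    obtain ⟨c, hc⟩ := hm
    have ht : tr (twirl X (twirl Xᶜ D)) = 0 := by rw [tr_twirl, tr_twirl, htr]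
    rw [← hc, Algebra.algebraMap_eq_smul_one, tr_smul] at ht
    rw [← hc, (mul_eq_zero.1 ht).resolve_right tr_one_ne_zero, map_zero]
  have e : D = (D - twirl X D) + twirl X (D - twirl Xᶜ D) := by
    rw [map_sub, h0]; abel
  have h1 : ‖D - twirl X D‖ ≤ 2 * ‖D - B‖ := by
    have : D - twirl X D = (D - B) - twirl X (D - B) := by rw [map_sub, hB']; abel
    rw [this]
    linarith [norm_sub_le (D - B) (twirl X (D - B)), norm_twirl_le X (D - B)]
  have h2 : ‖D - twirl Xᶜ D‖ ≤ 2 * ‖D - A‖ := by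
    have : D - twirl Xᶜ D = (D - A) - twirl Xᶜ (D - A) := by rw [map_sub, hA']; abel
    rw [this]
    linarith [norm_sub_le (D - A) (twirl Xᶜ (D - A)), norm_twirl_le Xᶜ (D - A)]
  have h3 := norm_add_le (D - twirl X D) (twirl X (D - twirl Xᶜ D))
  rw [← e] at h3
  linarith [norm_twirl_le X (D - twirl Xᶜ D)]

/-! ### Exponentials and Heisenberg dynamics -/

theorem expI_zero (A : Obs L) : expI 0 A = 1 := by simp [expI]

theorem expI_add (s t : ℝ) (A : Obs L) : expI (s + t) A = expI s A * expI t A := by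
  let _ : NormedAlgebra ℚ (Obs L) := NormedAlgebra.restrictScalars ℚ ℂ (Obs L)
  unfold expI
  rw [← NormedSpace.exp_add_of_commute]
  · congr 1; rw [← add_smul]; push_cast; ring_nf
  · exact ((Commute.refl A).smul_left _).smul_right _

theorem expI_neg_mul_self (t : ℝ) (A : Obs L) : expI (-t) A * expI t A = 1 := by
  rw [← expI_add, neg_add_cancel, expI_zero]

theorem expI_mul_neg_self (t : ℝ) (A : Obs L) : expI t A * expI (-t) A = 1 := by
  rw [← expI_add, add_neg_cancel, expI_zero]

theorem expI_neg_op (t : ℝ) (A : Obs L) : expI t (-A) = expI (-t) A := by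
  unfold expI; congr 1; rw [smul_neg, ← neg_smul]; push_cast; ring_nf

theorem star_expI (t : ℝ) {A : Obs L} (hA : IsSelfAdjoint A) : star (expI t A) = expI (-t) A := by
  unfold expI
  rw [NormedSpace.star_exp, star_smul, hA.star_eq]
  congr 1
  simp

theorem norm_le_one_of_unitary {V : Obs L} (h : star V * V = 1) : ‖V‖ ≤ 1 := by
  have h1 : ‖star V * V‖ = ‖V‖ * ‖V‖ := CStarRing.norm_star_mul_self
  rw [h] at h1
  have h3 : ‖(1 : Obs L)‖ ≤ 1 := ContinuousLinearMap.norm_id_le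
  nlinarith [norm_nonneg V]

theorem norm_expI_le (t : ℝ) {A : Obs L} (hA : IsSelfAdjoint A) : ‖expI t A‖ ≤ 1 :=
  norm_le_one_of_unitary (by rw [star_expI t hA, expI_neg_mul_self])

theorem Commute.expI_right {A B : Obs L} (h : Commute A B) (t : ℝ) : Commute A (expI t B) :=
  (h.smul_right _).exp_right

theorem expI_add_of_commute (t : ℝ) {A B : Obs L} (h : Commute A B) :
    expI t (A + B) = expI t A * expI t B := by
  let _ : NormedAlgebra ℚ (Obs L) := NormedAlgebra.restrictScalars ℚ ℂ (Obs L)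
  unfold expI
  rw [smul_add, NormedSpace.exp_add_of_commute]
  exact (h.smul_left _).smul_right _

theorem hasDerivAt_expI (t : ℝ) (A : Obs L) :
    HasDerivAt (fun t : ℝ => expI t A) (I • (A * expI t A)) t := by
  have h := (hasDerivAt_exp_smul_const' (I • A) (t : ℝ))
  have e : (fun t : ℝ => expI t A) = fun t : ℝ => NormedSpace.exp (t • (I • A)) := by
    funext t; unfold expI; congr 1
    rw [← Complex.coe_smul, smul_smul, mul_comm]
  rw [e]
  refine h.congr_deriv ?_
  rw [smul_mul_assoc, ← Complex.coe_smul t, smul_smul, mul_comm (t : ℂ)]; rfl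

theorem hasDerivAt_expI_neg (t : ℝ) (A : Obs L) :
    HasDerivAt (fun t : ℝ => expI (-t) A) (-(I • (A * expI (-t) A))) t := by
  have := hasDerivAt_expI t (-A)
  simp only [expI_neg_op, neg_mul, smul_neg] at this
  exact this

theorem conjExp_add (t : ℝ) (G A B : Obs L) :
    conjExp t G (A + B) = conjExp t G A + conjExp t G B := by
  simp only [conjExp, mul_add, add_mul]

theorem conjExp_sub (t : ℝ) (G A B : Obs L) :
    conjExp t G (A - B) = conjExp t G A - conjExp t G B := by
  simp only [conjExp, mul_sub, sub_mul]

theorem conjExp_neg (t : ℝ) (G A : Obs L) : conjExp t G (-A) = -conjExp t G A := by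
  simp only [conjExp, mul_neg, neg_mul]

theorem conjExp_smul (t : ℝ) (c : ℂ) (G A : Obs L) : conjExp t G (c • A) = c • conjExp t G A := by
  simp only [conjExp, mul_smul_comm, smul_mul_assoc]

theorem conjExp_sum {ι : Type*} (t : ℝ) (G : Obs L) (s : Finset ι) (f : ι → Obs L) :
    conjExp t G (∑ i ∈ s, f i) = ∑ i ∈ s, conjExp t G (f i) := by
  simp only [conjExp, mul_sum, sum_mul]

theorem conjExp_mul (t : ℝ) (G A B : Obs L) :
    conjExp t G (A * B) = conjExp t G A * conjExp t G B := by
  simp only [conjExp]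
  calc expI t G * (A * B) * expI (-t) G = expI t G * A * 1 * B * expI (-t) G := by
        simp only [mul_assoc, mul_one, one_mul]
    _ = expI t G * A * (expI (-t) G * expI t G) * B * expI (-t) G := by rw [expI_neg_mul_self]
    _ = _ := by simp only [mul_assoc]

theorem conjExp_cm (t : ℝ) (G A B : Obs L) :
    conjExp t G (cm A B) = cm (conjExp t G A) (conjExp t G B) := by
  rw [cm, conjExp_sub, conjExp_mul, conjExp_mul]; rfl

theorem conjExp_zero_time (G A : Obs L) : conjExp 0 G A = A := by
  simp [conjExp, expI_zero]

theorem conjExp_conjExp (s t : ℝ) (G A : Obs L) :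
    conjExp s G (conjExp t G A) = conjExp (s + t) G A := by
  simp only [conjExp]
  rw [expI_add, neg_add, add_comm (-s), expI_add]
  simp only [mul_assoc]

theorem conjExp_neg_op (t : ℝ) (G A : Obs L) : conjExp t (-G) A = conjExp (-t) G A := by
  simp only [conjExp, expI_neg_op]

theorem norm_conjExp_le (t : ℝ) {G : Obs L} (hG : IsSelfAdjoint G) (A : Obs L) :
    ‖conjExp t G A‖ ≤ ‖A‖ :=
  norm_conj_le (norm_expI_le t hG) (norm_expI_le (-t) hG) A

theorem norm_conjExp (t : ℝ) {G : Obs L} (hG : IsSelfAdjoint G) (A : Obs L) :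
    ‖conjExp t G A‖ = ‖A‖ := by
  refine le_antisymm (norm_conjExp_le t hG A) ?_
  have := norm_conjExp_le (-t) hG (conjExp t G A)
  rwa [conjExp_conjExp, neg_add_cancel, conjExp_zero_time] at this

theorem star_conjExp (t : ℝ) {G : Obs L} (hG : IsSelfAdjoint G) (A : Obs L) :
    star (conjExp t G A) = conjExp t G (star A) := by
  simp only [conjExp, star_mul, star_expI _ hG, neg_neg, mul_assoc]

theorem isSelfAdjoint_conjExp (t : ℝ) {G A : Obs L} (hG : IsSelfAdjoint G) (hA : IsSelfAdjoint A) :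
    IsSelfAdjoint (conjExp t G A) := by
  rw [IsSelfAdjoint, star_conjExp t hG, hA.star_eq]

theorem conjExp_of_commute (t : ℝ) {G A : Obs L} (h : Commute A G) : conjExp t G A = A := by
  rw [conjExp, ← (Commute.expI_right h t).eq, mul_assoc, expI_mul_neg_self, mul_one]

theorem hasDerivAt_conjExp (t : ℝ) (G A : Obs L) :
    HasDerivAt (fun t : ℝ => conjExp t G A) (conjExp t G (I • cm G A)) t := by
  have h1 := ((hasDerivAt_expI t G).mul_const A).mul (hasDerivAt_expI_neg t G)
  refine h1.congr_deriv ?_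
  have c1 : G * expI t G = expI t G * G := (Commute.expI_right (Commute.refl G) t).eq
  simp only [conjExp, cm]
  rw [c1]
  simp only [smul_sub, mul_sub, sub_mul, smul_mul_assoc, mul_smul_comm, mul_neg, mul_assoc]
  abel

theorem continuous_conjExp (G A : Obs L) : Continuous fun t : ℝ => conjExp t G A :=
  continuous_iff_continuousAt.2 fun t => (hasDerivAt_conjExp t G A).continuousAt

theorem cm_conjExp_self (t : ℝ) (G A : Obs L) : cm G (conjExp t G A) = conjExp t G (cm G A) := by
  rw [conjExp_cm, conjExp_of_commute t (Commute.refl G)]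

theorem norm_cm_conjExp (t : ℝ) {G : Obs L} (hG : IsSelfAdjoint G) (A B : Obs L) :
    ‖cm (conjExp t G A) B‖ = ‖cm A (conjExp (-t) G B)‖ := by
  rw [← norm_conjExp (-t) hG (cm (conjExp t G A) B), conjExp_cm, conjExp_conjExp, neg_add_cancel,
    conjExp_zero_time]

theorem evenAlgebra_isClosed (X : Region L) : IsClosed (evenAlgebra X : Set (Obs L)) :=
  Submodule.closed_of_finiteDimensional (evenAlgebra X).toSubmodule

theorem expI_mem {X : Region L} {A : Obs L} (hA : A ∈ evenAlgebra X) (t : ℝ) :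
    expI t A ∈ evenAlgebra X := by
  let _ : NormedAlgebra ℚ (Obs L) := NormedAlgebra.restrictScalars ℚ ℂ (Obs L)
  exact NormedSpace.exp_mem (R := ℂ) (evenAlgebra_isClosed X) (Subalgebra.smul_mem _ hA _)

theorem conjExp_mem {X : Region L} {G A : Obs L} (hG : G ∈ evenAlgebra X)
    (hA : A ∈ evenAlgebra X) (t : ℝ) : conjExp t G A ∈ evenAlgebra X :=
  mul_mem (mul_mem (expI_mem hG t) hA) (expI_mem hG (-t))

/-! ### Duhamel's formula and the abstract Lieb-Robinson bound -/

/-- Comparison of two dynamics. -/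
theorem norm_conjExp_sub_le {A C : Obs L} (hA : IsSelfAdjoint A) (hC : IsSelfAdjoint C) (B : Obs L)
    (t : ℝ) {M : ℝ} (hM : ∀ s : ℝ, |s| ≤ |t| → ‖cm C (conjExp s A B)‖ ≤ M) :
    ‖conjExp t A B - conjExp t (A + C) B‖ ≤ M * |t| := by
  have hAC : IsSelfAdjoint (A + C) := hA.add hC
  -- $B$ is evolved forward by $A$ and backward by $A+C$, so the derivative only sees the commutator
  -- of $C$ with the evolved $B$.
  let f : ℝ → Obs L := fun s => expI (-s) (A + C) * conjExp s A B * expI s (A + C)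
  have hf : ∀ s, HasDerivAt f (-(I • conjExp (-s) (A + C) (cm C (conjExp s A B)))) s := by
    intro s
    have h1 := ((hasDerivAt_expI_neg s (A + C)).mul (hasDerivAt_conjExp s A B)).mul
      (hasDerivAt_expI s (A + C))
    refine h1.congr_deriv ?_
    simp only [Pi.mul_apply]
    rw [conjExp_smul, ← cm_conjExp_self]
    have c1 : (A + C) * expI (-s) (A + C) = expI (-s) (A + C) * (A + C) :=
      (Commute.expI_right (Commute.refl _) _).eq
    rw [c1, conjExp.eq_1 (-s), neg_neg]
    generalize conjExp s A B = Z
    simp only [cm, mul_add, add_mul, mul_sub, sub_mul, smul_add, smul_sub, smul_mul_assoc,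
      mul_smul_comm, mul_neg, neg_mul, mul_assoc]
    abel
  have hb : ∀ s ∈ Set.uIcc 0 t, ‖-(I • conjExp (-s) (A + C) (cm C (conjExp s A B)))‖ ≤ M := by
    intro s hs
    rw [norm_neg, norm_smul, norm_I, one_mul]
    refine (norm_conjExp_le _ hAC _).trans (hM s ?_)
    have := Set.abs_sub_left_of_mem_uIcc hs
    simpa using this
  have h := (convex_uIcc 0 t).norm_image_sub_le_of_norm_hasDerivWithin_le
    (fun s _ => (hf s).hasDerivWithinAt) hb Set.left_mem_uIcc Set.right_mem_uIcc
  have e0 : f 0 = B := by simp [f, expI_zero, conjExp_zero_time]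
  have et : conjExp t (A + C) (f t - f 0) = conjExp t A B - conjExp t (A + C) B := by
    rw [e0, conjExp_sub]
    congr 1
    have : f t = conjExp (-t) (A + C) (conjExp t A B) := by simp [f, conjExp]
    rw [this, conjExp_conjExp, add_neg_cancel, conjExp_zero_time]
  rw [← et, norm_conjExp t hAC]
  simpa using h

/-- One round of a bootstrap: an a priori bound with constant $C$ improves to $1+C/2$. Moving the
dynamics onto the fermion operator $c$, the time derivative is controlled by the double commutator
$[A_s,[G,c]]$, hence by the kernel `N`. The rate $4\kappa$ is chosen so that time integration gives
a factor 1/4 for each of the two commutators in `osc`. -/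
theorem lieb_robinson_step {G : Obs L} (hG : IsSelfAdjoint G) {N : Torus L → Torus L → ℝ}
    (hN0 : ∀ y z, 0 ≤ N y z)
    (hN : ∀ A y (c : Obs L), c = 𝔞 y ∨ c = star (𝔞 y) →
      ‖cm A (cm G c)‖ ≤ ∑ z, N y z * osc z A)
    {w : Torus L → ℝ} {κ : ℝ} (hκ : 0 < κ) (hw : ∀ y, ∑ z, N y z * w z ≤ κ * w y)
    {A : Obs L} (hA : ∀ z, osc z A ≤ w z) {C : ℝ} (hC0 : 0 ≤ C)
    (hC : ∀ s : ℝ, 0 ≤ s → ∀ z, osc z (conjExp s G A) ≤ C * rexp (4 * κ * s) * w z)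
    (t : ℝ) (ht : 0 ≤ t) (y : Torus L) :
    osc y (conjExp t G A) ≤ (1 + C / 2) * rexp (4 * κ * t) * w y := by
  have hw0 : 0 ≤ w y := (osc_nonneg y A).trans (hA y)
  have key : ∀ c : Obs L, c = 𝔞 y ∨ c = star (𝔞 y) →
      ‖cm (conjExp t G A) c‖ ≤ ‖cm A c‖ + C / 4 * rexp (4 * κ * t) * w y := by
    intro c hc
    let f : ℝ → Obs L := fun s => cm A (conjExp (-s) G c)
    let f' : ℝ → Obs L := fun s => cm A (conjExp (-s) G (-(I • cm G c)))
    have hder : ∀ s, HasDerivAt (fun s : ℝ => conjExp (-s) G c)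
        (conjExp (-s) G (-(I • cm G c))) s := by
      intro s
      have := hasDerivAt_conjExp s (-G) c
      simp only [conjExp_neg_op, neg_cm, smul_neg] at this
      exact this
    have hf : ∀ s, HasDerivAt f (f' s) s := fun s =>
      ((hder s).const_mul A).sub ((hder s).mul_const A)
    have hf' : ∀ s, 0 ≤ s → ‖f' s‖ ≤ C * κ * rexp (4 * κ * s) * w y := by
      intro s hs
      have e : ‖f' s‖ = ‖cm (conjExp s G A) (cm G c)‖ := by
        rw [norm_cm_conjExp s hG]
        simp only [f', conjExp_neg, conjExp_smul, cm_neg, cm_smul, norm_neg, norm_smul,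
          norm_I, one_mul]
      rw [e]
      calc _ ≤ ∑ z, N y z * osc z (conjExp s G A) := hN _ y c hc
        _ ≤ ∑ z, N y z * (C * rexp (4 * κ * s) * w z) :=
          sum_le_sum fun z _ => mul_mono_left (hC s hs z) (hN0 y z)
        _ = C * rexp (4 * κ * s) * ∑ z, N y z * w z := by
          rw [mul_sum]; exact sum_congr rfl fun z _ => by ring
        _ ≤ C * rexp (4 * κ * s) * (κ * w y) := by gcongr; exact hw y
        _ = _ := by ring
    have hB : ∀ s : ℝ, HasDerivAt (fun s => ‖cm A c‖ + C / 4 * rexp (4 * κ * s) * w y)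
        (C * κ * rexp (4 * κ * s) * w y) s := by
      intro s
      have h1 : HasDerivAt (fun s : ℝ => rexp (4 * κ * s)) (rexp (4 * κ * s) * (4 * κ)) s := by
        have := ((hasDerivAt_id s).const_mul (4 * κ)).exp
        simpa using this
      have h2 := ((h1.const_mul (C / 4)).mul_const (w y)).const_add ‖cm A c‖
      refine h2.congr_deriv ?_
      ring
    have := image_norm_le_of_norm_deriv_right_le_deriv_boundary (f := f) (f' := f') (a := 0) (b := t)
      (fun s _ => (hf s).continuousAt.continuousWithinAt) (fun s _ => (hf s).hasDerivWithinAt)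
      (B := fun s => ‖cm A c‖ + C / 4 * rexp (4 * κ * s) * w y) (by
        simp only [f, neg_zero, conjExp_zero_time]
        have : 0 ≤ C / 4 * rexp (4 * κ * 0) * w y := by positivity
        linarith) hB (fun s hs => hf' s hs.1) (Set.right_mem_Icc.2 ht)
    rw [norm_cm_conjExp t hG]
    exact this
  have h1 := key _ (Or.inl rfl)
  have h2 := key _ (Or.inr rfl)
  have h3 := hA y
  have h4 : 1 ≤ rexp (4 * κ * t) := Real.one_le_exp (by positivity)
  have h5 : w y ≤ rexp (4 * κ * t) * w y := le_mul_of_one_le_left hw0 h4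
  unfold osc at *
  linarith

/-- The map $C\mapsto1+C/2$ contracts to its fixed point 2. The iteration starts from a crude
constant that may depend on the size of the torus; the dependence disappears in the limit. -/
theorem lieb_robinson_nonneg {G : Obs L} (hG : IsSelfAdjoint G) {N : Torus L → Torus L → ℝ}
    (hN0 : ∀ y z, 0 ≤ N y z)
    (hN : ∀ A y (c : Obs L), c = 𝔞 y ∨ c = star (𝔞 y) →
      ‖cm A (cm G c)‖ ≤ ∑ z, N y z * osc z A)
    {w : Torus L → ℝ} (hw0 : ∀ z, 0 < w z) {κ : ℝ} (hκ : 0 < κ)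
    (hw : ∀ y, ∑ z, N y z * w z ≤ κ * w y)
    {A : Obs L} (hA : ∀ z, osc z A ≤ w z) (t : ℝ) (ht : 0 ≤ t) (y : Torus L) :
    osc y (conjExp t G A) ≤ 2 * rexp (4 * κ * t) * w y := by
  let C₀ : ℝ := ∑ z, 4 * ‖A‖ / w z
  have hC₀ : 0 ≤ C₀ := sum_nonneg fun z _ => by have := hw0 z; positivity
  have h : ∀ n : ℕ, ∀ s : ℝ, 0 ≤ s → ∀ z,
      osc z (conjExp s G A) ≤ (2 + C₀ * (1 / 2) ^ n) * rexp (4 * κ * s) * w z := by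
    intro n
    induction n with
    | zero =>
      intro s hs z
      have h1 : osc z (conjExp s G A) ≤ 4 * ‖A‖ :=
        (osc_le_norm _ _).trans (by rw [norm_conjExp s hG])
      have h2 : 4 * ‖A‖ / w z ≤ C₀ := single_le_sum (f := fun z => 4 * ‖A‖ / w z)
          (fun z _ => by have := hw0 z; positivity) (mem_univ z)
      rw [div_le_iff₀ (hw0 z)] at h2
      have h4 : 1 ≤ rexp (4 * κ * s) := Real.one_le_exp (by positivity)
      have h5 : C₀ * w z ≤ (2 + C₀) * rexp (4 * κ * s) * w z := by
        gcongr
        · exact (hw0 z).le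
        · nlinarith
      simp only [pow_zero, mul_one]
      linarith
    | succ n ih =>
      intro s hs z
      have := lieb_robinson_step hG hN0 hN hκ hw hA (by positivity) ih s hs z
      convert this using 3
      rw [pow_succ]; ring
  have hlim : Filter.Tendsto (fun n : ℕ => (2 + C₀ * (1 / 2) ^ n) * rexp (4 * κ * t) * w y)
      Filter.atTop (nhds ((2 + C₀ * 0) * rexp (4 * κ * t) * w y)) := by
    have := tendsto_pow_atTop_nhds_zero_of_lt_one (r := (1 / 2 : ℝ)) (by norm_num) (by norm_num)
    exact (((this.const_mul C₀).const_add 2).mul_const _).mul_const _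
  have := ge_of_tendsto' hlim fun n => h n t ht y
  simpa using this

/-- The Lieb-Robinson bound, for a weight `w` which the interaction kernel `N` increases at most
by a factor. -/
theorem lieb_robinson {G : Obs L} (hG : IsSelfAdjoint G) {N : Torus L → Torus L → ℝ}
    (hN0 : ∀ y z, 0 ≤ N y z)
    (hN : ∀ A y (c : Obs L), c = 𝔞 y ∨ c = star (𝔞 y) →
      ‖cm A (cm G c)‖ ≤ ∑ z, N y z * osc z A)
    {w : Torus L → ℝ} (hw0 : ∀ z, 0 < w z) {κ : ℝ} (hκ : 0 < κ)
    (hw : ∀ y, ∑ z, N y z * w z ≤ κ * w y)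
    {A : Obs L} (hA : ∀ z, osc z A ≤ w z) (t : ℝ) (y : Torus L) :
    osc y (conjExp t G A) ≤ 2 * rexp (4 * κ * |t|) * w y := by
  rcases le_total 0 t with ht | ht
  · rw [abs_of_nonneg ht]
    exact lieb_robinson_nonneg hG hN0 hN hw0 hκ hw hA t ht y
  · rw [abs_of_nonpos ht, ← neg_neg t, ← conjExp_neg_op, neg_neg]
    refine lieb_robinson_nonneg hG.neg hN0 (fun A y c hc => ?_) hw0 hκ hw hA (-t) (by linarith) y
    rw [neg_cm, cm_neg, norm_neg]
    exact hN A y c hc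

/-! ### Distances on the torus and polynomial weights -/

theorem gdist_self (x : Torus L) : gdist x x = 0 := by simp [gdist]

theorem gdist_comm (x y : Torus L) : gdist x y = gdist y x := by
  unfold gdist
  rw [← neg_sub y.1, ← neg_sub y.2, ZMod.natAbs_valMinAbs_neg, ZMod.natAbs_valMinAbs_neg]

theorem gdist_triangle (x y z : Torus L) : gdist x z ≤ gdist x y + gdist y z := by
  unfold gdist
  have h1 := ZMod.natAbs_valMinAbs_add_le (x.1 - y.1) (y.1 - z.1)
  have h2 := ZMod.natAbs_valMinAbs_add_le (x.2 - y.2) (y.2 - z.2)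
  rw [sub_add_sub_cancel] at h1 h2
  have h3 := Int.natAbs_add_le (x.1 - y.1).valMinAbs (y.1 - z.1).valMinAbs
  have h4 := Int.natAbs_add_le (x.2 - y.2).valMinAbs (y.2 - z.2).valMinAbs
  omega

theorem gdist_le (x y : Torus L) : gdist x y ≤ L := by
  unfold gdist
  have h1 := ZMod.natAbs_valMinAbs_le (x.1 - y.1)
  have h2 := ZMod.natAbs_valMinAbs_le (x.2 - y.2)
  omega

/-- The polynomial weight `(1 + d)^{-k}`. -/
def wt (k d : ℕ) : ℝ := ((1 + (d : ℝ)) ^ k)⁻¹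

theorem wt_pos (k d : ℕ) : 0 < wt k d := by unfold wt; positivity

theorem wt_nonneg (k d : ℕ) : 0 ≤ wt k d := (wt_pos k d).le

theorem wt_zero_left (d : ℕ) : wt 0 d = 1 := by simp [wt]

theorem wt_zero_right (k : ℕ) : wt k 0 = 1 := by simp [wt]

theorem wt_add (k m d : ℕ) : wt (k + m) d = wt k d * wt m d := by
  unfold wt; rw [pow_add, mul_inv]

theorem wt_anti (k : ℕ) {d e : ℕ} (h : d ≤ e) : wt k e ≤ wt k d := by
  unfold wt
  have : (d : ℝ) ≤ e := by exact_mod_cast h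
  gcongr

theorem wt_le_one (k d : ℕ) : wt k d ≤ 1 := by
  rw [← wt_zero_right k]; exact wt_anti k (Nat.zero_le d)

theorem wt_anti_left {k m : ℕ} (h : k ≤ m) (d : ℕ) : wt m d ≤ wt k d := by
  obtain ⟨j, rfl⟩ := Nat.exists_eq_add_of_le h
  rw [wt_add]
  exact mul_le_of_le_one_right (wt_nonneg _ _) (wt_le_one _ _)

/-- This rests on $(1+a)(1+b)\ge1+a+b$; together with the triangle inequality it makes the weights
compatible with convolution. -/
theorem wt_mul_le (k : ℕ) {a b c : ℕ} (h : c ≤ a + b) : wt k a * wt k b ≤ wt k c := by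
  unfold wt
  rw [← mul_inv, ← mul_pow]
  have : (c : ℝ) ≤ a + b := by exact_mod_cast h
  have ha : (0 : ℝ) ≤ a := Nat.cast_nonneg a
  have hb : (0 : ℝ) ≤ b := Nat.cast_nonneg b
  gcongr
  nlinarith

theorem one_le_pow_mul_wt (k : ℕ) {d c : ℕ} (h : d ≤ c) : 1 ≤ (1 + (c : ℝ)) ^ k * wt k d := by
  unfold wt
  have : (d : ℝ) ≤ c := by exact_mod_cast h
  rw [← div_eq_mul_inv, one_le_div (by positivity)]
  gcongr

theorem wt_shift (k : ℕ) {a b c : ℕ} (h : c ≤ a + b) : wt k b ≤ (1 + (a : ℝ)) ^ k * wt k c := by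
  have h1 := wt_mul_le k h
  have h2 : wt k a = ((1 + (a : ℝ)) ^ k)⁻¹ := rfl
  rw [h2, inv_mul_le_iff₀ (by positivity)] at h1
  exact h1

/-- The summands are dominated by the telescoping differences of $2/(n+1)$. -/
theorem sum_wt_two_le (N : ℕ) : ∑ n ∈ range N, wt 2 n ≤ 2 := by
  have h : ∑ n ∈ range N, wt 2 n ≤ 2 - 2 / (N + 1 : ℝ) := by
    induction N with
    | zero => simp
    | succ N ih =>
      rw [sum_range_succ]
      have : wt 2 N ≤ 2 / (N + 1 : ℝ) - 2 / ((N : ℝ) + 1 + 1) := by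
        unfold wt
        rw [div_sub_div _ _ (by positivity) (by positivity), inv_eq_one_div,
          div_le_div_iff₀ (by positivity) (by positivity)]
        have : (0 : ℝ) ≤ N := Nat.cast_nonneg N
        nlinarith
      push_cast
      linarith
  have : (0 : ℝ) ≤ 2 / (N + 1 : ℝ) := by positivity
  linarith

theorem sum_zmod_wt_le : ∑ a : ZMod L, wt 2 a.valMinAbs.natAbs ≤ 4 := by
  have hmem : ∀ a ∈ (univ : Finset (ZMod L)), a.valMinAbs.natAbs ∈ range (L + 1) := fun a _ => by
      have := ZMod.natAbs_valMinAbs_le a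
      rw [mem_range]; omega
  rw [← sum_fiberwise_of_maps_to hmem]
  calc _ ≤ ∑ n ∈ range (L + 1), 2 * wt 2 n := by
        refine sum_le_sum fun n _ => ?_
        have hc : (univ.filter fun a : ZMod L => a.valMinAbs.natAbs = n).card ≤ 2 := by
          have : (univ.filter fun a : ZMod L => a.valMinAbs.natAbs = n) ⊆
              {(n : ZMod L), -(n : ZMod L)} := by
            intro a ha
            simp only [mem_filter, mem_univ, true_and] at ha
            have h := ZMod.coe_valMinAbs a
            rcases Int.natAbs_eq a.valMinAbs with h1 | h1 <;> rw [h1, ha] at h <;>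
              simp at h <;> simp [← h]
          exact (card_le_card this).trans card_le_two
        rw [sum_congr rfl (g := fun _ => wt 2 n) (fun a ha => by
          rw [(mem_filter.1 ha).2]), sum_const, nsmul_eq_mul]
        have : ((univ.filter fun a : ZMod L => a.valMinAbs.natAbs = n).card : ℝ) ≤ 2 := by
          exact_mod_cast hc
        exact mul_mono_right this (wt_nonneg _ _)
    _ ≤ 4 := by rw [← mul_sum]; linarith [sum_wt_two_le (L + 1)]

/-- Four powers of the graph distance dominate two powers of each coordinate distance, and a given
coordinate distance is attained at most twice. From here on a surplus of four powers pays for a sum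
over the torus, uniformly in its size. -/
theorem sum_wt_le (x : Torus L) : ∑ y, wt 4 (gdist x y) ≤ 16 := by
  have h : ∀ y : Torus L, wt 4 (gdist x y) ≤
      wt 2 (x.1 - y.1).valMinAbs.natAbs * wt 2 (x.2 - y.2).valMinAbs.natAbs := by
    intro y
    rw [show 4 = 2 + 2 from rfl, wt_add]
    exact mul_le_mul (wt_anti 2 (by unfold gdist; omega)) (wt_anti 2 (by unfold gdist; omega))
      (wt_nonneg _ _) (wt_nonneg _ _)
  have hs : ∀ a : ZMod L, ∑ b : ZMod L, wt 2 (a - b).valMinAbs.natAbs =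
      ∑ b : ZMod L, wt 2 b.valMinAbs.natAbs := fun a =>
    Fintype.sum_equiv (Equiv.subLeft a) _ _ fun b => by simp
  calc _ ≤ ∑ y : Torus L, wt 2 (x.1 - y.1).valMinAbs.natAbs * wt 2 (x.2 - y.2).valMinAbs.natAbs :=
        sum_le_sum fun y _ => h y
    _ = (∑ a : ZMod L, wt 2 (x.1 - a).valMinAbs.natAbs) *
        ∑ b : ZMod L, wt 2 (x.2 - b).valMinAbs.natAbs := by
        rw [sum_mul_sum, ← univ_product_univ, sum_product]
    _ ≤ 4 * 4 := by
        rw [hs, hs]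
        have := sum_zmod_wt_le (L := L)
        exact mul_le_mul this this (sum_nonneg fun _ _ => wt_nonneg _ _) (by norm_num)
    _ = 16 := by norm_num

theorem sum_wt_le' (x : Torus L) : ∑ y, wt 4 (gdist y x) ≤ 16 := by
  simp_rw [gdist_comm _ x]; exact sum_wt_le x

/-- The ball in the graph distance. -/
def ball (x : Torus L) (R : ℕ) : Region L := {y | gdist x y ≤ R}

theorem mem_ball {x y : Torus L} {R : ℕ} : y ∈ ball x R ↔ gdist x y ≤ R := by simp [ball]

theorem card_ball_le (x : Torus L) (R : ℕ) : ((ball x R).card : ℝ) ≤ 16 * (1 + (R : ℝ)) ^ 4 := by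
  calc ((ball x R).card : ℝ) = ∑ y ∈ ball x R, (1 : ℝ) := by simp
    _ ≤ ∑ y ∈ ball x R, (1 + (R : ℝ)) ^ 4 * wt 4 (gdist x y) :=
      sum_le_sum fun y hy => one_le_pow_mul_wt 4 (mem_ball.1 hy)
    _ ≤ ∑ y, (1 + (R : ℝ)) ^ 4 * wt 4 (gdist x y) :=
      sum_le_sum_of_subset_of_nonneg (subset_univ _) fun y _ _ =>
        mul_nonneg (by positivity) (wt_nonneg _ _)
    _ ≤ _ := by
      rw [← mul_sum, mul_comm (16 : ℝ)]
      gcongr; exact sum_wt_le x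

/-- Functions on the torus that change by at most one between neighbours. -/
def IsLip (D : Torus L → ℕ) : Prop := ∀ x y, D x ≤ D y + gdist x y

theorem isLip_gdist (x : Torus L) : IsLip (gdist x) := fun y z => by
  have := gdist_triangle x z y; rwa [gdist_comm z y] at this

open Classical in
/-- The distance to a set of sites (zero if the set is empty). -/
def sdist (S : Region L) (y : Torus L) : ℕ := if h : S.Nonempty then S.inf' h (gdist y) else 0

theorem sdist_le {S : Region L} {z : Torus L} (hz : z ∈ S) (y : Torus L) :
    sdist S y ≤ gdist y z := by
  rw [sdist, dif_pos ⟨z, hz⟩]; exact inf'_le _ hz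

theorem sdist_eq_zero {S : Region L} {z : Torus L} (hz : z ∈ S) : sdist S z = 0 :=
  Nat.le_zero.1 ((sdist_le hz z).trans (gdist_self z).le)

theorem exists_sdist {S : Region L} (h : S.Nonempty) (y : Torus L) :
    ∃ z ∈ S, sdist S y = gdist y z := by
  rw [sdist, dif_pos h]; exact exists_mem_eq_inf' h _

theorem isLip_sdist (S : Region L) : IsLip (sdist S) := by
  intro x y
  by_cases h : S.Nonempty
  · obtain ⟨z, hz, e⟩ := exists_sdist h y
    rw [e]
    have := sdist_le hz x
    have := gdist_triangle x y z
    omega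
  · simp [sdist, h]

theorem sdist_le_size (S : Region L) (y : Torus L) : sdist S y ≤ L := by
  by_cases h : S.Nonempty
  · obtain ⟨z, hz, e⟩ := exists_sdist h y
    rw [e]; exact gdist_le y z
  · simp [sdist, h]

theorem mem_fatten {S : Region L} {r : ℕ} {y : Torus L} :
    y ∈ fatten S r ↔ ∃ z ∈ S, gdist y z ≤ r := by simp [fatten]

theorem mem_fatten_iff {S : Region L} (h : S.Nonempty) {r : ℕ} {y : Torus L} :
    y ∈ fatten S r ↔ sdist S y ≤ r := by
  rw [mem_fatten]
  constructor
  · rintro ⟨z, hz, hr⟩; exact (sdist_le hz y).trans hr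
  · intro hr
    obtain ⟨z, hz, e⟩ := exists_sdist h y
    exact ⟨z, hz, e ▸ hr⟩

/-! ### Double commutators and Lieb-Robinson bounds for quasi-local fields -/

theorem norm_double_cm_le {X : Region L} {K : Obs L} (hK : K ∈ evenAlgebra X) (A : Obs L)
    {y : Torus L} {c : Obs L} (hc : c = 𝔞 y ∨ c = star (𝔞 y)) :
    ‖cm A (cm K c)‖ ≤ if y ∈ X then 4 * ‖K‖ * ∑ z ∈ X, osc z A else 0 := by
  split_ifs with hy
  · have hc' : c ∈ Algebra.adjoin ℂ (generators X) := Algebra.subset_adjoin ⟨y, hy, hc⟩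
    have hK' := evenAlgebra_le_adjoin X hK
    have hn : ‖c‖ ≤ 1 := by
      rcases hc with rfl | rfl
      · exact norm_annihilation_le y
      · exact norm_star_annihilation_le y
    have h1 := norm_cm_le_sum_osc (sub_mem (mul_mem hK' hc') (mul_mem hc' hK')) A
    have h2 : ‖K * c - c * K‖ ≤ 2 * ‖K‖ :=
      (norm_cm_le K c).trans (mul_le_of_le_one_right (by positivity) hn)
    have h3 := sum_nonneg fun z (_ : z ∈ X) => osc_nonneg z A
    calc ‖cm A (cm K c)‖ ≤ 2 * ‖K * c - c * K‖ * ∑ z ∈ X, osc z A := h1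
      _ ≤ 2 * (2 * ‖K‖) * ∑ z ∈ X, osc z A := by gcongr
      _ = _ := by ring
  · rw [cm_eq_zero.2 (evenAlgebra_commute hK hy hc), cm_zero, norm_zero]

theorem sum_far_osc_le {x : Torus L} {K : Obs L} {C : ℝ} {p : ℕ}
    (hK : ∀ y, osc y K ≤ C * wt (p + 4) (gdist x y)) (hC : 0 ≤ C) (n : ℕ) :
    ∑ y with n ≤ gdist x y, osc y K ≤ 16 * C * wt p n := by
  calc _ ≤ ∑ y with n ≤ gdist x y, C * wt p n * wt 4 (gdist x y) := by
        refine sum_le_sum fun y hy => (hK y).trans ?_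
        rw [wt_add, ← mul_assoc]
        have := wt_anti p (mem_filter.1 hy).2
        have := wt_nonneg 4 (gdist x y)
        gcongr
    _ ≤ ∑ y, C * wt p n * wt 4 (gdist x y) :=
        sum_le_sum_of_subset_of_nonneg (filter_subset _ _) fun y _ _ =>
          mul_nonneg (mul_nonneg hC (wt_nonneg _ _)) (wt_nonneg _ _)
    _ ≤ _ := by
        rw [← mul_sum]
        have := mul_mono_left (sum_wt_le x) (mul_nonneg hC (wt_nonneg p n))
        linarith

/-- The double commutator only involves sites in the ball. The decay $2k+2$ in the radius is spent
as $k$ powers on the distance to $y$, $k$ powers on the distance to the sites of $A$, and two powers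
on making the sum over radii converge. -/
theorem norm_double_cm_ball_le {x : Torus L} {n k : ℕ} {K : Obs L} {C : ℝ}
    (hKe : K ∈ evenAlgebra (ball x n)) (hC : 0 ≤ C) (hK : ‖K‖ ≤ C * wt (2 * k + 2) n) (A : Obs L)
    {y : Torus L} {c : Obs L} (hc : c = 𝔞 y ∨ c = star (𝔞 y)) :
    ‖cm A (cm K c)‖ ≤ 4 * C * wt k (gdist x y) * (∑ z, wt k (gdist x z) * osc z A) * wt 2 n := by
  have hS : 0 ≤ ∑ z, wt k (gdist x z) * osc z A :=
    sum_nonneg fun z _ => mul_nonneg (wt_nonneg _ _) (osc_nonneg _ _)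
  have w2 := wt_nonneg 2 n
  have wk := wt_nonneg k n
  have wy := wt_nonneg k (gdist x y)
  refine (norm_double_cm_le hKe A hc).trans ?_
  split_ifs with hy
  · have h1 : ∑ z ∈ ball x n, osc z A * wt k n ≤ ∑ z, wt k (gdist x z) * osc z A := by
      refine (sum_le_sum fun z hz => ?_).trans
        (sum_le_sum_of_subset_of_nonneg (subset_univ _) fun z _ _ =>
          mul_nonneg (wt_nonneg _ _) (osc_nonneg _ _))
      rw [mul_comm]
      exact mul_mono_right (wt_anti k (mem_ball.1 hz)) (osc_nonneg _ _)
    have h2 := wt_anti k (mem_ball.1 hy)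
    have h3 : 0 ≤ ∑ z ∈ ball x n, osc z A := sum_nonneg fun z _ => osc_nonneg z A
    rw [← sum_mul] at h1
    calc _ ≤ 4 * (C * wt (2 * k + 2) n) * ∑ z ∈ ball x n, osc z A := by gcongr
      _ = 4 * C * wt k n * ((∑ z ∈ ball x n, osc z A) * wt k n) * wt 2 n := by
          rw [wt_add, two_mul, wt_add]; ring
      _ ≤ _ := by gcongr
  · exact mul_nonneg (mul_nonneg (mul_nonneg (by linarith) wy) hS) w2

/-- Double commutators with an operator which is localized near `x` up to polynomial tails. -/
theorem norm_double_cm_quasilocal_le {x : Torus L} {K : Obs L} {C : ℝ} {k : ℕ}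
    (hKe : K ∈ evenAlgebra univ) (hC : 0 ≤ C)
    (hK : ∀ y, osc y K ≤ C * wt (2 * k + 2 + 4) (gdist x y)) (A : Obs L)
    {y : Torus L} {c : Obs L} (hc : c = 𝔞 y ∨ c = star (𝔞 y)) :
    ‖cm A (cm K c)‖ ≤ 256 * C * wt k (gdist x y) * ∑ z, wt k (gdist x z) * osc z A := by
  -- The truncations of `K` to growing balls. `F 0` is averaged over every site and commutes with
  -- `c`, `F (L + 1)` is `K` itself since no distance exceeds `L`, and each increment is small and
  -- strictly supported in a ball.
  obtain ⟨F, hF⟩ : ∃ F : ℕ → Obs L, ∀ n, F n = twirl {y | n ≤ gdist x y} K := ⟨_, fun _ => rfl⟩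
  have hF0 : cm (F 0) c = 0 := by
    have h0 : osc y (F 0) = 0 := by rw [hF]; exact osc_twirl_eq_zero _ _ (by simp)
    rcases hc with rfl | rfl
    · exact cm_eq_zero.2 (osc_eq_zero_iff.1 h0).1
    · exact cm_eq_zero.2 (osc_eq_zero_iff.1 h0).2
  have hFL : F (L + 1) = K := by
    rw [hF]
    refine twirl_eq_self fun z hz => ?_
    have := gdist_le x z
    have := (mem_filter.1 hz).2
    omega
  have hFm : ∀ n, F n ∈ evenAlgebra (ball x n) := fun n => by
    rw [hF]
    refine evenAlgebra_mono ?_ (twirl_mem _ hKe)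
    intro z hz
    simp only [mem_sdiff, mem_univ, mem_filter, true_and, not_le] at hz
    exact mem_ball.2 hz.le
  have hFm' : ∀ n, F (n + 1) ∈ evenAlgebra (ball x n) := fun n => by
    rw [hF]
    refine evenAlgebra_mono ?_ (twirl_mem _ hKe)
    intro z hz
    simp only [mem_sdiff, mem_univ, mem_filter, true_and, not_le] at hz
    exact mem_ball.2 (Nat.lt_succ_iff.1 hz)
  have hsum : K = F 0 + ∑ n ∈ range (L + 1), (F (n + 1) - F n) := by
    rw [sum_range_sub, hFL, add_sub_cancel]
  have hFn : ∀ n, ‖F (n + 1) - F n‖ ≤ 32 * C * wt (2 * k + 2) n := fun n => by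
    have h1 := (norm_sub_twirl_le _ K).trans (sum_far_osc_le hK hC n)
    have h2 := (norm_sub_twirl_le _ K).trans (sum_far_osc_le hK hC (n + 1))
    have h3 := wt_anti (2 * k + 2) (Nat.le_succ n)
    have e : F (n + 1) - F n = (K - F n) - (K - F (n + 1)) := by rw [sub_sub_sub_cancel_left]
    rw [← hF] at h1 h2
    rw [e]
    refine (norm_sub_le _ _).trans ?_
    have h4 := mul_mono_left h3 hC
    linarith
  have hcm : cm K c = ∑ n ∈ range (L + 1), cm (F (n + 1) - F n) c := by
    conv_lhs => rw [hsum]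
    rw [add_cm, hF0, zero_add, sum_cm]
  rw [hcm, cm_sum]
  have term : ∀ n, ‖cm A (cm (F (n + 1) - F n) c)‖ ≤
      4 * (32 * C) * wt k (gdist x y) * (∑ z, wt k (gdist x z) * osc z A) * wt 2 n := fun n =>
    norm_double_cm_ball_le (sub_mem (hFm' n) (hFm n)) (by positivity) (hFn n) A hc
  calc _ ≤ ∑ n ∈ range (L + 1), ‖cm A (cm (F (n + 1) - F n) c)‖ := norm_sum_le _ _
    _ ≤ ∑ n ∈ range (L + 1), 4 * (32 * C) * wt k (gdist x y) *
        (∑ z, wt k (gdist x z) * osc z A) * wt 2 n := sum_le_sum fun n _ => term n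
    _ ≤ 4 * (32 * C) * wt k (gdist x y) * (∑ z, wt k (gdist x z) * osc z A) * 2 := by
        rw [← mul_sum]
        have hS : 0 ≤ ∑ z, wt k (gdist x z) * osc z A :=
          sum_nonneg fun z _ => mul_nonneg (wt_nonneg _ _) (osc_nonneg _ _)
        exact mul_mono_left (sum_wt_two_le _)
          (mul_nonneg (mul_nonneg (by linarith) (wt_nonneg _ _)) hS)
    _ = _ := by ring

/-- The kernel is a composition of two convolutions. Each one reproduces the weight in `D`, as `D`
varies by no more than the distance, and costs a factor 16 for the lattice sum. -/
theorem sum_kernel_le {k : ℕ} {D : Torus L → ℕ} (hD : IsLip D) {f : Torus L → ℝ} {a : ℝ}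
    (ha : 0 ≤ a) (hf : ∀ z, f z ≤ a * wt k (D z)) (y : Torus L) :
    ∑ x, wt (k + 4) (gdist x y) * ∑ z, wt (k + 4) (gdist x z) * f z ≤ 256 * a * wt k (D y) := by
  have h1 : ∀ x, ∑ z, wt (k + 4) (gdist x z) * f z ≤ 16 * a * wt k (D x) := fun x => by
    calc _ ≤ ∑ z, a * wt k (D x) * wt 4 (gdist x z) := by
          refine sum_le_sum fun z _ => ?_
          have e := wt_mul_le k (hD x z)
          calc wt (k + 4) (gdist x z) * f z ≤ wt (k + 4) (gdist x z) * (a * wt k (D z)) :=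
                mul_mono_left (hf z) (wt_nonneg _ _)
            _ = a * (wt k (D z) * wt k (gdist x z)) * wt 4 (gdist x z) := by rw [wt_add]; ring
            _ ≤ _ := mul_mono_right (mul_mono_left e ha) (wt_nonneg _ _)
      _ ≤ a * wt k (D x) * 16 := by
          rw [← mul_sum]
          exact mul_mono_left (sum_wt_le x) (mul_nonneg ha (wt_nonneg _ _))
      _ = _ := by ring
  calc _ ≤ ∑ x, 16 * a * wt k (D y) * wt 4 (gdist x y) := by
        refine sum_le_sum fun x _ => ?_
        have e := wt_mul_le k (hD y x)
        rw [gdist_comm y x] at e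
        calc _ ≤ wt (k + 4) (gdist x y) * (16 * a * wt k (D x)) :=
              mul_mono_left (h1 x) (wt_nonneg _ _)
          _ = 16 * a * (wt k (D x) * wt k (gdist x y)) * wt 4 (gdist x y) := by rw [wt_add]; ring
          _ ≤ _ := mul_mono_right (mul_mono_left e (by linarith)) (wt_nonneg _ _)
    _ ≤ 16 * a * wt k (D y) * 16 := by
        rw [← mul_sum]
        exact mul_mono_left (sum_wt_le' y) (mul_nonneg (by linarith) (wt_nonneg _ _))
    _ = _ := by ring

theorem norm_double_cm_field_le {K : Torus L → Obs L} {C : ℝ} {k : ℕ}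
    (hKe : ∀ x, K x ∈ evenAlgebra univ) (hC : 0 ≤ C)
    (hK : ∀ x y, osc y (K x) ≤ C * wt (2 * k + 2 + 4) (gdist x y)) (A : Obs L)
    {y : Torus L} {c : Obs L} (hc : c = 𝔞 y ∨ c = star (𝔞 y)) :
    ‖cm A (cm (∑ x, K x) c)‖ ≤
      256 * C * ∑ x, wt k (gdist x y) * ∑ z, wt k (gdist x z) * osc z A := by
  rw [sum_cm, cm_sum, mul_sum]
  refine (norm_sum_le _ _).trans (sum_le_sum fun x _ => ?_)
  have := norm_double_cm_quasilocal_le (hKe x) hC (hK x) A hc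
  rwa [mul_assoc] at this

/-- The weight is polynomial and grows exponentially in time, so this version serves bounded times
only. The exponent in the hypothesis is the one required by `norm_double_cm_field_le` with $k+4$ in
place of $k$, the surplus four being used up by `sum_kernel_le`. The summand 1 in the rate only
keeps it positive. -/
theorem lieb_robinson_field {K : Torus L → Obs L} {C : ℝ} {k : ℕ}
    (hKe : ∀ x, K x ∈ evenAlgebra univ) (hC : 0 ≤ C)
    (hK : ∀ x y, osc y (K x) ≤ C * wt (2 * (k + 4) + 2 + 4) (gdist x y))
    (hs : IsSelfAdjoint (∑ x, K x)) {D : Torus L → ℕ} (hD : IsLip D) {A : Obs L} {a : ℝ}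
    (ha : 0 < a) (hA : ∀ z, osc z A ≤ a * wt k (D z)) (t : ℝ) (y : Torus L) :
    osc y (conjExp t (∑ x, K x) A) ≤
      2 * rexp (4 * (256 * C * 256 + 1) * |t|) * (a * wt k (D y)) := by
  refine lieb_robinson hs
    (N := fun y z => 256 * C * ∑ x, wt (k + 4) (gdist x y) * wt (k + 4) (gdist x z))
    (fun y z => mul_nonneg (by linarith) (sum_nonneg fun x _ =>
      mul_nonneg (wt_nonneg _ _) (wt_nonneg _ _))) ?_ (w := fun z => a * wt k (D z))
    (fun z => mul_pos ha (wt_pos _ _)) (by positivity) ?_ hA t y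
  · intro A y c hc
    refine (norm_double_cm_field_le hKe hC hK A hc).trans (le_of_eq ?_)
    simp only [mul_sum, sum_mul]
    rw [sum_comm]
    exact sum_congr rfl fun z _ => sum_congr rfl fun x _ => by ring
  · intro y
    have h := sum_kernel_le hD ha.le (f := fun z => a * wt k (D z)) (fun z => le_rfl) y
    have e : ∑ z, (256 * C * ∑ x, wt (k + 4) (gdist x y) * wt (k + 4) (gdist x z)) *
        (a * wt k (D z)) = 256 * C *
        ∑ x, wt (k + 4) (gdist x y) * ∑ z, wt (k + 4) (gdist x z) * (a * wt k (D z)) := by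
      simp only [mul_sum, sum_mul]
      rw [sum_comm]
      exact sum_congr rfl fun z _ => sum_congr rfl fun x _ => by ring
    rw [e]
    have h2 := mul_mono_left h (show 0 ≤ 256 * C by linarith)
    have h3 := mul_nonneg ha.le (wt_nonneg k (D y))
    linarith

theorem sum_support_wt_le {k c : ℕ} {D : Torus L → ℕ} (hD : IsLip D) (y : Torus L) :
    ∑ x with D x ≤ c, wt (k + 4) (gdist x y) ≤ 16 * (1 + (c : ℝ)) ^ k * wt k (D y) := by
  have h0 : 0 ≤ (1 + (c : ℝ)) ^ k * wt k (D y) := mul_nonneg (by positivity) (wt_nonneg _ _)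
  calc _ ≤ ∑ x with D x ≤ c, (1 + (c : ℝ)) ^ k * wt k (D y) * wt 4 (gdist x y) := by
        refine sum_le_sum fun x hx => ?_
        rw [wt_add]
        refine mul_mono_right (wt_shift k ?_) (wt_nonneg _ _)
        have := hD y x
        rw [gdist_comm] at this
        have := (mem_filter.1 hx).2
        omega
    _ ≤ ∑ x, (1 + (c : ℝ)) ^ k * wt k (D y) * wt 4 (gdist x y) :=
        sum_le_sum_of_subset_of_nonneg (filter_subset _ _) fun x _ _ =>
          mul_nonneg h0 (wt_nonneg _ _)
    _ ≤ _ := by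
        rw [← mul_sum]
        have := mul_mono_left (sum_wt_le' y) h0
        linarith

theorem osc_field_le {K : Torus L → Obs L} {C : ℝ} {k c : ℕ} (hC : 0 ≤ C)
    (hK : ∀ x y, osc y (K x) ≤ C * wt (k + 4) (gdist x y)) {D : Torus L → ℕ} (hD : IsLip D)
    (hs : ∀ x, K x ≠ 0 → D x ≤ c) (y : Torus L) :
    osc y (∑ x, K x) ≤ 16 * C * (1 + (c : ℝ)) ^ k * wt k (D y) := by
  calc osc y (∑ x, K x) ≤ ∑ x, osc y (K x) := osc_sum _ _ _
    _ = ∑ x with D x ≤ c, osc y (K x) := by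
        rw [sum_filter]
        refine sum_congr rfl fun x _ => ?_
        split_ifs with h
        · rfl
        · rw [not_imp_comm.1 (hs x) h, osc_zero]
    _ ≤ ∑ x with D x ≤ c, C * wt (k + 4) (gdist x y) := sum_le_sum fun x _ => hK x y
    _ ≤ _ := by
        rw [← mul_sum]
        have := mul_mono_left (sum_support_wt_le (k := k) (c := c) hD y) hC
        linarith

/-- The commutator of two fields is localized where the first one is. -/
theorem osc_cm_field_le {A B : Torus L → Obs L} {C : ℝ} {k c : ℕ} (hC : 0 ≤ C)
    (hAe : ∀ x, A x ∈ evenAlgebra univ) (hBe : ∀ x, B x ∈ evenAlgebra univ)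
    (hA : ∀ x y, osc y (A x) ≤ C * wt (2 * (k + 4) + 2 + 4) (gdist x y))
    (hB : ∀ x y, osc y (B x) ≤ C * wt (2 * (k + 4) + 2 + 4) (gdist x y))
    {D : Torus L → ℕ} (hD : IsLip D) (hs : ∀ x, A x ≠ 0 → D x ≤ c) (y : Torus L) :
    osc y (cm (∑ x, A x) (∑ x, B x)) ≤
      2 * (2 * 256 * 256 * 16 * C * C * (1 + (c : ℝ)) ^ k * wt k (D y)) := by
  have hle : ∀ d, C * wt (2 * (k + 4) + 2 + 4) d ≤ C * wt (k + 4) d := fun d =>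
    mul_mono_left (wt_anti_left (by omega) d) hC
  have hoA : ∀ z, osc z (∑ x, A x) ≤ 16 * C * (1 + (c : ℝ)) ^ k * wt k (D z) :=
    osc_field_le hC (fun x y => (hA x y).trans (hle _)) hD hs
  have hoB : ∀ z, osc z (∑ x, B x) ≤ 16 * C := fun z => by
    have := osc_field_le (D := fun _ => 0) (c := 0) (k := 0) hC
      (fun x y => (hB x y).trans (mul_mono_left (wt_anti_left (by omega) _) hC))
      (fun _ _ => by simp) (fun _ _ => le_rfl) z
    simpa [wt_zero_right] using this
  have hp : 0 ≤ (1 + (c : ℝ)) ^ k := by positivity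
  have key : ∀ b : Obs L, b = 𝔞 y ∨ b = star (𝔞 y) →
      ‖cm (cm (∑ x, A x) (∑ x, B x)) b‖ ≤
        2 * 256 * 256 * 16 * C * C * (1 + (c : ℝ)) ^ k * wt k (D y) := by
    intro b hb
    -- These are the two halves of the Jacobi identity. Here the decay comes from the oscillations
    -- of the first field; in the second half it comes from the sum over its sites, which is
    -- restricted to small `D`.
    have h1 : ‖cm (∑ x, A x) (cm (∑ x, B x) b)‖ ≤
        256 * C * (256 * (16 * C * (1 + (c : ℝ)) ^ k) * wt k (D y)) :=
      (norm_double_cm_field_le hBe hC hB _ hb).trans (mul_mono_left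
        (sum_kernel_le hD (mul_nonneg (by linarith) hp) hoA y) (by linarith))
    have h2 : ‖cm (∑ x, B x) (cm (∑ x, A x) b)‖ ≤
        256 * C * (256 * (16 * C * (1 + (c : ℝ)) ^ k) * wt k (D y)) := by
      rw [sum_cm univ A, cm_sum]
      refine (norm_sum_le _ _).trans ?_
      have hz : ∀ x, ∑ z, wt (k + 4) (gdist x z) * osc z (∑ x, B x) ≤ 16 * (16 * C) := fun x => by
        calc _ ≤ ∑ z, (16 * C) * wt 4 (gdist x z) := by
              refine sum_le_sum fun z _ => ?_
              rw [mul_comm]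
              exact mul_le_mul (hoB z) (wt_anti_left (by omega) _) (wt_nonneg _ _) (by linarith)
          _ ≤ _ := by
              rw [← mul_sum]
              have := mul_mono_left (sum_wt_le x) (show 0 ≤ 16 * C by linarith)
              linarith
      calc ∑ x, ‖cm (∑ x, B x) (cm (A x) b)‖ = ∑ x with D x ≤ c, ‖cm (∑ x, B x) (cm (A x) b)‖ := by
            rw [sum_filter]
            refine sum_congr rfl fun x _ => ?_
            split_ifs with h
            · rfl
            · rw [not_imp_comm.1 (hs x) h, zero_cm, cm_zero, norm_zero]
        _ ≤ ∑ x with D x ≤ c, 256 * C * (16 * (16 * C)) * wt (k + 4) (gdist x y) := by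
            refine sum_le_sum fun x _ => ?_
            refine (norm_double_cm_quasilocal_le (hAe x) hC (hA x) _ hb).trans ?_
            have := mul_mono_left (hz x)
              (mul_nonneg (show 0 ≤ 256 * C by linarith) (wt_nonneg (k + 4) (gdist x y)))
            linarith
        _ ≤ _ := by
            rw [← mul_sum]
            have := mul_mono_left (sum_support_wt_le (k := k) (c := c) hD y)
              (show 0 ≤ 256 * C * (16 * (16 * C)) by positivity)
            refine this.trans (le_of_eq ?_)
            ring
    rw [cm_jacobi]
    refine (norm_sub_le _ _).trans ?_
    linarith
  have := add_le_add (key _ (Or.inl rfl)) (key _ (Or.inr rfl))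
  unfold osc
  linarith

/-- The Lieb-Robinson bound for a finite range Hamiltonian, with an exponential weight. -/
theorem lieb_robinson_exp {h : Torus L → Obs L} {m : ℝ} {R : ℕ}
    (he : ∀ x, h x ∈ evenAlgebra (ball x R)) (hm : ∀ x, ‖h x‖ ≤ m) (hm0 : 0 ≤ m)
    (hs : IsSelfAdjoint (∑ x, h x)) {D : Torus L → ℕ} (hD : IsLip D) {A : Obs L} {a : ℝ}
    (ha : 0 < a) (hA : ∀ z, osc z A ≤ a * rexp (-(D z : ℝ))) (t : ℝ) (y : Torus L) :
    osc y (conjExp t (∑ x, h x) A) ≤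
      2 * rexp (4 * (4 * m * (16 * (1 + (R : ℝ)) ^ 4) ^ 2 * rexp (2 * R) + 1) * |t|) *
        (a * rexp (-(D y : ℝ))) := by
  -- The kernel counts the balls that contain both sites. Such sites are at distance at most $2R$,
  -- so an exponential weight changes by at most $e^{2R}$.
  have hN : ∀ y z : Torus L, 0 ≤ ∑ x, if gdist x y ≤ R ∧ gdist x z ≤ R then 4 * m else 0 :=
    fun y z => sum_nonneg fun x _ => by split_ifs <;> positivity
  refine lieb_robinson hs (N := fun y z => ∑ x, if gdist x y ≤ R ∧ gdist x z ≤ R then 4 * m else 0)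
    hN ?_ (w := fun z => a * rexp (-(D z : ℝ))) (fun z => by positivity) (by positivity) ?_ hA t y
  · intro A y c hc
    rw [sum_cm, cm_sum]
    refine (norm_sum_le _ _).trans ?_
    simp only [sum_mul]
    rw [sum_comm]
    refine sum_le_sum fun x _ => (norm_double_cm_le (he x) A hc).trans ?_
    split_ifs with hy
    · rw [mem_ball] at hy
      have e : ∑ z, (if gdist x y ≤ R ∧ gdist x z ≤ R then 4 * m else 0) * osc z A =
          4 * m * ∑ z ∈ ball x R, osc z A := by
        rw [ball, sum_filter, mul_sum]
        refine sum_congr rfl fun z _ => ?_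
        by_cases hz : gdist x z ≤ R <;> simp [hy, hz]
      rw [e]
      have := sum_nonneg fun z (_ : z ∈ ball x R) => osc_nonneg z A
      exact mul_mono_right (by linarith [hm x]) this
    · rw [mem_ball] at hy
      exact sum_nonneg fun z _ => by simp [hy]
  · intro y
    have hb : ∀ x z, (if gdist x y ≤ R ∧ gdist x z ≤ R then 4 * m else 0) *
        (a * rexp (-(D z : ℝ))) ≤ (if gdist x y ≤ R ∧ gdist x z ≤ R then
          4 * m * rexp (2 * R) * (a * rexp (-(D y : ℝ))) else 0) := by
      intro x z
      split_ifs with h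
      · have h1 := hD y z
        have h2 := gdist_triangle y x z
        rw [gdist_comm y x] at h2
        have h3 : (D y : ℝ) ≤ D z + 2 * R := by
          have : D y ≤ D z + 2 * R := by omega
          exact_mod_cast this
        have h4 : rexp (-(D z : ℝ)) ≤ rexp (2 * R) * rexp (-(D y : ℝ)) := by
          rw [← Real.exp_add]; exact Real.exp_le_exp.2 (by linarith)
        have := mul_mono_left h4 (show 0 ≤ 4 * m * a by positivity)
        linarith
      · simp
    simp only [sum_mul]
    calc _ ≤ ∑ z, ∑ x, (if gdist x y ≤ R ∧ gdist x z ≤ R then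
          4 * m * rexp (2 * R) * (a * rexp (-(D y : ℝ))) else 0) :=
          sum_le_sum fun z _ => sum_le_sum fun x _ => hb x z
      _ = ∑ x, ∑ z, (if gdist x y ≤ R ∧ gdist x z ≤ R then
          4 * m * rexp (2 * R) * (a * rexp (-(D y : ℝ))) else 0) := sum_comm
      _ = ∑ x ∈ ball y R, ∑ z ∈ ball x R, 4 * m * rexp (2 * R) * (a * rexp (-(D y : ℝ))) := by
          rw [ball, sum_filter]
          refine sum_congr rfl fun x _ => ?_
          rw [gdist_comm y x]
          split_ifs with hx
          · rw [ball, sum_filter]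
            exact sum_congr rfl fun z _ => by simp [hx]
          · exact sum_eq_zero fun z _ => by simp [hx]
      _ ≤ ∑ x ∈ ball y R, (16 * (1 + (R : ℝ)) ^ 4) * (4 * m * rexp (2 * R) *
          (a * rexp (-(D y : ℝ)))) := by
          refine sum_le_sum fun x _ => ?_
          rw [sum_const, nsmul_eq_mul]
          exact mul_mono_right (card_ball_le x R)
      _ ≤ (16 * (1 + (R : ℝ)) ^ 4) * ((16 * (1 + (R : ℝ)) ^ 4) * (4 * m * rexp (2 * R) *
          (a * rexp (-(D y : ℝ))))) := by
          rw [sum_const, nsmul_eq_mul]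
          exact mul_mono_right (card_ball_le y R)
      _ ≤ _ := by
          have : 0 ≤ a * rexp (-(D y : ℝ)) := by positivity
          nlinarith

end Lattice

/-- Comparable distances have comparable weights. In particular a decay in a distance proportional
to the size becomes a decay in the size. -/
theorem wt_scale (k : ℕ) {n d e : ℕ} (h : n + 1 ≤ e * (1 + d)) : wt k d ≤ (e : ℝ) ^ k * wt k n := by
  unfold wt
  have h' : (1 + (n : ℝ)) ≤ e * (1 + (d : ℝ)) := by
    have : ((n + 1 : ℕ) : ℝ) ≤ ((e * (1 + d) : ℕ) : ℝ) := by exact_mod_cast h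
    push_cast at this; linarith
  rw [← div_eq_mul_inv, inv_eq_one_div, div_le_div_iff₀ (by positivity) (by positivity), one_mul,
    ← mul_pow]
  gcongr

/-! ### Calculus of families: rapid decay, polynomial growth, localization -/

section Families

variable {ι : Type} {n : ι → ℕ}

/-- Families of numbers that are bounded by every negative power of the size. -/
def Rapid (n : ι → ℕ) (f : ι → ℝ) : Prop := ∀ k, ∃ C, 0 ≤ C ∧ ∀ i, f i ≤ C * wt k (n i)

/-- Families of numbers that are bounded by a power of the size. -/
def PolyBdd (n : ι → ℕ) (f : ι → ℝ) : Prop :=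
  ∃ C, 0 ≤ C ∧ ∃ a : ℕ, ∀ i, f i ≤ C * (1 + (n i : ℝ)) ^ a

theorem Rapid.mono {f g : ι → ℝ} (hg : Rapid n g) (h : ∀ i, f i ≤ g i) : Rapid n f := fun k => by
  obtain ⟨C, hC, hb⟩ := hg k
  exact ⟨C, hC, fun i => (h i).trans (hb i)⟩

/-- Reindexing encodes uniformity: further parameters such as times are adjoined to the index type,
and an estimate over the larger index type is uniform in them. -/
theorem Rapid.comp {J : Type} {f : ι → ℝ} (hf : Rapid n f) (g : J → ι) :
    Rapid (fun j => n (g j)) (fun j => f (g j)) := fun k => by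
  obtain ⟨C, hC, hb⟩ := hf k
  exact ⟨C, hC, fun j => hb (g j)⟩

theorem Rapid.of_forall {f : ι → ℝ} (h : ∀ i, f i ≤ 0) : Rapid n f := fun k =>
  ⟨0, le_rfl, fun i => by rw [zero_mul]; exact h i⟩

theorem Rapid.add {f g : ι → ℝ} (hf : Rapid n f) (hg : Rapid n g) :
    Rapid n (fun i => f i + g i) := fun k => by
  obtain ⟨C, hC, hb⟩ := hf k
  obtain ⟨C', hC', hb'⟩ := hg k
  exact ⟨C + C', by positivity, fun i => by rw [add_mul]; exact add_le_add (hb i) (hb' i)⟩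

theorem Rapid.mul_poly {f g : ι → ℝ} (hf : Rapid n f) (hg : PolyBdd n g)
    (hg0 : ∀ i, 0 ≤ g i := by intro; positivity) : Rapid n (fun i => f i * g i) := fun k => by
  obtain ⟨C', hC', a, hb'⟩ := hg
  obtain ⟨C, hC, hb⟩ := hf (k + a)
  refine ⟨C * C', by positivity, fun i => ?_⟩
  calc f i * g i ≤ (C * wt (k + a) (n i)) * g i := mul_mono_right (hb i) (hg0 i)
    _ ≤ (C * wt (k + a) (n i)) * (C' * (1 + (n i : ℝ)) ^ a) :=
        mul_mono_left (hb' i) (mul_nonneg hC (wt_nonneg _ _))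
    _ = C * C' * wt k (n i) * (wt a (n i) * (1 + (n i : ℝ)) ^ a) := by rw [wt_add]; ring
    _ = _ := by
        rw [wt, wt, inv_mul_cancel₀ (by positivity), mul_one]

theorem Rapid.const_mul {f : ι → ℝ} (hf : Rapid n f) {c : ℝ} (hc : 0 ≤ c) :
    Rapid n (fun i => c * f i) := fun k => by
  obtain ⟨C, hC, hb⟩ := hf k
  exact ⟨c * C, by positivity, fun i => by
    rw [mul_assoc]; exact mul_mono_left (hb i) hc⟩

/-- Using $2k$ powers for the square leaves $k$ powers for its root. Energy estimates bound squares
of norms, and this shows that nothing is lost. -/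
theorem Rapid.of_sq {f g : ι → ℝ} (hf : Rapid n f) (h : ∀ i, g i ^ 2 ≤ f i) : Rapid n g :=
  fun k => by
  obtain ⟨C, hC, hb⟩ := hf (k + k)
  refine ⟨√C, Real.sqrt_nonneg _, fun i => ?_⟩
  refine (le_abs_self _).trans ?_
  rw [← Real.sqrt_sq_eq_abs]
  refine Real.sqrt_le_iff.2 ⟨mul_nonneg (Real.sqrt_nonneg _) (wt_nonneg _ _), ?_⟩
  refine ((h i).trans (hb i)).trans (le_of_eq ?_)
  rw [mul_pow, Real.sq_sqrt hC, wt_add]; ring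

theorem PolyBdd.mono {f g : ι → ℝ} (hg : PolyBdd n g) (h : ∀ i, f i ≤ g i) : PolyBdd n f := by
  obtain ⟨C, hC, a, hb⟩ := hg
  exact ⟨C, hC, a, fun i => (h i).trans (hb i)⟩

theorem PolyBdd.comp {J : Type} {f : ι → ℝ} (hf : PolyBdd n f) (g : J → ι) :
    PolyBdd (fun j => n (g j)) (fun j => f (g j)) := by
  obtain ⟨C, hC, a, hb⟩ := hf
  exact ⟨C, hC, a, fun i => hb (g i)⟩

theorem PolyBdd.const (c : ℝ) : PolyBdd n (fun _ : ι => c) :=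
  ⟨|c|, abs_nonneg c, 0, fun i => by simpa using le_abs_self c⟩

theorem PolyBdd.add {f g : ι → ℝ} (hf : PolyBdd n f) (hg : PolyBdd n g) :
    PolyBdd n (fun i => f i + g i) := by
  obtain ⟨C, hC, a, hb⟩ := hf
  obtain ⟨C', hC', a', hb'⟩ := hg
  refine ⟨C + C', by positivity, a + a', fun i => ?_⟩
  have h1 : (1 : ℝ) ≤ 1 + (n i : ℝ) := by linarith [(Nat.cast_nonneg (n i) : (0 : ℝ) ≤ n i)]
  have h2 : (1 + (n i : ℝ)) ^ a ≤ (1 + (n i : ℝ)) ^ (a + a') := pow_le_pow_right₀ h1 (by omega)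
  have h3 : (1 + (n i : ℝ)) ^ a' ≤ (1 + (n i : ℝ)) ^ (a + a') := pow_le_pow_right₀ h1 (by omega)
  nlinarith [hb i, hb' i, mul_mono_left h2 hC, mul_mono_left h3 hC']

theorem PolyBdd.mul {f g : ι → ℝ} (hf : PolyBdd n f) (hg : PolyBdd n g)
    (hg0 : ∀ i, 0 ≤ g i := by intro; positivity) : PolyBdd n (fun i => f i * g i) := by
  obtain ⟨C, hC, a, hb⟩ := hf
  obtain ⟨C', hC', a', hb'⟩ := hg
  refine ⟨C * C', by positivity, a + a', fun i => ?_⟩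
  calc f i * g i ≤ (C * (1 + (n i : ℝ)) ^ a) * g i := mul_mono_right (hb i) (hg0 i)
    _ ≤ (C * (1 + (n i : ℝ)) ^ a) * (C' * (1 + (n i : ℝ)) ^ a') := mul_mono_left (hb' i)
    _ = _ := by rw [pow_add]; ring

theorem Rapid.polyBdd {f : ι → ℝ} (hf : Rapid n f) : PolyBdd n f := by
  obtain ⟨C, hC, hb⟩ := hf 0
  exact ⟨C, hC, 0, fun i => by simpa [wt_zero_left] using hb i⟩

variable [∀ i, NeZero (n i)]

abbrev Family (n : ι → ℕ) [∀ i, NeZero (n i)] := ∀ i, Obs (n i)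
abbrev Density (n : ι → ℕ) [∀ i, NeZero (n i)] := ∀ i, Torus (n i) → Obs (n i)
abbrev Distance (n : ι → ℕ) := ∀ i, Torus (n i) → ℕ
abbrev Regions (n : ι → ℕ) := ∀ i, Region (n i)
abbrev Terms (n : ι → ℕ) [∀ i, NeZero (n i)] := ∀ i, Region (n i) → Obs (n i)
notation:max "sdists" S:max => fun i => sdist (S i)

theorem isLip_sdists {S : Regions n} (i : ι) : IsLip (sdist (S i)) := isLip_sdist _

theorem card_torus (L : ℕ) [NeZero L] : (Fintype.card (Torus L) : ℝ) ≤ (1 + (L : ℝ)) ^ 2 := by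
  rw [Fintype.card_prod, ZMod.card]
  push_cast
  have : (0 : ℝ) ≤ L := Nat.cast_nonneg L
  nlinarith

theorem card_le_torus {L : ℕ} [NeZero L] (Y : Region L) : (Y.card : ℝ) ≤ (1 + (L : ℝ)) ^ 2 :=
  le_trans (by exact_mod_cast card_le_univ Y) (card_torus L)

theorem Rapid.sum_sites {Y : Regions n} {f : ∀ i, Torus (n i) → ℝ}
    (h : ∀ k, ∃ C, 0 ≤ C ∧ ∀ i, ∀ y ∈ Y i, f i y ≤ C * wt k (n i)) :
    Rapid n (fun i => ∑ y ∈ Y i, f i y) := by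
  -- The point 0 is adjoined so that the supremum is taken over a nonempty set even if the region is
  -- empty.
  have h1 : Rapid n (fun i => sSup ((fun y => f i y) '' (Y i : Set (Torus (n i))) ∪ {0})) :=
    fun k => by
    obtain ⟨C, hC, hb⟩ := h k
    refine ⟨C, hC, fun i => csSup_le ⟨0, by simp⟩ ?_⟩
    rintro _ (⟨y, hy, rfl⟩ | h0)
    · exact hb i y hy
    · rw [Set.mem_singleton_iff.1 h0]; exact mul_nonneg hC (wt_nonneg _ _)
  have hbdd : ∀ i, BddAbove ((fun y => f i y) '' (Y i : Set (Torus (n i))) ∪ {0}) := fun i =>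
    ((Set.toFinite _).image _ |>.union (Set.finite_singleton _)).bddAbove
  have h2 : PolyBdd n (fun i => ((Y i).card : ℝ)) :=
    ⟨1, zero_le_one, 2, fun i => by rw [one_mul]; exact card_le_torus _⟩
  refine (h1.mul_poly h2 fun i => Nat.cast_nonneg _).mono fun i => ?_
  rw [mul_comm, ← nsmul_eq_mul]
  refine sum_le_card_nsmul _ _ _ fun y hy => ?_
  exact le_csSup (hbdd i) (Or.inl ⟨y, hy, rfl⟩)

/-- Families of even operators, of polynomially bounded norm, localized where `D` is small. -/
structure Near (D : Distance n) (A : Family n) : Prop where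
  even : ∀ i, A i ∈ evenAlgebra univ
  poly : PolyBdd n (fun i => ‖A i‖)
  decay : ∀ k, ∃ C, 0 ≤ C ∧ ∀ i y, osc y (A i) ≤ C * wt k (D i y)

/-- Families of fields of uniformly bounded and uniformly localized even operators. -/
structure QField (K : Density n) : Prop where
  even : ∀ i x, K i x ∈ evenAlgebra univ
  bdd : ∃ C, 0 ≤ C ∧ ∀ i x, ‖K i x‖ ≤ C
  decay : ∀ k, ∃ C, 0 ≤ C ∧ ∀ i x y, osc y (K i x) ≤ C * wt k (gdist x y)

variable {D D' : Distance n} {A B : Family n}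
  {K K' : Density n}

theorem Near.comp {J : Type} (h : Near D A) (g : J → ι) :
    Near (n := fun j => n (g j)) (fun j => D (g j)) (fun j => A (g j)) where
  even j := h.even (g j)
  poly := h.poly.comp g
  decay k := by
    obtain ⟨C, hC, hb⟩ := h.decay k
    exact ⟨C, hC, fun j => hb (g j)⟩

theorem QField.comp {J : Type} (h : QField K) (g : J → ι) :
    QField (n := fun j => n (g j)) (fun j => K (g j)) where
  even j := h.even (g j)
  bdd := by
    obtain ⟨C, hC, hb⟩ := h.bdd
    exact ⟨C, hC, fun j => hb (g j)⟩
  decay k := by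
    obtain ⟨C, hC, hb⟩ := h.decay k
    exact ⟨C, hC, fun j => hb (g j)⟩

theorem Near.smul (c : ι → ℂ) (hc : ∃ M, ∀ i, ‖c i‖ ≤ M) (h : Near D A) :
    Near D (fun i => c i • A i) := by
  obtain ⟨M, hM⟩ := hc
  have hM' : ∀ i, ‖c i‖ ≤ |M| := fun i => (hM i).trans (le_abs_self M)
  refine ⟨fun i => Subalgebra.smul_mem _ (h.even i) _,
    ((PolyBdd.const |M|).mul h.poly).mono fun i => ?_, fun k => ?_⟩
  · rw [norm_smul]; exact mul_mono_right (hM' i)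
  · obtain ⟨C, hC, hb⟩ := h.decay k
    refine ⟨|M| * C, by positivity, fun i y => ?_⟩
    rw [osc_smul, mul_assoc]
    exact mul_le_mul (hM' i) (hb i y) (osc_nonneg _ _) (abs_nonneg _)

theorem Near.add (hA : Near D A) (hB : Near D B) : Near D (fun i => A i + B i) := by
  refine ⟨fun i => add_mem (hA.even i) (hB.even i),
    (hA.poly.add hB.poly).mono fun i => norm_add_le _ _, fun k => ?_⟩
  obtain ⟨C, hC, hb⟩ := hA.decay k
  obtain ⟨C', hC', hb'⟩ := hB.decay k
  exact ⟨C + C', by positivity, fun i y => (osc_add _ _ _).trans (by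
    rw [add_mul]; exact add_le_add (hb i y) (hb' i y))⟩

theorem Near.neg (hA : Near D A) : Near D (fun i => -A i) :=
  ⟨fun i => neg_mem (hA.even i), by simpa using hA.poly, fun k => by
    simpa [osc_neg] using hA.decay k⟩

theorem Near.sub (hA : Near D A) (hB : Near D B) : Near D (fun i => A i - B i) := by
  simpa [sub_eq_add_neg] using hA.add hB.neg

/-- Localization in the intersection of three regions. -/
theorem Near.inter {D₁ D₂ D₃ : Distance n} (h₁ : Near D₁ A) (h₂ : Near D₂ A)
    (h₃ : Near D₃ A)
    (h : ∃ e : ℕ, ∀ i y, D i y + 1 ≤ e * (1 + max (D₁ i y) (max (D₂ i y) (D₃ i y)))) :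
    Near D A := by
  obtain ⟨e, he⟩ := h
  refine ⟨h₁.even, h₁.poly, fun k => ?_⟩
  obtain ⟨C₁, hC₁, hb₁⟩ := h₁.decay k
  obtain ⟨C₂, hC₂, hb₂⟩ := h₂.decay k
  obtain ⟨C₃, hC₃, hb₃⟩ := h₃.decay k
  refine ⟨(C₁ + C₂ + C₃) * e ^ k, by positivity, fun i y => ?_⟩
  have hm : osc y (A i) ≤ (C₁ + C₂ + C₃) * wt k (max (D₁ i y) (max (D₂ i y) (D₃ i y))) := by
    have key : ∀ {C' : ℝ} {d : ℕ}, osc y (A i) ≤ C' * wt k d → C' ≤ C₁ + C₂ + C₃ →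
        osc y (A i) ≤ (C₁ + C₂ + C₃) * wt k d := fun h1 h2 =>
      h1.trans (mul_mono_right h2 (wt_nonneg _ _))
    rcases max_choice (D₁ i y) (max (D₂ i y) (D₃ i y)) with h | h
    · rw [h]; exact key (hb₁ i y) (by linarith)
    · rw [h]
      rcases max_choice (D₂ i y) (D₃ i y) with h | h
      · rw [h]; exact key (hb₂ i y) (by linarith)
      · rw [h]; exact key (hb₃ i y) (by linarith)
  refine hm.trans ?_
  rw [mul_assoc]
  exact mul_mono_left (wt_scale k (he i y))

/-- Distances never exceed the size, so a rapidly small operator counts as localized anywhere. -/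
theorem Near.of_rapid (hA : ∀ i, A i ∈ evenAlgebra univ) (h : Rapid n (fun i => ‖A i‖))
    (hD : ∀ i y, D i y ≤ n i) : Near D A := by
  refine ⟨hA, h.polyBdd, fun k => ?_⟩
  obtain ⟨C, hC, hb⟩ := h k
  refine ⟨4 * C, by positivity, fun i y => (osc_le_norm _ _).trans ?_⟩
  have h1 := hb i
  have h2 := mul_mono_left (wt_anti k (hD i y)) hC
  linarith

/-- Two regions at a distance proportional to the size. -/
def Separated (D D' : Distance n) : Prop := ∃ c : ℕ, ∀ i y, n i ≤ c * (1 + D i y + D' i y)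

/-- The torus is cut into the sites closer to one region and those closer to the other. On each
piece the larger of the two distances is at least proportional to the size, so one of the operators
has rapidly small oscillations there. -/
theorem Near.rapid_cm (hA : Near D A) (hB : Near D' B) (hs : Separated D D') :
    Rapid n (fun i => ‖cm (A i) (B i)‖) := by
  obtain ⟨c, hc⟩ := hs
  have h1 : Rapid n (fun i => ∑ y ∈ ({y | D i y ≤ D' i y} : Region (n i)), osc y (B i)) := by
    refine Rapid.sum_sites fun k => ?_
    obtain ⟨C, hC, hb⟩ := hB.decay k
    refine ⟨C * ((2 * c + 1 : ℕ) : ℝ) ^ k, by positivity, fun i y hy => (hb i y).trans ?_⟩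
    rw [mul_assoc]
    refine mul_mono_left (wt_scale k ?_) hC
    have := hc i y
    have := (mem_filter.1 hy).2
    nlinarith
  have h2 : Rapid n (fun i => ∑ y ∈ ({y | D i y ≤ D' i y} : Region (n i))ᶜ, osc y (A i)) := by
    refine Rapid.sum_sites fun k => ?_
    obtain ⟨C, hC, hb⟩ := hA.decay k
    refine ⟨C * ((2 * c + 1 : ℕ) : ℝ) ^ k, by positivity, fun i y hy => (hb i y).trans ?_⟩
    rw [mul_assoc]
    refine mul_mono_left (wt_scale k ?_) hC
    have := hc i y
    simp only [mem_compl, mem_filter, mem_univ, true_and, not_le] at hy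
    nlinarith
  refine ((h1.mul_poly ((PolyBdd.const 2).mul hA.poly)).add
    (h2.mul_poly ((PolyBdd.const 2).mul hB.poly))).mono fun i => ?_
  have := norm_cm_le_of_split {y | D i y ≤ D' i y} (hB.even i) (A i)
  linarith

theorem QField.add (h : QField K) (h' : QField K') : QField (fun i x => K i x + K' i x) := by
  refine ⟨fun i x => add_mem (h.even i x) (h'.even i x), ?_, fun k => ?_⟩
  · obtain ⟨C, hC, hb⟩ := h.bdd
    obtain ⟨C', hC', hb'⟩ := h'.bdd
    exact ⟨C + C', by positivity, fun i x => (norm_add_le _ _).trans (add_le_add (hb i x) (hb' i x))⟩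
  · obtain ⟨C, hC, hb⟩ := h.decay k
    obtain ⟨C', hC', hb'⟩ := h'.decay k
    exact ⟨C + C', by positivity, fun i x y => (osc_add _ _ _).trans (by
      rw [add_mul]; exact add_le_add (hb i x y) (hb' i x y))⟩

theorem QField.neg (h : QField K) : QField (fun i x => -K i x) :=
  ⟨fun i x => neg_mem (h.even i x), by simpa using h.bdd, fun k => by
    simpa [osc_neg] using h.decay k⟩

theorem QField.sub (h : QField K) (h' : QField K') : QField (fun i x => K i x - K' i x) := by
  simpa [sub_eq_add_neg] using h.add h'.neg

open Classical in
/-- The restriction of a field to a set of sites. -/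
def restr (S : Regions n) (K : Density n) :
    Density n := fun i x => if x ∈ S i then K i x else 0

theorem QField.restr (h : QField K) (S : Regions n) : QField (restr S K) := by
  refine ⟨fun i x => ?_, ?_, fun k => ?_⟩
  · unfold HallPump.restr; split_ifs
    · exact h.even i x
    · exact zero_mem _
  · obtain ⟨C, hC, hb⟩ := h.bdd
    refine ⟨C, hC, fun i x => ?_⟩
    unfold HallPump.restr; split_ifs
    · exact hb i x
    · simpa using hC
  · obtain ⟨C, hC, hb⟩ := h.decay k
    refine ⟨C, hC, fun i x y => ?_⟩
    unfold HallPump.restr; split_ifs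
    · exact hb i x y
    · rw [osc_zero]; exact mul_nonneg hC (wt_nonneg _ _)

theorem QField.sum_even (h : QField K) (i : ι) : ∑ x, K i x ∈ evenAlgebra univ :=
  sum_mem fun x _ => h.even i x

theorem QField.sum_poly (h : QField K) : PolyBdd n (fun i => ‖∑ x, K i x‖) := by
  obtain ⟨C, hC, hb⟩ := h.bdd
  refine ⟨C, hC, 2, fun i => (norm_sum_le _ _).trans ?_⟩
  calc _ ≤ ∑ _x : Torus (n i), C := sum_le_sum fun x _ => hb i x
    _ = Fintype.card (Torus (n i)) * C := by rw [sum_const, nsmul_eq_mul]; rfl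
    _ ≤ _ := by rw [mul_comm]; exact mul_mono_left (card_torus _) hC

theorem QField.near_sum (h : QField K) (hD : ∀ i, IsLip (D i))
    (hs : ∃ c, ∀ i x, K i x ≠ 0 → D i x ≤ c) : Near D (fun i => ∑ x, K i x) := by
  obtain ⟨c, hc⟩ := hs
  refine ⟨h.sum_even, h.sum_poly, fun k => ?_⟩
  obtain ⟨C, hC, hb⟩ := h.decay (k + 4)
  exact ⟨16 * C * (1 + (c : ℝ)) ^ k, by positivity, fun i y =>
    osc_field_le hC (hb i) (hD i) (hc i) y⟩

theorem QField.near_cm (h : QField K) (h' : QField K') (hD : ∀ i, IsLip (D i))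
    (hs : ∃ c, ∀ i x, K i x ≠ 0 → D i x ≤ c) : Near D (fun i => cm (∑ x, K i x) (∑ x, K' i x)) := by
  obtain ⟨c, hc⟩ := hs
  refine ⟨fun i => sub_mem (mul_mem (h.sum_even i) (h'.sum_even i))
    (mul_mem (h'.sum_even i) (h.sum_even i)), ?_, fun k => ?_⟩
  · exact (((PolyBdd.const 2).mul h.sum_poly).mul h'.sum_poly).mono fun i => norm_cm_le _ _
  · obtain ⟨C, hC, hb⟩ := h.decay (2 * (k + 4) + 2 + 4)
    obtain ⟨C', hC', hb'⟩ := h'.decay (2 * (k + 4) + 2 + 4)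
    refine ⟨2 * (2 * 256 * 256 * 16 * (C + C') * (C + C') * (1 + (c : ℝ)) ^ k), by positivity,
      fun i y => ?_⟩
    have h1 : ∀ d, C * wt (2 * (k + 4) + 2 + 4) d ≤ (C + C') * wt (2 * (k + 4) + 2 + 4) d :=
      fun d => mul_mono_right (by linarith) (wt_nonneg _ _)
    have h2 : ∀ d, C' * wt (2 * (k + 4) + 2 + 4) d ≤ (C + C') * wt (2 * (k + 4) + 2 + 4) d :=
      fun d => mul_mono_right (by linarith) (wt_nonneg _ _)
    have := osc_cm_field_le (add_nonneg hC hC') (h.even i) (h'.even i)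
      (fun x y => (hb i x y).trans (h1 _)) (fun x y => (hb' i x y).trans (h2 _)) (hD i) (hc i) y
    linarith

/-- Localization is preserved by the dynamics of a field, for bounded times. -/
theorem Near.conj (hA : Near D A) (hD : ∀ i, IsLip (D i)) (hK : QField K)
    (hs : ∀ i, IsSelfAdjoint (∑ x, K i x)) {T : ℝ} {t : ι → ℝ} (ht : ∀ i, |t i| ≤ T) :
    Near D (fun i => conjExp (t i) (∑ x, K i x) (A i)) := by
  refine ⟨fun i => conjExp_mem (hK.sum_even i) (hA.even i) _,
    hA.poly.mono fun i => norm_conjExp_le _ (hs i) _, fun k => ?_⟩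
  obtain ⟨C, hC, hb⟩ := hK.decay (2 * (k + 4) + 2 + 4)
  obtain ⟨a, ha, hb'⟩ := hA.decay k
  refine ⟨2 * rexp (4 * (256 * C * 256 + 1) * T) * (a + 1), by positivity, fun i y => ?_⟩
  refine (lieb_robinson_field (hK.even i) hC (hb i) (hs i) (hD i) (a := a + 1) (by positivity)
    (fun z => (hb' i z).trans (mul_mono_right (by linarith) (wt_nonneg _ _))) (t i) y).trans ?_
  rw [← mul_assoc]
  refine mul_mono_right ?_ (wt_nonneg _ _)
  have := ht i
  gcongr

/-- Two dynamics whose generators differ by an operator far away from `B` agree on `B`. -/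
theorem Near.rapid_conj_sub (hB : Near D B) (hD : ∀ i, IsLip (D i)) (hK : QField K)
    (hs : ∀ i, IsSelfAdjoint (∑ x, K i x)) (hA : Near D' A) (hAs : ∀ i, IsSelfAdjoint (A i))
    (hsep : Separated D D') {T : ℝ} {t : ι → ℝ} (ht : ∀ i, |t i| ≤ T) :
    Rapid n (fun i => ‖conjExp (t i) (∑ x, K i x) (B i) -
      conjExp (t i) (∑ x, K i x + A i) (B i)‖) := by
  -- All intermediate times are adjoined to the index, so that the commutator bound is uniform along
  -- the Duhamel integral.
  let J : Type := Σ i : ι, {s : ℝ // |s| ≤ |t i|}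
  have hn : Near (n := fun j : J => n j.1) (fun j => D j.1)
      (fun j => conjExp j.2.1 (∑ x, K j.1 x) (B j.1)) :=
    (hB.comp (J := J) Sigma.fst).conj (fun j => hD j.1) (hK.comp Sigma.fst) (fun j => hs j.1)
      (t := fun j => j.2.1) (T := T) (fun j => j.2.2.trans (ht j.1))
  have hr := (hA.comp (J := J) Sigma.fst).rapid_cm hn (by
    obtain ⟨c, hc⟩ := hsep
    exact ⟨c, fun j y => (hc j.1 y).trans (by ring_nf; rfl)⟩)
  intro k
  obtain ⟨C, hC, hb⟩ := hr k
  refine ⟨C * |T|, by positivity, fun i => ?_⟩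
  have h1 := norm_conjExp_sub_le (hs i) (hAs i) (B i) (t i) (M := C * wt k (n i))
    (fun s hs' => hb ⟨i, s, hs'⟩)
  refine h1.trans ?_
  rw [mul_right_comm]
  refine mul_mono_right ?_ (wt_nonneg _ _)
  exact mul_mono_left ((ht i).trans (le_abs_self T)) hC

end Families

/-! ### Cocycles, integration of derivatives, and equality up to rapid errors -/

section Single

variable {L : ℕ} [NeZero L]

theorem osc_star (y : Torus L) (A : Obs L) : osc y (star A) = osc y A := by
  have h1 : cm (star A) (𝔞 y) = -star (cm A (star (𝔞 y))) := by
    simp [cm]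
  have h2 : cm (star A) (star (𝔞 y)) = -star (cm A (𝔞 y)) := by
    simp [cm]
  rw [osc, osc, h1, h2, norm_neg, norm_neg, norm_star, norm_star, add_comm]

theorem hasDerivAt_expI' (t : ℝ) (A : Obs L) :
    HasDerivAt (fun t : ℝ => expI t A) (I • (expI t A * A)) t := by
  have := hasDerivAt_expI t A
  rwa [(Commute.expI_right (Commute.refl A) t).eq] at this

theorem norm_image_sub_le_real {E : Type} [NormedAddCommGroup E] [NormedSpace ℝ E] {f f' : ℝ → E}
    (hf : ∀ s, HasDerivAt f (f' s) s) {t M : ℝ} (hM : ∀ s : ℝ, |s| ≤ |t| → ‖f' s‖ ≤ M) :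
    ‖f t - f 0‖ ≤ M * |t| := by
  have := (convex_Icc (-|t|) |t|).norm_image_sub_le_of_norm_hasDerivWithin_le
    (f := f) (f' := f') (C := M) (x := 0) (y := t) (fun s _ => (hf s).hasDerivWithinAt)
    (fun s hs => hM s (abs_le.2 hs)) ⟨by simp, by simp⟩ ⟨neg_abs_le t, le_abs_self t⟩
  simpa using this

/-- The unitary comparing two dynamics is localized where the generators differ. -/
theorem osc_cocycle_le {G Q : Obs L} (hG : IsSelfAdjoint G) (hQ : IsSelfAdjoint Q) (y : Torus L)
    {t M : ℝ} (hM : ∀ s : ℝ, |s| ≤ |t| → osc y (conjExp s G (G - Q)) ≤ M) :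
    osc y (expI t G * expI (-t) Q) ≤ 2 * (M * |t|) := by
  have key : ∀ c : Obs L, (∀ A : Obs L, ‖cm A c‖ ≤ osc y A) →
      ‖cm (expI t G * expI (-t) Q) c‖ ≤ M * |t| := by
    intro c hc
    let S : ℝ → Obs L := fun s => expI s G * expI (-s) Q
    let S' : ℝ → Obs L := fun s => expI s Q * expI (-s) G
    have hS : ∀ s, HasDerivAt S (I • (conjExp s G (G - Q) * S s)) s := by
      intro s
      refine ((hasDerivAt_expI' s G).mul (hasDerivAt_expI_neg s Q)).congr_deriv ?_
      have : conjExp s G (G - Q) * S s = expI s G * (G - Q) * expI (-s) Q := by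
        simp only [conjExp, S, mul_assoc]
        rw [← mul_assoc (expI (-s) G) (expI s G), expI_neg_mul_self, one_mul]
      rw [this]
      simp only [mul_sub, sub_mul, smul_sub, smul_mul_assoc, mul_neg, mul_smul_comm, mul_assoc]
      abel
    have hS' : ∀ s, HasDerivAt S' (-(I • (S' s * conjExp s G (G - Q)))) s := by
      intro s
      refine ((hasDerivAt_expI' s Q).mul (hasDerivAt_expI_neg s G)).congr_deriv ?_
      have : S' s * conjExp s G (G - Q) = expI s Q * (G - Q) * expI (-s) G := by
        simp only [conjExp, S', mul_assoc]
        rw [← mul_assoc (expI (-s) G) (expI s G), expI_neg_mul_self, one_mul]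
      rw [this]
      simp only [mul_sub, sub_mul, smul_sub, smul_mul_assoc, mul_neg, mul_smul_comm, mul_assoc]
      abel
    have h1 : ∀ s, S' s * S s = 1 := fun s => by
      simp only [S, S', mul_assoc]
      rw [← mul_assoc (expI (-s) G) (expI s G), expI_neg_mul_self, one_mul, expI_mul_neg_self]
    have h1' : ∀ s, S s * S' s = 1 := fun s => by
      simp only [S, S', mul_assoc]
      rw [← mul_assoc (expI (-s) Q) (expI s Q), expI_neg_mul_self, one_mul, expI_mul_neg_self]
    have hn : ∀ s, ‖S s‖ ≤ 1 := fun s =>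
      (norm_mul_le_of_le_one (norm_expI_le _ hQ)).trans (norm_expI_le _ hG)
    have hn' : ∀ s, ‖S' s‖ ≤ 1 := fun s =>
      (norm_mul_le_of_le_one (norm_expI_le _ hG)).trans (norm_expI_le _ hQ)
    -- `S'` inverts the unitary `S`, and $[S,c]=-S(S'cS-c)$. The derivative of $S'cS$ contains `c`
    -- only through its commutator with the evolved difference of the generators.
    have hf : ∀ s, HasDerivAt (fun s => S' s * c * S s)
        (-(I • (S' s * cm (conjExp s G (G - Q)) c * S s))) s := fun s => by
      refine (((hS' s).mul_const c).mul (hS s)).congr_deriv ?_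
      simp only [cm, mul_sub, sub_mul, smul_sub, smul_mul_assoc, neg_mul, mul_smul_comm, mul_assoc]
      abel
    have h2 := norm_image_sub_le_real (t := t) (M := M) hf (fun s hs => by
      rw [norm_neg, norm_smul, norm_I, one_mul]
      exact (norm_conj_le (hn' s) (hn s) _).trans ((hc _).trans (hM s hs)))
    have e : cm (S t) c = -(S t * (S' t * c * S t - S' 0 * c * S 0)) := by
      have e0 : S' 0 * c * S 0 = c := by simp [S, S', expI_zero]
      have e1 : S t * (S' t * c * S t) = c * S t := by
        rw [mul_assoc (S' t), ← mul_assoc (S t), h1', one_mul]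
      rw [e0, mul_sub, e1, neg_sub, cm]
    rw [show expI t G * expI (-t) Q = S t from rfl, e, norm_neg]
    exact (norm_mul_le_of_le_one' (hn t)).trans h2
  have h1 := key (𝔞 y) fun A => le_add_of_nonneg_right (norm_nonneg _)
  have h2 := key (star (𝔞 y)) fun A => le_add_of_nonneg_left (norm_nonneg _)
  unfold osc; linarith

end Single

section Families

variable {ι : Type} {n : ι → ℕ}

/-- The mean value inequality on a fixed interval, with the time as part of the index. -/
theorem Rapid.of_hasDerivWithinAt {E : ι → Type} [∀ i, NormedAddCommGroup (E i)]
    [∀ i, NormedSpace ℝ (E i)] {F F' : ∀ i, ℝ → E i} {T : ℝ}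
    (hF : ∀ i, ∀ s ∈ Set.Icc 0 T, HasDerivWithinAt (F i) (F' i s) (Set.Icc 0 T) s)
    (h : Rapid (fun j : ι × Set.Icc 0 T => n j.1) (fun j => ‖F' j.1 j.2‖)) :
    Rapid (fun j : ι × Set.Icc 0 T => n j.1) (fun j => ‖F j.1 j.2 - F j.1 0‖) := fun k => by
  obtain ⟨C, hC, hb⟩ := h k
  refine ⟨C * |T|, by positivity, fun j => ?_⟩
  have := norm_image_sub_le_of_norm_deriv_le_segment' (C := C * wt k (n j.1)) (hF j.1)
    (fun s hs => hb (j.1, ⟨s, Set.Ico_subset_Icc_self hs⟩)) j.2 j.2.2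
  refine this.trans ?_
  have h1 := j.2.2
  have h2 : (j.2 : ℝ) - 0 ≤ |T| := by rw [sub_zero]; exact h1.2.trans (le_abs_self T)
  have h3 := wt_nonneg k (n j.1)
  calc C * wt k (n j.1) * ((j.2 : ℝ) - 0) ≤ C * wt k (n j.1) * |T| := by gcongr
    _ = _ := by ring

variable [∀ i, NeZero (n i)]
variable {D D' : Distance n} {A A' A'' B B' : Family n}
  {K K' : Density n}

theorem Near.of_hasDerivWithinAt {F F' : ∀ i, ℝ → Obs (n i)} {T : ℝ} (hT : 0 ≤ T)
    (heven : ∀ i, F i T - F i 0 ∈ evenAlgebra univ)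
    (hF : ∀ i, ∀ s ∈ Set.Icc 0 T, HasDerivWithinAt (F i) (F' i s) (Set.Icc 0 T) s)
    (h : Near (n := fun j : ι × Set.Icc 0 T => n j.1) (fun j => D j.1) (fun j => F' j.1 j.2)) :
    Near D (fun i => F i T - F i 0) := by
  refine ⟨heven, ?_, fun k => ?_⟩
  · obtain ⟨C, hC, a, hb⟩ := h.poly
    refine ⟨C * |T|, by positivity, a, fun i => ?_⟩
    have := norm_image_sub_le_of_norm_deriv_le_segment' (C := C * (1 + (n i : ℝ)) ^ a) (hF i)
      (fun s hs => hb (i, ⟨s, Set.Ico_subset_Icc_self hs⟩)) T (Set.right_mem_Icc.2 hT)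
    refine this.trans (le_of_eq ?_)
    rw [sub_zero, abs_of_nonneg hT]; ring
  · obtain ⟨C, hC, hb⟩ := h.decay k
    refine ⟨2 * (C * |T|), by positivity, fun i y => ?_⟩
    have key : ∀ c : Obs (n i), (∀ A : Obs (n i), ‖cm A c‖ ≤ osc y A) →
        ‖cm (F i T - F i 0) c‖ ≤ C * |T| * wt k (D i y) := by
      intro c hc
      have hd : ∀ s ∈ Set.Icc 0 T, HasDerivWithinAt (fun s => cm (F i s) c) (cm (F' i s) c)
          (Set.Icc 0 T) s := fun s hs =>
        ((hF i s hs).mul_const c).sub ((hF i s hs).const_mul c)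
      have := norm_image_sub_le_of_norm_deriv_le_segment' (C := C * wt k (D i y)) hd
        (fun s hs => (hc _).trans (hb (i, ⟨s, Set.Ico_subset_Icc_self hs⟩) y)) T
        (Set.right_mem_Icc.2 hT)
      rw [sub_cm]
      refine this.trans (le_of_eq ?_)
      rw [sub_zero, abs_of_nonneg hT]; ring
    have h1 := key (𝔞 y) fun A => le_add_of_nonneg_right (norm_nonneg _)
    have h2 := key (star (𝔞 y)) fun A => le_add_of_nonneg_left (norm_nonneg _)
    unfold osc; linarith

theorem Near.star (h : Near D A) : Near D (fun i => star (A i)) :=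
  ⟨fun i => star_mem_evenAlgebra (h.even i), by simpa using h.poly, fun k => by
    simpa [osc_star] using h.decay k⟩

/-- The point is the case of a charge at time $2\pi$: the second factor is then 1, and the
exponential of the perturbed charge itself is localized where the perturbation is. -/
theorem Near.cocycle {Q : Family n} (hD : ∀ i, IsLip (D i)) (hK : QField K)
    (hs : ∀ i, IsSelfAdjoint (∑ x, K i x)) (hQ : ∀ i, IsSelfAdjoint (Q i))
    (hQe : ∀ i, Q i ∈ evenAlgebra univ)
    (hd : Near D (fun i => ∑ x, K i x - Q i)) {T : ℝ} {t : ι → ℝ} (ht : ∀ i, |t i| ≤ T) :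
    Near D (fun i => expI (t i) (∑ x, K i x) * expI (-t i) (Q i)) := by
  refine ⟨fun i => mul_mem (expI_mem (hK.sum_even i) _) (expI_mem (hQe i) _),
    (PolyBdd.const 1).mono fun i => (norm_mul_le_of_le_one (norm_expI_le _ (hQ i))).trans
      (norm_expI_le _ (hs i)), fun k => ?_⟩
  let J : Type := Σ i : ι, {s : ℝ // |s| ≤ |t i|}
  have hn : Near (n := fun j : J => n j.1) (fun j => D j.1)
      (fun j => conjExp j.2.1 (∑ x, K j.1 x) (∑ x, K j.1 x - Q j.1)) :=
    (hd.comp (J := J) Sigma.fst).conj (fun j => hD j.1) (hK.comp Sigma.fst) (fun j => hs j.1)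
      (t := fun j => j.2.1) (T := T) (fun j => j.2.2.trans (ht j.1))
  obtain ⟨C, hC, hb⟩ := hn.decay k
  refine ⟨2 * (C * |T|), by positivity, fun i y => ?_⟩
  refine (osc_cocycle_le (hs i) (hQ i) y (M := C * wt k (D i y)) fun s hs' =>
    hb ⟨i, s, hs'⟩ y).trans ?_
  have h1 : |t i| ≤ |T| := (ht i).trans (le_abs_self T)
  have h2 := wt_nonneg k (D i y)
  calc 2 * (C * wt k (D i y) * |t i|) ≤ 2 * (C * wt k (D i y) * |T|) := by gcongr
    _ = _ := by ring

/-- Equality up to errors that decay faster than any power of the size. -/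
def RapidEq (A B : Family n) : Prop := Rapid n (fun i => ‖A i - B i‖)

theorem RapidEq.of_eq (h : ∀ i, A i = B i) : RapidEq A B :=
  Rapid.of_forall fun i => by rw [h i, sub_self, norm_zero]

theorem RapidEq.refl (A : Family n) : RapidEq A A := RapidEq.of_eq fun _ => rfl

theorem RapidEq.symm (h : RapidEq A B) : RapidEq B A := Rapid.mono h fun _ => (norm_sub_rev _ _).le

theorem RapidEq.trans (h : RapidEq A B) (h' : RapidEq B A') : RapidEq A A' :=
  (Rapid.add h h').mono fun _ => norm_sub_le_norm_sub_add_norm_sub _ _ _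

theorem RapidEq.comp {J : Type} (h : RapidEq A B) (g : J → ι) :
    RapidEq (n := fun j => n (g j)) (fun j => A (g j)) (fun j => B (g j)) := Rapid.comp h g

theorem RapidEq.star (h : RapidEq A A') : RapidEq (fun i => star (A i)) (fun i => star (A' i)) :=
  Rapid.mono h fun i => by rw [← star_sub, norm_star]

theorem RapidEq.mul (h : RapidEq A A') (h' : RapidEq B B') (hA : PolyBdd n fun i => ‖A i‖)
    (hB : PolyBdd n fun i => ‖B' i‖) : RapidEq (fun i => A i * B i) (fun i => A' i * B' i) := by
  refine ((Rapid.mul_poly h' hA).add (Rapid.mul_poly h hB)).mono fun i => ?_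
  have : A i * B i - A' i * B' i = A i * (B i - B' i) + (A i - A' i) * B' i := by noncomm_ring
  rw [this]
  refine (norm_add_le _ _).trans (add_le_add ?_ (norm_mul_le _ _))
  rw [mul_comm ‖B i - B' i‖]; exact norm_mul_le _ _

theorem Near.rapidEq_mul_comm (hA : Near D A) (hB : Near D' B) (hs : Separated D D') :
    RapidEq (fun i => A i * B i) (fun i => B i * A i) := hA.rapid_cm hB hs

theorem PolyBdd.norm_add (hA : PolyBdd n fun i => ‖A i‖) (hB : PolyBdd n fun i => ‖B i‖) :
    PolyBdd n fun i => ‖A i + B i‖ := (hA.add hB).mono fun _ => norm_add_le _ _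

theorem PolyBdd.norm_sub (hA : PolyBdd n fun i => ‖A i‖) (hB : PolyBdd n fun i => ‖B i‖) :
    PolyBdd n fun i => ‖A i - B i‖ := (hA.add hB).mono fun _ => norm_sub_le _ _

theorem PolyBdd.norm_mul (hA : PolyBdd n fun i => ‖A i‖) (hB : PolyBdd n fun i => ‖B i‖) :
    PolyBdd n fun i => ‖A i * B i‖ :=
  (PolyBdd.mul hA hB).mono fun _ => norm_mul_le _ _

theorem PolyBdd.norm_star (hA : PolyBdd n fun i => ‖A i‖) : PolyBdd n fun i => ‖star (A i)‖ := by
  simpa using hA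

end Families

/-! ### The quasi-adiabatic filter -/

section

open MeasureTheory

/-- Two powers of decay are kept back, which leaves the integrable majorant $(1+u^2)^{-1}$ at large
times. -/
theorem IsFilterFunction.integrable_mul_pow {γ : ℝ} {W : ℝ → ℝ} (hW : IsFilterFunction γ W) (k : ℕ) :
    Integrable fun u => |W u| * (1 + |u|) ^ k := by
  obtain ⟨C, hC⟩ := hW.decay (k + 2)
  refine ((hW.integrable.abs.const_mul (2 ^ k)).add
    (integrable_inv_one_add_sq.const_mul (2 ^ (k + 1) * |C|))).mono'
    (hW.integrable.abs.aestronglyMeasurable.mul (by fun_prop)) (.of_forall fun u => ?_)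
  have hp : 0 ≤ |W u| * (1 + |u|) ^ k := by positivity
  rw [Real.norm_of_nonneg hp]
  simp only [Pi.add_apply]
  rcases le_total |u| 1 with h | h
  · have h1 : (1 + |u|) ^ k ≤ 2 ^ k := by
      gcongr; linarith
    have h2 : 0 ≤ 2 ^ (k + 1) * |C| * (1 + u ^ 2)⁻¹ := by positivity
    nlinarith [abs_nonneg (W u)]
  · have h0 : 0 < |u| := by linarith
    have h1 : (1 + |u|) ^ k ≤ (2 * |u|) ^ k := by
      gcongr; linarith
    have h2 : |W u| ≤ |C| / |u| ^ (k + 2) := (hC u h).trans (by gcongr; exact le_abs_self C)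
    have h3 : 0 ≤ 2 ^ k * |W u| := by positivity
    have h4 : |W u| * (1 + |u|) ^ k ≤ |C| / |u| ^ (k + 2) * (2 * |u|) ^ k := by gcongr
    have h5 : |C| / |u| ^ (k + 2) * (2 * |u|) ^ k = 2 ^ k * |C| * (u ^ 2)⁻¹ := by
      rw [← sq_abs u, mul_pow, pow_add]; field_simp
    have h6 : (u ^ 2)⁻¹ ≤ 2 * (1 + u ^ 2)⁻¹ := by
      have : 1 ≤ u ^ 2 := by rw [← sq_abs]; nlinarith
      rw [← div_eq_mul_inv, inv_eq_one_div, div_le_div_iff₀ (by linarith) (by positivity)]; linarith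
    have h7 : 2 ^ k * |C| * (u ^ 2)⁻¹ ≤ 2 ^ k * |C| * (2 * (1 + u ^ 2)⁻¹) := by gcongr
    rw [h5] at h4
    calc _ ≤ _ := h4.trans h7
      _ = 2 ^ (k + 1) * |C| * (1 + u ^ 2)⁻¹ := by ring
      _ ≤ _ := by linarith

/-- This is $x^k/k!\le e^x$ at $x=(1+d)/2$, with $e^{1/2}\le2$. -/
theorem exp_half_le_wt (k d : ℕ) : rexp (-(d : ℝ) / 2) ≤ 2 ^ k * k.factorial * 2 * wt k d := by
  have h1 := Real.pow_div_factorial_le_exp ((1 + (d : ℝ)) / 2) (by positivity) k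
  have h2 : rexp (1 / 2) ≤ 2 := by
    have := Real.exp_one_lt_d9
    have h3 : rexp (1 / 2) * rexp (1 / 2) = rexp 1 := by rw [← Real.exp_add]; norm_num
    nlinarith [Real.exp_pos (1 / 2)]
  have h3 : rexp ((1 + (d : ℝ)) / 2) = rexp (1 / 2) * rexp ((d : ℝ) / 2) := by
    rw [← Real.exp_add]; ring_nf
  rw [wt, neg_div, Real.exp_neg, ← div_eq_mul_inv, inv_eq_one_div,
    div_le_div_iff₀ (Real.exp_pos _) (by positivity), one_mul]
  rw [div_pow, div_div, div_le_iff₀ (by positivity), h3] at h1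
  have h4 : 0 ≤ rexp ((d : ℝ) / 2) * (2 ^ k * k.factorial) := by positivity
  nlinarith

/-- A quantity that is small before the light cone arrives and moderate afterwards. -/
theorem exists_lightCone_bound (κ : ℝ) (hκ : 0 ≤ κ) (k : ℕ) : ∃ C, 0 ≤ C ∧
    ∀ (A B f u : ℝ) (d : ℕ), 0 ≤ A → 0 ≤ B → f ≤ A * rexp (κ * |u| - d) →
      f ≤ B * (1 + |u|) → f ≤ C * (A + B) * wt k d * (1 + |u|) ^ (k + 1) := by
  refine ⟨2 ^ k * k.factorial * 2 + (1 + 2 * κ) ^ k, by positivity, fun A B f u d hA hB h1 h2 => ?_⟩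
  have hw := wt_nonneg k d
  have hu : 1 ≤ 1 + |u| := by linarith [abs_nonneg u]
  have hu' : 1 ≤ (1 + |u|) ^ (k + 1) := one_le_pow₀ hu
  -- Well inside the light cone half of the exponential decay survives. Otherwise $d$ is bounded by
  -- a multiple of the time, and powers of the time, which the filter can integrate, replace the
  -- missing decay.
  rcases le_total (κ * |u|) (d / 2) with h | h
  · have h3 : rexp (κ * |u| - d) ≤ 2 ^ k * k.factorial * 2 * wt k d :=
      (Real.exp_le_exp.2 (by linarith)).trans (exp_half_le_wt k d)
    calc f ≤ A * (2 ^ k * k.factorial * 2 * wt k d) := h1.trans (by gcongr)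
      _ ≤ (A + B) * ((2 ^ k * k.factorial * 2 + (1 + 2 * κ) ^ k) * wt k d) := by
          gcongr
          · linarith
          · linarith [show 0 ≤ (1 + 2 * κ) ^ k by positivity]
      _ = (2 ^ k * k.factorial * 2 + (1 + 2 * κ) ^ k) * (A + B) * wt k d * 1 := by ring
      _ ≤ _ := by gcongr
  · have h3 : 1 + (d : ℝ) ≤ (1 + 2 * κ) * (1 + |u|) := by nlinarith [abs_nonneg u]
    have h4 : 1 ≤ (1 + 2 * κ) ^ k * (1 + |u|) ^ k * wt k d := by
      rw [wt, ← div_eq_mul_inv, le_div_iff₀ (by positivity), one_mul, ← mul_pow]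
      gcongr
    calc f ≤ B * (1 + |u|) * 1 := by rw [mul_one]; exact h2
      _ ≤ B * (1 + |u|) * ((1 + 2 * κ) ^ k * (1 + |u|) ^ k * wt k d) := by gcongr
      _ = (1 + 2 * κ) ^ k * B * wt k d * (1 + |u|) ^ (k + 1) := by ring
      _ ≤ _ := by
          gcongr
          · linarith [show (0 : ℝ) ≤ 2 ^ k * k.factorial * 2 by positivity]
          · linarith

section Single

variable {L : ℕ} [NeZero L] {W : ℝ → ℝ}

theorem integrable_smul_conjExp (hW : Integrable W) {H : Obs L} (hH : IsSelfAdjoint H) (D : Obs L) :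
    Integrable fun u : ℝ => (W u : ℂ) • conjExp u H D := by
  refine (hW.norm.mul_const ‖D‖).mono'
    ((continuous_ofReal.comp_aestronglyMeasurable hW.aestronglyMeasurable).smul
      (continuous_conjExp H D).aestronglyMeasurable) (.of_forall fun u => ?_)
  rw [norm_smul, norm_real]
  exact mul_mono_left (norm_conjExp_le _ hH _)

theorem map_quasiAdiabatic {E : Type} [NormedAddCommGroup E] [NormedSpace ℂ E] [CompleteSpace E]
    (hW : Integrable W) {H : Obs L} (hH : IsSelfAdjoint H) (D : Obs L) (T : Obs L →L[ℂ] E) :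
    T (quasiAdiabatic W H D) = ∫ u : ℝ, (W u : ℂ) • T (conjExp u H D) := by
  rw [quasiAdiabatic, ← T.integral_comp_comm (integrable_smul_conjExp hW hH D)]
  simp only [map_smul]

theorem quasiAdiabatic_add (hW : Integrable W) {H : Obs L} (hH : IsSelfAdjoint H) (A B : Obs L) :
    quasiAdiabatic W H (A + B) = quasiAdiabatic W H A + quasiAdiabatic W H B := by
  simp only [quasiAdiabatic, conjExp_add, smul_add]
  exact integral_add (integrable_smul_conjExp hW hH A) (integrable_smul_conjExp hW hH B)

theorem quasiAdiabatic_smul (H A : Obs L) (c : ℂ) :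
    quasiAdiabatic W H (c • A) = c • quasiAdiabatic W H A := by
  simp only [quasiAdiabatic, conjExp_smul]
  rw [← integral_smul]
  congr 1; funext u; rw [smul_comm]

theorem quasiAdiabatic_zero (H : Obs L) : quasiAdiabatic W H 0 = 0 := by
  simp [quasiAdiabatic, conjExp]

theorem quasiAdiabatic_sum {ι : Type} (hW : Integrable W) {H : Obs L} (hH : IsSelfAdjoint H)
    (s : Finset ι) (f : ι → Obs L) :
    quasiAdiabatic W H (∑ x ∈ s, f x) = ∑ x ∈ s, quasiAdiabatic W H (f x) := by
  simp only [quasiAdiabatic, conjExp_sum, smul_sum]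
  exact integral_finsetSum _ fun x _ => integrable_smul_conjExp hW hH (f x)

theorem norm_quasiAdiabatic_le (hW : Integrable W) {H : Obs L} (hH : IsSelfAdjoint H) (A : Obs L) :
    ‖quasiAdiabatic W H A‖ ≤ (∫ u, |W u|) * ‖A‖ := by
  rw [← integral_mul_const]
  refine norm_integral_le_of_norm_le (hW.abs.mul_const _) (.of_forall fun u => ?_)
  rw [norm_smul, norm_real]
  exact mul_mono_left (norm_conjExp_le _ hH _)

theorem isSelfAdjoint_quasiAdiabatic {H A : Obs L} (hH : IsSelfAdjoint H) (hA : IsSelfAdjoint A) :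
    IsSelfAdjoint (quasiAdiabatic W H A) := by
  rw [IsSelfAdjoint, quasiAdiabatic]
  have := ((starL' ℝ : Obs L ≃L[ℝ] Obs L)).integral_comp_comm
    (fun u : ℝ => (W u : ℂ) • conjExp u H A) (μ := volume)
  change _ = star _ at this
  rw [← this]
  congr 1; funext u
  change star _ = _
  rw [star_smul, (isSelfAdjoint_conjExp u hH hA).star_eq]
  simp

/-- A continuous linear projection whose kernel is an algebra of local operators. -/
theorem exists_projection_evenAlgebra (X : Region L) : ∃ Θ : Obs L →L[ℂ] Obs L,
    (∀ B, Θ B = 0 ↔ B ∈ evenAlgebra X) ∧ ∀ B, B - Θ B ∈ evenAlgebra X := by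
  obtain ⟨C, hC⟩ := (Subalgebra.toSubmodule (evenAlgebra X)).exists_isCompl
  have hk : ∀ B, C.projection _ hC.symm B = 0 ↔ B ∈ evenAlgebra X := fun B => by
    rw [Submodule.projection_apply, Submodule.coe_eq_zero,
      Submodule.projectionOnto_apply_eq_zero_iff]; rfl
  refine ⟨LinearMap.toContinuousLinearMap (C.projection _ hC.symm), hk, fun B => ?_⟩
  rw [← hk, map_sub, sub_eq_zero]
  exact (Submodule.projection_apply_left hC.symm (C.projectionOnto _ hC.symm B)).symm

/-- A continuous linear map whose kernel is the even algebra annihilates the integrand and may be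
pulled under the integral. -/
theorem quasiAdiabatic_mem {X : Region L} (hW : Integrable W) {H A : Obs L}
    (hH : IsSelfAdjoint H) (hHX : H ∈ evenAlgebra X) (hA : A ∈ evenAlgebra X) :
    quasiAdiabatic W H A ∈ evenAlgebra X := by
  obtain ⟨Θ, hk, -⟩ := exists_projection_evenAlgebra X
  rw [← hk, map_quasiAdiabatic hW hH A Θ]
  refine integral_eq_zero_of_ae (.of_forall fun u => ?_)
  simp only [Pi.zero_apply]
  rw [(hk _).2 (conjExp_mem hHX hA u), smul_zero]

/-- The commutator with a fixed operator, as a continuous linear map. -/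
def cmRight (c : Obs L) : Obs L →L[ℂ] Obs L := LinearMap.toContinuousLinearMap
    { toFun := fun A => cm A c, map_add' := fun A B => add_cm A B c,
      map_smul' := fun a A => smul_cm a A c }

theorem cm_quasiAdiabatic (hW : Integrable W) {H : Obs L} (hH : IsSelfAdjoint H) (A c : Obs L) :
    cm (quasiAdiabatic W H A) c = ∫ u : ℝ, (W u : ℂ) • cm (conjExp u H A) c :=
  map_quasiAdiabatic hW hH A (cmRight c)

theorem commute_quasiAdiabatic (hW : Integrable W) {H A c : Obs L} (hH : IsSelfAdjoint H)
    (hc : Commute c H) (hA : Commute c A) : Commute c (quasiAdiabatic W H A) := by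
  refine (cm_eq_zero.1 ?_).symm
  rw [cm_quasiAdiabatic hW hH]
  refine integral_eq_zero_of_ae (.of_forall fun u => ?_)
  have : Commute c (conjExp u H A) :=
    ((Commute.expI_right hc u).mul_right hA).mul_right (Commute.expI_right hc _)
  simp only [Pi.zero_apply]
  rw [cm_eq_zero.2 this.symm, smul_zero]

theorem osc_quasiAdiabatic_le (hW : Integrable W) {H : Obs L} (hH : IsSelfAdjoint H) (A : Obs L)
    (y : Torus L) {b : ℝ → ℝ} (hb : ∀ u, osc y (conjExp u H A) ≤ b u)
    (hi : Integrable fun u => |W u| * b u) :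
    osc y (quasiAdiabatic W H A) ≤ 2 * ∫ u, |W u| * b u := by
  have key : ∀ c : Obs L, (∀ A : Obs L, ‖cm A c‖ ≤ osc y A) →
      ‖cm (quasiAdiabatic W H A) c‖ ≤ ∫ u, |W u| * b u := by
    intro c hc
    rw [cm_quasiAdiabatic hW hH]
    refine norm_integral_le_of_norm_le hi (.of_forall fun u => ?_)
    rw [norm_smul, norm_real]
    exact mul_mono_left ((hc _).trans (hb u))
  have h1 := key (𝔞 y) fun A => le_add_of_nonneg_right (norm_nonneg _)
  have h2 := key (star (𝔞 y)) fun A => le_add_of_nonneg_left (norm_nonneg _)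
  unfold osc; linarith

theorem norm_quasiAdiabatic_sub_le (hW : Integrable W) {H H' : Obs L} (hH : IsSelfAdjoint H)
    (hH' : IsSelfAdjoint H') (A : Obs L) {b : ℝ → ℝ}
    (hb : ∀ u, ‖conjExp u H A - conjExp u H' A‖ ≤ b u) (hi : Integrable fun u => |W u| * b u) :
    ‖quasiAdiabatic W H A - quasiAdiabatic W H' A‖ ≤ ∫ u, |W u| * b u := by
  rw [quasiAdiabatic, quasiAdiabatic, ← integral_sub (integrable_smul_conjExp hW hH A)
    (integrable_smul_conjExp hW hH' A)]
  refine norm_integral_le_of_norm_le hi (.of_forall fun u => ?_)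
  rw [← smul_sub, norm_smul, norm_real]
  exact mul_mono_left (hb u)

theorem expI_conjExp (t θ : ℝ) (Q H : Obs L) : expI t (conjExp θ Q H) = conjExp θ Q (expI t H) := by
  let _ : NormedAlgebra ℚ (Obs L) := NormedAlgebra.restrictScalars ℚ ℂ (Obs L)
  let g : (Obs L)ˣ := ⟨expI θ Q, expI (-θ) Q, expI_mul_neg_self θ Q, expI_neg_mul_self θ Q⟩
  have := NormedSpace.exp_units_conj g ((I * (t : ℂ)) • H)
  unfold conjExp
  rw [expI, ← smul_mul_assoc, ← mul_smul_comm]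
  exact this

theorem conjExp_quasiAdiabatic (hW : Integrable W) {H : Obs L} (hH : IsSelfAdjoint H) (A Q : Obs L)
    (θ : ℝ) :
    conjExp θ Q (quasiAdiabatic W H A) = quasiAdiabatic W (conjExp θ Q H) (conjExp θ Q A) := by
  let T : Obs L →ₗ[ℂ] Obs L := {
    toFun := fun A => conjExp θ Q A
    map_add' := fun A B => conjExp_add θ Q A B
    map_smul' := fun a A => conjExp_smul θ a Q A }
  have := map_quasiAdiabatic hW hH A (LinearMap.toContinuousLinearMap T)
  change conjExp θ Q (quasiAdiabatic W H A) = ∫ u, (W u : ℂ) • conjExp θ Q (conjExp u H A) at this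
  rw [this, quasiAdiabatic]
  congr 1; funext u; congr 1
  rw [conjExp.eq_def u H A, conjExp_mul, conjExp_mul, ← expI_conjExp, ← expI_conjExp]; rfl

end Single

end

/-! ### Locality of filtered observables -/

section

open MeasureTheory

section Families

variable {ι : Type} {n : ι → ℕ} [∀ i, NeZero (n i)]
variable {D D' : Distance n} {h h' j g : Density n}

/-- Families of fields of finite range and bounded strength. -/
def SField (h : Density n) : Prop :=
  ∃ (R : ℕ) (m : ℝ), 0 ≤ m ∧ ∀ i x, h i x ∈ evenAlgebra (ball x R) ∧ ‖h i x‖ ≤ m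

theorem SField.even (hh : SField h) (i : ι) (x : Torus (n i)) : h i x ∈ evenAlgebra univ := by
  obtain ⟨R, m, hm, hb⟩ := hh
  exact evenAlgebra_mono (subset_univ _) (hb i x).1

theorem osc_le_of_mem_ball {L : ℕ} [NeZero L] {x : Torus L} {R : ℕ} {A : Obs L}
    (hA : A ∈ evenAlgebra (ball x R)) {m : ℝ} (hm : ‖A‖ ≤ m) (y : Torus L) :
    osc y A ≤ if gdist x y ≤ R then 4 * m else 0 := by
  split_ifs with h1
  · exact (osc_le_norm y A).trans (by linarith)
  · exact (osc_eq_zero_of_mem hA (by rwa [mem_ball])).le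

theorem SField.qfield (hh : SField h) : QField h := by
  refine ⟨hh.even, ?_, fun k => ?_⟩
  · obtain ⟨R, m, hm, hb⟩ := hh
    exact ⟨m, hm, fun i x => (hb i x).2⟩
  · obtain ⟨R, m, hm, hb⟩ := hh
    refine ⟨4 * m * (1 + (R : ℝ)) ^ k, by positivity, fun i x y => ?_⟩
    refine (osc_le_of_mem_ball (hb i x).1 (hb i x).2 y).trans ?_
    split_ifs with h1
    · rw [mul_assoc]
      exact le_mul_of_one_le_right (by positivity) (one_le_pow_mul_wt k h1)
    · exact mul_nonneg (by positivity) (wt_nonneg _ _)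

theorem SField.sub (hh : SField h) (hh' : SField h') : SField (fun i x => h i x - h' i x) := by
  obtain ⟨R, m, hm, hb⟩ := hh
  obtain ⟨R', m', hm', hb'⟩ := hh'
  have hs : ∀ {L : ℕ} [NeZero L] (x : Torus L) {r s : ℕ}, r ≤ s → ball x r ⊆ ball x s :=
    fun x r s hrs y hy => mem_ball.2 ((mem_ball.1 hy).trans hrs)
  refine ⟨max R R', m + m', by positivity, fun i x => ⟨sub_mem
    (evenAlgebra_mono (hs x (le_max_left _ _)) (hb i x).1)
    (evenAlgebra_mono (hs x (le_max_right _ _)) (hb' i x).1), ?_⟩⟩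
  exact (norm_sub_le _ _).trans (add_le_add (hb i x).2 (hb' i x).2)

variable {γ : ℝ} {W : ℝ → ℝ}

/-- The quasi-adiabatic filter maps local fields to quasi-local fields. -/
theorem SField.qfield_quasiAdiabatic (hW : IsFilterFunction γ W) (hh : SField h)
    (hs : ∀ i, IsSelfAdjoint (∑ x, h i x)) (hj : SField j) :
    QField (fun i x => quasiAdiabatic W (∑ x, h i x) (j i x)) := by
  refine ⟨fun i x => quasiAdiabatic_mem hW.integrable (hs i) (hh.qfield.sum_even i) (hj.even i x),
    ?_, fun k => ?_⟩
  · obtain ⟨R, m, hm, hb⟩ := hj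
    refine ⟨(∫ u, |W u|) * m, mul_nonneg (integral_nonneg fun _ => abs_nonneg _) hm, fun i x =>
      (norm_quasiAdiabatic_le hW.integrable (hs i) _).trans ?_⟩
    exact mul_mono_left (hb i x).2 (integral_nonneg fun _ => abs_nonneg _)
  · obtain ⟨R, m, hm, hb⟩ := hh
    obtain ⟨R', m', hm', hb'⟩ := hj
    set κ : ℝ := 4 * (4 * m * (16 * (1 + (R : ℝ)) ^ 4) ^ 2 * rexp (2 * R) + 1) with hκ
    have hκ0 : 0 ≤ κ := by positivity
    obtain ⟨C, hC, hl⟩ := exists_lightCone_bound κ hκ0 k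
    -- Amplitude of an exponential weight above the oscillations of a strictly local operator:
    -- $e^{R'}$ compensates the weight on the support, and the summand 1 makes it positive.
    set a : ℝ := 4 * m' * rexp R' + 1 with ha
    have ha0 : 0 < a := by positivity
    set M : ℝ := ∫ u, |W u| * (1 + |u|) ^ (k + 1)
    have hM : 0 ≤ M := integral_nonneg fun u => by positivity
    refine ⟨2 * (C * (2 * a + 4 * m') * M), by positivity, fun i x y => ?_⟩
    have hosc : ∀ z, osc z (j i x) ≤ a * rexp (-(gdist x z : ℝ)) := fun z => by
      refine (osc_le_of_mem_ball (hb' i x).1 (hb' i x).2 z).trans ?_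
      split_ifs with h1
      · have h2 : (1 : ℝ) ≤ rexp R' * rexp (-(gdist x z : ℝ)) := by
          rw [← Real.exp_add]; refine Real.one_le_exp ?_
          have : (gdist x z : ℝ) ≤ R' := by exact_mod_cast h1
          linarith
        calc 4 * m' = 4 * m' * 1 := by ring
          _ ≤ 4 * m' * (rexp R' * rexp (-(gdist x z : ℝ))) := by gcongr
          _ ≤ _ := by rw [ha, add_mul]; nlinarith [Real.exp_pos (-(gdist x z : ℝ))]
      · positivity
    have hb2 : ∀ u, osc y (conjExp u (∑ x, h i x) (j i x)) ≤
        C * (2 * a + 4 * m') * wt k (gdist x y) * (1 + |u|) ^ (k + 1) := fun u => by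
      refine hl (2 * a) (4 * m') _ u (gdist x y) (by positivity) (by positivity) ?_ ?_
      · refine (lieb_robinson_exp (fun x => (hb i x).1) (fun x => (hb i x).2) hm (hs i)
          (isLip_gdist x) ha0 hosc u y).trans (le_of_eq ?_)
        rw [sub_eq_add_neg, Real.exp_add]; ring
      · refine (osc_le_norm _ _).trans ?_
        have h1 := norm_conjExp_le u (hs i) (j i x)
        have h2 := (hb' i x).2
        nlinarith [abs_nonneg u]
    have e : (fun u => |W u| * (C * (2 * a + 4 * m') * wt k (gdist x y) * (1 + |u|) ^ (k + 1))) =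
        fun u => (C * (2 * a + 4 * m') * wt k (gdist x y)) * (|W u| * (1 + |u|) ^ (k + 1)) := by
      funext u; ring
    have := osc_quasiAdiabatic_le hW.integrable (hs i) (j i x) y hb2 (by
      rw [e]; exact (hW.integrable_mul_pow (k + 1)).const_mul _)
    refine this.trans (le_of_eq ?_)
    rw [e, integral_const_mul]; ring

/-- The filtered observable is insensitive to changes of the Hamiltonian far away. -/
theorem SField.rapid_quasiAdiabatic_sub (hW : IsFilterFunction γ W) (hh : SField h)
    (hs : ∀ i, IsSelfAdjoint (∑ x, h i x)) (hj : SField j) (hg : SField g)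
    (hgs : ∀ i, IsSelfAdjoint (∑ x, g i x)) (hD : ∀ i, IsLip (D i)) (hD' : ∀ i, IsLip (D' i))
    (hjD : ∃ c, ∀ i x, j i x ≠ 0 → D i x ≤ c) (hgD : ∃ c, ∀ i x, g i x ≠ 0 → D' i x ≤ c)
    (hsep : Separated D D') : RapidEq (fun i => quasiAdiabatic W (∑ x, h i x) (∑ x, j i x))
      (fun i => quasiAdiabatic W (∑ x, h i x + ∑ x, g i x) (∑ x, j i x)) := by
  have hJp := hj.qfield.sum_poly
  obtain ⟨R, m, hm, hb⟩ := hh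
  obtain ⟨R₁, m₁, hm₁, hb₁⟩ := hj
  obtain ⟨R₂, m₂, hm₂, hb₂⟩ := hg
  obtain ⟨c₁, hc₁⟩ := hjD
  obtain ⟨c₂, hc₂⟩ := hgD
  obtain ⟨e₀, he₀⟩ := hsep
  set κ : ℝ := 4 * (4 * m * (16 * (1 + (R : ℝ)) ^ 4) ^ 2 * rexp (2 * R) + 1) with hκ
  have hκ0 : 0 ≤ κ := by positivity
  -- A positive separation constant, so that `n i / e` is a meaningful lower bound, up to a
  -- constant, for the distance between the two supports.
  set e := e₀ + 1 with he
  set J : ∀ i, Obs (n i) := fun i => ∑ x, j i x with hJ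
  set a : ι → ℝ := fun i => 4 * ‖J i‖ * rexp (c₁ + R₁ : ℕ) + 1 with ha
  have ha0 : ∀ i, 0 < a i := fun i => by positivity
  set b : ℝ := 2 * m₂ * (16 * (1 + (R₂ : ℝ)) ^ 4 * (2 * rexp (1 + c₂ + R₂ : ℕ))) with hbdef
  have hb0 : 0 ≤ b := by positivity
  set A : ι → ℝ := fun i => Fintype.card (Torus (n i)) * (b * a i) with hA
  have hA0 : ∀ i, 0 ≤ A i := fun i => mul_nonneg (Nat.cast_nonneg _) (mul_nonneg hb0 (ha0 i).le)
  set d : ι → ℕ := fun i => n i / e with hd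
  have hosc : ∀ i z, osc z (J i) ≤ a i * rexp (-(D i z : ℝ)) := fun i z => by
    by_cases hz : D i z ≤ c₁ + R₁
    · have h2 : (1 : ℝ) ≤ rexp (c₁ + R₁ : ℕ) * rexp (-(D i z : ℝ)) := by
        rw [← Real.exp_add]; refine Real.one_le_exp ?_
        have : (D i z : ℝ) ≤ (c₁ + R₁ : ℕ) := by exact_mod_cast hz
        linarith
      calc osc z (J i) ≤ 4 * ‖J i‖ * 1 := by rw [mul_one]; exact osc_le_norm _ _
        _ ≤ 4 * ‖J i‖ * (rexp (c₁ + R₁ : ℕ) * rexp (-(D i z : ℝ))) := by gcongr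
        _ ≤ _ := by
          simp only [ha]; rw [add_mul]; nlinarith [Real.exp_pos (-(D i z : ℝ))]
    · have h0 : osc z (J i) = 0 := by
        refine le_antisymm ((osc_sum _ _ _).trans (sum_nonpos fun x _ => ?_)) (osc_nonneg _ _)
        by_cases hx : j i x = 0
        · rw [hx, osc_zero]
        · refine (osc_eq_zero_of_mem (hb₁ i x).1 ?_).le
          rw [mem_ball]
          have h1 := hc₁ i x hx
          have h2 := hD i z x
          rw [gdist_comm z x] at h2
          omega
      rw [h0]
      exact mul_nonneg (ha0 i).le (Real.exp_pos _).le
  -- Every nonzero term of the perturbation sits in a ball whose distance from the observable is at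
  -- least `d i` up to a constant, so the exponential Lieb-Robinson bound applies term by term.
  have hcm : ∀ i s u, |s| ≤ |u| → ‖cm (∑ x, g i x) (conjExp s (∑ x, h i x) (J i))‖ ≤
      A i * rexp (κ * |u| - d i) := fun i s u hsu => by
    rw [sum_cm]
    refine (norm_sum_le _ _).trans ?_
    have hterm : ∀ x, ‖cm (g i x) (conjExp s (∑ x, h i x) (J i))‖ ≤
        b * a i * rexp (κ * |u| - d i) := fun x => by
      by_cases hx : g i x = 0
      · rw [hx, zero_cm, norm_zero]
        exact mul_nonneg (mul_nonneg hb0 (ha0 i).le) (Real.exp_pos _).le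
      · have h1 := norm_cm_le_sum_osc
          (evenAlgebra_le_adjoin _ (hb₂ i x).1) (conjExp s (∑ x, h i x) (J i))
        rw [cm_symm, norm_neg]
        refine h1.trans ?_
        have h2 : ∀ z ∈ ball x R₂, osc z (conjExp s (∑ x, h i x) (J i)) ≤
            2 * rexp (1 + c₂ + R₂ : ℕ) * (a i * rexp (κ * |u| - d i)) := fun z hz => by
          refine (lieb_robinson_exp (fun x => (hb i x).1) (fun x => (hb i x).2) hm (hs i)
            (hD i) (ha0 i) (hosc i) s z).trans ?_
          have h3 : n i / e ≤ 1 + D i z + c₂ + R₂ := by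
            refine Nat.div_le_of_le_mul ?_
            have h4 := hc₂ i x hx
            have h5 := hD' i z x
            rw [gdist_comm z x] at h5
            have h6 := mem_ball.1 hz
            have h7 := he₀ i z
            have h8 : 1 + D i z + D' i z ≤ 1 + D i z + c₂ + R₂ := by omega
            calc n i ≤ e₀ * (1 + D i z + D' i z) := h7
              _ ≤ e * (1 + D i z + c₂ + R₂) := Nat.mul_le_mul (by omega) h8
          have h3' : (d i : ℝ) ≤ (1 + c₂ + R₂ : ℕ) + D i z := by
            have : ((n i / e : ℕ) : ℝ) ≤ ((1 + D i z + c₂ + R₂ : ℕ) : ℝ) := by exact_mod_cast h3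
            simp only [hd]; push_cast at this ⊢; linarith
          have h9 : rexp (κ * |s|) * rexp (-(D i z : ℝ)) ≤
              rexp (1 + c₂ + R₂ : ℕ) * rexp (κ * |u| - d i) := by
            rw [← Real.exp_add, ← Real.exp_add]
            refine Real.exp_le_exp.2 ?_
            have := mul_mono_left hsu hκ0
            linarith
          calc _ = 2 * a i * (rexp (κ * |s|) * rexp (-(D i z : ℝ))) := by ring
            _ ≤ 2 * a i * (rexp (1 + c₂ + R₂ : ℕ) * rexp (κ * |u| - d i)) :=
                mul_mono_left h9 (by linarith [ha0 i])
            _ = _ := by ring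
        have h10 := sum_le_sum h2
        rw [sum_const, nsmul_eq_mul] at h10
        have h11 := card_ball_le x R₂
        have h12 : 0 ≤ 2 * rexp (1 + c₂ + R₂ : ℕ) * (a i * rexp (κ * |u| - d i)) :=
          mul_nonneg (by positivity) (mul_nonneg (ha0 i).le (Real.exp_pos _).le)
        have h13 := h10.trans (mul_mono_right h11 h12)
        have h14 : 0 ≤ ∑ z ∈ ball x R₂, osc z (conjExp s (∑ x, h i x) (J i)) :=
          sum_nonneg fun _ _ => osc_nonneg _ _
        calc _ ≤ 2 * m₂ * ∑ z ∈ ball x R₂, osc z (conjExp s (∑ x, h i x) (J i)) := by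
              refine mul_mono_right ?_ h14
              linarith [(hb₂ i x).2]
          _ ≤ 2 * m₂ * _ := mul_mono_left h13
          _ = _ := by rw [hbdef]; ring
    refine (sum_le_sum fun x _ => hterm x).trans (le_of_eq ?_)
    rw [sum_const, nsmul_eq_mul, hA, card_univ]; ring
  have hdiff : ∀ i u, ‖conjExp u (∑ x, h i x) (J i) - conjExp u (∑ x, h i x + ∑ x, g i x) (J i)‖ ≤
      A i * rexp ((κ + 1) * |u| - d i) := fun i u => by
    refine (norm_conjExp_sub_le (hs i) (hgs i) (J i) u fun s hsu => hcm i s u hsu).trans ?_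
    have h1 : |u| ≤ rexp |u| := by linarith [Real.add_one_le_exp |u|]
    have h2 : rexp ((κ + 1) * |u| - d i) = rexp (κ * |u| - d i) * rexp |u| := by
      rw [← Real.exp_add]; ring_nf
    rw [h2, ← mul_assoc]
    exact mul_mono_left h1 (mul_nonneg (hA0 i) (Real.exp_pos _).le)
  have hpoly : PolyBdd n (fun i => A i + 2 * ‖J i‖ + 1) := by
    have h1 : PolyBdd n a := ((((PolyBdd.const 4).mul hJp).mul
      (PolyBdd.const (rexp (c₁ + R₁ : ℕ))) fun _ => (Real.exp_pos _).le).add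
      (PolyBdd.const 1)).mono fun i => le_rfl
    have h2 : PolyBdd n (fun i => (Fintype.card (Torus (n i)) : ℝ)) :=
      ⟨1, zero_le_one, 2, fun i => by rw [one_mul]; exact card_torus _⟩
    have h3 : PolyBdd n A := h2.mul ((PolyBdd.const b).mul h1 fun i => (ha0 i).le)
      fun i => mul_nonneg hb0 (ha0 i).le
    exact (h3.add ((PolyBdd.const 2).mul hJp)).add (PolyBdd.const 1)
  have hpos : ∀ i, 0 < A i + 2 * ‖J i‖ + 1 := fun i => by
    have := hA0 i
    positivity
  -- Dividing by the amplitude leaves an estimate with constants independent of the size; the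
  -- amplitude grows at most polynomially and is restored at the end.
  have hmain : Rapid n (fun i => ‖quasiAdiabatic W (∑ x, h i x) (J i) -
      quasiAdiabatic W (∑ x, h i x + ∑ x, g i x) (J i)‖ / (A i + 2 * ‖J i‖ + 1)) := fun k => by
    obtain ⟨C, hC, hl⟩ := exists_lightCone_bound (κ + 1) (by positivity) k
    set M : ℝ := ∫ u, |W u| * (1 + |u|) ^ (k + 1)
    have hM : 0 ≤ M := integral_nonneg fun u => by positivity
    refine ⟨C * M * (e : ℝ) ^ k, by positivity, fun i => ?_⟩
    rw [div_le_iff₀ (hpos i)]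
    have hb2 : ∀ u, ‖conjExp u (∑ x, h i x) (J i) - conjExp u (∑ x, h i x + ∑ x, g i x) (J i)‖ ≤
        C * (A i + 2 * ‖J i‖) * wt k (d i) * (1 + |u|) ^ (k + 1) := fun u => by
      refine hl (A i) (2 * ‖J i‖) _ u (d i) (hA0 i) (by positivity) (hdiff i u) ?_
      have h1 := norm_sub_le (conjExp u (∑ x, h i x) (J i))
        (conjExp u (∑ x, h i x + ∑ x, g i x) (J i))
      have h2 := norm_conjExp_le u (hs i) (J i)
      have h3 := norm_conjExp_le u ((hs i).add (hgs i)) (J i)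
      nlinarith [abs_nonneg u, norm_nonneg (J i)]
    have e1 : (fun u => |W u| * (C * (A i + 2 * ‖J i‖) * wt k (d i) * (1 + |u|) ^ (k + 1))) =
        fun u => (C * (A i + 2 * ‖J i‖) * wt k (d i)) * (|W u| * (1 + |u|) ^ (k + 1)) := by
      funext u; ring
    have h1 := norm_quasiAdiabatic_sub_le hW.integrable (hs i) ((hs i).add (hgs i)) (J i) hb2 (by
      rw [e1]; exact (hW.integrable_mul_pow (k + 1)).const_mul _)
    rw [e1, integral_const_mul] at h1
    have h2 : wt k (d i) ≤ (e : ℝ) ^ k * wt k (n i) := by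
      refine wt_scale k ?_
      have := Nat.lt_mul_div_succ (n i) (show 0 < e by omega)
      simp only [hd]; rw [add_comm 1]; omega
    refine h1.trans ?_
    have h3 : A i + 2 * ‖J i‖ ≤ A i + 2 * ‖J i‖ + 1 := by linarith
    have h4 : 0 ≤ A i + 2 * ‖J i‖ := by have := hA0 i; positivity
    calc C * (A i + 2 * ‖J i‖) * wt k (d i) * M
        ≤ C * (A i + 2 * ‖J i‖ + 1) * ((e : ℝ) ^ k * wt k (n i)) * M := by
          refine mul_mono_right ?_ hM
          exact mul_le_mul (mul_mono_left h3 hC) h2 (wt_nonneg _ _) (mul_nonneg hC (hpos i).le)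
      _ = _ := by ring
  refine (hmain.mul_poly hpoly fun i => (hpos i).le).mono fun i => ?_
  rw [div_mul_cancel₀ _ (hpos i).ne']

end Families

end

/-! ### Spectral theory of gapped Hamiltonians -/

section

open MeasureTheory

section Spectral

notation "ℙ" => groundProj

variable {L : ℕ} [NeZero L]

theorem inner_star_left (A : Obs L) (v w : Fock L) : inner ℂ (star A v) w = inner ℂ v (A w) := by
  rw [ContinuousLinearMap.star_eq_adjoint]; exact ContinuousLinearMap.adjoint_inner_left A w v

theorem inner_star_right (A : Obs L) (v w : Fock L) : inner ℂ v (star A w) = inner ℂ (A v) w := by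
  rw [ContinuousLinearMap.star_eq_adjoint]; exact ContinuousLinearMap.adjoint_inner_right A v w

theorem inner_apply_left {A : Obs L} (hA : IsSelfAdjoint A) (v w : Fock L) :
    inner ℂ (A v) w = inner ℂ v (A w) := by
  rw [← inner_star_left, hA.star_eq]

theorem exists_eigenbasis {A : Obs L} (hA : IsSelfAdjoint A) :
    ∃ (b : OrthonormalBasis (Fin (Module.finrank ℂ (Fock L))) ℂ (Fock L))
      (e : Fin (Module.finrank ℂ (Fock L)) → ℝ), ∀ i, A (b i) = (e i : ℂ) • b i :=
  ⟨hA.isSymmetric.eigenvectorBasis rfl, hA.isSymmetric.eigenvalues rfl,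
    fun i => hA.isSymmetric.apply_eigenvectorBasis rfl i⟩

theorem obs_ext_basis {ι : Type} [Fintype ι] (b : OrthonormalBasis ι ℂ (Fock L)) {A B : Obs L}
    (h : ∀ i, A (b i) = B (b i)) : A = B := by
  have : (A : Fock L →ₗ[ℂ] Fock L) = B := b.toBasis.ext fun i => by simpa using h i
  ext1 v
  exact LinearMap.congr_fun this v

theorem mem_spectrum_real {A : Obs L} {v : Fock L} (hv : v ≠ 0) {e : ℝ} (h : A v = (e : ℂ) • v) :
    e ∈ spectrum ℝ A := by
  intro hu
  have h0 : (algebraMap ℝ (Obs L) e - A) v = 0 := by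
    rw [Algebra.algebraMap_eq_smul_one]
    simp [h, sub_self]
  obtain ⟨u, hu⟩ := hu
  have h1 : (↑u⁻¹ * (↑u : Obs L)) v = v := by rw [Units.inv_mul]; rfl
  rw [hu, mul_apply_eq_comp, h0, map_zero] at h1
  exact hv h1.symm

theorem mem_spectrum_complex {A : Obs L} {v : Fock L} (hv : v ≠ 0) {e : ℂ} (h : A v = e • v) :
    e ∈ spectrum ℂ A := by
  intro hu
  have h0 : (algebraMap ℂ (Obs L) e - A) v = 0 := by
    rw [Algebra.algebraMap_eq_smul_one]
    simp [h, sub_self]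
  obtain ⟨u, hu⟩ := hu
  have h1 : (↑u⁻¹ * (↑u : Obs L)) v = v := by rw [Units.inv_mul]; rfl
  rw [hu, mul_apply_eq_comp, h0, map_zero] at h1
  exact hv h1.symm

theorem exists_of_mem_spectrum {A : Obs L} {e : ℝ} (h : e ∈ spectrum ℝ A) :
    ∃ v : Fock L, v ≠ 0 ∧ A v = (e : ℂ) • v := by
  by_contra! hc
  apply h
  change IsUnit (algebraMap ℝ (Obs L) e - A)
  rw [ContinuousLinearMap.isUnit_iff_bijective]
  have hv : ∀ v, (algebraMap ℝ (Obs L) e - A) v = (e : ℂ) • v - A v := fun v => by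
    rw [Algebra.algebraMap_eq_smul_one]
    simp
  have hi : Function.Injective (algebraMap ℝ (Obs L) e - A : Obs L) := by
    refine (injective_iff_map_eq_zero (algebraMap ℝ (Obs L) e - A : Obs L)).2 fun v h0 => ?_
    by_contra hv0
    rw [hv, sub_eq_zero] at h0
    exact hc v hv0 h0.symm
  exact ⟨hi, LinearMap.surjective_of_injective
    (f := ((algebraMap ℝ (Obs L) e - A : Obs L) : Fock L →ₗ[ℂ] Fock L)) hi⟩

theorem expI_apply_of_eigen {A : Obs L} {v : Fock L} {e : ℝ} (h : A v = (e : ℂ) • v) (t : ℝ) :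
    expI t A v = cexp (I * t * e) • v := by
  have hd : ∀ s : ℝ, HasDerivAt (fun s : ℝ => cexp (-(I * s * e)) • expI s A v) 0 s := by
    intro s
    have h1 : HasDerivAt (fun s : ℝ => expI s A v) (I • (e : ℂ) • expI s A v) s := by
      have := ((ContinuousLinearMap.apply ℂ (Fock L) v).restrictScalars
        ℝ).hasFDerivAt.comp_hasDerivAt s (hasDerivAt_expI' s A)
      refine this.congr_deriv ?_
      simp [h]
    have h2 : HasDerivAt (fun s : ℝ => cexp (-(I * s * e))) (cexp (-(I * s * e)) * -(I * e)) s := by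
      have h3 : HasDerivAt (fun s : ℝ => -(I * s * e)) (-(I * e)) s := by
        have := (((hasDerivAt_id s).ofReal_comp.const_mul I).mul_const (e : ℂ)).neg
        exact this.congr_deriv (by simp)
      exact h3.cexp
    refine (h2.smul h1).congr_deriv ?_
    rw [smul_smul, smul_smul, ← add_smul]
    convert zero_smul ℂ (expI s A v) using 2
    ring
  have hc := is_const_of_deriv_eq_zero (fun s => (hd s).differentiableAt) (fun s => (hd s).deriv) t 0
  simp only [expI_zero, ofReal_zero, mul_zero, zero_mul, neg_zero, exp_zero, one_smul,
    one_apply_eq_self] at hc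
  rw [← hc, smul_smul, ← exp_add, add_neg_cancel, exp_zero, one_smul, hc]

theorem expI_two_pi_of_integral {A : Obs L} (hA : IsSelfAdjoint A)
    (h : spectrum ℂ A ⊆ Set.range fun n : ℤ => (n : ℂ)) : expI (2 * π) A = 1 := by
  obtain ⟨b, e, hb⟩ := exists_eigenbasis hA
  refine obs_ext_basis b fun i => ?_
  rw [expI_apply_of_eigen (hb i)]
  obtain ⟨m, hm⟩ := h (mem_spectrum_complex (b.orthonormal.ne_zero i) (hb i))
  simp only at hm
  rw [← hm]
  have : cexp (I * ((2 * π : ℝ) : ℂ) * (m : ℂ)) = 1 := by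
    rw [exp_eq_one_iff]
    exact ⟨m, by push_cast; ring⟩
  rw [this, one_smul]; rfl

theorem groundEnergy_mem {H : Obs L} (hH : IsSelfAdjoint H) : groundEnergy H ∈ spectrum ℝ H := by
  obtain ⟨b, e, hb⟩ := exists_eigenbasis hH
  have hsub : spectrum ℝ H ⊆ Set.range e := by
    intro x hx
    obtain ⟨v, hv, hx⟩ := exists_of_mem_spectrum hx
    by_contra hr
    apply hv
    refine b.toBasis.ext_elem fun i => ?_
    simp only [OrthonormalBasis.coe_toBasis_repr_apply, OrthonormalBasis.repr_apply_apply,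
      inner_zero_right]
    have h1 := inner_apply_left hH (b i) v
    rw [hb, hx, inner_smul_left, inner_smul_right, conj_ofReal] at h1
    have h2 : ((e i : ℂ) - x) * inner ℂ (b i) v = 0 := by rw [sub_mul, h1, sub_self]
    rcases mul_eq_zero.1 h2 with h3 | h3
    · exact absurd ⟨i, by exact_mod_cast sub_eq_zero.1 h3⟩ hr
    · exact h3
  have hne : (spectrum ℝ H).Nonempty := by
    have : 0 < Module.finrank ℂ (Fock L) := Module.finrank_pos
    exact ⟨_, mem_spectrum_real (b.orthonormal.ne_zero ⟨0, this⟩) (hb ⟨0, this⟩)⟩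
  exact hne.csInf_mem ((Set.finite_range e).subset hsub)

theorem groundEnergy_le {H : Obs L} {v : Fock L} (hv : v ≠ 0) {e : ℝ}
    (h : H v = (e : ℂ) • v) : groundEnergy H ≤ e := by
  have hbdd : BddBelow (spectrum ℝ H) := by
    refine ⟨-‖H‖, fun x hx => ?_⟩
    obtain ⟨w, hw, hx⟩ := exists_of_mem_spectrum hx
    have h1 := H.le_opNorm w
    rw [hx, norm_smul, norm_real, Real.norm_eq_abs] at h1
    have h2 : |x| ≤ ‖H‖ := le_of_mul_le_mul_right h1 (norm_pos_iff.2 hw)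
    exact (abs_le.1 h2).1
  exact csInf_le hbdd (mem_spectrum_real hv h)

theorem mem_groundSpace {H : Obs L} {v : Fock L} :
    v ∈ groundSpace H ↔ H v = (groundEnergy H : ℂ) • v := Module.End.mem_eigenspace_iff

theorem isSelfAdjoint_groundProj (H : Obs L) : IsSelfAdjoint (ℙ H) :=
  isSelfAdjoint_starProjection _

theorem groundProj_mul_self (H : Obs L) : ℙ H * ℙ H = ℙ H :=
  Submodule.isIdempotentElem_starProjection _

theorem norm_groundProj_le (H : Obs L) : ‖ℙ H‖ ≤ 1 := Submodule.starProjection_norm_le _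

theorem mul_groundProj (H : Obs L) : H * ℙ H = (groundEnergy H : ℂ) • ℙ H := by
  ext1 v
  exact mem_groundSpace.1 (Submodule.starProjection_apply_mem (groundSpace H) v)

theorem groundProj_mul {H : Obs L} (hH : IsSelfAdjoint H) :
    ℙ H * H = (groundEnergy H : ℂ) • ℙ H := by
  have := congrArg star (mul_groundProj H)
  simpa [(isSelfAdjoint_groundProj H).star_eq, hH.star_eq] using this

theorem groundProj_apply_of_eq {H : Obs L} {v : Fock L} (h : H v = (groundEnergy H : ℂ) • v) :
    ℙ H v = v := Submodule.starProjection_eq_self_iff.2 (mem_groundSpace.2 h)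

theorem groundProj_apply_of_ne {H : Obs L} (hH : IsSelfAdjoint H) {v : Fock L} {e : ℝ}
    (h : H v = (e : ℂ) • v) (hne : e ≠ groundEnergy H) : ℙ H v = 0 := by
  refine (Submodule.starProjection_apply_eq_zero_iff (groundSpace H)).2 fun w hw => ?_
  have h1 := inner_apply_left hH w v
  rw [mem_groundSpace.1 hw, h, inner_smul_left, inner_smul_right, conj_ofReal] at h1
  have h2 : ((e : ℂ) - groundEnergy H) * inner ℂ w v = 0 := by rw [sub_mul, h1, sub_self]
  rcases mul_eq_zero.1 h2 with h3 | h3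
  · exact absurd (by exact_mod_cast sub_eq_zero.1 h3) hne
  · exact h3

variable {γ : ℝ} {p : ℕ} {H : Obs L}

/-- The variational principle with a gap. -/
theorem IsGapped.le_inner (hg : IsGapped γ p H) (hH : IsSelfAdjoint H) (v : Fock L) :
    groundEnergy H * ‖v‖ ^ 2 + γ * ‖v - ℙ H v‖ ^ 2 ≤ (inner ℂ v (H v)).re := by
  obtain ⟨b, e, hb⟩ := exists_eigenbasis hH
  have h1 : ∀ i, inner ℂ (b i) (H v) = (e i : ℂ) * inner ℂ (b i) v := fun i => by
    rw [← inner_apply_left hH, hb, inner_smul_left, conj_ofReal]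
  rw [← b.sum_inner_mul_inner v (H v), re_sum, ← b.sum_sq_norm_inner_right v,
    ← b.sum_sq_norm_inner_right (v - ℙ H v), mul_sum, mul_sum, ← sum_add_distrib]
  refine sum_le_sum fun i _ => ?_
  have h2 : (inner ℂ v (b i) * inner ℂ (b i) (H v)).re = e i * ‖inner ℂ (b i) v‖ ^ 2 := by
    rw [h1, ← inner_conj_symm v (b i), mul_left_comm, re_ofReal_mul, mul_comm, mul_comm (e i)]
    congr 1
    rw [← normSq_eq_conj_mul_self, ofReal_re, normSq_eq_norm_sq]
  have h3 : inner ℂ (b i) (v - ℙ H v) = inner ℂ (b i - ℙ H (b i)) v := by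
    rw [inner_sub_right, inner_sub_left, inner_apply_left (isSelfAdjoint_groundProj H)]
  rw [h2, h3]
  by_cases he : e i = groundEnergy H
  · rw [groundProj_apply_of_eq (by rw [hb, he]), sub_self, inner_zero_left, norm_zero, he]; simp
  · rw [groundProj_apply_of_ne hH (hb i) he, sub_zero, ← add_mul]
    exact mul_mono_right (hg.2 _ (mem_spectrum_real (b.orthonormal.ne_zero i) (hb i)) he)

theorem groundEnergy_mul_le_inner (hH : IsSelfAdjoint H) (v : Fock L) :
    groundEnergy H * ‖v‖ ^ 2 ≤ (inner ℂ v (H v)).re := by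
  have hg : IsGapped 0 (Module.finrank ℂ (groundSpace H)) H := by
    refine ⟨rfl, fun e he _ => ?_⟩
    obtain ⟨w, hw, he⟩ := exists_of_mem_spectrum he
    rw [add_zero]; exact groundEnergy_le hw he
  simpa using hg.le_inner hH v

/-- `H - E₀` -/
def excitation (H : Obs L) : Obs L := H - (groundEnergy H : ℂ) • (1 : Obs L)

theorem isSelfAdjoint_excitation (hH : IsSelfAdjoint H) : IsSelfAdjoint (excitation H) := by
  rw [IsSelfAdjoint, excitation]; simp [hH.star_eq]

theorem excitation_mul_groundProj (H : Obs L) : excitation H * ℙ H = 0 := by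
  rw [excitation, sub_mul, mul_groundProj]; simp

theorem groundProj_mul_excitation (hH : IsSelfAdjoint H) : ℙ H * excitation H = 0 := by
  rw [excitation, mul_sub, groundProj_mul hH]; simp

theorem cm_excitation (H A : Obs L) : cm (excitation H) A = cm H A := by
  simp [excitation, cm, sub_mul, mul_sub]

theorem re_inner_excitation (H : Obs L) (v : Fock L) : (inner ℂ v (excitation H v)).re =
    (inner ℂ v (H v)).re - groundEnergy H * ‖v‖ ^ 2 := by
  have h : inner ℂ v v = ((‖v‖ ^ 2 : ℝ) : ℂ) := by
    rw [inner_self_eq_norm_sq_to_K]; simp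
  simp only [excitation, sub_apply, smul_apply, one_apply_eq_self, inner_sub_right,
    inner_smul_right, sub_re]
  rw [h, ← ofReal_mul, ofReal_re]

theorem IsGapped.le_inner_excitation (hg : IsGapped γ p H) (hH : IsSelfAdjoint H) (v : Fock L) :
    γ * ‖(1 - ℙ H) v‖ ^ 2 ≤ (inner ℂ v (excitation H v)).re := by
  have h1 := hg.le_inner hH v
  have h2 := re_inner_excitation H v
  rw [h2]
  have h3 : (1 - ℙ H) v = v - ℙ H v := rfl
  rw [h3]; linarith

theorem inner_excitation_nonneg (hH : IsSelfAdjoint H) (v : Fock L) :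
    0 ≤ (inner ℂ v (excitation H v)).re := by
  have h1 := groundEnergy_mul_le_inner hH v
  have h2 := re_inner_excitation H v
  linarith

/-- If the energies added by two operations sum up to almost zero, none of them excites the
ground states. -/
theorem IsGapped.norm_sq_le (hg : IsGapped γ p H) (hγ : 0 < γ) (hH : IsSelfAdjoint H) (X Y : Obs L) :
    ‖(1 - ℙ H) * X * ℙ H‖ ^ 2 ≤
      γ⁻¹ * ‖ℙ H * (star X * excitation H * X + star Y * excitation H * Y) *
        ℙ H‖ := by
  set P := ℙ H with hP
  set M := P * (star X * excitation H * X + star Y * excitation H * Y) * P with hM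
  have key : ∀ v, ‖((1 - P) * X * P) v‖ ^ 2 ≤ γ⁻¹ * ‖M‖ * ‖v‖ ^ 2 := fun v => by
    have h1 := hg.le_inner_excitation hH (X (P v))
    have h2 := inner_excitation_nonneg hH (Y (P v))
    have h3 : (inner ℂ v (M v)).re = (inner ℂ (X (P v)) (excitation H (X (P v)))).re +
        (inner ℂ (Y (P v)) (excitation H (Y (P v)))).re := by
      rw [hM]
      simp only [mul_apply_eq_comp, add_apply]
      rw [← inner_apply_left (isSelfAdjoint_groundProj H), inner_add_right, inner_star_right,
        inner_star_right, add_re]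
    have h4 : (inner ℂ v (M v)).re ≤ ‖M‖ * ‖v‖ ^ 2 := by
      refine (re_le_norm _).trans ((norm_inner_le_norm _ _).trans ?_)
      have := M.le_opNorm v
      nlinarith [norm_nonneg v]
    have h5 : γ * ‖((1 - P) * X * P) v‖ ^ 2 ≤ ‖M‖ * ‖v‖ ^ 2 := by
      have e : ((1 - P) * X * P) v = (1 - P) (X (P v)) := rfl
      rw [e]; linarith
    rw [mul_assoc γ⁻¹, ← div_eq_inv_mul, le_div_iff₀ hγ, mul_comm]; exact h5
  have h6 : ‖(1 - P) * X * P‖ ≤ √(γ⁻¹ * ‖M‖) := by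
    refine ContinuousLinearMap.opNorm_le_bound _ (Real.sqrt_nonneg _) fun v => ?_
    refine le_of_sq_le_sq ?_ (by positivity)
    rw [mul_pow, Real.sq_sqrt (by positivity)]
    exact key v
  calc _ ≤ √(γ⁻¹ * ‖M‖) ^ 2 := by gcongr
    _ = _ := Real.sq_sqrt (by positivity)

end Spectral

end

/-! ### The quasi-adiabatic generator on the ground state space -/

section

open MeasureTheory

section Spectral

variable {L : ℕ} [NeZero L] {γ : ℝ} {p : ℕ} {H : Obs L} {W : ℝ → ℝ}

theorem one_sub_groundProj_mul_self (H : Obs L) :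
    (1 - ℙ H) * (1 - ℙ H) = 1 - ℙ H := by
  simp only [sub_mul, mul_sub, one_mul, mul_one, groundProj_mul_self]; abel

theorem groundProj_mul_one_sub (H : Obs L) : ℙ H * (1 - ℙ H) = 0 := by
  rw [mul_sub, mul_one, groundProj_mul_self, sub_self]

theorem one_sub_mul_groundProj (H : Obs L) : (1 - ℙ H) * ℙ H = 0 := by
  rw [sub_mul, one_mul, groundProj_mul_self, sub_self]

theorem norm_one_sub_groundProj_le (H : Obs L) : ‖1 - ℙ H‖ ≤ 1 := by
  have hs : star (1 - ℙ H) = 1 - ℙ H := by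
    rw [star_sub, star_one, (isSelfAdjoint_groundProj H).star_eq]
  have h := CStarRing.norm_star_mul_self (x := 1 - ℙ H)
  rw [hs, one_sub_groundProj_mul_self] at h
  by_contra! hc
  nlinarith

theorem excitation_mul_one_sub (H : Obs L) : excitation H * (1 - ℙ H) = excitation H := by
  rw [mul_sub, mul_one, excitation_mul_groundProj, sub_zero]

/-- Self-adjointness makes the opposite off-diagonal block vanish as well. -/
theorem commute_of_offdiag {B P : Obs L} (hB : IsSelfAdjoint B) (hP : IsSelfAdjoint P)
    (h : P * B * (1 - P) = 0) : Commute B P := by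
  have h1 : P * B = P * B * P := by rw [mul_sub, mul_one, sub_eq_zero] at h; exact h
  have h2 := congrArg star h1
  simp only [star_mul, hB.star_eq, hP.star_eq] at h2
  rw [Commute, SemiconjBy, h2, h1, mul_assoc]

theorem groundProj_mul_expI (hH : IsSelfAdjoint H) (t : ℝ) :
    ℙ H * expI t H = cexp (I * t * groundEnergy H) • ℙ H := by
  have h : ∀ s, expI s H * ℙ H =
      cexp (I * s * groundEnergy H) • ℙ H := fun s => by
    ext1 v
    exact expI_apply_of_eigen (by
      have := DFunLike.congr_fun (mul_groundProj H) v
      exact this) s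
  have h1 := congrArg star (h (-t))
  rw [star_mul, star_expI _ hH, neg_neg, (isSelfAdjoint_groundProj H).star_eq, star_smul,
    (isSelfAdjoint_groundProj H).star_eq] at h1
  rw [h1]
  congr 1
  rw [star_def, ← exp_conj]
  congr 1
  simp

/-- The defining property of the quasi-adiabatic generator of a gapped system. -/
theorem IsGapped.proj_mul_quasiAdiabatic (hg : IsGapped γ p H) (hγ : 0 < γ)
    (hW : IsFilterFunction γ W) (hH : IsSelfAdjoint H) (A : Obs L) :
    ℙ H * quasiAdiabatic W H A * excitation H =
      -(I • (ℙ H * A * (1 - ℙ H))) := by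
  obtain ⟨b, e, hb⟩ := exists_eigenbasis hH
  set P := ℙ H with hP
  set E := groundEnergy H with hE
  refine obs_ext_basis b fun i => ?_
  have hex : excitation H (b i) = ((e i : ℂ) - E) • b i := by
    simp only [excitation, sub_apply, smul_apply, one_apply_eq_self, hb, sub_smul, hE]
  have h1 : (P * quasiAdiabatic W H A * excitation H) (b i) =
      ((e i : ℂ) - E) • P (quasiAdiabatic W H A (b i)) := by
    simp only [mul_apply_eq_comp, hex, map_smul]
  rw [h1]
  -- On ground states both sides vanish. On an excited eigenvector the integral is the Fourier
  -- transform of the filter at the energy difference `E - e i`, which has modulus at least `γ`.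
  by_cases he : e i = E
  · have h2 : (1 - P) (b i) = 0 := by
      simp only [sub_apply, one_apply_eq_self]
      rw [groundProj_apply_of_eq (by rw [hb, he]), sub_self]
    have h3 : (-(I • (P * A * (1 - P)))) (b i) = 0 := by
      simp only [neg_apply, smul_apply, mul_apply_eq_comp, h2, map_zero, smul_zero, neg_zero]
    rw [h3, he, sub_self, zero_smul]
  · have h2 : (1 - P) (b i) = b i := by
      simp only [sub_apply, one_apply_eq_self]
      rw [groundProj_apply_of_ne hH (hb i) he, sub_zero]
    let T : Obs L →ₗ[ℂ] Fock L := {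
      toFun := fun B => P (B (b i))
      map_add' := fun B C => by simp
      map_smul' := fun c B => by simp }
    have h3 := map_quasiAdiabatic hW.integrable hH A (LinearMap.toContinuousLinearMap T)
    change P (quasiAdiabatic W H A (b i)) = ∫ u : ℝ, (W u : ℂ) • P (conjExp u H A (b i)) at h3
    have h4 : ∀ u : ℝ, (W u : ℂ) • P (conjExp u H A (b i)) =
        ((W u : ℂ) * cexp (I * (u : ℂ) * ((E - e i : ℝ) : ℂ))) • P (A (b i)) := by
      intro u
      have h5 : P (conjExp u H A (b i)) = (P * expI u H) (A (expI (-u) H (b i))) := rfl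
      rw [h5, groundProj_mul_expI hH, expI_apply_of_eigen (hb i)]
      simp only [smul_apply, map_smul, smul_smul]
      rw [mul_assoc, ← exp_add]
      congr 3
      push_cast; ring
    have hgap : γ ≤ |E - e i| := by
      have := hg.2 _ (mem_spectrum_real (b.orthonormal.ne_zero i) (hb i)) he
      rw [abs_sub_comm]
      exact (by linarith : γ ≤ e i - E).trans (le_abs_self _)
    simp only [h4] at h3
    rw [integral_smul_const, hW.fourier _ hgap] at h3
    have h6 : (-(I • (P * A * (1 - P)))) (b i) = (-I) • P (A (b i)) := by
      simp only [neg_apply, smul_apply, mul_apply_eq_comp, h2, neg_smul]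
    rw [h6, h3, smul_smul]
    congr 1
    have h7 : ((E - e i : ℝ) : ℂ) ≠ 0 := by
      rw [Ne, ofReal_eq_zero]; intro h; rw [h, abs_zero] at hgap; linarith
    push_cast at h7 ⊢
    field_simp
    ring

/-- Between the ground states and the excited states the filter inverts the commutator with $H$, so
$i[H,K]$ cancels the off-diagonal part of $A$. Thus $A$ is block diagonal up to a commutator with
$H$. -/
theorem IsGapped.commute_add_cm (hg : IsGapped γ p H) (hγ : 0 < γ)
    (hW : IsFilterFunction γ W) (hH : IsSelfAdjoint H) {A : Obs L} (hA : IsSelfAdjoint A) :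
    Commute (A + I • cm H (quasiAdiabatic W H A)) (ℙ H) := by
  have hK := isSelfAdjoint_quasiAdiabatic (W := W) hH hA
  have h := hg.proj_mul_quasiAdiabatic hγ hW hH A
  set K := quasiAdiabatic W H A
  set P := ℙ H with hP
  refine commute_of_offdiag ?_ (isSelfAdjoint_groundProj H) ?_
  · rw [IsSelfAdjoint, cm]
    simp only [star_add, star_smul, star_sub, star_mul, hA.star_eq, hK.star_eq, hH.star_eq,
      star_def, conj_I]
    rw [neg_smul, ← smul_neg, neg_sub]
  · rw [← cm_excitation, cm]
    have h1 : P * (A + I • (excitation H * K - K * excitation H)) * (1 - P) =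
        P * A * (1 - P) + I • (P * excitation H * K * (1 - P) -
          P * K * (excitation H * (1 - P))) := by
      simp only [mul_add, add_mul, mul_sub, sub_mul, mul_smul_comm, smul_mul_assoc, mul_assoc,
        smul_sub]
      abel
    rw [h1, groundProj_mul_excitation hH, excitation_mul_one_sub, h]
    simp [smul_smul]

theorem isUnit_excitation_add (hH : IsSelfAdjoint H) : IsUnit (excitation H + ℙ H) := by
  rw [ContinuousLinearMap.isUnit_iff_bijective]
  have hi : Function.Injective (excitation H + ℙ H : Obs L) := by
    refine (injective_iff_map_eq_zero (excitation H + ℙ H : Obs L)).2 fun v h0 => ?_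
    have h1 : ℙ H v = 0 := by
      have e : ℙ H * (excitation H + ℙ H) = ℙ H := by
        rw [mul_add, groundProj_mul_excitation hH, zero_add, groundProj_mul_self]
      rw [← e, mul_apply_eq_comp, h0, map_zero]
    rw [add_apply, h1, add_zero] at h0
    rw [← h1]
    refine (groundProj_apply_of_eq ?_).symm
    simpa [excitation, sub_eq_zero] using h0
  exact ⟨hi, LinearMap.surjective_of_injective
    (f := ((excitation H + ℙ H : Obs L) : Fock L →ₗ[ℂ] Fock L)) hi⟩

theorem reducedResolvent_eq (H : Obs L) :
    reducedResolvent H = (1 - ℙ H) * Ring.inverse (excitation H + ℙ H) := rfl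

theorem commute_groundProj_add (hH : IsSelfAdjoint H) :
    Commute (1 - ℙ H) (excitation H + ℙ H) := by
  have h : Commute (ℙ H) (excitation H + ℙ H) := by
    rw [Commute, SemiconjBy, mul_add, add_mul, groundProj_mul_excitation hH,
      excitation_mul_groundProj]
  exact (Commute.one_left _).sub_left h

theorem excitation_mul_reducedResolvent (hH : IsSelfAdjoint H) :
    excitation H * reducedResolvent H = 1 - ℙ H := by
  have hu := isUnit_excitation_add hH
  set P := ℙ H with hP
  have h1 : excitation H = (1 - P) * (excitation H + P) := by
    rw [mul_add, one_sub_mul_groundProj, sub_mul, one_mul, groundProj_mul_excitation hH]; simp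
  have h2 : (excitation H + P) * (1 - P) = excitation H := by
    rw [← (commute_groundProj_add hH).eq, ← h1]
  rw [reducedResolvent_eq, ← mul_assoc, excitation_mul_one_sub]
  nth_rw 1 [h1]
  rw [mul_assoc, Ring.mul_inverse_cancel _ hu, mul_one]

theorem isSelfAdjoint_reducedResolvent (hH : IsSelfAdjoint H) :
    IsSelfAdjoint (reducedResolvent H) := by
  have hs : IsSelfAdjoint (excitation H + ℙ H) :=
    (isSelfAdjoint_excitation hH).add (isSelfAdjoint_groundProj H)
  have hc : Commute (1 - ℙ H) (Ring.inverse (excitation H + ℙ H)) := by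
    have h1 := commute_groundProj_add hH
    obtain ⟨u, hu⟩ := isUnit_excitation_add hH
    rw [← hu] at h1 ⊢
    rw [Ring.inverse_unit]
    exact h1.units_inv_right
  rw [IsSelfAdjoint, reducedResolvent_eq, star_mul, ← Ring.inverse_star, hs.star_eq, star_sub, star_one,
    (isSelfAdjoint_groundProj H).star_eq]
  exact hc.eq.symm

/-- The off-diagonal part of the generator is the observable divided by energy differences. This is
the link to the resolvents in Kubo's formula. -/
theorem IsGapped.proj_mul_quasiAdiabatic_mul (hg : IsGapped γ p H) (hγ : 0 < γ)
    (hW : IsFilterFunction γ W) (hH : IsSelfAdjoint H) (A : Obs L) :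
    ℙ H * quasiAdiabatic W H A * (1 - ℙ H) =
      -(I • (ℙ H * A * reducedResolvent H)) := by
  have hR : (1 - ℙ H) * reducedResolvent H = reducedResolvent H := by
    rw [reducedResolvent_eq, ← mul_assoc, one_sub_groundProj_mul_self]
  rw [← excitation_mul_reducedResolvent hH, ← mul_assoc, hg.proj_mul_quasiAdiabatic hγ hW hH,
    neg_mul, smul_mul_assoc, mul_assoc _ _ (reducedResolvent H), hR]

theorem isSelfAdjoint_I_smul_cm {A B : Obs L} (hA : IsSelfAdjoint A) (hB : IsSelfAdjoint B) :
    IsSelfAdjoint (I • cm A B) := by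
  rw [IsSelfAdjoint, cm]
  simp only [star_smul, star_sub, star_mul, hA.star_eq, hB.star_eq, star_def, conj_I]
  rw [neg_smul, ← smul_neg, neg_sub]

/-- The gauge transformation generated by `Q`, corrected by the quasi-adiabatic generator of the
change of the Hamiltonian, preserves the ground state space. -/
theorem IsGapped.commute_quasiAdiabatic_sub (hg : IsGapped γ p H) (hγ : 0 < γ)
    (hW : IsFilterFunction γ W) (hH : IsSelfAdjoint H) {Q : Obs L} (hQ : IsSelfAdjoint Q) :
    Commute (quasiAdiabatic W H (I • cm Q H) - Q) (ℙ H) := by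
  have hA := isSelfAdjoint_I_smul_cm hQ hH
  have hK := isSelfAdjoint_quasiAdiabatic (W := W) hH hA
  have h := hg.proj_mul_quasiAdiabatic hγ hW hH (I • cm Q H)
  set K := quasiAdiabatic W H (I • cm Q H)
  set P := ℙ H with hP
  refine commute_of_offdiag (hK.sub hQ) (isSelfAdjoint_groundProj H) ?_
  have h1 : P * (K - Q) * excitation H = 0 := by
    rw [mul_sub, sub_mul, h, cm_symm, ← cm_excitation, cm]
    have e : P * (I • -(excitation H * Q - Q * excitation H)) * (1 - P) =
        I • (P * Q * (excitation H * (1 - P)) - P * excitation H * Q * (1 - P)) := by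
      simp only [mul_sub, sub_mul, mul_smul_comm, smul_mul_assoc, mul_assoc, neg_sub, smul_sub]
      abel
    rw [e, excitation_mul_one_sub, groundProj_mul_excitation hH]
    simp [smul_smul]
  rw [← excitation_mul_reducedResolvent hH, ← mul_assoc, h1, zero_mul]

theorem groundEnergy_conj {V : Obs L} (hV : star V * V = 1) (hV' : V * star V = 1) (H : Obs L) :
    groundEnergy (star V * H * V) = groundEnergy H := by
  let u : (Obs L)ˣ := ⟨star V, V, hV, hV'⟩
  have := spectrum.units_conjugate (R := ℝ) (a := H) (u := u)
  exact congrArg sInf this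

theorem isSelfAdjoint_star_conj {V H : Obs L} (hH : IsSelfAdjoint H) :
    IsSelfAdjoint (star V * H * V) := by
  rw [IsSelfAdjoint]; simp [hH.star_eq, mul_assoc]

theorem groundProj_conj {V : Obs L} (hV : star V * V = 1) (hV' : V * star V = 1)
    (hH : IsSelfAdjoint H) : ℙ (star V * H * V) = star V * ℙ H * V := by
  have hs := isSelfAdjoint_star_conj (V := V) hH
  obtain ⟨b, e, hb⟩ := exists_eigenbasis hs
  refine obs_ext_basis b fun i => ?_
  have h1 : H (V (b i)) = (e i : ℂ) • V (b i) := by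
    rw [← map_smul, ← hb]
    simp only [← mul_apply_eq_comp, ← mul_assoc, hV', one_mul]
  by_cases he : e i = groundEnergy H
  · rw [groundProj_apply_of_eq (by rw [hb, groundEnergy_conj hV hV', he])]
    simp only [mul_apply_eq_comp]
    rw [groundProj_apply_of_eq (by rw [h1, he]), ← mul_apply_eq_comp, hV]; rfl
  · rw [groundProj_apply_of_ne hs (hb i) (by rwa [groundEnergy_conj hV hV'])]
    simp only [mul_apply_eq_comp]
    rw [groundProj_apply_of_ne hH h1 he, map_zero]

theorem tr_groundProj (H : Obs L) : tr (ℙ H) = Module.finrank ℂ (groundSpace H) := by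
  have h : LinearMap.IsProj (groundSpace H) (ℙ H : Fock L →ₗ[ℂ] Fock L) :=
    ⟨fun v => Submodule.starProjection_apply_mem _ v,
      fun v hv => Submodule.starProjection_eq_self_iff.2 hv⟩
  exact h.trace

theorem IsGapped.conj {V : Obs L} (hg : IsGapped γ p H) (hV : star V * V = 1)
    (hV' : V * star V = 1) (hH : IsSelfAdjoint H) : IsGapped γ p (star V * H * V) := by
  refine ⟨?_, fun e he hne => ?_⟩
  · have h1 := tr_groundProj (star V * H * V)
    rw [groundProj_conj hV hV' hH, tr_mul_comm, ← mul_assoc, hV', one_mul, tr_groundProj, hg.1] at h1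
    exact_mod_cast h1.symm
  · rw [groundEnergy_conj hV hV'] at hne ⊢
    let u : (Obs L)ˣ := ⟨star V, V, hV, hV'⟩
    have := spectrum.units_conjugate (R := ℝ) (a := H) (u := u)
    change spectrum ℝ (star V * H * V) = _ at this
    rw [this] at he
    exact hg.2 e he hne

end Spectral

end

/-! ### Perturbation and transport of ground state projections -/

section

open MeasureTheory Filter Topology

section Spectral

variable {L : ℕ} [NeZero L] {γ : ℝ} {p : ℕ}

/-- A ground state of $H$ serves as a trial state for $H'$. -/
theorem groundEnergy_sub_le {H H' : Obs L} (hH : IsSelfAdjoint H) (hH' : IsSelfAdjoint H') :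
    groundEnergy H' - groundEnergy H ≤ ‖H' - H‖ := by
  obtain ⟨v, hv, he⟩ := exists_of_mem_spectrum (groundEnergy_mem hH)
  have h1 := groundEnergy_mul_le_inner hH' v
  have h2 : (inner ℂ v (H v)).re = groundEnergy H * ‖v‖ ^ 2 := by
    have h : inner ℂ v v = ((‖v‖ ^ 2 : ℝ) : ℂ) := by rw [inner_self_eq_norm_sq_to_K]; simp
    rw [he, inner_smul_right, h, ← ofReal_mul, ofReal_re]
  have h3 : (inner ℂ v ((H' - H) v)).re ≤ ‖H' - H‖ * ‖v‖ ^ 2 := by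
    refine (re_le_norm _).trans ((norm_inner_le_norm _ _).trans ?_)
    have := (H' - H).le_opNorm v
    nlinarith [norm_nonneg v]
  rw [sub_apply, inner_sub_right, sub_re, h2] at h3
  have hpos : 0 < ‖v‖ ^ 2 := by have := norm_pos_iff.2 hv; positivity
  refine le_of_mul_le_mul_right ?_ hpos
  linarith

theorem abs_groundEnergy_sub_le {H H' : Obs L} (hH : IsSelfAdjoint H) (hH' : IsSelfAdjoint H') :
    |groundEnergy H' - groundEnergy H| ≤ ‖H' - H‖ :=
  abs_sub_le_iff.2 ⟨groundEnergy_sub_le hH hH', by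
    rw [norm_sub_rev]; exact groundEnergy_sub_le hH' hH⟩

/-- Pair the approximate eigenvalue equation with $u$ and use the gap: an excited vector cannot
nearly solve it with eigenvalue $c$ unless it is small. -/
theorem IsGapped.norm_le_of_excited {H : Obs L} (hg : IsGapped γ p H) (hH : IsSelfAdjoint H)
    {u : Fock L} (hu : ℙ H u = 0) {B : Obs L} {c M : ℝ}
    (hM : ‖H u + B u - (c : ℂ) • u‖ ≤ M) : (groundEnergy H + γ - c - ‖B‖) * ‖u‖ ≤ M := by
  by_cases h0 : u = 0
  · rw [h0, norm_zero, mul_zero]; exact (norm_nonneg _).trans hM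
  have hpos : 0 < ‖u‖ := norm_pos_iff.2 h0
  refine le_of_mul_le_mul_right ?_ hpos
  have h1 := hg.le_inner hH u
  rw [hu, sub_zero] at h1
  have h2 : (inner ℂ u (H u + B u - (c : ℂ) • u)).re ≤ M * ‖u‖ := by
    refine (re_le_norm _).trans ((norm_inner_le_norm _ _).trans ?_)
    rw [mul_comm]; gcongr
  have h3 : -(‖B‖ * ‖u‖ ^ 2) ≤ (inner ℂ u (B u)).re := by
    have h4 : ‖inner ℂ u (B u)‖ ≤ ‖B‖ * ‖u‖ ^ 2 := by
      refine (norm_inner_le_norm _ _).trans ?_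
      have := B.le_opNorm u
      nlinarith [norm_nonneg u]
    have := (abs_le.1 (abs_re_le_norm (inner ℂ u (B u)))).1
    linarith
  have h : inner ℂ u u = ((‖u‖ ^ 2 : ℝ) : ℂ) := by rw [inner_self_eq_norm_sq_to_K]; simp
  rw [inner_sub_right, inner_add_right, inner_smul_right, h, ← ofReal_mul, sub_re,
    add_re, ofReal_re] at h2
  nlinarith

/-- Perturbations that almost commute with the ground state projection hardly change it. -/
theorem norm_groundProj_sub_le {Y Y₂ B : Obs L} (hγ : 0 < γ) (hY : IsSelfAdjoint Y)
    (hY₂ : IsSelfAdjoint Y₂) (hg : IsGapped γ p Y) (hg₂ : IsGapped γ p Y₂)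
    (hB : Commute B (ℙ Y)) {δ : ℝ} (hδ : ‖Y₂ - Y - B‖ ≤ δ) (hs : ‖B‖ + δ ≤ γ / 8) :
    ‖ℙ Y₂ - ℙ Y‖ ≤ 4 / γ * δ := by
  set P := ℙ Y with hP
  set P₂ := ℙ Y₂ with hP₂
  have hδ0 : 0 ≤ δ := (norm_nonneg _).trans hδ
  have hd : ‖Y₂ - Y‖ ≤ γ / 8 := by
    have : Y₂ - Y = (Y₂ - Y - B) + B := by abel
    rw [this]; exact (norm_add_le _ _).trans (by linarith)
  have hE := abs_le.1 ((abs_groundEnergy_sub_le hY hY₂).trans hd)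
  have n1 := norm_groundProj_le Y
  have n2 := norm_groundProj_le Y₂
  have n3 := norm_one_sub_groundProj_le Y
  have n4 := norm_one_sub_groundProj_le Y₂
  -- The excited part of a ground state of `Y₂` solves the eigenvalue equation of $Y+B$ up to `δ`.
  -- The shift of the ground energy and the norm of `B` use up at most a quarter of the gap.
  have hx : ‖(1 - P) * P₂‖ ≤ 2 / γ * δ := by
    refine ContinuousLinearMap.opNorm_le_bound _ (by positivity) fun v => ?_
    set u := ((1 - P) * P₂) v with hu
    have h1 : P u = 0 := by
      rw [hu, ← mul_apply_eq_comp, ← mul_assoc, groundProj_mul_one_sub, zero_mul]; rfl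
    have h2 : Y u + B u - (groundEnergy Y₂ : ℂ) • u = ((1 - P) * (Y + B - Y₂) * P₂) v := by
      have e1 : (1 - P) * Y = Y * (1 - P) := by
        rw [mul_sub, sub_mul, groundProj_mul hY, mul_groundProj]; simp
      have e2 : (1 - P) * B = B * (1 - P) := by rw [mul_sub, sub_mul, hB.eq]; simp
      have e3 : (1 - P) * (Y + B - Y₂) * P₂ =
          Y * ((1 - P) * P₂) + B * ((1 - P) * P₂) - (groundEnergy Y₂ : ℂ) • ((1 - P) * P₂) := by
        rw [mul_sub, mul_add, sub_mul, add_mul, e1, e2, mul_assoc (1 - P) Y₂, mul_groundProj]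
        simp only [mul_assoc, mul_smul_comm, hP₂]
      rw [e3]; rfl
    have h3 : ‖Y u + B u - (groundEnergy Y₂ : ℂ) • u‖ ≤ δ * ‖v‖ := by
      rw [h2]
      refine (ContinuousLinearMap.le_opNorm _ _).trans (mul_mono_right ?_)
      refine (norm_conj_le n3 n2 _).trans (le_trans (le_of_eq ?_) hδ)
      rw [← norm_neg]; congr 1; abel
    have h4 := hg.norm_le_of_excited hY h1 h3
    have h5 : γ / 2 * ‖u‖ ≤ δ * ‖v‖ := le_trans (mul_mono_right (by linarith)) h4
    have h6 : 2 / γ * δ * ‖v‖ = 2 / γ * (δ * ‖v‖) := by ring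
    rw [h6]
    calc ‖u‖ = 2 / γ * (γ / 2 * ‖u‖) := by field_simp
      _ ≤ _ := by gcongr
  -- Here `B` reappears multiplied by the quantity `X` to be estimated. Its coefficient is at most
  -- 1/7, so it can be absorbed on the left.
  have hx' : ‖(1 - P₂) * P‖ ≤ 2 / γ * δ := by
    set X := ‖(1 - P₂) * P‖ with hX
    have hX0 : 0 ≤ X := norm_nonneg _
    have key : X ≤ 8 / (7 * γ) * (δ + X * ‖B‖) := by
      refine ContinuousLinearMap.opNorm_le_bound _ (by positivity) fun v => ?_
      set u := ((1 - P₂) * P) v with hu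
      have h1 : P₂ u = 0 := by
        rw [hu, ← mul_apply_eq_comp, ← mul_assoc, groundProj_mul_one_sub, zero_mul]; rfl
      have h2 : Y₂ u + (0 : Obs L) u - (groundEnergy Y : ℂ) • u =
          ((1 - P₂) * (Y₂ - Y - B) * P + (1 - P₂) * P * B) v := by
        have e1 : (1 - P₂) * Y₂ = Y₂ * (1 - P₂) := by
          rw [mul_sub, sub_mul, groundProj_mul hY₂, mul_groundProj]; simp
        have e3 : (1 - P₂) * (Y₂ - Y - B) * P + (1 - P₂) * P * B =
            Y₂ * ((1 - P₂) * P) - (groundEnergy Y : ℂ) • ((1 - P₂) * P) := by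
          rw [mul_sub, mul_sub, sub_mul, sub_mul, e1, mul_assoc (1 - P₂) Y, mul_groundProj,
            mul_assoc (1 - P₂) B, hB.eq]
          simp only [mul_assoc, mul_smul_comm]; abel
        rw [e3]; simp [hu]
      have h3 : ‖Y₂ u + (0 : Obs L) u - (groundEnergy Y : ℂ) • u‖ ≤ (δ + X * ‖B‖) * ‖v‖ := by
        rw [h2]
        refine (ContinuousLinearMap.le_opNorm _ _).trans (mul_mono_right ?_)
        exact (norm_add_le _ _).trans (add_le_add ((norm_conj_le n4 n1 _).trans hδ)
          (norm_mul_le _ _))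
      have h4 := hg₂.norm_le_of_excited hY₂ h1 h3
      rw [norm_zero, sub_zero] at h4
      have h5 : 7 * γ / 8 * ‖u‖ ≤ (δ + X * ‖B‖) * ‖v‖ := le_trans (mul_mono_right (by linarith)) h4
      rw [mul_assoc]
      calc ‖u‖ = 8 / (7 * γ) * (7 * γ / 8 * ‖u‖) := by field_simp
        _ ≤ _ := by gcongr
    have h1 : X * ‖B‖ ≤ X * (γ / 8) := mul_mono_left (by linarith) hX0
    have h2 : 8 / (7 * γ) * (δ + X * ‖B‖) ≤ 8 / (7 * γ) * (δ + X * (γ / 8)) := by gcongr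
    have h3 : 8 / (7 * γ) * (δ + X * (γ / 8)) = 8 / (7 * γ) * δ + X / 7 := by field_simp
    have h4 : 2 / γ * δ = 7 / 4 * (8 / (7 * γ) * δ) := by field_simp; ring
    have h5 : 0 ≤ 8 / (7 * γ) * δ := by positivity
    linarith
  have e : P₂ - P = (1 - P) * P₂ - star ((1 - P₂) * P) := by
    simp only [star_mul, star_sub, star_one, hP, hP₂, (isSelfAdjoint_groundProj _).star_eq]
    noncomm_ring
  rw [e]
  refine (norm_sub_le _ _).trans ?_
  rw [norm_star]
  have : 4 / γ * δ = 2 / γ * δ + 2 / γ * δ := by ring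
  linarith

/-- Transport of the ground state projection along a path of gapped operators whose derivative
almost commutes with it. -/
theorem norm_groundProj_path_le {Y B R : ℝ → Obs L} {T ε : ℝ} (hγ : 0 < γ) (hε : 0 < ε)
    (hY : ∀ s ∈ Set.Icc 0 T, IsSelfAdjoint (Y s)) (hg : ∀ s ∈ Set.Icc 0 T, IsGapped γ p (Y s))
    (hd : ∀ s ∈ Set.Icc 0 T, HasDerivAt Y (B s + R s) s)
    (hB : ∀ s ∈ Set.Icc 0 T, Commute (B s) (ℙ (Y s)))
    (hR : ∀ s ∈ Set.Icc 0 T, ‖R s‖ ≤ ε) {s : ℝ} (hs : s ∈ Set.Icc 0 T) :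
    ‖ℙ (Y s) - ℙ (Y 0)‖ ≤ 4 / γ * (4 * ε) * s := by
  let f : ℝ → Obs L := fun s => ℙ (Y s) - ℙ (Y 0)
  have hcont : ContinuousOn f (Set.Icc 0 T) := by
    refine ContinuousOn.sub (fun x hx => ?_) continuousOn_const
    have h1 : Tendsto (fun z => ‖Y z - Y x‖) (𝓝[Set.Icc 0 T] x) (𝓝 0) := by
      have := ((hd x hx).continuousAt.tendsto.mono_left
        (nhdsWithin_le_nhds (s := Set.Icc 0 T))).sub_const (Y x)
      rw [sub_self] at this
      simpa using this.norm
    rw [ContinuousWithinAt, tendsto_iff_norm_sub_tendsto_zero]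
    refine squeeze_zero' (.of_forall fun _ => norm_nonneg _) ?_
      (by simpa using h1.const_mul (4 / γ))
    filter_upwards [h1.eventually (eventually_le_nhds (show (0 : ℝ) < γ / 8 by positivity)),
      self_mem_nhdsWithin] with z hz hz'
    exact norm_groundProj_sub_le hγ (hY x hx) (hY z hz') (hg x hx) (hg z hz')
      (Commute.zero_left _) (by rw [sub_zero]) (by rw [norm_zero, zero_add]; exact hz)
  -- Over a short step the operator moves by a commuting part and an error of at most `2 * ε` times
  -- the step: `ε` from `R` and `ε` from the remainder of the derivative. Only the error moves the
  -- projection. The larger multiples 3 and 4 supply the strict inequality of the comparison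
  -- theorem.
  have hslope : ∀ x ∈ Set.Ico 0 T, ∀ r, 4 / γ * (3 * ε) < r →
      ∃ᶠ z in 𝓝[>] x, slope (norm ∘ f) x z < r := by
    intro x hx r hr
    have hx' := Set.Ico_subset_Icc_self hx
    refine Eventually.frequently ?_
    have h1 := ((hd x hx').isLittleO.def hε).filter_mono (nhdsWithin_le_nhds (s := Set.Ioi x))
    have h2 : ∀ᶠ z in 𝓝[>] x, (z - x) * (‖B x‖ + 2 * ε) < γ / 8 := by
      have : Tendsto (fun z => (z - x) * (‖B x‖ + 2 * ε)) (𝓝[>] x) (𝓝 0) := by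
        have h : Continuous fun z : ℝ => (z - x) * (‖B x‖ + 2 * ε) := by fun_prop
        simpa using (h.tendsto x).mono_left (nhdsWithin_le_nhds (s := Set.Ioi x))
      exact this.eventually (eventually_lt_nhds (by positivity))
    filter_upwards [h1, h2, self_mem_nhdsWithin, Ioo_mem_nhdsGT hx.2] with z h1 h2 h3 h4
    have hzx : 0 < z - x := sub_pos.2 h3
    have hz : z ∈ Set.Icc 0 T := ⟨hx.1.trans h4.1.le, h4.2.le⟩
    rw [Real.norm_of_nonneg hzx.le] at h1
    have h5 : ‖Y z - Y x - (z - x) • B x‖ ≤ (z - x) * (2 * ε) := by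
      have e : Y z - Y x - (z - x) • B x =
          (Y z - Y x - (z - x) • (B x + R x)) + (z - x) • R x := by rw [smul_add]; abel
      rw [e]
      refine (norm_add_le _ _).trans ?_
      rw [norm_smul, Real.norm_of_nonneg hzx.le]
      have := mul_mono_left (hR x hx') hzx.le
      linarith
    have h6 := norm_groundProj_sub_le hγ (hY x hx') (hY z hz) (hg x hx') (hg z hz)
      (B := (z - x) • B x) ((hB x hx').smul_left _) h5 (by
        rw [norm_smul, Real.norm_of_nonneg hzx.le]; linarith)
    have h7 : ‖f z‖ - ‖f x‖ ≤ 4 / γ * ((z - x) * (2 * ε)) := by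
      refine (norm_sub_norm_le _ _).trans ?_
      have : f z - f x = ℙ (Y z) - ℙ (Y x) := by simp [f]
      rwa [this]
    rw [slope_def_field, div_lt_iff₀ hzx]
    refine lt_of_le_of_lt h7 ?_
    have h8 : 4 / γ * (2 * ε) < r := by
      refine lt_trans ?_ hr
      have : 0 < 4 / γ := by positivity
      nlinarith
    calc 4 / γ * ((z - x) * (2 * ε)) = 4 / γ * (2 * ε) * (z - x) := by ring
      _ < r * (z - x) := by gcongr
  have hlt : 4 / γ * (3 * ε) < 4 / γ * (4 * ε) := by
    have : 0 < 4 / γ := by positivity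
    nlinarith
  exact image_norm_le_of_liminf_right_slope_norm_lt_deriv_boundary
    (f' := fun _ => 4 / γ * (3 * ε)) hcont hslope (B := fun s => 4 / γ * (4 * ε) * s)
    (B' := fun _ => 4 / γ * (4 * ε)) (by simp [f]) (by fun_prop)
    (fun x _ => by simpa using ((hasDerivAt_id x).const_mul (4 / γ * (4 * ε))).hasDerivWithinAt)
    (fun x _ _ => hlt) hs

end Spectral

end

/-! ### Geometry of the strips -/

section Geometry

variable {L : ℕ} [NeZero L]

theorem natAbs_valMinAbs_sub (a b : ZMod L) : (a - b).valMinAbs.natAbs =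
    min (a.val - b.val + (b.val - a.val)) (L - (a.val - b.val + (b.val - a.val))) := by
  rcases le_total b.val a.val with h | h
  · rw [ZMod.valMinAbs_natAbs_eq_min, ZMod.val_sub h, Nat.sub_eq_zero_of_le h, add_zero]
  · rw [← ZMod.natAbs_valMinAbs_neg, neg_sub, ZMod.valMinAbs_natAbs_eq_min, ZMod.val_sub h,
      Nat.sub_eq_zero_of_le h, zero_add]

/-- The boundary line `{x₂ = L/2 - 1}` of the horizontal strip. -/
def etaPlus (L : ℕ) [NeZero L] : Region L := {x | x.2.val = L / 2 - 1}

/-- A strip with its two boundary lines. -/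
structure IsStrip (S lm lp : Region L) : Prop where
  zero_mem : (0 : Torus L) ∈ S
  compl_nonempty : Sᶜ.Nonempty
  minus_nonempty : lm.Nonempty
  plus_nonempty : lp.Nonempty
  edge : ∀ z ∈ S, ∀ w ∉ S, sdist lm z < gdist z w ∨ sdist lp z < gdist z w
  sep : ∀ y, L ≤ 2 * (1 + sdist lm y + sdist lp y)

theorem val_half_sub_one (L : ℕ) [NeZero L] : ((L / 2 - 1 : ℕ) : ZMod L).val = L / 2 - 1 := by
  have : 0 < L := Nat.pos_of_ne_zero (NeZero.ne L)
  exact ZMod.val_natCast_of_lt (by omega)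

theorem val_half (L : ℕ) [NeZero L] : ((L / 2 : ℕ) : ZMod L).val = L / 2 := by
  have : 0 < L := Nat.pos_of_ne_zero (NeZero.ne L)
  exact ZMod.val_natCast_of_lt (by omega)

theorem natAbs_valMinAbs_sub_le (a b : ZMod L) :
    (a - b).valMinAbs.natAbs ≤ a.val - b.val + (b.val - a.val) := by
  rw [natAbs_valMinAbs_sub]; exact min_le_left _ _

/-- A shortest way out of the strip passes one of its boundary lines and then takes at least one
more step, since these lines belong to the strip. The resulting strictness is what
`near_plus_of_ne_zero` uses. -/
theorem val_lt_of_lt_half (hL : Even L) {a b : ZMod L} (ha : a.val < L / 2) (hb : ¬b.val < L / 2) :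
    a.val < (a - b).valMinAbs.natAbs ∨ L / 2 - 1 - a.val < (a - b).valMinAbs.natAbs := by
  have h3 := ZMod.val_lt b
  rw [natAbs_valMinAbs_sub]
  generalize a.val = v at *
  generalize b.val = w at *
  obtain ⟨h, rfl⟩ := hL
  have e1 : v - w = 0 := by omega
  rw [e1, zero_add]
  rcases le_total (w - v) (h + h - (w - v)) with h4 | h4
  · rw [min_eq_left h4]; omega
  · rw [min_eq_right h4]; omega

theorem le_natAbs_of_val_eq (hL : Even L) {a b : ZMod L} (ha : a.val = 0) (hb : b.val = L / 2 - 1) :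
    L ≤ 2 * (1 + (a - b).valMinAbs.natAbs) := by
  have hL0 : 0 < L := Nat.pos_of_ne_zero (NeZero.ne L)
  rw [natAbs_valMinAbs_sub, ha, hb]
  obtain ⟨h, rfl⟩ := hL
  have e1 : 0 - ((h + h) / 2 - 1) + ((h + h) / 2 - 1 - 0) = h - 1 := by omega
  rw [e1, min_eq_left (by omega)]
  omega

/-- The coordinate is kept abstract so that the horizontal and the vertical strip are treated at
once. The last hypothesis allows moving a point along this coordinate alone. -/
theorem isStrip_coord (hL : Even L) (c : Torus L → ZMod L) (h0 : c 0 = 0)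
    (hc : ∀ z w, (c z - c w).valMinAbs.natAbs ≤ gdist z w)
    (hw : ∀ z a, ∃ w, c w = a ∧ gdist z w = (c z - a).valMinAbs.natAbs) :
    IsStrip ({x | (c x).val < L / 2} : Region L) ({x | (c x).val = 0} : Region L)
      ({x | (c x).val = L / 2 - 1} : Region L) := by
  have hL2 : L / 2 < L ∧ 0 < L / 2 := by
    have := Nat.pos_of_ne_zero (NeZero.ne L)
    obtain ⟨h, rfl⟩ := hL
    omega
  obtain ⟨zp, hp, -⟩ := hw 0 ((L / 2 - 1 : ℕ) : ZMod L)
  obtain ⟨zc, hcc, -⟩ := hw 0 ((L / 2 : ℕ) : ZMod L)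
  have m0 : (0 : Torus L) ∈ ({x | (c x).val = 0} : Region L) := by simp [h0]
  have mp : zp ∈ ({x | (c x).val = L / 2 - 1} : Region L) := by
    simp only [mem_filter, mem_univ, true_and, hp, val_half_sub_one]
  refine ⟨?_, ⟨zc, ?_⟩, ⟨_, m0⟩, ⟨_, mp⟩, fun z hz w hw' => ?_, fun y => ?_⟩
  · simpa [h0] using hL2.2
  · simp only [mem_compl, mem_filter, mem_univ, true_and, hcc, val_half, lt_irrefl, not_false_iff]
  · simp only [mem_filter, mem_univ, true_and] at hz hw'
    obtain ⟨x, hx, hx'⟩ := hw z 0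
    obtain ⟨y, hy, hy'⟩ := hw z ((L / 2 - 1 : ℕ) : ZMod L)
    have h1 := (sdist_le (S := {x | (c x).val = 0}) (by simp [hx]) z).trans
      (hx'.le.trans (natAbs_valMinAbs_sub_le _ _))
    have h2 := (sdist_le (S := {x | (c x).val = L / 2 - 1})
      (by simp only [mem_filter, mem_univ, true_and, hy, val_half_sub_one]) z).trans
      (hy'.le.trans (natAbs_valMinAbs_sub_le _ _))
    rw [ZMod.val_zero] at h1
    rw [val_half_sub_one] at h2
    have h3 := hc z w
    rcases val_lt_of_lt_half hL hz hw' with h5 | h5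
    · left; omega
    · right; omega
  · obtain ⟨a, ha, ha'⟩ := exists_sdist ⟨_, m0⟩ y
    obtain ⟨b, hb, hb'⟩ := exists_sdist ⟨_, mp⟩ y
    simp only [mem_filter, mem_univ, true_and] at ha hb
    have h3 := gdist_triangle a y b
    rw [gdist_comm a y] at h3
    have h4 := hc a b
    have h5 := le_natAbs_of_val_eq hL ha hb
    omega

theorem isStrip_nu (hL : Even L) : IsStrip (nu L) (nuMinus L) (nuPlus L) :=
  isStrip_coord hL Prod.fst rfl (fun _ _ => Nat.le_add_right _ _) fun z a =>
    ⟨(a, z.2), rfl, by simp [gdist]⟩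

theorem isStrip_eta (hL : Even L) : IsStrip (eta L) (etaMinus L) (etaPlus L) :=
  isStrip_coord hL Prod.snd rfl (fun _ _ => Nat.le_add_left _ _) fun z a =>
    ⟨(z.1, a), rfl, by simp [gdist]⟩

end Geometry

/-! ### From local terms to fields; charge conservation -/

section LocalTerms

variable {L : ℕ} [NeZero L]

open Classical in
/-- A site of a nonempty set. -/
def anchor (X : Region L) : Torus L := if h : X.Nonempty then h.choose else 0

theorem anchor_mem {X : Region L} (h : X.Nonempty) : anchor X ∈ X := by
  rw [anchor, dif_pos h]; exact h.choose_spec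

theorem anchor_empty : anchor (∅ : Region L) = 0 := by simp [anchor]

/-- The sum of the terms attached to a site. -/
def gather (Ψ : Region L → Obs L) (x : Torus L) : Obs L := ∑ X with anchor X = x, Ψ X

theorem sum_gather (Ψ : Region L → Obs L) : ∑ x, gather Ψ x = ∑ X, Ψ X := sum_fiberwise _ _ _

theorem exists_of_gather_ne_zero {Ψ : Region L → Obs L} {x : Torus L} (h : gather Ψ x ≠ 0) :
    ∃ X, anchor X = x ∧ Ψ X ≠ 0 := by
  obtain ⟨X, hX, h⟩ := exists_ne_zero_of_sum_ne_zero h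
  exact ⟨X, (mem_filter.1 hX).2, h⟩

/-- Terms of range `R` and strength `m`, supported in the `R'`-fattenings. -/
structure TermBound (R R' : ℕ) (m : ℝ) (Ψ : Region L → Obs L) : Prop where
  mem : ∀ X, Ψ X ∈ evenAlgebra (fatten X R')
  range : ∀ X, Ψ X ≠ 0 → ∀ x ∈ X, ∀ y ∈ X, gdist x y ≤ R
  bdd : ∀ X, ‖Ψ X‖ ≤ m

theorem TermBound.nonneg {R R' : ℕ} {m : ℝ} {Ψ : Region L → Obs L}
    (h : TermBound R R' m Ψ) : 0 ≤ m := (norm_nonneg _).trans (h.bdd ∅)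

theorem TermBound.mask {R R' : ℕ} {m : ℝ} {Ψ : Region L → Obs L} (h : TermBound R R' m Ψ)
    (c : Region L → Prop) [DecidablePred c] :
    TermBound R R' m (fun X => if c X then Ψ X else 0) where
  mem X := by split_ifs; exacts [h.mem X, zero_mem _]
  range X := by split_ifs; exacts [h.range X, fun h => absurd rfl h]
  bdd X := by split_ifs; exacts [h.bdd X, by rw [norm_zero]; exact h.nonneg]

theorem TermBound.mask' {R R' : ℕ} {m : ℝ} {Ψ : Region L → Obs L} (h : TermBound R R' m Ψ)
    (c : Region L → Prop) [DecidablePred c] :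
    TermBound R R' m (fun X => if c X then 0 else Ψ X) := by
  refine ⟨fun X => ?_, fun X => ?_, fun X => ?_⟩
  · split_ifs; exacts [zero_mem _, h.mem X]
  · split_ifs; exacts [fun h => absurd rfl h, h.range X]
  · split_ifs; exacts [by rw [norm_zero]; exact h.nonneg, h.bdd X]

theorem subset_ball {X : Region L} {R : ℕ} (h : ∀ x ∈ X, ∀ y ∈ X, gdist x y ≤ R) :
    X ⊆ ball (anchor X) R := fun y hy => mem_ball.2 (h _ (anchor_mem ⟨y, hy⟩) y hy)

/-- Only subsets of the ball contribute, and their number is bounded independently of the size of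
the torus. -/
theorem norm_sum_le_of_subset_ball {x : Torus L} {R : ℕ} {m : ℝ} (hm : 0 ≤ m)
    {Ψ : Region L → Obs L} (hb : ∀ X, ‖Ψ X‖ ≤ m) (s : Finset (Region L))
    (hs : ∀ X ∈ s, Ψ X ≠ 0 → X ⊆ ball x R) : ‖∑ X ∈ s, Ψ X‖ ≤ 2 ^ (16 * (1 + R) ^ 4) * m := by
  classical
  rw [← sum_filter_ne_zero]
  refine (norm_sum_le _ _).trans ((sum_le_card_nsmul _ _ m fun X _ => hb X).trans ?_)
  rw [nsmul_eq_mul]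
  refine mul_mono_right ?_ hm
  have h1 : (s.filter fun X => Ψ X ≠ 0) ⊆ (ball x R).powerset := fun X hX => by
    rw [mem_filter] at hX
    exact mem_powerset.2 (hs X hX.1 hX.2)
  have h2 := card_le_card h1
  rw [card_powerset] at h2
  have h3 : (ball x R).card ≤ 16 * (1 + R) ^ 4 := by exact_mod_cast card_ball_le x R
  have h4 := h2.trans (Nat.pow_le_pow_right (by norm_num) h3)
  exact_mod_cast h4

theorem fatten_subset_ball {X : Region L} {R R' : ℕ}
    (h : ∀ x ∈ X, ∀ y ∈ X, gdist x y ≤ R) : fatten X R' ⊆ ball (anchor X) (R + R') := by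
  intro y hy
  obtain ⟨z, hz, hyz⟩ := mem_fatten.1 hy
  rw [mem_ball]
  have h1 := h _ (anchor_mem ⟨z, hz⟩) z hz
  have h2 := gdist_triangle (anchor X) z y
  rw [gdist_comm z y] at h2
  omega

theorem TermBound.gather_mem {R R' : ℕ} {m : ℝ} {Ψ : Region L → Obs L}
    (h : TermBound R R' m Ψ) (x : Torus L) : gather Ψ x ∈ evenAlgebra (ball x (R + R')) := by
  refine sum_mem fun X hX => ?_
  rw [mem_filter] at hX
  by_cases h0 : Ψ X = 0
  · rw [h0]; exact zero_mem _
  · rw [← hX.2]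
    exact evenAlgebra_mono (fatten_subset_ball (h.range X h0)) (h.mem X)

theorem TermBound.norm_gather_le {R R' : ℕ} {m : ℝ} {Ψ : Region L → Obs L}
    (h : TermBound R R' m Ψ) (x : Torus L) : ‖gather Ψ x‖ ≤ 2 ^ (16 * (1 + R) ^ 4) * m := by
  refine norm_sum_le_of_subset_ball (x := x) h.nonneg h.bdd _ fun X hX h0 => ?_
  rw [← (mem_filter.1 hX).2]
  exact subset_ball (h.range X h0)

theorem sfield_gather {ι : Type} {n : ι → ℕ} [∀ i, NeZero (n i)] {R R' : ℕ} {m : ℝ}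
    {Ψ : Terms n} (h : ∀ i, TermBound R R' m (Ψ i)) :
    SField (fun i => gather (Ψ i)) := by
  refine ⟨R + R', 2 ^ (16 * (1 + R) ^ 4) * |m|, by positivity, fun i x => ⟨(h i).gather_mem x, ?_⟩⟩
  have := (h i).norm_gather_le x
  rwa [abs_of_nonneg (h i).nonneg]

/-- The local terms of a charge and of a charge conserving Hamiltonian. -/
structure LocalSystem (Rq RΦ : ℕ) (mq mΦ : ℝ) (q Φ : Region L → Obs L) : Prop where
  charge_selfAdjoint : ∀ X, IsSelfAdjoint (q X)
  charge_mem : ∀ X, q X ∈ evenAlgebra X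
  charge_range : ∀ X, q X ≠ 0 → ∀ x ∈ X, ∀ y ∈ X, gdist x y ≤ Rq
  charge_bdd : ∀ X, ‖q X‖ ≤ mq
  integral : ∀ X, spectrum ℂ (q X) ⊆ Set.range fun n : ℤ => (n : ℂ)
  comm : ∀ X Y, Commute (q X) (q Y)
  selfAdjoint : ∀ X, IsSelfAdjoint (Φ X)
  mem : ∀ X, Φ X ∈ evenAlgebra X
  range : ∀ X, Φ X ≠ 0 → ∀ x ∈ X, ∀ y ∈ X, gdist x y ≤ RΦ
  bdd : ∀ X, ‖Φ X‖ ≤ mΦ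
  conserved : ∀ X, Commute (Φ X) (charge q univ)

theorem subset_fatten (X : Region L) (R : ℕ) : X ⊆ fatten X R := fun x hx =>
  mem_fatten.2 ⟨x, hx, by rw [gdist_self]; exact Nat.zero_le _⟩

theorem sum_selfAdjoint {ι : Type} {s : Finset ι} {f : ι → Obs L} (h : ∀ x ∈ s, IsSelfAdjoint (f x)) :
    IsSelfAdjoint (∑ x ∈ s, f x) := by
  rw [IsSelfAdjoint, star_sum]
  exact sum_congr rfl fun x hx => (h x hx).star_eq

open Classical in
/-- The part of the charge in `S` whose terms meet `X`. -/
def nearCharge (q : Region L → Obs L) (S X : Region L) : Obs L :=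
  ∑ Z ∈ S.powerset with (Z ∩ X).Nonempty, q Z

/-- The current terms `i[Q_S, Φ(X)]`. -/
def currentTerm (q Φ : Region L → Obs L) (S X : Region L) : Obs L := I • cm (charge q S) (Φ X)

namespace LocalSystem

variable {Rq RΦ : ℕ} {mq mΦ : ℝ} {q Φ : Region L → Obs L}
  {S lm lp : Region L} {r : ℕ}

local notation "System" => LocalSystem Rq RΦ mq mΦ q Φ

theorem isSelfAdjoint_charge (s : System) (S : Region L) : IsSelfAdjoint (charge q S) :=
  sum_selfAdjoint fun Z _ => s.charge_selfAdjoint Z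

theorem isSelfAdjoint_hamiltonian (s : System) : IsSelfAdjoint (hamiltonian Φ) :=
  sum_selfAdjoint fun Z _ => s.selfAdjoint Z

theorem charge_mem_univ (s : System) (S : Region L) : charge q S ∈ evenAlgebra univ :=
  sum_mem fun Z _ => evenAlgebra_mono (subset_univ _) (s.charge_mem Z)

theorem commute_charge (s : System) (S S' : Region L) : Commute (charge q S) (charge q S') :=
  Commute.sum_left _ _ _ fun _ _ => Commute.sum_right _ _ _ fun _ _ => s.comm _ _

/-- The terms of the charge commute, so the exponential factorizes, and each factor is 1 by
integrality of the spectrum. -/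
theorem expI_charge (s : System) (S : Region L) : expI (2 * π) (charge q S) = 1 := by
  classical
  have : ∀ t : Finset (Region L), expI (2 * π) (∑ Z ∈ t, q Z) = 1 := fun t => by
    induction t using Finset.induction_on with
    | empty => simp [expI]
    | insert Z t hZ ih =>
      rw [sum_insert hZ, expI_add_of_commute _ (Commute.sum_right _ _ _ fun _ _ => s.comm _ _),
        ih, expI_two_pi_of_integral (s.charge_selfAdjoint Z) (s.integral Z), one_mul]
  exact this _

theorem exists_farCharge (s : System) (S X : Region L) : ∃ F, charge q S = nearCharge q S X + F ∧
    Commute (Φ X) F ∧ Commute (nearCharge q S X) F := by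
  classical
  refine ⟨∑ Z ∈ S.powerset with ¬(Z ∩ X).Nonempty, q Z, ?_, ?_, ?_⟩
  · rw [charge, nearCharge]
    exact (sum_filter_add_sum_filter_not _ _ _).symm
  · refine Commute.sum_right _ _ _ fun Z hZ => commute_of_disjoint (s.mem X) (s.charge_mem Z) ?_
    rw [disjoint_comm, disjoint_iff_inter_eq_empty, ← not_nonempty_iff_eq_empty]
    exact (mem_filter.1 hZ).2
  · exact Commute.sum_left _ _ _ fun _ _ => Commute.sum_right _ _ _ fun _ _ => s.comm _ _

theorem cm_charge (s : System) (S X : Region L) :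
    cm (charge q S) (Φ X) = cm (nearCharge q S X) (Φ X) := by
  obtain ⟨F, h1, h2, -⟩ := s.exists_farCharge S X
  rw [h1, add_cm, cm_eq_zero.2 h2.symm, add_zero]

/-- The charge away from $X$ commutes with everything involved and cancels in the conjugation. Gauge
transformed terms therefore remain strictly local. -/
theorem conjExp_charge (s : System) (S X : Region L) {A : Obs L} (t : ℝ)
    (hA : ∀ F, Commute (Φ X) F → Commute (nearCharge q S X) F → Commute A F) :
    conjExp t (charge q S) A = conjExp t (nearCharge q S X) A := by
  obtain ⟨F, h1, h2, h3⟩ := s.exists_farCharge S X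
  rw [h1, conjExp, expI_add_of_commute _ h3, expI_add_of_commute _ h3]
  have hc := hA F h2 h3
  have e1 : expI t F * A * expI (-t) F = A := conjExp_of_commute t hc
  have c1 : Commute (expI t (nearCharge q S X)) (expI t F) :=
    (Commute.expI_right (Commute.expI_right h3 t).symm t).symm
  have c2 : Commute (expI (-t) (nearCharge q S X)) (expI (-t) F) :=
    (Commute.expI_right (Commute.expI_right h3 _).symm _).symm
  rw [c2.eq]
  simp only [mul_assoc] at e1 ⊢
  rw [← mul_assoc A, ← mul_assoc (expI t F), ← mul_assoc (expI t F)]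
  simp only [mul_assoc] at e1 ⊢
  rw [conjExp]
  have : expI t F * (A * (expI (-t) F * expI (-t) (nearCharge q S X))) =
      A * expI (-t) (nearCharge q S X) := by
    rw [← mul_assoc A, ← mul_assoc (expI t F), e1]
  rw [this, mul_assoc]

theorem nearCharge_mem (s : System)
    (S X : Region L) : nearCharge q S X ∈ evenAlgebra (fatten X Rq) := by
  classical
  refine sum_mem fun Z hZ => ?_
  by_cases h0 : q Z = 0
  · rw [h0]; exact zero_mem _
  · refine evenAlgebra_mono (fun y hy => ?_) (s.charge_mem Z)
    obtain ⟨z, hz⟩ := (mem_filter.1 hZ).2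
    rw [mem_inter] at hz
    exact mem_fatten.2 ⟨z, hz.2, s.charge_range Z h0 y hy z hz.1⟩

theorem mem_fatten_term (s : System) (X : Region L) (R : ℕ) : Φ X ∈ evenAlgebra (fatten X R) :=
  evenAlgebra_mono (subset_fatten X R) (s.mem X)

theorem norm_nearCharge_le (s : System) {X : Region L} (S : Region L)
    (hX : ∀ x ∈ X, ∀ y ∈ X, gdist x y ≤ RΦ) :
    ‖nearCharge q S X‖ ≤ 2 ^ (16 * (1 + (RΦ + Rq)) ^ 4) * mq := by
  classical
  refine norm_sum_le_of_subset_ball (x := anchor X) ((norm_nonneg _).trans (s.charge_bdd ∅))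
    s.charge_bdd _ fun Z hZ h0 y hy => ?_
  obtain ⟨z, hz⟩ := (mem_filter.1 hZ).2
  rw [mem_inter] at hz
  rw [mem_ball]
  have h1 := hX _ (anchor_mem ⟨z, hz.2⟩) z hz.2
  have h2 := s.charge_range Z h0 z hz.1 y hy
  have h3 := gdist_triangle (anchor X) z y
  omega

theorem termBound (s : System)
    : TermBound RΦ 0 mΦ Φ := ⟨fun X => s.mem_fatten_term X 0, s.range, s.bdd⟩

theorem termBound_charge (s : System) : TermBound Rq 0 mq q :=
  ⟨fun X => evenAlgebra_mono (subset_fatten X 0) (s.charge_mem X), s.charge_range, s.charge_bdd⟩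

theorem termBound_currentTerm (s : System) (S : Region L) :
    TermBound RΦ Rq (2 * (2 ^ (16 * (1 + (RΦ + Rq)) ^ 4) * mq) * mΦ) (currentTerm q Φ S) := by
  have hmq := (norm_nonneg _).trans (s.charge_bdd ∅)
  have hmΦ := (norm_nonneg _).trans (s.bdd ∅)
  have h0 : ∀ X, currentTerm q Φ S X ≠ 0 → Φ X ≠ 0 := fun X h h0 => h (by
    rw [currentTerm, h0, cm_zero, smul_zero])
  refine ⟨fun X => ?_, fun X h => s.range X (h0 X h), fun X => ?_⟩
  · rw [currentTerm, s.cm_charge]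
    exact Subalgebra.smul_mem _ (sub_mem (mul_mem (s.nearCharge_mem S X) (s.mem_fatten_term X _))
      (mul_mem (s.mem_fatten_term X _) (s.nearCharge_mem S X))) _
  · by_cases h : currentTerm q Φ S X = 0
    · rw [h, norm_zero]; positivity
    · rw [currentTerm, norm_smul, norm_I, one_mul, s.cm_charge]
      refine (norm_cm_le _ _).trans ?_
      have h1 := s.norm_nearCharge_le S (s.range X (h0 X h))
      have h2 := s.bdd X
      have h3 : (0 : ℝ) ≤ 2 ^ (16 * (1 + (RΦ + Rq)) ^ 4) * mq := by positivity
      gcongr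

theorem termBound_conj (s : System) {Ψ : Region L → Obs L} {m : ℝ} (h : TermBound RΦ Rq m Ψ)
    (S : Region L) (t : ℝ)
    (hA : ∀ X F, Commute (Φ X) F → Commute (nearCharge q S X) F → Commute (Ψ X) F) :
    TermBound RΦ Rq m (fun X => conjExp t (charge q S) (Ψ X)) := by
  refine ⟨fun X => ?_, fun X h1 => h.range X fun h0 => h1 ?_, fun X =>
    (norm_conjExp_le t (s.isSelfAdjoint_charge S) _).trans (h.bdd X)⟩
  · rw [s.conjExp_charge S X t (hA X)]
    exact conjExp_mem (s.nearCharge_mem S X) (h.mem X) t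
  · rw [h0]; simp [conjExp]

theorem termBound_conj_term (s : System) (S : Region L) (t : ℝ) :
    TermBound RΦ Rq mΦ (fun X => conjExp t (charge q S) (Φ X)) :=
  s.termBound_conj ⟨fun X => s.mem_fatten_term X _, s.range, s.bdd⟩ S t fun _ _ h _ => h

theorem termBound_conj_currentTerm (s : System) (S : Region L) (t : ℝ) :
    TermBound RΦ Rq (2 * (2 ^ (16 * (1 + (RΦ + Rq)) ^ 4) * mq) * mΦ)
      (fun X => conjExp t (charge q S) (currentTerm q Φ S X)) := by
  refine s.termBound_conj (s.termBound_currentTerm S) S t fun X F h1 h2 => ?_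
  rw [currentTerm, s.cm_charge]
  exact ((h2.mul_left h1).sub_left (h1.mul_left h2)).smul_left _

/-- A term far from the lower line with a nonvanishing current is close to the upper line. -/
theorem near_plus_of_ne_zero (s : System)
    (hS : IsStrip S lm lp) (hr : RΦ + Rq ≤ r + 1) {X : Region L}
    (h : currentTerm q Φ S X ≠ 0) (hX : ¬(X ∩ fatten lm r).Nonempty) :
    X.Nonempty ∧ ∀ x ∈ X, sdist lp x ≤ r + RΦ := by
  classical
  have hΦ : Φ X ≠ 0 := fun h0 => h (by rw [currentTerm, h0, cm_zero, smul_zero])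
  have h1 : cm (charge q S) (Φ X) ≠ 0 := fun h0 => h (by rw [currentTerm, h0, smul_zero])
  obtain ⟨z, hzX, hzS⟩ : ∃ z ∈ X, z ∈ S := by
    rw [s.cm_charge] at h1
    have : nearCharge q S X ≠ 0 := fun h0 => h1 (by rw [h0, zero_cm])
    obtain ⟨Z, hZ, -⟩ := exists_ne_zero_of_sum_ne_zero this
    rw [mem_filter, mem_powerset] at hZ
    obtain ⟨z, hz⟩ := hZ.2
    rw [mem_inter] at hz
    exact ⟨z, hz.2, hZ.1 hz.1⟩
  -- Otherwise every charge term meeting $X$ lies inside the strip, the current equals the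
  -- commutator with the total charge, and conservation makes it vanish.
  obtain ⟨w, hwS, x', hx', hw⟩ : ∃ w ∉ S, ∃ x' ∈ X, gdist x' w ≤ Rq := by
    by_contra! hc
    apply h1
    have hu : cm (nearCharge q univ X) (Φ X) = 0 := by
      rw [← s.cm_charge]; exact cm_eq_zero.2 (s.conserved X).symm
    have he : nearCharge q univ X = nearCharge q S X := by
      refine (sum_subset (fun Z hZ => ?_) fun Z hZ hZ' => ?_).symm
      · rw [mem_filter] at hZ ⊢
        exact ⟨by simp, hZ.2⟩
      · by_contra h0
        rw [mem_filter] at hZ hZ'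
        apply hZ'
        refine ⟨mem_powerset.2 fun y hy => ?_, hZ.2⟩
        obtain ⟨x', hx'⟩ := hZ.2
        rw [mem_inter] at hx'
        by_contra hyS
        exact absurd (s.charge_range Z h0 x' hx'.1 y hy) (not_le.2 (hc y hyS x' hx'.2))
    rw [s.cm_charge, ← he, hu]
  have hd := s.range X hΦ
  refine ⟨⟨z, hzX⟩, fun x hx => ?_⟩
  have h2 := hd z hzX x' hx'
  have h3 := gdist_triangle z x' w
  have h4 := hd x hx z hzX
  -- The two points are at distance at most $R_\Phi+R_q\le r+1$. Since the edge inequality is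
  -- strict, the first case puts $z$ within distance $r$ of the lower line, contrary to the
  -- assumption on $X$. This accounts for the condition $r\ge R_\Phi+R_q-1$.
  rcases hS.edge z hzS w hwS with h5 | h5
  · exfalso
    apply hX
    refine ⟨z, mem_inter.2 ⟨hzX, (mem_fatten_iff hS.minus_nonempty).2 (by omega)⟩⟩
  · have := isLip_sdist lp x z
    omega

theorem near_minus (hlm : lm.Nonempty) {X : Region L}
    (hd : ∀ x ∈ X, ∀ y ∈ X, gdist x y ≤ RΦ) (hX : (X ∩ fatten lm r).Nonempty) {x : Torus L}
    (hx : x ∈ X) : sdist lm x ≤ r + RΦ := by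
  classical
  obtain ⟨z, hz⟩ := hX
  rw [mem_inter, mem_fatten_iff hlm] at hz
  have h1 := hd x hx z hz.1
  have h2 := isLip_sdist lm x z
  omega

end LocalSystem

end LocalTerms

/-! ### The twist Hamiltonian in the rotating frame -/

section

open MeasureTheory

section Twist

variable {L : ℕ} [NeZero L] (q Φ : Region L → Obs L) (S l : Region L) (r : ℕ)

open Classical in
/-- The current terms close to the line `l`. -/
def minusCurrentTerm (X : Region L) : Obs L :=
  if (X ∩ fatten l r).Nonempty then currentTerm q Φ S X else 0

open Classical in
/-- The gauge transformed current terms away from the line `l`. -/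
def plusCurrentTerm (t : ℝ) (X : Region L) : Obs L :=
  if (X ∩ fatten l r).Nonempty then 0 else conjExp t (charge q S) (currentTerm q Φ S X)

open Classical in
/-- The changes of the terms away from the line `l` under a gauge transformation. -/
def plusTwistTerm (t : ℝ) (X : Region L) : Obs L :=
  if (X ∩ fatten l r).Nonempty then 0 else conjExp t (charge q S) (Φ X) - Φ X

/-- The current across the line `l`. -/
def minusCurrent : Obs L := ∑ X, minusCurrentTerm q Φ S l r X

/-- The gauge transformed current across the other boundary of `S`. -/
def plusCurrent (t : ℝ) : Obs L := ∑ X, plusCurrentTerm q Φ S l r t X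

notation:max "minusGen" W:max q:max Φ:max S:max l:max r:max =>
  quasiAdiabatic W (hamiltonian Φ) (minusCurrent q Φ S l r)
notation:max "plusGen" W:max q:max Φ:max S:max l:max r:max =>
  quasiAdiabatic W (hamiltonian Φ) (plusCurrent q Φ S l r 0)

/-- The Hamiltonian with the terms away from `l` gauge transformed. -/
def plusTwist (t : ℝ) : Obs L := hamiltonian Φ + ∑ X, plusTwistTerm q Φ S l r t X

theorem plusTwist_eq (t : ℝ) : plusTwist q Φ S l r t = ∑ X, (Φ X + plusTwistTerm q Φ S l r t X) := by
  rw [plusTwist, hamiltonian, sum_add_distrib]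

/-- Undoing the gauge transformation everywhere restores the terms near the line and moves the
twist, with the opposite sign, to the other terms, where it acts only near the other edge of the
strip. -/
theorem twistHamiltonian_eq (θ : ℝ) : twistHamiltonian q Φ S l r θ =
    conjExp θ (charge q S) (plusTwist q Φ S l r (-θ)) := by
  rw [plusTwist_eq, conjExp_sum]
  refine sum_congr rfl fun X _ => ?_
  rw [twistTerm, plusTwistTerm]
  split_ifs
  · rw [add_zero]
  · rw [add_sub_cancel, conjExp_conjExp, add_neg_cancel, conjExp_zero_time]

theorem plusTwist_zero : plusTwist q Φ S l r 0 = hamiltonian Φ := by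
  rw [plusTwist, add_eq_left]
  refine sum_eq_zero fun X _ => ?_
  rw [plusTwistTerm, conjExp_zero_time, sub_self, ite_self]

theorem hasDerivAt_twistHamiltonian (θ : ℝ) : HasDerivAt (twistHamiltonian q Φ S l r)
    (conjExp θ (charge q S) (minusCurrent q Φ S l r)) θ := by
  have h : ∀ X, HasDerivAt (fun θ => twistTerm q Φ S l r θ X)
      (conjExp θ (charge q S) (minusCurrentTerm q Φ S l r X)) θ := fun X => by
    unfold twistTerm minusCurrentTerm
    split_ifs
    · exact hasDerivAt_conjExp θ (charge q S) (Φ X)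
    · simpa [conjExp] using hasDerivAt_const θ (Φ X)
  have := HasDerivAt.sum (u := univ) fun X _ => h X
  rw [minusCurrent, conjExp_sum]
  refine this.congr_of_eventuallyEq (.of_forall fun θ => ?_)
  simp [twistHamiltonian]

theorem current_eq : current q Φ S l r = minusCurrent q Φ S l r := by
  rw [current, (hasDerivAt_twistHamiltonian q Φ S l r 0).deriv, conjExp_zero_time]

theorem hasDerivAt_plusTwist (t : ℝ) :
    HasDerivAt (plusTwist q Φ S l r) (plusCurrent q Φ S l r t) t := by
  have h : ∀ X, HasDerivAt (fun t => plusTwistTerm q Φ S l r t X)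
      (plusCurrentTerm q Φ S l r t X) t := fun X => by
    unfold plusTwistTerm plusCurrentTerm
    split_ifs
    · exact hasDerivAt_const t _
    · exact (hasDerivAt_conjExp t (charge q S) (Φ X)).sub_const _
  have := (HasDerivAt.sum (u := univ) fun X _ => h X).const_add (hamiltonian Φ)
  refine this.congr_of_eventuallyEq (.of_forall fun t => ?_)
  simp [plusTwist]

/-- The total current out of the strip splits into the two edges. The current at the lower line does
not depend on the flux in this frame. -/
theorem cm_charge_plusTwist (t : ℝ) : I • cm (charge q S) (plusTwist q Φ S l r t) =
    minusCurrent q Φ S l r + plusCurrent q Φ S l r t := by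
  rw [plusTwist_eq, cm_sum, smul_sum, minusCurrent, plusCurrent, ← sum_add_distrib]
  refine sum_congr rfl fun X _ => ?_
  rw [plusTwistTerm, minusCurrentTerm, plusCurrentTerm]
  split_ifs
  · rw [add_zero, add_zero, currentTerm]
  · rw [add_sub_cancel, zero_add, cm_conjExp_self, ← conjExp_smul, currentTerm]

theorem cm_charge_hamiltonian : I • cm (charge q S) (hamiltonian Φ) =
    minusCurrent q Φ S l r + plusCurrent q Φ S l r 0 := by
  rw [← cm_charge_plusTwist, plusTwist_zero]

theorem twistAntitwistGenMinus_zero (W : ℝ → ℝ) : twistAntitwistGenMinus q Φ S l r W 0 =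
    minusGen W q Φ S l r := by
  rw [twistAntitwistGenMinus, twistAntitwist, conjExp_zero_time]
  congr 1
  rw [twistAntitwistDerivMinus, minusCurrent, sum_filter]
  refine sum_congr rfl fun X _ => ?_
  rw [minusCurrentTerm]
  split_ifs
  · rw [(hasDerivAt_conjExp 0 (charge q S) (Φ X)).deriv, conjExp_zero_time, currentTerm]
  · rfl

variable {q Φ S l r} {Rq RΦ : ℕ} {mq mΦ : ℝ}

local notation "System" => LocalSystem Rq RΦ mq mΦ q Φ

namespace LocalSystem

theorem isSelfAdjoint_currentTerm (s : System) (X : Region L) :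
    IsSelfAdjoint (currentTerm q Φ S X) :=
  isSelfAdjoint_I_smul_cm (s.isSelfAdjoint_charge S) (s.selfAdjoint X)

theorem isSelfAdjoint_minusCurrent (s : System) : IsSelfAdjoint (minusCurrent q Φ S l r) := by
  refine sum_selfAdjoint fun X _ => ?_
  rw [minusCurrentTerm]
  split_ifs
  exacts [s.isSelfAdjoint_currentTerm X, IsSelfAdjoint.zero _]

theorem isSelfAdjoint_plusCurrent (s : System) (t : ℝ) :
    IsSelfAdjoint (plusCurrent q Φ S l r t) := by
  refine sum_selfAdjoint fun X _ => ?_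
  rw [plusCurrentTerm]
  split_ifs
  exacts [IsSelfAdjoint.zero _,
    isSelfAdjoint_conjExp t (s.isSelfAdjoint_charge S) (s.isSelfAdjoint_currentTerm X)]

theorem isSelfAdjoint_sum_plusTwistTerm (s : System) (t : ℝ) :
    IsSelfAdjoint (∑ X, plusTwistTerm q Φ S l r t X) := by
  refine sum_selfAdjoint fun X _ => ?_
  rw [plusTwistTerm]
  split_ifs
  exacts [IsSelfAdjoint.zero _,
    (isSelfAdjoint_conjExp t (s.isSelfAdjoint_charge S) (s.selfAdjoint X)).sub (s.selfAdjoint X)]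

theorem isSelfAdjoint_plusTwist (s : System) (t : ℝ) : IsSelfAdjoint (plusTwist q Φ S l r t) :=
  s.isSelfAdjoint_hamiltonian.add (s.isSelfAdjoint_sum_plusTwistTerm t)

theorem conjExp_two_pi (s : System) (S : Region L) (A : Obs L) :
    conjExp (-(2 * π)) (charge q S) A = A := by
  have h := s.expI_charge S
  have h' := expI_mul_neg_self (2 * π) (charge q S)
  rw [h, one_mul] at h'
  rw [conjExp, neg_neg, h, h', one_mul, mul_one]

theorem plusTwist_two_pi (s : System) : plusTwist q Φ S l r (-(2 * π)) = hamiltonian Φ := by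
  rw [plusTwist, add_eq_left]
  refine sum_eq_zero fun X _ => ?_
  rw [plusTwistTerm, s.conjExp_two_pi, sub_self, ite_self]

/-- The filter is covariant under conjugation, so the driving enters only through the speed, the
rotation of the frame and the twist at the far edge. -/
theorem parallelGen_eq (s : System) {W φ : ℝ → ℝ} (hW : Integrable W) {x : ℝ}
    (hφ : DifferentiableAt ℝ φ x) : parallelGen q Φ S l r W φ x =
      ((deriv φ x : ℝ) : ℂ) • conjExp (φ x) (charge q S)
        (quasiAdiabatic W (plusTwist q Φ S l r (-φ x)) (minusCurrent q Φ S l r)) := by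
  have h := (hasDerivAt_twistHamiltonian q Φ S l r (φ x)).scomp x hφ.hasDerivAt
  rw [parallelGen]
  have e : deriv (fun t => twistHamiltonian q Φ S l r (φ t)) x =
      ((deriv φ x : ℝ) : ℂ) • conjExp (φ x) (charge q S) (minusCurrent q Φ S l r) := by
    rw [← Complex.coe_smul] at h
    exact h.deriv
  rw [e, quasiAdiabatic_smul, twistHamiltonian_eq, conjExp_quasiAdiabatic hW
    (s.isSelfAdjoint_plusTwist _)]

theorem commute_charge_univ (s : System) : Commute (charge q univ) (hamiltonian Φ) :=
  Commute.sum_right _ _ _ fun X _ => (s.conserved X).symm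

theorem commute_charge_univ_gather (s : System) (x : Torus L) :
    Commute (charge q univ) (gather (minusCurrentTerm q Φ S l r) x) := by
  refine Commute.sum_right _ _ _ fun X _ => ?_
  rw [minusCurrentTerm]
  split_ifs
  · have h1 := s.commute_charge univ S
    have h2 := (s.conserved X).symm
    exact ((h1.mul_right h2).sub_right (h2.mul_right h1)).smul_right _
  · exact Commute.zero_right _

end LocalSystem

end Twist

/-! ### The quasi-adiabatic generators of the edge currents as fields -/

section Fields

variable {ι : Type} {n : ι → ℕ} [∀ i, NeZero (n i)] {Rq RΦ r : ℕ} {mq mΦ γ : ℝ} {W : ℝ → ℝ}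
  {q Φ : Terms n} {S lm lp : Regions n}

/-- A family of local systems with uniform bounds. -/
abbrev LocalSystems (Rq RΦ : ℕ) (mq mΦ : ℝ) (q Φ : Terms n) : Prop :=
  ∀ i, LocalSystem Rq RΦ mq mΦ (q i) (Φ i)

/-- A family of strips with their boundary lines. -/
abbrev IsStrips (S lm lp : Regions n) : Prop := ∀ i, IsStrip (S i) (lm i) (lp i)

/-- The twisted Hamiltonians are gapped, uniformly in the flux. -/
abbrev IsFluxGapped (γ : ℝ) (p : ℕ) (q Φ : Terms n)
    (S lm : Regions n) (r : ℕ) : Prop :=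
  ∀ i, ∀ t ∈ Set.Icc 0 (2 * π), IsGapped γ p (plusTwist (q i) (Φ i) (S i) (lm i) r (-t))

theorem IsFluxGapped.gapped {p : ℕ} (hg : IsFluxGapped γ p q Φ S lm r) (i : ι) :
    IsGapped γ p (hamiltonian (Φ i)) := by
  have := hg i 0 ⟨le_rfl, Real.two_pi_pos.le⟩
  rwa [neg_zero, plusTwist_zero] at this

local notation "Systems" => LocalSystems Rq RΦ mq mΦ q Φ

theorem hamiltonian_eq_sum {L : ℕ} [NeZero L] (Φ : Region L → Obs L) :
    hamiltonian Φ = ∑ x, gather Φ x := (sum_gather Φ).symm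

theorem sfield_hamiltonian (s : Systems) :
    SField (fun i => gather (Φ i)) := sfield_gather fun i => (s i).termBound

theorem sfield_minusCurrent (s : Systems) :
    SField (fun i => gather (minusCurrentTerm (q i) (Φ i) (S i) (lm i) r)) :=
  sfield_gather fun i => ((s i).termBound_currentTerm (S i)).mask fun X => (X ∩ fatten (lm i) r).Nonempty

theorem sfield_plusCurrent (s : Systems) (t : ι → ℝ) :
    SField (fun i => gather (plusCurrentTerm (q i) (Φ i) (S i) (lm i) r (t i))) :=
  sfield_gather fun i => ((s i).termBound_conj_currentTerm (S i) (t i)).mask'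
    fun X => (X ∩ fatten (lm i) r).Nonempty

theorem sfield_plusTwist (s : Systems) (t : ι → ℝ) :
    SField (fun i => gather (plusTwistTerm (q i) (Φ i) (S i) (lm i) r (t i))) := by
  refine sfield_gather (R := RΦ) (R' := Rq) (m := mΦ + mΦ) fun i =>
    TermBound.mask' (Ψ := fun X => conjExp (t i) (charge (q i) (S i)) (Φ i X) - Φ i X) ?_
      fun X => (X ∩ fatten (lm i) r).Nonempty
  have h := (s i).termBound_conj_term (S i) (t i)
  refine ⟨fun X => sub_mem (h.mem X) ((s i).mem_fatten_term X _), fun X h0 => (s i).range X fun h1 =>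
    h0 ?_, fun X => (norm_sub_le _ _).trans (add_le_add (h.bdd X) ((s i).bdd X))⟩
  rw [h1]; simp [conjExp]

theorem sfield_charge (s : Systems) :
    SField (fun i => gather (fun X => if X ⊆ S i then q i X else 0)) :=
  sfield_gather fun i => (s i).termBound_charge.mask fun X => X ⊆ S i

theorem sfield_charge_compl (s : Systems) :
    SField (fun i => gather (fun X => if X ⊆ S i then 0 else q i X)) :=
  sfield_gather fun i => (s i).termBound_charge.mask' fun X => X ⊆ S i

theorem sum_gather_charge {L : ℕ} [NeZero L] (q : Region L → Obs L) (S : Region L) :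
    ∑ x, gather (fun X => if X ⊆ S then q X else 0) x = charge q S := by
  rw [sum_gather, charge, ← sum_filter]
  congr 1; ext X; simp

theorem sum_gather_charge_compl {L : ℕ} [NeZero L] (q : Region L → Obs L)
    (S : Region L) : ∑ x, gather (fun X => if X ⊆ S then 0 else q X) x =
      charge q univ - charge q S := by
  have h : charge q univ = ∑ X, q X := by rw [charge, powerset_univ]
  rw [h, ← sum_gather_charge q S, sum_gather, sum_gather, ← sum_sub_distrib]
  refine sum_congr rfl fun X _ => ?_
  split_ifs <;> simp

theorem support_minusCurrent (s : Systems) (hS : IsStrips S lm lp) : ∃ c, ∀ i x,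
      gather (minusCurrentTerm (q i) (Φ i) (S i) (lm i) r) x ≠ 0 → sdist (lm i) x ≤ c := by
  refine ⟨r + RΦ, fun i x hx => ?_⟩
  obtain ⟨X, rfl, hX⟩ := exists_of_gather_ne_zero hx
  rw [minusCurrentTerm] at hX
  split_ifs at hX with h
  · have hne : X.Nonempty := h.mono inter_subset_left
    exact LocalSystem.near_minus (hS i).minus_nonempty
      (((s i).termBound_currentTerm (S i)).range X hX) h (anchor_mem hne)
  · exact absurd rfl hX

theorem support_plusCurrent (s : Systems)
    (hS : IsStrips S lm lp) (hr : RΦ + Rq ≤ r + 1) (t : ι → ℝ) : ∃ c, ∀ i x,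
      gather (plusCurrentTerm (q i) (Φ i) (S i) (lm i) r (t i)) x ≠ 0 → sdist (lp i) x ≤ c := by
  refine ⟨r + RΦ, fun i x hx => ?_⟩
  obtain ⟨X, rfl, hX⟩ := exists_of_gather_ne_zero hx
  rw [plusCurrentTerm] at hX
  split_ifs at hX with h
  · exact absurd rfl hX
  · obtain ⟨h1, h2⟩ := (s i).near_plus_of_ne_zero (hS i) hr (X := X) (fun h0 => hX (by
      rw [h0]; simp [conjExp])) h
    exact h2 _ (anchor_mem h1)

theorem support_plusTwist (s : Systems)
    (hS : IsStrips S lm lp) (hr : RΦ + Rq ≤ r + 1) (t : ι → ℝ) : ∃ c, ∀ i x,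
      gather (plusTwistTerm (q i) (Φ i) (S i) (lm i) r (t i)) x ≠ 0 → sdist (lp i) x ≤ c := by
  refine ⟨r + RΦ, fun i x hx => ?_⟩
  obtain ⟨X, rfl, hX⟩ := exists_of_gather_ne_zero hx
  rw [plusTwistTerm] at hX
  split_ifs at hX with h
  · exact absurd rfl hX
  · obtain ⟨h1, h2⟩ := (s i).near_plus_of_ne_zero (hS i) hr (X := X) (fun h0 => hX (by
      rw [currentTerm, smul_eq_zero_iff_right I_ne_zero, cm_eq_zero] at h0
      rw [conjExp_of_commute _ h0.symm, sub_self])) h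
    exact h2 _ (anchor_mem h1)

theorem support_charge (h0 : ∀ i, (0 : Torus (n i)) ∈ S i) : ∃ c, ∀ i x,
    gather (fun X => if X ⊆ S i then q i X else 0) x ≠ 0 → sdist (S i) x ≤ c := by
  refine ⟨0, fun i x hx => ?_⟩
  obtain ⟨X, rfl, hX⟩ := exists_of_gather_ne_zero hx
  split_ifs at hX with h
  · rcases X.eq_empty_or_nonempty with rfl | hne
    -- The term of the empty set is attached to the origin by convention, which is why a strip is
    -- required to contain it.
    · rw [anchor_empty, sdist_eq_zero (h0 i)]
    · exact (sdist_eq_zero (h (anchor_mem hne))).le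
  · exact absurd rfl hX

theorem support_charge_compl (s : Systems) : ∃ c, ∀ i x,
    gather (fun X => if X ⊆ S i then 0 else q i X) x ≠ 0 → sdist (S i)ᶜ x ≤ c := by
  refine ⟨Rq, fun i x hx => ?_⟩
  obtain ⟨X, rfl, hX⟩ := exists_of_gather_ne_zero hx
  split_ifs at hX with h
  · exact absurd rfl hX
  · obtain ⟨y, hy, hyS⟩ := not_subset.1 h
    refine (sdist_le (mem_compl.2 hyS) _).trans ?_
    exact (s i).charge_range X hX _ (anchor_mem ⟨y, hy⟩) y hy

/-- The quasi-adiabatic generator of the current, as a field. -/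
def minusGenField (W : ℝ → ℝ) (q Φ : Terms n)
    (S lm : Regions n) (r : ℕ) (i : ι) (x : Torus (n i)) : Obs (n i) :=
  quasiAdiabatic W (hamiltonian (Φ i)) (gather (minusCurrentTerm (q i) (Φ i) (S i) (lm i) r) x)

theorem qfield_minusGen (hW : IsFilterFunction γ W)
    (s : Systems) : QField (minusGenField W q Φ S lm r) := by
  have := SField.qfield_quasiAdiabatic hW (sfield_hamiltonian s)
    (fun i => by rw [← hamiltonian_eq_sum]; exact (s i).isSelfAdjoint_hamiltonian)
    (sfield_minusCurrent (S := S) (lm := lm) (r := r) s)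
  simp only [← hamiltonian_eq_sum] at this
  exact this

theorem sum_minusGenField (hW : IsFilterFunction γ W)
    (s : Systems) (i : ι) : ∑ x, minusGenField W q Φ S lm r i x =
      minusGen W (q i) (Φ i) (S i) (lm i) r := by
  rw [minusCurrent, ← sum_gather, quasiAdiabatic_sum hW.integrable (s i).isSelfAdjoint_hamiltonian]
  rfl

theorem support_minusGen (s : Systems) (hS : IsStrips S lm lp) : ∃ c, ∀ i x,
      minusGenField W q Φ S lm r i x ≠ 0 → sdist (lm i) x ≤ c := by
  obtain ⟨c, hc⟩ := support_minusCurrent (r := r) s hS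
  refine ⟨c, fun i x hx => hc i x fun h0 => hx ?_⟩
  rw [minusGenField, h0, quasiAdiabatic_zero]

/-- The quasi-adiabatic generator of the current across the upper line, as a field. -/
def plusGenField (W : ℝ → ℝ) (q Φ : Terms n)
    (S lm : Regions n) (r : ℕ) (t : ι → ℝ) (i : ι) (x : Torus (n i)) : Obs (n i) :=
  quasiAdiabatic W (plusTwist (q i) (Φ i) (S i) (lm i) r (t i))
    (gather (plusCurrentTerm (q i) (Φ i) (S i) (lm i) r (t i)) x)

theorem plusTwist_eq_sum {L : ℕ} [NeZero L] (q Φ : Region L → Obs L)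
    (S l : Region L) (r : ℕ) (t : ℝ) : plusTwist q Φ S l r t =
      ∑ x, (gather Φ x + gather (plusTwistTerm q Φ S l r t) x) := by
  rw [sum_add_distrib, sum_gather, sum_gather]; rfl

theorem sfield_plusTwist_total (s : Systems) (t : ι → ℝ) : SField (fun i x => gather (Φ i) x +
      gather (plusTwistTerm (q i) (Φ i) (S i) (lm i) r (t i)) x) := by
  have h0 : SField (fun i (_ : Torus (n i)) => (0 : Obs (n i))) :=
    ⟨0, 0, le_rfl, fun i x => ⟨zero_mem _, by simp⟩⟩
  simpa using (sfield_hamiltonian s).sub (h0.sub (sfield_plusTwist (S := S) (lm := lm) (r := r) s t))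

theorem qfield_plusGen (hW : IsFilterFunction γ W) (s : Systems) (t : ι → ℝ) :
    QField (plusGenField W q Φ S lm r t) := by
  have := SField.qfield_quasiAdiabatic hW (sfield_plusTwist_total (S := S) (lm := lm) (r := r) s t)
    (fun i => by rw [← plusTwist_eq_sum]; exact (s i).isSelfAdjoint_plusTwist _)
    (sfield_plusCurrent (S := S) (lm := lm) (r := r) s t)
  simp only [← plusTwist_eq_sum] at this
  exact this

theorem sum_plusGenField (hW : IsFilterFunction γ W) (s : Systems) (t : ι → ℝ) (i : ι) :
    ∑ x, plusGenField W q Φ S lm r t i x =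
      quasiAdiabatic W (plusTwist (q i) (Φ i) (S i) (lm i) r (t i))
        (plusCurrent (q i) (Φ i) (S i) (lm i) r (t i)) := by
  rw [plusCurrent, ← sum_gather, quasiAdiabatic_sum hW.integrable ((s i).isSelfAdjoint_plusTwist _)]
  rfl

theorem support_plusGen (s : Systems)
    (hS : IsStrips S lm lp) (hr : RΦ + Rq ≤ r + 1) (t : ι → ℝ) : ∃ c, ∀ i x,
      plusGenField W q Φ S lm r t i x ≠ 0 → sdist (lp i) x ≤ c := by
  obtain ⟨c, hc⟩ := support_plusCurrent (r := r) s hS hr t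
  refine ⟨c, fun i x hx => hc i x fun h0 => hx ?_⟩
  rw [plusGenField, h0, quasiAdiabatic_zero]

theorem separated_lines (hS : IsStrips S lm lp) :
    Separated (sdists lm) (sdists lp) := ⟨2, fun i y => (hS i).sep y⟩

/-- Twisting the Hamiltonian at the upper line does not affect the generator at the lower line. -/
theorem rapidEq_minusGen (hW : IsFilterFunction γ W) (s : Systems)
    (hS : IsStrips S lm lp) (hr : RΦ + Rq ≤ r + 1) (t : ι → ℝ) :
    RapidEq (fun i => minusGen W (q i) (Φ i) (S i) (lm i) r)
      (fun i => quasiAdiabatic W (plusTwist (q i) (Φ i) (S i) (lm i) r (t i))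
        (minusCurrent (q i) (Φ i) (S i) (lm i) r)) := by
  have := SField.rapid_quasiAdiabatic_sub hW (sfield_hamiltonian s)
    (fun i => by rw [← hamiltonian_eq_sum]; exact (s i).isSelfAdjoint_hamiltonian)
    (sfield_minusCurrent (S := S) (lm := lm) (r := r) s)
    (sfield_plusTwist (S := S) (lm := lm) (r := r) s t)
    (fun i => by rw [sum_gather]; exact (s i).isSelfAdjoint_sum_plusTwistTerm _)
    (fun i => isLip_sdist (lm i)) (fun i => isLip_sdist (lp i)) (support_minusCurrent s hS)
    (support_plusTwist s hS hr t) (separated_lines hS)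
  simp only [sum_gather] at this
  exact this

end Fields

end

/-! ### Parallel transport over one flux quantum -/

section

open MeasureTheory

theorem IsDriving.differentiableAt {φ : ℝ → ℝ} (hφ : IsDriving φ) (x : ℝ) :
    DifferentiableAt ℝ φ x := hφ.smooth.contDiffAt.differentiableAt (by simp)

theorem IsDriving.exists_bound {φ : ℝ → ℝ} (hφ : IsDriving φ) :
    ∃ M, 0 ≤ M ∧ ∀ s ∈ Set.Icc (0 : ℝ) 1, |deriv φ s| ≤ M := by
  have hc : Continuous (deriv φ) := hφ.smooth.continuous_deriv (by simp)
  obtain ⟨M, hM⟩ := isCompact_Icc.exists_bound_of_continuousOn (s := Set.Icc (0 : ℝ) 1) hc.continuousOn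
  exact ⟨M, (norm_nonneg _).trans (hM 0 ⟨le_rfl, zero_le_one⟩), hM⟩

section Single

variable {L : ℕ} [NeZero L] {q Φ : Region L → Obs L} {S l : Region L} {r : ℕ}
  {Rq RΦ : ℕ} {mq mΦ : ℝ} {W φ : ℝ → ℝ} {U : ℝ → Obs L}

local notation "System" => LocalSystem Rq RΦ mq mΦ q Φ

theorem LocalSystem.isSelfAdjoint_parallelGen (s : System) (hW : Integrable W)
    (hφ : IsDriving φ) (x : ℝ) : IsSelfAdjoint (parallelGen q Φ S l r W φ x) := by
  rw [s.parallelGen_eq hW (hφ.differentiableAt x)]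
  have h := isSelfAdjoint_conjExp (φ x) (s.isSelfAdjoint_charge S) (isSelfAdjoint_quasiAdiabatic (W := W)
    (s.isSelfAdjoint_plusTwist (S := S) (l := l) (r := r) (-φ x))
    (s.isSelfAdjoint_minusCurrent (S := S) (l := l) (r := r)))
  rw [IsSelfAdjoint, star_smul, h.star_eq, star_def, conj_ofReal]

theorem LocalSystem.minusCurrent_mem (s : System) : minusCurrent q Φ S l r ∈ evenAlgebra univ := by
  refine sum_mem fun X _ => ?_
  rw [minusCurrentTerm]
  split_ifs
  · exact evenAlgebra_mono (subset_univ _) ((s.termBound_currentTerm S).mem X)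
  · exact zero_mem _

theorem LocalSystem.hamiltonian_mem (s : System) : hamiltonian Φ ∈ evenAlgebra univ :=
  sum_mem fun X _ => evenAlgebra_mono (subset_univ _) (s.mem X)

theorem LocalSystem.plusTwist_mem (s : System) (t : ℝ) :
    plusTwist q Φ S l r t ∈ evenAlgebra univ := by
  refine add_mem s.hamiltonian_mem (sum_mem fun X _ => ?_)
  have h := evenAlgebra_mono (subset_univ _) (s.mem X)
  rw [plusTwistTerm]
  split_ifs
  · exact zero_mem _
  · exact sub_mem (conjExp_mem (s.charge_mem_univ S) h t) h

theorem LocalSystem.parallelGen_mem (s : System) (hW : Integrable W)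
    (hφ : IsDriving φ) (x : ℝ) : parallelGen q Φ S l r W φ x ∈ evenAlgebra univ := by
  rw [s.parallelGen_eq hW (hφ.differentiableAt x)]
  exact Subalgebra.smul_mem _ (conjExp_mem (s.charge_mem_univ S) (quasiAdiabatic_mem hW
    (s.isSelfAdjoint_plusTwist _) (s.plusTwist_mem _) s.minusCurrent_mem) _) _

theorem LocalSystem.exists_norm_parallelGen_le (s : System) (hW : Integrable W)
    (hφ : IsDriving φ) : ∃ M, ∀ x ∈ Set.Icc (0 : ℝ) 1, ‖parallelGen q Φ S l r W φ x‖ ≤ M := by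
  obtain ⟨M, hM, hb⟩ := hφ.exists_bound
  refine ⟨M * ((∫ u, |W u|) * ‖minusCurrent q Φ S l r‖), fun x hx => ?_⟩
  rw [s.parallelGen_eq hW (hφ.differentiableAt x), norm_smul, norm_real]
  refine mul_le_mul (hb x hx) ?_ (norm_nonneg _) hM
  exact (norm_conjExp_le _ (s.isSelfAdjoint_charge S) _).trans
    (norm_quasiAdiabatic_le hW (s.isSelfAdjoint_plusTwist _) _)

theorem LocalSystem.parallel_unitary (s : System) (hW : Integrable W)
    (hφ : IsDriving φ) (hU : IsParallelTransport q Φ S l r W φ U) {x : ℝ}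
    (hx : x ∈ Set.Icc (0 : ℝ) 1) : star (U x) * U x = 1 := by
  have hd : ∀ x ∈ Set.Icc (0 : ℝ) 1, HasDerivWithinAt (fun x => star (U x) * U x) 0
      (Set.Icc 0 1) x := fun x hx => by
    have h := hU.2 x hx
    refine (h.star.mul h).congr_deriv ?_
    have hs := s.isSelfAdjoint_parallelGen (S := S) (l := l) (r := r) hW hφ x
    rw [star_smul, star_mul, hs.star_eq, star_def, conj_I, smul_mul_assoc,
      mul_smul_comm, mul_assoc, neg_smul, neg_add_cancel]
  have := norm_image_sub_le_of_norm_deriv_le_segment' hd (C := 0) (fun _ _ => by simp) x hx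
  rw [zero_mul, hU.1, star_one, one_mul] at this
  exact sub_eq_zero.1 (norm_le_zero_iff.1 this)

/-- The differential equation preserves the even algebra: the component of the solution in a
complement starts at zero and satisfies a linear Grönwall inequality. -/
theorem LocalSystem.parallel_mem (s : System) (hW : Integrable W)
    (hφ : IsDriving φ) (hU : IsParallelTransport q Φ S l r W φ U) : U 1 ∈ evenAlgebra univ := by
  obtain ⟨Θ, hk, hΘ⟩ := exists_projection_evenAlgebra (univ : Region L)
  obtain ⟨M, hM⟩ := s.exists_norm_parallelGen_le (S := S) (l := l) (r := r) hW hφ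
  rw [← hk]
  have hd : ∀ x ∈ Set.Icc (0 : ℝ) 1, HasDerivWithinAt (fun x => Θ (U x))
      (Θ (I • (parallelGen q Φ S l r W φ x * U x))) (Set.Icc 0 1) x := fun x hx =>
    (Θ.restrictScalars ℝ).hasFDerivAt.comp_hasDerivWithinAt x (hU.2 x hx)
  -- The even part of the solution stays even under multiplication by the even generator and is
  -- killed by `Θ`, which closes the inequality for the remaining component.
  have e : ∀ x, Θ (I • (parallelGen q Φ S l r W φ x * U x)) =
      I • Θ (parallelGen q Φ S l r W φ x * Θ (U x)) := fun x => by
    rw [map_smul]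
    congr 1
    rw [← sub_eq_zero, ← map_sub, ← mul_sub, hk]
    exact mul_mem (s.parallelGen_mem hW hφ x) (hΘ _)
  have := norm_le_gronwallBound_of_norm_deriv_right_le (f := fun x => Θ (U x)) (δ := 0)
    (K := ‖Θ‖ * M) (ε := 0) (a := 0) (b := 1) (fun x hx => (hd x hx).continuousWithinAt)
    (fun x hx => (hd x (Set.Ico_subset_Icc_self hx)).mono_of_mem_nhdsWithin
      (Icc_mem_nhdsGE_of_mem hx))
    (by rw [hU.1, (hk 1).2 (one_mem _), norm_zero])
    (fun x hx => by
      rw [e, norm_smul, norm_I, one_mul, add_zero, mul_assoc]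
      refine (Θ.le_opNorm _).trans (mul_mono_left ?_)
      refine (norm_mul_le _ _).trans (mul_mono_right ?_)
      exact hM x (Set.Ico_subset_Icc_self hx)) 1 ⟨zero_le_one, le_rfl⟩
  rw [gronwallBound_ε0_δ0] at this
  exact norm_le_zero_iff.1 this

end Single

section Families

variable {ι : Type} {n : ι → ℕ} [∀ i, NeZero (n i)] {Rq RΦ r : ℕ} {mq mΦ γ : ℝ} {W φ : ℝ → ℝ}
  {q Φ : Terms n} {S lm lp : Regions n}
  {U : ∀ i, ℝ → Obs (n i)}

local notation "Systems" => LocalSystems Rq RΦ mq mΦ q Φ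

/-- Parallel transport along one flux quantum is generated by a flux independent operator. -/
theorem rapidEq_parallel (hW : IsFilterFunction γ W) (hφ : IsDriving φ) (s : Systems)
    (hS : IsStrips S lm lp) (hr : RΦ + Rq ≤ r + 1)
    (hU : ∀ i, IsParallelTransport (q i) (Φ i) (S i) (lm i) r W φ (U i)) :
    RapidEq (fun i => U i 1) (fun i => expI (2 * π)
      (minusGen W (q i) (Φ i) (S i) (lm i) r -
        charge (q i) (S i))) := by
  set K : ∀ i, Obs (n i) := fun i =>
    minusGen W (q i) (Φ i) (S i) (lm i) r with hK
  set K' : ∀ i, ℝ → Obs (n i) := fun i x =>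
    quasiAdiabatic W (plusTwist (q i) (Φ i) (S i) (lm i) r (-φ x))
      (minusCurrent (q i) (Φ i) (S i) (lm i) r) with hK'
  set Q : ∀ i, Obs (n i) := fun i => charge (q i) (S i) with hQ
  set G : ∀ i, Obs (n i) := fun i => K i - Q i with hG
  have hGs : ∀ i, IsSelfAdjoint (G i) := fun i => (isSelfAdjoint_quasiAdiabatic
    (s i).isSelfAdjoint_hamiltonian (s i).isSelfAdjoint_minusCurrent).sub
      ((s i).isSelfAdjoint_charge _)
  have hQs : ∀ i, IsSelfAdjoint (Q i) := fun i => (s i).isSelfAdjoint_charge _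
  -- The transport is first rotated back by the charge and then compared with the candidate
  -- generator. What remains in the derivative is the difference `K' - K` of the generators with and
  -- without the twist at the far edge.
  let F : ∀ i, ℝ → Obs (n i) := fun i x => expI (-φ x) (G i) * (expI (-φ x) (Q i) * U i x)
  let F' : ∀ i, ℝ → Obs (n i) := fun i x => (I * ((deriv φ x : ℝ) : ℂ)) •
    (expI (-φ x) (G i) * ((K' i x - K i) * (expI (-φ x) (Q i) * U i x)))
  have hexp : ∀ {L : ℕ} [NeZero L] (A : Obs L) (x : ℝ), HasDerivAt (fun x => expI (-φ x) A)
      (((deriv φ x : ℝ) : ℂ) • -(I • (A * expI (-φ x) A))) x := fun A x => by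
    have := (hasDerivAt_expI_neg (φ x) A).scomp x (hφ.differentiableAt x).hasDerivAt
    rw [← Complex.coe_smul] at this
    exact this
  have hF : ∀ i, ∀ x ∈ Set.Icc (0 : ℝ) 1, HasDerivWithinAt (F i) (F' i x) (Set.Icc 0 1) x := by
    intro i x hx
    have h1 := (hU i).2 x hx
    rw [(s i).parallelGen_eq hW.integrable (hφ.differentiableAt x)] at h1
    refine ((hexp (G i) x).hasDerivWithinAt.mul
      ((hexp (Q i) x).hasDerivWithinAt.mul h1)).congr_deriv ?_
    have e1 : expI (-φ x) (Q i) * (conjExp (φ x) (Q i) (K' i x) * U i x) =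
        K' i x * (expI (-φ x) (Q i) * U i x) := by
      simp only [conjExp, ← mul_assoc]
      rw [expI_neg_mul_self, one_mul]
    have e2 : G i * expI (-φ x) (G i) = expI (-φ x) (G i) * G i :=
      (Commute.expI_right (Commute.refl (G i)) _).eq
    have e3 : K' i x - K i = K' i x - G i - Q i := by simp only [hG]; abel
    change (((deriv φ x : ℝ) : ℂ) • -(I • (G i * expI (-φ x) (G i)))) *
        (expI (-φ x) (Q i) * U i x) + expI (-φ x) (G i) *
        ((((deriv φ x : ℝ) : ℂ) • -(I • (Q i * expI (-φ x) (Q i)))) * U i x +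
          expI (-φ x) (Q i) * (I • ((((deriv φ x : ℝ) : ℂ) •
            conjExp (φ x) (Q i) (K' i x)) * U i x))) = F' i x
    simp only [F']
    rw [e2, e3]
    simp only [smul_mul_assoc, mul_smul_comm, smul_neg, neg_mul, mul_neg, e1, smul_smul, mul_add,
      sub_mul, mul_sub, smul_sub, mul_assoc]
    rw [mul_comm ((deriv φ x : ℝ) : ℂ) I]
    abel
  have hbd : Rapid (fun j : ι × Set.Icc (0 : ℝ) 1 => n j.1) (fun j => ‖F' j.1 j.2‖) := by
    obtain ⟨M, hM, hb⟩ := hφ.exists_bound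
    have h := rapidEq_minusGen (n := fun j : ι × Set.Icc (0 : ℝ) 1 => n j.1) (r := r) hW
      (fun j => s j.1) (fun j => hS j.1) hr (fun j => -φ j.2)
    refine (Rapid.const_mul h hM).mono fun j => ?_
    simp only [F']
    rw [norm_smul, norm_mul, norm_I, one_mul, norm_real, norm_sub_rev]
    refine mul_le_mul (hb _ j.2.2) ?_ (norm_nonneg _) hM
    refine (norm_mul_le_of_le_one' (norm_expI_le _ (hGs _))).trans (norm_mul_le_of_le_one ?_)
    exact (norm_mul_le_of_le_one' (norm_expI_le _ (hQs _))).trans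
      (norm_le_one_of_unitary ((s j.1).parallel_unitary hW.integrable hφ (hU j.1) j.2.2))
  have hmain := (Rapid.of_hasDerivWithinAt hF hbd).comp
    (fun i : ι => ((i, ⟨1, zero_le_one, le_rfl⟩) : ι × Set.Icc (0 : ℝ) 1))
  refine Rapid.mono hmain fun i => ?_
  have e0 : F i 0 = 1 := by simp [F, hφ.zero, expI_zero, (hU i).1]
  -- At the end of the drive the rotation of the frame is trivial, by integrality of the charge.
  have e1 : F i 1 = expI (-(2 * π)) (G i) * U i 1 := by
    have h := (s i).expI_charge (S i)
    have h' := expI_mul_neg_self (2 * π) (charge (q i) (S i))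
    rw [h, one_mul] at h'
    simp only [F, hφ.one, hQ]
    rw [h', one_mul]
  have e2 : U i 1 - expI (2 * π) (G i) = expI (2 * π) (G i) * (F i 1 - F i 0) := by
    rw [e0, e1, mul_sub, ← mul_assoc, expI_mul_neg_self, one_mul, mul_one]
  change ‖U i 1 - expI (2 * π) (G i)‖ ≤ ‖F i 1 - F i 0‖
  rw [e2]
  exact norm_mul_le_of_le_one' (norm_expI_le _ (hGs i))

end Families

end

/-! ### The two halves of the torus, and commutators with the charge of a strip -/

section Geometry

variable {L : ℕ} [NeZero L] {S lm lp : Region L}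

theorem IsStrip.symm (h : IsStrip S lm lp) : IsStrip S lp lm :=
  ⟨h.zero_mem, h.compl_nonempty, h.plus_nonempty, h.minus_nonempty,
    fun z hz w hw => (h.edge z hz w hw).symm, fun y => by have := h.sep y; omega⟩

/-- The sites that are closer to `lm` than to `lp`. -/
def closer (lm lp : Region L) : Region L := {x | sdist lm x ≤ sdist lp x}

theorem mem_closer {x : Torus L} : x ∈ closer lm lp ↔ sdist lm x ≤ sdist lp x := by simp [closer]

theorem mem_closer_of_not_mem {x : Torus L} (h : x ∉ closer lm lp) : x ∈ closer lp lm := by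
  rw [mem_closer] at *; omega

theorem IsStrip.closer_nonempty (h : IsStrip S lm lp) : (closer lm lp).Nonempty := by
  obtain ⟨x, hx⟩ := h.minus_nonempty
  exact ⟨x, mem_closer.2 (by rw [sdist_eq_zero hx]; exact Nat.zero_le _)⟩

/-- A point within $m$ of the strip and of its complement is within $3m$ of one of the boundary
lines. If this is `lp`, being within $m$ of the half belonging to `lm` brings it within $5m$ of
`lm`. -/
theorem IsStrip.sdist_minus_le (h : IsStrip S lm lp) (y : Torus L) : sdist lm y + 1 ≤
      5 * (1 + max (sdist S y) (max (sdist Sᶜ y) (sdist (closer lm lp) y))) := by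
  obtain ⟨z, hz, h1⟩ := exists_sdist ⟨_, h.zero_mem⟩ y
  obtain ⟨w, hw, h2⟩ := exists_sdist h.compl_nonempty y
  obtain ⟨x, hx, h3⟩ := exists_sdist h.closer_nonempty y
  rw [mem_closer] at hx
  have h4 := isLip_sdist lm y z
  have h5 := isLip_sdist lm y x
  have h6 := isLip_sdist lp x y
  have h7 := isLip_sdist lp y z
  have h8 := gdist_triangle z y w
  have h9 := gdist_comm y z
  have h10 := gdist_comm y x
  have m1 := le_max_left (sdist S y) (max (sdist Sᶜ y) (sdist (closer lm lp) y))
  have m2 := (le_max_left (sdist Sᶜ y) (sdist (closer lm lp) y)).trans (le_max_right (sdist S y) _)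
  have m3 := (le_max_right (sdist Sᶜ y) (sdist (closer lm lp) y)).trans (le_max_right (sdist S y) _)
  generalize max (sdist S y) (max (sdist Sᶜ y) (sdist (closer lm lp) y)) = m at *
  rcases h.edge z hz w (mem_compl.1 hw) with h0 | h0 <;> omega

/-- A site of the half belonging to `lm` has at least half of the total separation between itself
and `lp`. -/
theorem IsStrip.sep_closer (h : IsStrip S lm lp) (y : Torus L) :
    L ≤ 4 * (1 + sdist lp y + sdist (closer lm lp) y) := by
  obtain ⟨x, hx, h3⟩ := exists_sdist h.closer_nonempty y
  rw [mem_closer] at hx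
  have h6 := isLip_sdist lp x y
  have h7 := h.sep x
  have h10 := gdist_comm y x
  omega

end Geometry

section Families

variable {ι : Type} {n : ι → ℕ} [∀ i, NeZero (n i)] {Rq RΦ r : ℕ} {mq mΦ γ : ℝ} {W φ : ℝ → ℝ}
  {q Φ : Terms n} {S lm lp : Regions n}

local notation "Systems" => LocalSystems Rq RΦ mq mΦ q Φ

theorem separated_closer (hS : IsStrips S lm lp) :
    Separated (sdists lp) (fun i => sdist (closer (lm i) (lp i))) :=
  ⟨4, fun i y => (hS i).sep_closer y⟩

theorem Separated.symm {D D' : Distance n} (h : Separated D D') : Separated D' D := by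
  obtain ⟨c, hc⟩ := h
  exact ⟨c, fun i y => (hc i y).trans (le_of_eq (by ring))⟩

theorem Near.of_rapid_sdist {A : Family n} (hA : ∀ i, A i ∈ evenAlgebra univ)
    (h : Rapid n (fun i => ‖A i‖)) (Z : Regions n) : Near (sdists Z) A :=
  Near.of_rapid hA h fun _ _ => sdist_le_size _ _

theorem Near.cm_swap {D : Distance n} {A B : Family n}
    (h : Near D (fun i => cm (A i) (B i))) : Near D (fun i => cm (B i) (A i)) := by
  have e : (fun i => cm (B i) (A i)) = fun i => -cm (A i) (B i) := by
    funext i; simp [cm]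
  rw [e]; exact h.neg

/-- The commutator of the charge in a strip with a charge conserving observable on one side of the
strip is localized at the boundary line on that side. -/
theorem near_cm_charge (s : Systems)
    (hS : IsStrips S lm lp) {K : Density n} (hK : QField K)
    (hc : ∀ i, Commute (charge (q i) univ) (∑ x, K i x))
    (hs : ∀ i x, K i x ≠ 0 → x ∈ closer (lm i) (lp i)) :
    Near (sdists lm) (fun i => cm (charge (q i) (S i)) (∑ x, K i x)) := by
  have h1 : Near (sdists S) (fun i => cm (charge (q i) (S i)) (∑ x, K i x)) := by
    have := (sfield_charge (S := S) s).qfield.near_cm hK (D := sdists S)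
      isLip_sdists (support_charge fun i => (hS i).zero_mem)
    simpa only [sum_gather_charge] using this
  -- By conservation of the total charge the commutator equals minus the one with the charge not
  -- contained in the strip, so it also lives near the complement.
  have h2 : Near (fun i => sdist (S i)ᶜ) (fun i => cm (charge (q i) (S i)) (∑ x, K i x)) := by
    have := ((sfield_charge_compl (S := S) s).qfield.near_cm hK (D := fun i => sdist (S i)ᶜ)
      isLip_sdists (support_charge_compl s)).neg
    simp only [sum_gather_charge_compl, sub_cm, cm_eq_zero.2 (hc _)] at this
    simpa using this
  have h3 : Near (fun i => sdist (closer (lm i) (lp i)))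
      (fun i => cm (charge (q i) (S i)) (∑ x, K i x)) := by
    have := hK.near_cm (sfield_charge (S := S) s).qfield
      (D := fun i => sdist (closer (lm i) (lp i))) isLip_sdists
      ⟨0, fun i x hx => (sdist_eq_zero (hs i x hx)).le⟩
    simp only [sum_gather_charge] at this
    exact this.cm_swap
  exact h1.inter h2 h3 ⟨5, fun i y => (hS i).sdist_minus_le y⟩

variable {D D' DA : Distance n} {A X : Family n} {K : Density n}

theorem hasDerivAt_conjExp_neg {L : ℕ} [NeZero L] (t : ℝ) (G A : Obs L) :
    HasDerivAt (fun t => conjExp (-t) G A) (I • conjExp (-t) G (cm A G)) t := by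
  have := (hasDerivAt_conjExp (-t) G A).scomp t (hasDerivAt_neg t)
  refine this.congr_deriv ?_
  have e : cm A G = -cm G A := by simp [cm]
  rw [e]
  simp [conjExp_smul, conjExp_neg]

/-- An observable changes under the dynamics of a field where it does not commute with it. -/
theorem Near.conj_sub_self (hD : ∀ i, IsLip (D i)) (hK : QField K)
    (hs : ∀ i, IsSelfAdjoint (∑ x, K i x)) (hX : ∀ i, X i ∈ evenAlgebra univ)
    (h : Near D (fun i => cm (X i) (∑ x, K i x))) {T : ℝ} (hT : 0 ≤ T) :
    Near D (fun i => conjExp (-T) (∑ x, K i x) (X i) - X i) := by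
  have h1 := Near.of_hasDerivWithinAt (D := D) (T := T)
    (F := fun i t => conjExp (-t) (∑ x, K i x) (X i))
    (F' := fun i t => I • conjExp (-t) (∑ x, K i x) (cm (X i) (∑ x, K i x))) hT
    (fun i => sub_mem (conjExp_mem (hK.sum_even i) (hX i) _) (conjExp_mem (hK.sum_even i) (hX i) _))
    (fun i t _ => (hasDerivAt_conjExp_neg t _ _).hasDerivWithinAt)
    (Near.smul (fun _ => I) ⟨1, fun _ => by simp⟩ ((h.comp Prod.fst).conj (fun j => hD j.1)
      (hK.comp Prod.fst) (fun j => hs j.1) (T := T) (t := fun j : ι × Set.Icc 0 T => -(j.2 : ℝ))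
      fun j => by rw [abs_neg, abs_of_nonneg j.2.2.1]; exact j.2.2.2))
  simpa only [neg_zero, conjExp_zero_time] using h1

/-- The additional change of an observable under the dynamics when a far away part is added to
the generator. -/
theorem Near.conj_sub_conj (hD : ∀ i, IsLip (D i)) (hD' : ∀ i, IsLip (D' i)) (hn : ∀ i y, D' i y ≤ n i)
    (hK : QField K) (hs : ∀ i, IsSelfAdjoint (∑ x, K i x)) {K' : Density n}
    (hK' : QField K') (hs' : ∀ i, IsSelfAdjoint (∑ x, K' i x))
    (hA : Near DA (fun i => ∑ x, K' i x)) (hsep : Separated D DA) (hX : ∀ i, X i ∈ evenAlgebra univ)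
    (h : Near D (fun i => cm (X i) (∑ x, K i x))) (h' : Near D' (fun i => cm (X i) (∑ x, K' i x)))
    {T : ℝ} (hT : 0 ≤ T) : Near D' (fun i => conjExp (-T) (∑ x, K i x + ∑ x, K' i x) (X i) -
      conjExp (-T) (∑ x, K i x) (X i)) := by
  have hKK := hK.add hK'
  have hss : ∀ i, IsSelfAdjoint (∑ x, (K i x + K' i x)) := fun i => by
    rw [sum_add_distrib]; exact (hs i).add (hs' i)
  have htT : ∀ j : ι × Set.Icc 0 T, |-(j.2 : ℝ)| ≤ T := fun j => by
    rw [abs_neg, abs_of_nonneg j.2.2.1]; exact j.2.2.2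
  have hev : ∀ i, ∀ B ∈ evenAlgebra univ, ∀ t, conjExp t (∑ x, K i x + ∑ x, K' i x) B -
      conjExp t (∑ x, K i x) B ∈ evenAlgebra univ := fun i B hB t =>
    sub_mem (conjExp_mem (add_mem (hK.sum_even i) (hK'.sum_even i)) hB _)
      (conjExp_mem (hK.sum_even i) hB _)
  have h1 : Near (n := fun j : ι × Set.Icc 0 T => n j.1) (fun j => D' j.1)
      (fun j => conjExp (-(j.2 : ℝ)) (∑ x, K j.1 x + ∑ x, K' j.1 x)
        (cm (X j.1) (∑ x, K' j.1 x))) := by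
    have := (h'.comp (J := ι × Set.Icc 0 T) Prod.fst).conj (fun j => hD' j.1) (hKK.comp Prod.fst)
      (fun j => hss j.1) htT
    simpa only [sum_add_distrib] using this
  -- The part of the derivative coming from the first generator is localized at `D`, where the added
  -- generator is hardly visible, so the two evolutions of it nearly coincide.
  have h2 : Near (n := fun j : ι × Set.Icc 0 T => n j.1) (fun j => D' j.1)
      (fun j => conjExp (-(j.2 : ℝ)) (∑ x, K j.1 x + ∑ x, K' j.1 x) (cm (X j.1) (∑ x, K j.1 x)) -
        conjExp (-(j.2 : ℝ)) (∑ x, K j.1 x) (cm (X j.1) (∑ x, K j.1 x))) := by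
    refine Near.of_rapid (fun j => hev j.1 _ (h.even j.1) _) ?_ fun j => hn j.1
    have := (h.comp (J := ι × Set.Icc 0 T) Prod.fst).rapid_conj_sub (fun j => hD j.1)
      (hK.comp Prod.fst) (fun j => hs j.1) (hA.comp Prod.fst) (fun j => hs' j.1) (by
        obtain ⟨c, hc⟩ := hsep
        exact ⟨c, fun j y => hc j.1 y⟩) htT
    exact this.mono fun j => (norm_sub_rev _ _).le
  have h3 := Near.of_hasDerivWithinAt (D := D') (T := T)
    (F := fun i t => conjExp (-t) (∑ x, K i x + ∑ x, K' i x) (X i) -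
      conjExp (-t) (∑ x, K i x) (X i))
    (F' := fun i t => I • (conjExp (-t) (∑ x, K i x + ∑ x, K' i x) (cm (X i) (∑ x, K' i x)) +
      (conjExp (-t) (∑ x, K i x + ∑ x, K' i x) (cm (X i) (∑ x, K i x)) -
        conjExp (-t) (∑ x, K i x) (cm (X i) (∑ x, K i x))))) hT
    (fun i => sub_mem (hev i _ (hX i) _) (hev i _ (hX i) _))
    (fun i t _ => by
      refine (((hasDerivAt_conjExp_neg t _ _).sub
        (hasDerivAt_conjExp_neg t _ _)).hasDerivWithinAt).congr_deriv ?_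
      rw [cm_add, conjExp_add, ← smul_sub]
      congr 1; abel)
    (Near.smul (fun _ => I) ⟨1, fun _ => by simp⟩ (h1.add h2))
  simpa only [neg_zero, conjExp_zero_time, sub_self, sub_zero] using h3

end Families

/-! ### Splitting the flux insertion and the transported charge -/

section Families

variable {ι : Type} {n : ι → ℕ} [∀ i, NeZero (n i)] {Rq RΦ r : ℕ} {mq mΦ γ : ℝ} {W φ : ℝ → ℝ}
  {q Φ : Terms n} {S lm lp N nm np : Regions n}
  {U : ∀ i, ℝ → Obs (n i)}

local notation "Systems" => LocalSystems Rq RΦ mq mΦ q Φ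

theorem sum_restr_add {K : Density n} (Y : Regions n) (i : ι) :
    ∑ x, restr Y K i x + ∑ x, restr (fun i => (Y i)ᶜ) K i x = ∑ x, K i x := by
  classical
  rw [← sum_add_distrib]
  refine sum_congr rfl fun x _ => ?_
  simp only [restr, mem_compl]
  split_ifs <;> simp_all

theorem mem_of_restr_ne_zero {K : Density n} {Y : Regions n} {i : ι}
    {x : Torus (n i)} (h : restr Y K i x ≠ 0) : x ∈ Y i ∧ K i x ≠ 0 := by
  classical
  rw [restr] at h
  split_ifs at h with hx
  · exact ⟨hx, h⟩
  · exact absurd rfl h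

/-- The part of the generator of the flux insertion on the left, with the charge in the strip
subtracted. -/
def leftField (W : ℝ → ℝ) (q Φ : Terms n)
    (S lm nm np : Regions n) (r : ℕ) (i : ι) (x : Torus (n i)) : Obs (n i) :=
  restr (fun i => closer (nm i) (np i)) (minusGenField W q Φ S lm r) i x -
    gather (fun X => if X ⊆ S i then q i X else 0) x

/-- The part of the generator of the flux insertion on the right. -/
def rightField (W : ℝ → ℝ) (q Φ : Terms n)
    (S lm nm np : Regions n) (r : ℕ) : Density n :=
  restr (fun i => (closer (nm i) (np i))ᶜ) (minusGenField W q Φ S lm r)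

/-- The flux independent generator of the flux insertion. -/
def fluxGen (W : ℝ → ℝ) {L : ℕ} [NeZero L] (q Φ : Region L → Obs L) (S l : Region L)
    (r : ℕ) : Obs L := minusGen W q Φ S l r - charge q S

theorem qfield_left (hW : IsFilterFunction γ W)
    (s : Systems) : QField (leftField W q Φ S lm nm np r) :=
  ((qfield_minusGen hW s).restr _).sub (sfield_charge s).qfield

theorem qfield_right (hW : IsFilterFunction γ W)
    (s : Systems) : QField (rightField W q Φ S lm nm np r) :=
  (qfield_minusGen hW s).restr _

theorem sum_left (i : ι) : ∑ x, leftField W q Φ S lm nm np r i x =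
    ∑ x, restr (fun i => closer (nm i) (np i)) (minusGenField W q Φ S lm r) i x -
      charge (q i) (S i) := by
  simp only [leftField]
  rw [sum_sub_distrib, sum_gather_charge]

theorem sum_left_add_right (hW : IsFilterFunction γ W) (s : Systems) (i : ι) :
    ∑ x, leftField W q Φ S lm nm np r i x + ∑ x, rightField W q Φ S lm nm np r i x =
      fluxGen W (q i) (Φ i) (S i) (lm i) r := by
  rw [sum_left, rightField, sub_add_eq_add_sub, sum_restr_add, sum_minusGenField hW s, fluxGen]

theorem isSelfAdjoint_sum_restr (s : Systems) (Y : Regions n) (i : ι) :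
    IsSelfAdjoint (∑ x, restr Y (minusGenField W q Φ S lm r) i x) := by
  classical
  refine sum_selfAdjoint fun x _ => ?_
  rw [restr]
  split_ifs
  · refine isSelfAdjoint_quasiAdiabatic (s i).isSelfAdjoint_hamiltonian (sum_selfAdjoint fun X _ => ?_)
    rw [minusCurrentTerm]
    split_ifs
    · exact isSelfAdjoint_I_smul_cm ((s i).isSelfAdjoint_charge _) ((s i).selfAdjoint X)
    · exact IsSelfAdjoint.zero _
  · exact IsSelfAdjoint.zero _

theorem isSelfAdjoint_left (s : Systems) (i : ι) :
    IsSelfAdjoint (∑ x, leftField W q Φ S lm nm np r i x) := by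
  rw [sum_left]
  exact (isSelfAdjoint_sum_restr s _ i).sub ((s i).isSelfAdjoint_charge _)

theorem isSelfAdjoint_right (s : Systems) (i : ι) :
    IsSelfAdjoint (∑ x, rightField W q Φ S lm nm np r i x) := isSelfAdjoint_sum_restr s _ i

theorem isSelfAdjoint_fluxGen {L : ℕ} [NeZero L] {q Φ : Region L → Obs L}
    {S l : Region L} (s : LocalSystem Rq RΦ mq mΦ q Φ) : IsSelfAdjoint (fluxGen W q Φ S l r) :=
  (isSelfAdjoint_quasiAdiabatic s.isSelfAdjoint_hamiltonian s.isSelfAdjoint_minusCurrent).sub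
    (s.isSelfAdjoint_charge _)

theorem near_right (hW : IsFilterFunction γ W) (s : Systems) :
    Near (fun i => sdist (closer (np i) (nm i))) (fun i => ∑ x, rightField W q Φ S lm nm np r i x) :=
  (qfield_right hW s).near_sum isLip_sdists ⟨0, fun i x hx => (sdist_eq_zero
    (mem_closer_of_not_mem (mem_compl.1 (mem_of_restr_ne_zero hx).1))).le⟩

theorem commute_sum_restr (hW : IsFilterFunction γ W) (s : Systems)
    (Y : Regions n) (i : ι) : Commute (charge (q i) univ)
      (∑ x, restr Y (minusGenField W q Φ S lm r) i x) := by
  classical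
  refine Commute.sum_right _ _ _ fun x _ => ?_
  rw [restr]
  split_ifs
  · exact commute_quasiAdiabatic hW.integrable (s i).isSelfAdjoint_hamiltonian
      (s i).commute_charge_univ ((s i).commute_charge_univ_gather x)
  · exact Commute.zero_right _

/-- The charge inside the left generator commutes with the charge of the other strip, so only the
filtered current contributes, and this is charge conserving. -/
theorem near_cm_charge_left (hW : IsFilterFunction γ W) (s : Systems) (hN : IsStrips N nm np) :
    Near (sdists nm)
      (fun i => cm (charge (q i) (N i)) (∑ x, leftField W q Φ S lm nm np r i x)) := by
  have := near_cm_charge s hN ((qfield_minusGen (S := S) (lm := lm) (r := r) hW s).restr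
    (fun i => closer (nm i) (np i))) (commute_sum_restr hW s _)
    (fun i x hx => (mem_of_restr_ne_zero hx).1)
  simpa only [sum_left, cm_sub, cm_eq_zero.2 ((s _).commute_charge (N _) (S _)), sub_zero] using this

theorem near_cm_charge_right (hW : IsFilterFunction γ W) (s : Systems) (hN : IsStrips N nm np) :
    Near (sdists np)
      (fun i => cm (charge (q i) (N i)) (∑ x, rightField W q Φ S lm nm np r i x)) :=
  near_cm_charge s (fun i => (hN i).symm) (qfield_right hW s) (commute_sum_restr hW s _)
    (fun _ _ hx => mem_closer_of_not_mem (mem_compl.1 (mem_of_restr_ne_zero hx).1))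

/-- The charge transported across the line `nm`. -/
def transportMinus (W : ℝ → ℝ) (q Φ : Terms n)
    (S lm N nm np : Regions n) (r : ℕ) (i : ι) : Obs (n i) :=
  conjExp (-(2 * π)) (∑ x, leftField W q Φ S lm nm np r i x) (charge (q i) (N i)) -
    charge (q i) (N i)

theorem tr_conjExp {L : ℕ} [NeZero L] (t : ℝ) (G A : Obs L) : tr (conjExp t G A) = tr A := by
  rw [conjExp, tr_mul_comm, ← mul_assoc, expI_neg_mul_self, one_mul]

theorem tr_transportMinus (i : ι) : tr (transportMinus W q Φ S lm N nm np r i) = 0 := by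
  rw [transportMinus, tr_sub, tr_conjExp, sub_self]

theorem near_transportMinus (hW : IsFilterFunction γ W) (s : Systems) (hN : IsStrips N nm np) :
    Near (sdists nm) (transportMinus W q Φ S lm N nm np r) :=
  Near.conj_sub_self isLip_sdists (qfield_left hW s) (isSelfAdjoint_left s)
    (fun i => (s i).charge_mem_univ _) (near_cm_charge_left hW s hN) Real.two_pi_pos.le

theorem polyBdd_charge (s : Systems) (N : Regions n) :
    PolyBdd n (fun i => ‖charge (q i) (N i)‖) := by
  have := (sfield_charge (S := N) s).qfield.sum_poly
  simpa only [sum_gather_charge] using this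

/-- Up to rapidly small errors the transport is the flow of the full generator at time $2\pi$.
Compared with the flow of the left half, it changes the charge additionally only near `np`. -/
theorem near_transportPlus (hW : IsFilterFunction γ W) (hφ : IsDriving φ) (s : Systems)
    (hS : IsStrips S lm lp) (hN : IsStrips N nm np) (hr : RΦ + Rq ≤ r + 1)
    (hU : ∀ i, IsParallelTransport (q i) (Φ i) (S i) (lm i) r W φ (U i)) :
    Near (sdists np) (fun i => star (U i 1) * charge (q i) (N i) * U i 1 -
      charge (q i) (N i) - transportMinus W q Φ S lm N nm np r i) := by
  have hQ := polyBdd_charge s N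
  have h1 := Near.conj_sub_conj (D := sdists nm) (D' := sdists np)
    isLip_sdists isLip_sdists (fun i => sdist_le_size _)
    (qfield_left (S := S) (lm := lm) (nm := nm) (np := np) (r := r) hW s)
    (isSelfAdjoint_left s) (qfield_right (S := S) (lm := lm) (nm := nm) (np := np) (r := r) hW s)
    (isSelfAdjoint_right s) (near_right hW s)
    (separated_closer fun i => (hN i).symm) (fun i => (s i).charge_mem_univ _)
    (near_cm_charge_left hW s hN) (near_cm_charge_right hW s hN) Real.two_pi_pos.le
  have hu := rapidEq_parallel hW hφ s hS hr hU
  have hone : PolyBdd n fun i => ‖U i 1‖ := (PolyBdd.const 1).mono fun i =>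
    norm_le_one_of_unitary ((s i).parallel_unitary hW.integrable hφ (hU i) ⟨zero_le_one, le_rfl⟩)
  have hone' : PolyBdd n fun i => ‖expI (2 * π) (fluxGen W (q i) (Φ i) (S i) (lm i) r)‖ :=
    (PolyBdd.const 1).mono fun i => norm_expI_le _ (isSelfAdjoint_fluxGen (s i))
  have h2 : RapidEq (fun i => star (U i 1) * charge (q i) (N i) * U i 1)
      (fun i => conjExp (-(2 * π)) (fluxGen W (q i) (Φ i) (S i) (lm i) r)
        (charge (q i) (N i))) := by
    have := (hu.star.mul (RapidEq.refl fun i => charge (q i) (N i)) hone.norm_star hQ).mul hu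
      (hone.norm_star.norm_mul hQ) hone'
    refine this.trans (RapidEq.of_eq fun i => ?_)
    rw [conjExp, neg_neg, ← star_expI _ (isSelfAdjoint_fluxGen (s i)), fluxGen]
  have h3 := Near.of_rapid_sdist (fun i => sub_mem (mul_mem (mul_mem (star_mem_evenAlgebra
    ((s i).parallel_mem hW.integrable hφ (hU i))) ((s i).charge_mem_univ (N i)))
    ((s i).parallel_mem hW.integrable hφ (hU i))) (conjExp_mem (sub_mem (quasiAdiabatic_mem
      hW.integrable (s i).isSelfAdjoint_hamiltonian (s i).hamiltonian_mem (s i).minusCurrent_mem)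
      ((s i).charge_mem_univ _)) ((s i).charge_mem_univ (N i)) _)) h2 np
  simp only [sum_left_add_right hW s] at h1
  have e : (fun i => star (U i 1) * charge (q i) (N i) * U i 1 - charge (q i) (N i) -
      transportMinus W q Φ S lm N nm np r i) = fun i =>
      (star (U i 1) * charge (q i) (N i) * U i 1 - conjExp (-(2 * π))
        (fluxGen W (q i) (Φ i) (S i) (lm i) r) (charge (q i) (N i))) +
      (conjExp (-(2 * π)) (fluxGen W (q i) (Φ i) (S i) (lm i) r) (charge (q i) (N i)) -
        conjExp (-(2 * π)) (∑ x, leftField W q Φ S lm nm np r i x) (charge (q i) (N i))) := by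
    funext i
    rw [transportMinus]; abel
  rw [e]
  exact h3.add h1

/-- The right half of the generator is far from `nm`, so it may be added to the dynamics of anything
localized there. -/
theorem Near.rapid_conj_left (hW : IsFilterFunction γ W) (s : Systems) (hN : IsStrips N nm np)
    {M : Family n} (hM : Near (sdists nm) M) :
    Rapid (fun j : ι × Set.Icc 0 (2 * π) => n j.1) (fun j =>
      ‖conjExp (-j.2) (∑ x, leftField W q Φ S lm nm np r j.1 x) (M j.1) -
        conjExp (-j.2) (fluxGen W (q j.1) (Φ j.1) (S j.1) (lm j.1) r) (M j.1)‖) := by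
  have := (hM.comp (J := ι × Set.Icc 0 (2 * π)) Prod.fst).rapid_conj_sub (fun j => isLip_sdist _)
    ((qfield_left (S := S) (lm := lm) (nm := nm) (np := np) (r := r) hW s).comp Prod.fst)
    (fun j => isSelfAdjoint_left s j.1)
    ((near_right (S := S) (lm := lm) (nm := nm) (np := np) (r := r) hW s).comp Prod.fst)
    (fun j => isSelfAdjoint_right s j.1) (by
      obtain ⟨c, hc⟩ := separated_closer fun i => (hN i).symm
      exact ⟨c, fun j y => hc j.1 y⟩) (T := 2 * π) (t := fun j => -(j.2 : ℝ))
    (fun j => by rw [abs_neg, abs_of_nonneg j.2.2.1]; exact j.2.2.2)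
  simpa only [sum_left_add_right hW s] using this

end Families

/-! ### Almost supported families and uniqueness of the splitting -/

/-- The even sizes. -/
def EvenSize : Type := {L : ℕ // L ≠ 0 ∧ Even L}

instance (i : EvenSize) : NeZero i.1 := ⟨i.2.1⟩

theorem sum_far_wt_le {L : ℕ} [NeZero L] {Z : Region L} (hZ : Z.Nonempty) (k r : ℕ) :
    ∑ y ∈ (fatten Z r)ᶜ, wt (k + 4) (sdist Z y) ≤ 16 * Z.card * wt k r := by
  have h1 : ∀ y ∈ (fatten Z r)ᶜ, wt (k + 4) (sdist Z y) ≤ wt k r * ∑ z ∈ Z, wt 4 (gdist z y) := by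
    intro y hy
    rw [mem_compl, mem_fatten_iff hZ, not_le] at hy
    obtain ⟨z, hz, e⟩ := exists_sdist hZ y
    rw [wt_add]
    refine mul_le_mul (wt_anti k hy.le) ?_ (wt_nonneg _ _) (wt_nonneg _ _)
    rw [e, gdist_comm]
    exact single_le_sum (f := fun z => wt 4 (gdist z y)) (fun z _ => wt_nonneg _ _) hz
  calc _ ≤ ∑ y ∈ (fatten Z r)ᶜ, wt k r * ∑ z ∈ Z, wt 4 (gdist z y) := sum_le_sum h1
    _ ≤ ∑ y, wt k r * ∑ z ∈ Z, wt 4 (gdist z y) :=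
        sum_le_sum_of_subset_of_nonneg (subset_univ _) fun y _ _ =>
          mul_nonneg (wt_nonneg _ _) (sum_nonneg fun z _ => wt_nonneg _ _)
    _ = wt k r * ∑ z ∈ Z, ∑ y, wt 4 (gdist z y) := by rw [← mul_sum, sum_comm]
    _ ≤ wt k r * ∑ _z ∈ Z, 16 := by
        refine mul_mono_left (sum_le_sum fun z _ => sum_wt_le z) (wt_nonneg _ _)
    _ = _ := by rw [sum_const, nsmul_eq_mul]; ring

/-- The approximants are averages over the complement of the fattening. Four surplus powers sum the
oscillations around each site of $Z$, which gives the factor $|Z|$. -/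
theorem isAlmostSupported_of_near {Z : ∀ (L : ℕ) [NeZero L], Region L}
    {O : ∀ (L : ℕ) [NeZero L], Obs L} (hZ : ∀ (L : ℕ) [NeZero L], Even L → (Z L).Nonempty)
    (h : Near (ι := EvenSize) (n := fun i => i.1) (fun i => sdist (Z i.1)) (fun i => O i.1)) :
    IsAlmostSupported Z O := by
  refine ⟨fun L _ r => twirl (fatten (Z L) r)ᶜ (O L), fun L _ hL r => ?_, fun k => ?_⟩
  · have := twirl_mem (fatten (Z L) r)ᶜ (h.even ⟨L, NeZero.ne L, hL⟩)
    rwa [show univ \ (fatten (Z L) r)ᶜ = fatten (Z L) r by ext; simp] at this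
  · obtain ⟨C, hC, hb⟩ := h.decay (k + 4)
    refine ⟨16 * C, fun L _ hL r hr => ?_⟩
    have h1 : ∑ y ∈ (fatten (Z L) r)ᶜ, osc y (O L) ≤ C * (16 * (Z L).card * wt k r) := by
      refine (sum_le_sum fun y _ => hb ⟨L, NeZero.ne L, hL⟩ y).trans ?_
      rw [← mul_sum]
      exact mul_mono_left (sum_far_wt_le (hZ L hL) k r) hC
    have hr' : (0 : ℝ) < r := by exact_mod_cast hr
    have h2 : wt k r ≤ 1 / (r : ℝ) ^ k := by
      rw [wt, ← one_div]
      exact one_div_le_one_div_of_le (by positivity) (pow_le_pow_left₀ hr'.le (by linarith) k)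
    have h0 := norm_nonneg (O L)
    calc _ ≤ C * (16 * (Z L).card * wt k r) := (norm_sub_twirl_le _ _).trans h1
      _ ≤ C * (16 * (Z L).card * (1 / (r : ℝ) ^ k)) := by gcongr
      _ = 16 * C * 1 * (Z L).card / (r : ℝ) ^ k := by ring
      _ ≤ _ := by gcongr; linarith

/-- At fixed size the operator is a limit of even operators as $r\to\infty$, and the even algebra is
closed. -/
theorem IsAlmostSupported.even {Z : ∀ (L : ℕ) [NeZero L], Region L}
    {O : ∀ (L : ℕ) [NeZero L], Obs L} (h : IsAlmostSupported Z O) (L : ℕ) [NeZero L] (hL : Even L) :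
    O L ∈ evenAlgebra univ := by
  obtain ⟨A, hA, hb⟩ := h
  obtain ⟨C, hC⟩ := hb 1
  have ht : Filter.Tendsto (fun r : ℕ => A L r) Filter.atTop (nhds (O L)) := by
    rw [tendsto_iff_norm_sub_tendsto_zero]
    refine squeeze_zero' (.of_forall fun r => norm_nonneg _)
      (Filter.eventually_atTop.2 ⟨1, fun r hr => ?_⟩)
      (tendsto_const_div_atTop_nhds_zero_nat (C * (1 + ‖O L‖) * ((Z L).card : ℝ)))
    have := hC L hL r hr
    rwa [norm_sub_rev, pow_one] at this
  exact (evenAlgebra_isClosed univ).mem_of_tendsto ht (.of_forall fun r =>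
    evenAlgebra_mono (subset_univ _) (hA L hL r))

/-- Only finitely many indices have small size, and they are absorbed into the constants. -/
theorem Rapid.of_large {f g : EvenSize → ℝ} {N : ℕ} (hg : Rapid (fun i => i.1) g)
    (h : ∀ i : EvenSize, N ≤ i.1 → f i ≤ g i) : Rapid (fun i => i.1) f := fun k => by
  obtain ⟨C, hC, hb⟩ := hg k
  have hfin : Set.Finite {i : EvenSize | i.1 < N} :=
    Set.Finite.preimage Subtype.val_injective.injOn (Set.finite_Iio N)
  obtain ⟨M, hM⟩ := (hfin.image f).bddAbove
  refine ⟨C + |M| * (1 + (N : ℝ)) ^ k, by positivity, fun i => ?_⟩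
  rw [add_mul]
  have hw := wt_nonneg k i.1
  by_cases hi : i.1 < N
  · have h1 := hM ⟨i, hi, rfl⟩
    have h2 := one_le_pow_mul_wt k hi.le
    have h3 : |M| * 1 ≤ |M| * ((1 + (N : ℝ)) ^ k * wt k i.1) := mul_mono_left h2
    have h4 := mul_nonneg hC hw
    have h5 := le_abs_self M
    rw [mul_assoc]
    linarith
  · have h1 := (h i (not_lt.1 hi)).trans (hb i)
    have : 0 ≤ |M| * (1 + (N : ℝ)) ^ k * wt k i.1 := by positivity
    linarith

/-- Almost support is relative to the norm of the operator, and nothing is known about the norm in a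
general splitting. Once `e` is at most 1/2, the unknown on the right can be absorbed. -/
theorem Rapid.of_self_consistent {f e t : EvenSize → ℝ} (hf : ∀ i, 0 ≤ f i) (he : Rapid (fun i => i.1) e)
    (ht : PolyBdd (fun i => i.1) t) (ht0 : ∀ i, 0 ≤ t i) {N : ℕ}
    (h : ∀ i : EvenSize, N ≤ i.1 → f i ≤ e i * (1 + f i + t i)) : Rapid (fun i => i.1) f := by
  obtain ⟨C, hC, hb⟩ := he 1
  have hg : Rapid (fun i : EvenSize => i.1) (fun i => 2 * (max (e i) 0 * (1 + t i))) := by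
    refine Rapid.const_mul (Rapid.mul_poly (fun k => ?_) ((PolyBdd.const 1).add ht)
      fun i => by have := ht0 i; linarith) two_pos.le
    obtain ⟨C, hC, hb⟩ := he k
    exact ⟨C, hC, fun i => max_le (hb i) (mul_nonneg hC (wt_nonneg _ _))⟩
  refine Rapid.of_large (N := N + ⌈2 * C⌉₊) hg fun i hi => ?_
  have h1 := h i (by omega)
  have h2 : e i ≤ 1 / 2 := by
    refine (hb i).trans ?_
    have h3 : 2 * C ≤ (i.1 : ℝ) := (Nat.le_ceil _).trans (by exact_mod_cast by omega)
    rw [wt, pow_one, ← div_eq_mul_inv, div_le_iff₀ (by positivity)]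
    linarith
  have h3 := hf i
  have h4 := ht0 i
  have h5 := mul_mono_right h2 h3
  have h6 : e i * (1 + t i) ≤ max (e i) 0 * (1 + t i) :=
    mul_mono_right (le_max_left _ _) (by linarith)
  linarith [mul_add (e i) (1 + t i) (f i), show e i * (1 + f i + t i) = e i * (1 + t i) + e i * f i by ring]

/-- The splitting of a charge transport operator is unique. -/
theorem rapid_splitting_sub {T Tm Tp Tm' Tp' : ∀ (L : ℕ) [NeZero L], Obs L}
    (h : IsTransportSplitting T Tm Tp) (h' : IsTransportSplitting T Tm' Tp')
    (hm : PolyBdd (ι := EvenSize) (fun i => i.1) (fun i => ‖Tm' i.1‖))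
    (hp : PolyBdd (ι := EvenSize) (fun i => i.1) (fun i => ‖Tp' i.1‖)) :
    Rapid (ι := EvenSize) (fun i => i.1) (fun i => ‖Tm i.1 - Tm' i.1‖) := by
  obtain ⟨A, hA, hAb⟩ := h.minus
  obtain ⟨A', hA', hAb'⟩ := h'.minus
  obtain ⟨B, hB, hBb⟩ := h.plus
  obtain ⟨B', hB', hBb'⟩ := h'.plus
  -- The radius is proportional to the size, yet $4\rho+2<L$, which keeps the fattenings of the two
  -- lines disjoint by the separation of the lines. From $L=8$ on it is at least 1.
  let ρ : EvenSize → ℕ := fun i => (i.1 - 3) / 4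
  let F : EvenSize → ℝ := fun i => (2 * (‖Tm i.1 - A i.1 (ρ i)‖ + ‖Tm' i.1 - A' i.1 (ρ i)‖) +
    2 * (‖Tp i.1 - B i.1 (ρ i)‖ + ‖Tp' i.1 - B' i.1 (ρ i)‖)) /
      (1 + ‖Tm i.1 - Tm' i.1‖ + (‖Tm' i.1‖ + ‖Tp' i.1‖))
  have hden : ∀ i : EvenSize, 0 < 1 + ‖Tm i.1 - Tm' i.1‖ + (‖Tm' i.1‖ + ‖Tp' i.1‖) := fun i => by
    positivity
  have hD : ∀ i : EvenSize, Tm i.1 - Tm' i.1 = Tp' i.1 - Tp i.1 := fun i => by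
    have e1 := h.add i.1 i.2.2
    have e2 := h'.add i.1 i.2.2
    rw [e1] at e2
    rw [sub_eq_sub_iff_add_eq_add, e2, add_comm]
  have hF : Rapid (fun i : EvenSize => i.1) F := by
    have hbig : Rapid (fun i : EvenSize => i.1) (fun i => if 8 ≤ i.1 then F i else 0) := by
      intro k
      obtain ⟨C1, h1⟩ := hAb (k + 2)
      obtain ⟨C2, h2⟩ := hAb' (k + 2)
      obtain ⟨C3, h3⟩ := hBb (k + 2)
      obtain ⟨C4, h4⟩ := hBb' (k + 2)
      refine ⟨2 * (|C1| + |C2| + |C3| + |C4|) * 32 ^ (k + 2), by positivity, fun i => ?_⟩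
      dsimp only
      split_ifs with hi
      · have hρ : 1 ≤ ρ i := by simp only [ρ]; omega
        have hρ' : i.1 + 1 ≤ 32 * ρ i := by simp only [ρ]; omega
        have hρ0 : (0 : ℝ) < ρ i := by exact_mod_cast hρ
        have hw : ∀ Z : Finset (Torus i.1), (Z.card : ℝ) / (ρ i : ℝ) ^ (k + 2) ≤
            32 ^ (k + 2) * wt k i.1 := fun Z => by
          have e1 : (1 + (i.1 : ℝ)) ≤ 32 * (ρ i : ℝ) := by exact_mod_cast (by omega)
          have e2 : (1 + (i.1 : ℝ)) ^ (k + 2) ≤ 32 ^ (k + 2) * (ρ i : ℝ) ^ (k + 2) := by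
            rw [← mul_pow]; exact pow_le_pow_left₀ (by positivity) e1 _
          have e3 := card_le_torus Z
          rw [div_le_iff₀ (by positivity), wt]
          calc (Z.card : ℝ) ≤ (1 + (i.1 : ℝ)) ^ 2 := e3
            _ = ((1 + (i.1 : ℝ)) ^ k)⁻¹ * (1 + (i.1 : ℝ)) ^ (k + 2) := by
                rw [pow_add]; field_simp
            _ ≤ ((1 + (i.1 : ℝ)) ^ k)⁻¹ * (32 ^ (k + 2) * (ρ i : ℝ) ^ (k + 2)) := by gcongr
            _ = _ := by ring
        have key : ∀ (C : ℝ) (Z : Finset (Torus i.1)) (O : Obs i.1) (a : ℝ),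
            ‖O‖ ≤ ‖Tm i.1 - Tm' i.1‖ + (‖Tm' i.1‖ + ‖Tp' i.1‖) →
            a ≤ C * (1 + ‖O‖) * (Z.card : ℝ) / (ρ i : ℝ) ^ (k + 2) →
            a ≤ |C| * (32 ^ (k + 2) * wt k i.1) *
              (1 + ‖Tm i.1 - Tm' i.1‖ + (‖Tm' i.1‖ + ‖Tp' i.1‖)) := by
          intro C Z O a hO ha
          refine ha.trans ?_
          have e0 : 0 ≤ (Z.card : ℝ) / (ρ i : ℝ) ^ (k + 2) := by positivity
          have e1 := le_abs_self C
          have e2 := norm_nonneg O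
          calc C * (1 + ‖O‖) * (Z.card : ℝ) / (ρ i : ℝ) ^ (k + 2)
              = C * ((Z.card : ℝ) / (ρ i : ℝ) ^ (k + 2)) * (1 + ‖O‖) := by ring
            _ ≤ |C| * ((Z.card : ℝ) / (ρ i : ℝ) ^ (k + 2)) * (1 + ‖O‖) := by gcongr
            _ ≤ _ := by
              refine mul_le_mul (mul_mono_left (hw Z)) (by linarith)
                (by positivity) (mul_nonneg (abs_nonneg C) (mul_nonneg (by positivity) (wt_nonneg _ _)))
        have n1 : ‖Tm i.1‖ ≤ ‖Tm i.1 - Tm' i.1‖ + ‖Tm' i.1‖ := norm_le_norm_sub_add _ _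
        have n2 : ‖Tp i.1‖ ≤ ‖Tm i.1 - Tm' i.1‖ + ‖Tp' i.1‖ := by
          rw [hD i, norm_sub_rev]; exact norm_le_norm_sub_add _ _
        have p1 := norm_nonneg (Tm i.1 - Tm' i.1)
        have p2 := norm_nonneg (Tm' i.1)
        have p3 := norm_nonneg (Tp' i.1)
        have k1 := key C1 _ (Tm i.1) _ (by linarith) (h1 i.1 i.2.2 (ρ i) hρ)
        have k2 := key C2 _ (Tm' i.1) _ (by linarith) (h2 i.1 i.2.2 (ρ i) hρ)
        have k3 := key C3 _ (Tp i.1) _ (by linarith) (h3 i.1 i.2.2 (ρ i) hρ)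
        have k4 := key C4 _ (Tp' i.1) _ (by linarith) (h4 i.1 i.2.2 (ρ i) hρ)
        simp only [F]
        rw [div_le_iff₀ (hden i)]
        linarith
      · exact mul_nonneg (by positivity) (wt_nonneg _ _)
    refine Rapid.of_large (N := 8) hbig fun i hi => ?_
    rw [if_pos hi]
  refine Rapid.of_self_consistent (e := F) (N := 8) (fun i => norm_nonneg _) hF (hm.add hp)
    (fun i => add_nonneg (norm_nonneg _) (norm_nonneg _)) fun i hi => ?_
  simp only [F]
  rw [div_mul_cancel₀ _ (hden i).ne']
  have hstrip := isStrip_nu (L := i.1) i.2.2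
  have hdis : Disjoint (fatten (nuMinus i.1) (ρ i)) (fatten (nuPlus i.1) (ρ i)) := by
    rw [disjoint_left]
    intro y hy hy'
    rw [mem_fatten_iff hstrip.minus_nonempty] at hy
    rw [mem_fatten_iff hstrip.plus_nonempty] at hy'
    have := hstrip.sep y
    simp only [ρ] at hy hy'
    omega
  have := norm_le_of_traceless hdis (D := Tm i.1 - Tm' i.1) (A := A i.1 (ρ i) - A' i.1 (ρ i))
    (B := B' i.1 (ρ i) - B i.1 (ρ i)) (sub_mem (h.minus.even i.1 i.2.2) (h'.minus.even i.1 i.2.2))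
    (by rw [tr_sub, h.traceless i.1 i.2.2, h'.traceless i.1 i.2.2, sub_zero])
    (sub_mem (hA i.1 i.2.2 _) (hA' i.1 i.2.2 _)) (sub_mem (hB' i.1 i.2.2 _) (hB i.1 i.2.2 _))
  have e1 : ‖Tm i.1 - Tm' i.1 - (A i.1 (ρ i) - A' i.1 (ρ i))‖ ≤
      ‖Tm i.1 - A i.1 (ρ i)‖ + ‖Tm' i.1 - A' i.1 (ρ i)‖ := by
    rw [sub_sub_sub_comm]; exact norm_sub_le _ _
  have e2 : ‖Tm i.1 - Tm' i.1 - (B' i.1 (ρ i) - B i.1 (ρ i))‖ ≤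
      ‖Tp i.1 - B i.1 (ρ i)‖ + ‖Tp' i.1 - B' i.1 (ρ i)‖ := by
    rw [hD i, sub_sub_sub_comm, add_comm]; exact norm_sub_le _ _
  linarith

/-! ### Traces and determinants on the ground state space -/

section Compression

variable {L : ℕ} [NeZero L] (E : Submodule ℂ (Fock L))

/-- The compression of an operator to a subspace. -/
def compress (A : Obs L) : E →ₗ[ℂ] E :=
  (E.orthogonalProjectionOnto : Fock L →ₗ[ℂ] E) ∘ₗ (A : Fock L →ₗ[ℂ] Fock L) ∘ₗ E.subtype

theorem coe_compress (A : Obs L) (v : E) : (compress E A v : Fock L) = E.starProjection (A v) := rfl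

theorem compress_mul (A B : Obs L) :
    compress E (A * E.starProjection * B) = compress E A * compress E B := rfl

theorem compress_proj_mul (A : Obs L) : compress E (E.starProjection * A) = compress E A := by
  ext v
  simp only [coe_compress]
  change E.starProjection (E.starProjection (A v)) = E.starProjection (A v)
  exact Submodule.starProjection_eq_self_iff.2 (Submodule.starProjection_apply_mem _ _)

theorem compress_one : compress E (1 : Obs L) = 1 := by
  ext v
  exact Submodule.starProjection_eq_self_iff.2 v.2

theorem inner_compress (A : Obs L) (v w : E) :
    inner ℂ v (compress E A w) = inner ℂ (v : Fock L) (A w) := by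
  rw [Submodule.coe_inner, coe_compress, ← Submodule.inner_starProjection_left_eq_right,
    Submodule.starProjection_eq_self_iff.2 v.2]

theorem trace_compress (A : Obs L) :
    LinearMap.trace ℂ E (compress E A) = tr (E.starProjection * A) := by
  have h := LinearMap.trace_comp_comm' (R := ℂ) E.subtype
    ((E.orthogonalProjectionOnto : Fock L →ₗ[ℂ] E) ∘ₗ (A : Fock L →ₗ[ℂ] Fock L))
  exact h

theorem norm_inner_compress_le (A : Obs L) {ι : Type} [Fintype ι] (b : OrthonormalBasis ι ℂ E) (j k : ι) :
    ‖inner ℂ (b j) (compress E A (b k))‖ ≤ ‖A‖ := by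
  rw [inner_compress]
  refine (norm_inner_le_norm _ _).trans ?_
  have h1 : ‖((b j : E) : Fock L)‖ = 1 := b.orthonormal.1 j
  have h2 : ‖((b k : E) : Fock L)‖ = 1 := b.orthonormal.1 k
  have := A.le_opNorm (b k : Fock L)
  rw [h2, mul_one] at this
  rw [h1, one_mul]; exact this

theorem norm_tr_starProjection_mul_le (A : Obs L) :
    ‖tr (E.starProjection * A)‖ ≤ Module.finrank ℂ E * ‖A‖ := by
  rw [← trace_compress, LinearMap.trace_eq_sum_inner _ (stdOrthonormalBasis ℂ E)]
  refine (norm_sum_le _ _).trans ((sum_le_sum fun j _ => norm_inner_compress_le E A _ j j).trans ?_)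
  simp

/-- The determinant of the compression of an operator to a subspace. -/
def detOn (A : Obs L) : ℂ := LinearMap.det (compress E A)

theorem detOn_one : detOn E (1 : Obs L) = 1 := by rw [detOn, compress_one, map_one]

theorem detOn_mul (A B : Obs L) : detOn E (A * E.starProjection * B) = detOn E A * detOn E B := by
  rw [detOn, compress_mul, map_mul, detOn, detOn]

theorem detOn_proj_mul (A : Obs L) : detOn E (E.starProjection * A) = detOn E A := by
  rw [detOn, compress_proj_mul, detOn]

theorem detOn_mul_of_commute {A : Obs L} (hA : Commute A E.starProjection) (B : Obs L) :
    detOn E (A * B) = detOn E A * detOn E B := by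
  rw [← detOn_mul, hA.eq, mul_assoc, detOn_proj_mul]

theorem detOn_eq {p : ℕ} (b : OrthonormalBasis (Fin p) ℂ E) (A : Obs L) :
    detOn E A = Matrix.det (Matrix.of fun j k => inner ℂ (b j) (compress E A (b k))) := by
  rw [detOn, ← LinearMap.det_toMatrix b.toBasis]
  congr 1
  ext j k
  rw [LinearMap.toMatrix_apply, Matrix.of_apply, OrthonormalBasis.coe_toBasis,
    OrthonormalBasis.coe_toBasis_repr_apply, OrthonormalBasis.repr_apply_apply]

/-- Since $A$ preserves the subspace, eigenvectors of its compression are eigenvectors of $A$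
itself. In such a basis the exponential is diagonal and the determinant is the product of the
phases. -/
theorem detOn_expI {A : Obs L} (hA : IsSelfAdjoint A) (hc : Commute A E.starProjection) (t : ℝ) :
    detOn E (expI t A) = cexp (I * t * tr (E.starProjection * A)) := by
  have hs : (compress E A).IsSymmetric := fun v w => by
    rw [inner_compress, ← inner_conj_symm, inner_compress, inner_conj_symm, inner_apply_left hA]
  set b := hs.eigenvectorBasis rfl with hb
  set e := hs.eigenvalues rfl with he
  have h1 : ∀ j, A (b j : Fock L) = (e j : ℂ) • (b j : Fock L) := fun j => by
    have h2 := congrArg (Subtype.val) (hs.apply_eigenvectorBasis rfl j)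
    rw [coe_compress] at h2
    have h3 : E.starProjection (A (b j : Fock L)) = A (b j : Fock L) := by
      have h4 := congrArg (fun B : Obs L => B (b j : Fock L)) hc.eq
      simp only [mul_apply_eq_comp] at h4
      rw [← h4, Submodule.starProjection_eq_self_iff.2 (b j).2]
    rw [← h3]; exact h2
  have h2 : ∀ j, compress E A (b j) = (e j : ℂ) • b j := fun j => hs.apply_eigenvectorBasis rfl j
  have h3 : ∀ j, compress E (expI t A) (b j) = cexp (I * t * e j) • b j := fun j => by
    apply Subtype.ext
    rw [coe_compress, expI_apply_of_eigen (h1 j), map_smul,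
      Submodule.starProjection_eq_self_iff.2 (b j).2]
    rfl
  rw [← trace_compress, LinearMap.trace_eq_sum_inner _ b, detOn_eq E b]
  have e1 : (Matrix.of fun j k => inner ℂ (b j) (compress E (expI t A) (b k))) =
      Matrix.diagonal fun j => cexp (I * t * e j) := by
    ext j k
    rw [Matrix.of_apply, h3, inner_smul_right, Matrix.diagonal_apply,
      orthonormal_iff_ite.1 b.orthonormal]
    split_ifs with h
    · rw [h, mul_one]
    · rw [mul_zero]
  rw [e1, Matrix.det_diagonal, ← exp_sum, mul_sum]
  congr 1
  refine sum_congr rfl fun j _ => ?_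
  rw [h2, inner_smul_right, orthonormal_iff_ite.1 b.orthonormal, if_pos rfl, mul_one]

theorem tr_groundProj_im {H A : Obs L} (hA : IsSelfAdjoint A) : (tr (ℙ H * A)).im = 0 := by
  rw [groundProj, ← trace_compress,
    LinearMap.trace_eq_sum_inner _ (stdOrthonormalBasis ℂ (groundSpace H)), im_sum]
  refine sum_eq_zero fun j _ => ?_
  rw [inner_compress, ← conj_eq_iff_im, inner_conj_symm, inner_apply_left hA]

theorem norm_tr_groundProj_mul_le {γ : ℝ} {p : ℕ} {H : Obs L} (hg : IsGapped γ p H) (A : Obs L) :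
    ‖tr (ℙ H * A)‖ ≤ p * ‖A‖ := by
  have := norm_tr_starProjection_mul_le (groundSpace H) A
  rwa [hg.1] at this

/-- Writing the difference as the trace of $P(P-P')A+P'A(P-P')$ keeps a projection of rank $p$ in
each term, so that the huge dimension of Fock space does not enter. -/
theorem norm_tr_groundProj_sub_le {γ : ℝ} {p : ℕ} {H H' : Obs L} (hg : IsGapped γ p H)
    (hg' : IsGapped γ p H') (A : Obs L) : ‖tr (ℙ H * A) - tr (ℙ H' * A)‖ ≤
      2 * p * (‖ℙ H - ℙ H'‖ * ‖A‖) := by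
  have e : tr (ℙ H * A) - tr (ℙ H' * A) =
      tr (ℙ H * ((ℙ H - ℙ H') * A)) +
        tr (ℙ H' * (A * (ℙ H - ℙ H'))) := by
    have e1 : ℙ H * ((ℙ H - ℙ H') * A) =
        ℙ H * A - ℙ H * ℙ H' * A := by
      rw [sub_mul, mul_sub, ← mul_assoc, groundProj_mul_self, mul_assoc]
    have e2 : tr (ℙ H' * (A * (ℙ H - ℙ H'))) =
        tr (ℙ H * ℙ H' * A) - tr (ℙ H' * A) := by
      rw [← mul_assoc, tr_mul_comm, ← mul_assoc, sub_mul, groundProj_mul_self, sub_mul, tr_sub]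
    rw [e1, e2, tr_sub]; ring
  rw [e]
  have h1 := norm_tr_groundProj_mul_le hg ((ℙ H - ℙ H') * A)
  have h2 := norm_tr_groundProj_mul_le hg' (A * (ℙ H - ℙ H'))
  have h3 := norm_mul_le (ℙ H - ℙ H') A
  have h4 := norm_mul_le A (ℙ H - ℙ H')
  have hp : (0 : ℝ) ≤ p := Nat.cast_nonneg p
  have h5 := mul_mono_left h3 hp
  have h6 := mul_mono_left h4 hp
  refine (norm_add_le _ _).trans ?_
  rw [mul_comm ‖A‖] at h6
  linarith

end Compression

section Families

variable {ι : Type} {n : ι → ℕ}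

theorem Rapid.prod_sub {κ : Type} {a b : ι → κ → ℂ} (s : Finset κ)
    (h : ∀ j, Rapid n (fun i => ‖a i j - b i j‖)) (ha : ∀ j, PolyBdd n (fun i => ‖a i j‖))
    (hb : ∀ j, PolyBdd n (fun i => ‖b i j‖)) :
    Rapid n (fun i => ‖∏ j ∈ s, a i j - ∏ j ∈ s, b i j‖) ∧ PolyBdd n (fun i => ‖∏ j ∈ s, b i j‖) := by
  classical
  induction s using Finset.induction_on with
  | empty => exact ⟨Rapid.of_forall fun i => by simp, (PolyBdd.const 1).mono fun i => by simp⟩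
  | insert j s hj ih =>
    simp only [prod_insert hj]
    refine ⟨((ih.1.mul_poly (ha j)).add ((h j).mul_poly ih.2)).mono fun i => ?_, ((hb j).mul ih.2).mono
        fun i => norm_mul_le _ _⟩
    have e : a i j * ∏ j ∈ s, a i j - b i j * ∏ j ∈ s, b i j =
        (∏ j ∈ s, a i j - ∏ j ∈ s, b i j) * a i j + (a i j - b i j) * ∏ j ∈ s, b i j := by ring
    rw [e]
    exact (norm_add_le _ _).trans (add_le_add (norm_mul_le _ _) (norm_mul_le _ _))

theorem Rapid.sum_sub {κ : Type} {a b : ι → κ → ℂ} (s : Finset κ)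
    (h : ∀ j, Rapid n (fun i => ‖a i j - b i j‖)) :
    Rapid n (fun i => ‖∑ j ∈ s, a i j - ∑ j ∈ s, b i j‖) := by
  classical
  induction s using Finset.induction_on with
  | empty => exact Rapid.of_forall fun i => by simp
  | insert j s hj ih =>
    simp only [sum_insert hj]
    refine ((h j).add ih).mono fun i => ?_
    rw [add_sub_add_comm]; exact norm_add_le _ _

theorem Rapid.det_sub {p : ℕ} {M N : ι → Matrix (Fin p) (Fin p) ℂ}
    (h : ∀ j k, Rapid n (fun i => ‖M i j k - N i j k‖)) (hM : ∀ j k, PolyBdd n (fun i => ‖M i j k‖))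
    (hN : ∀ j k, PolyBdd n (fun i => ‖N i j k‖)) : Rapid n (fun i => ‖(M i).det - (N i).det‖) := by
  simp only [Matrix.det_apply]
  refine Rapid.sum_sub _ fun σ => ?_
  have := (Rapid.prod_sub (a := fun i j => M i (σ j) j) (b := fun i j => N i (σ j) j) univ
    (fun j => h _ _) (fun j => hM _ _) (fun j => hN _ _)).1
  refine this.mono fun i => ?_
  rw [← smul_sub, Units.smul_def, zsmul_eq_mul, norm_mul]
  rcases Int.units_eq_one_or (Equiv.Perm.sign σ) with h | h <;> simp [h]

variable [∀ i, NeZero (n i)] {γ : ℝ} {p : ℕ} {H A B : Family n}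

/-- The matrices have the fixed size `p`, so the determinant is a fixed polynomial in entries that
are controlled by operator norms. -/
theorem RapidEq.detOn (hg : ∀ i, IsGapped γ p (H i)) (h : RapidEq A B) (hA : PolyBdd n fun i => ‖A i‖)
    (hB : PolyBdd n fun i => ‖B i‖) :
    Rapid n (fun i => ‖detOn (groundSpace (H i)) (A i) - detOn (groundSpace (H i)) (B i)‖) := by
  let b : ∀ i, OrthonormalBasis (Fin p) ℂ (groundSpace (H i)) := fun i =>
    (stdOrthonormalBasis ℂ (groundSpace (H i))).reindex (finCongr (hg i).1)
  simp only [fun i => detOn_eq (groundSpace (H i)) (b i)]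
  refine Rapid.det_sub (fun j k => Rapid.mono h fun i => ?_)
    (fun j k => hA.mono fun i => norm_inner_compress_le _ _ (b i) j k)
    (fun j k => hB.mono fun i => norm_inner_compress_le _ _ (b i) j k)
  have := norm_inner_compress_le (groundSpace (H i)) (A i - B i) (b i) j k
  refine le_trans (le_of_eq ?_) this
  simp only [Matrix.of_apply]
  rw [← inner_sub_right]
  congr 2
  apply Subtype.ext
  simp [coe_compress]

end Families

/-! ### Transport of ground state projections and of expectation values -/

section Single

variable {L : ℕ} [NeZero L]

theorem hasDerivAt_conjExp_path {G X' : Obs L} {X : ℝ → Obs L} {t : ℝ} (hX : HasDerivAt X X' t) :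
    HasDerivAt (fun t => conjExp (-t) G (X t)) (conjExp (-t) G (X' + I • cm (X t) G)) t := by
  have h1 : HasDerivAt (fun t => expI (-t) G * X t * expI t G) _ t :=
    ((hasDerivAt_expI_neg t G).mul hX).mul (hasDerivAt_expI t G)
  simp only [conjExp, neg_neg] at h1 ⊢
  refine h1.congr_deriv ?_
  have c1 : G * expI (-t) G = expI (-t) G * G := (Commute.expI_right (Commute.refl G) _).eq
  have c2 : expI t G * G = G * expI t G := (Commute.expI_right (Commute.refl G) _).eq.symm
  simp only [cm, c1, c2, mul_add, add_mul, mul_sub, sub_mul, smul_sub, smul_mul_assoc, mul_smul_comm,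
    neg_mul, mul_neg, mul_assoc]
  abel

theorem conjExp_eq_star {G : Obs L} (hG : IsSelfAdjoint G) (t : ℝ) (A : Obs L) :
    conjExp (-t) G A = star (expI t G) * A * expI t G := by
  rw [conjExp, neg_neg, star_expI _ hG]

theorem star_expI_mul {G : Obs L} (hG : IsSelfAdjoint G) (t : ℝ) : star (expI t G) * expI t G = 1 := by
  rw [star_expI _ hG, expI_neg_mul_self]

theorem expI_mul_star {G : Obs L} (hG : IsSelfAdjoint G) (t : ℝ) : expI t G * star (expI t G) = 1 := by
  rw [star_expI _ hG, expI_mul_neg_self]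

theorem groundProj_conjExp {G H : Obs L} (hG : IsSelfAdjoint G) (hH : IsSelfAdjoint H) (t : ℝ) :
    ℙ (conjExp t G H) = conjExp t G (ℙ H) := by
  rw [← neg_neg t, conjExp_eq_star hG, conjExp_eq_star hG]
  exact groundProj_conj (star_expI_mul hG _) (expI_mul_star hG _) hH

theorem IsGapped.conjExp {γ : ℝ} {p : ℕ} {G H : Obs L} (hg : IsGapped γ p H) (hG : IsSelfAdjoint G)
    (hH : IsSelfAdjoint H) (t : ℝ) : IsGapped γ p (conjExp t G H) := by
  rw [← neg_neg t, conjExp_eq_star hG]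
  exact hg.conj (star_expI_mul hG _) (expI_mul_star hG _) hH

theorem commute_conjExp {A B : Obs L} (h : Commute A B) (t : ℝ) (G : Obs L) :
    Commute (conjExp t G A) (conjExp t G B) := by
  rw [Commute, SemiconjBy, ← conjExp_mul, ← conjExp_mul, h.eq]

/-- The protocol takes every value between 0 and $2\pi$ by continuity, and the change of frame is
unitary. -/
theorem LocalSystem.isGapped_plusTwist {Rq RΦ r p : ℕ} {mq mΦ γ : ℝ} {φ : ℝ → ℝ}
    {q Φ : Region L → Obs L} {S l : Region L} (s : LocalSystem Rq RΦ mq mΦ q Φ) (hφ : IsDriving φ)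
    (hg : ∀ x ∈ Set.Icc (0 : ℝ) 1, IsGapped γ p (twistHamiltonian q Φ S l r (φ x))) {t : ℝ}
    (ht : t ∈ Set.Icc 0 (2 * π)) : IsGapped γ p (plusTwist q Φ S l r (-t)) := by
  have hc : ContinuousOn φ (Set.Icc 0 1) := hφ.smooth.continuous.continuousOn
  have := intermediate_value_Icc zero_le_one hc
  rw [hφ.zero, hφ.one] at this
  obtain ⟨x, hx, rfl⟩ := this ht
  have h := hg x hx
  rw [twistHamiltonian_eq] at h
  have h2 := h.conjExp (s.isSelfAdjoint_charge S)
    (isSelfAdjoint_conjExp (φ x) (s.isSelfAdjoint_charge S) (s.isSelfAdjoint_plusTwist (-φ x))) (-φ x)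
  rwa [conjExp_conjExp, neg_add_cancel, conjExp_zero_time] at h2

theorem tr_mul_cm_of_commute {P A B : Obs L} (h : Commute B P) : tr (P * cm A B) = 0 := by
  have e : tr (P * (B * A)) = tr (P * (A * B)) := by
    rw [← mul_assoc, ← h.eq, mul_assoc, tr_mul_comm, mul_assoc]
  rw [cm, mul_sub, tr_sub, e, sub_self]

theorem hasDerivAt_tr_conjExp (P G M : Obs L) (t : ℝ) :
    HasDerivAt (fun t : ℝ => tr (P * conjExp (-t) G M)) (tr (P * (I • conjExp (-t) G (cm M G)))) t := by
  let T : Obs L →L[ℝ] ℂ := LinearMap.toContinuousLinearMap (((LinearMap.trace ℂ (Fock L)).comp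
    (ContinuousLinearMap.coeLM ℂ)).restrictScalars ℝ)
  exact T.hasFDerivAt.comp_hasDerivAt t ((hasDerivAt_conjExp_neg t G M).const_mul P)

end Single

section Families

variable {ι : Type} {n : ι → ℕ} [∀ i, NeZero (n i)] {Rq RΦ r p : ℕ} {mq mΦ γ : ℝ} {W φ : ℝ → ℝ}
  {q Φ : Terms n} {S lm lp N nm np : Regions n}

local notation "Systems" => LocalSystems Rq RΦ mq mΦ q Φ

theorem polyBdd_plusTwist (s : Systems) (t : ι → ℝ) :
    PolyBdd n (fun i => ‖plusTwist (q i) (Φ i) (S i) (lm i) r (t i)‖) := by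
  have := (sfield_plusTwist_total (S := S) (lm := lm) (r := r) s t).qfield.sum_poly
  simpa only [← plusTwist_eq_sum] using this

/-- The ground state projection is parallel transported along the flux insertion. -/
theorem rapid_groundProj_transport (hγ : 0 < γ) (hW : IsFilterFunction γ W) (s : Systems)
    (hS : IsStrips S lm lp) (hr : RΦ + Rq ≤ r + 1) (hg : IsFluxGapped γ p q Φ S lm r) :
    Rapid (fun j : ι × Set.Icc 0 (2 * π) => n j.1) (fun j =>
      ‖conjExp (-j.2) (fluxGen W (q j.1) (Φ j.1) (S j.1) (lm j.1) r)
        (ℙ (plusTwist (q j.1) (Φ j.1) (S j.1) (lm j.1) r (-j.2))) -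
          ℙ (hamiltonian (Φ j.1))‖) := by
  let J := ι × Set.Icc 0 (2 * π)
  let H' : ∀ i, ℝ → Obs (n i) := fun i t => plusTwist (q i) (Φ i) (S i) (lm i) r (-t)
  let G := fun i => fluxGen W (q i) (Φ i) (S i) (lm i) r
  let J₀ := fun i => minusCurrent (q i) (Φ i) (S i) (lm i) r
  let K := fun i => quasiAdiabatic W (hamiltonian (Φ i)) (J₀ i)
  let K' : ∀ i, ℝ → Obs (n i) := fun i t => quasiAdiabatic W (H' i t) (J₀ i)
  let B : ∀ i, ℝ → Obs (n i) := fun i t => conjExp (-t) (G i) (J₀ i + I • cm (H' i t) (K' i t))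
  let R : ∀ i, ℝ → Obs (n i) := fun i t => conjExp (-t) (G i) (I • cm (H' i t) (K i - K' i t))
  have hGs : ∀ i, IsSelfAdjoint (G i) := fun i => isSelfAdjoint_fluxGen (s i)
  have hH' : ∀ i t, IsSelfAdjoint (H' i t) := fun i t => (s i).isSelfAdjoint_plusTwist _
  have hd : ∀ i t, HasDerivAt (fun t => conjExp (-t) (G i) (H' i t)) (B i t + R i t) t := by
    intro i t
    have h1 : HasDerivAt (H' i) (-plusCurrent (q i) (Φ i) (S i) (lm i) r (-t)) t := by
      have := (hasDerivAt_plusTwist (q i) (Φ i) (S i) (lm i) r (-t)).scomp t (hasDerivAt_neg t)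
      rw [neg_one_smul] at this
      exact this
    refine (hasDerivAt_conjExp_path h1).congr_deriv ?_
    have e := cm_charge_plusTwist (q i) (Φ i) (S i) (lm i) r (-t)
    simp only [B, R]
    rw [← conjExp_add]
    congr 1
    -- The charge in the generator yields both edge currents. The one at the upper edge cancels
    -- against the derivative of the twisted Hamiltonian, and the lower one together with the
    -- filtered commutator preserves the ground states, up to the small difference of `K` and `K'`.
    have e2 : cm (H' i t) (G i) = cm (H' i t) (K i) + cm (charge (q i) (S i)) (H' i t) := by
      rw [cm_symm (charge (q i) (S i))]
      simp only [G, fluxGen, cm_sub, K, J₀]; abel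
    rw [e2, smul_add, e, cm_sub, smul_sub]
    simp only [J₀]
    abel
  have hR : Rapid (fun j : J => n j.1) (fun j => ‖R j.1 j.2‖) := by
    have h1 := rapidEq_minusGen (n := fun j : J => n j.1) (r := r) hW (fun j => s j.1)
      (fun j => hS j.1) hr (fun j => -(j.2 : ℝ))
    have h2 := polyBdd_plusTwist (n := fun j : J => n j.1) (S := fun j => S j.1)
      (lm := fun j => lm j.1) (r := r) (fun j => s j.1) (fun j => -(j.2 : ℝ))
    refine (Rapid.mul_poly h1 ((PolyBdd.const 2).mul h2)).mono fun j => ?_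
    refine (norm_conjExp_le _ (hGs _) _).trans ?_
    rw [norm_smul, norm_I, one_mul]
    refine (norm_cm_le _ _).trans (le_of_eq ?_)
    rw [mul_comm]
  intro k
  obtain ⟨C, hC, hb⟩ := hR k
  refine ⟨4 / γ * (4 * (C + 1)) * (2 * π), by have := Real.pi_pos; positivity, fun j => ?_⟩
  have hw := wt_pos k (n j.1)
  have h0 : conjExp (-0) (G j.1) (H' j.1 0) = hamiltonian (Φ j.1) := by
    simp only [H']
    rw [neg_zero, conjExp_zero_time, plusTwist_zero]
  have := norm_groundProj_path_le (Y := fun t => conjExp (-t) (G j.1) (H' j.1 t)) (B := B j.1)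
    (R := R j.1) (T := 2 * π) (ε := (C + 1) * wt k (n j.1)) (p := p) hγ (by positivity)
    (fun t _ => isSelfAdjoint_conjExp _ (hGs _) (hH' _ t))
    (fun t ht => (hg j.1 t ht).conjExp (hGs _) (hH' _ t) _) (fun t _ => hd j.1 t) (fun t ht => by
      rw [groundProj_conjExp (hGs _) (hH' _ t)]
      exact commute_conjExp ((hg j.1 t ht).commute_add_cm hγ hW (hH' _ t)
        (s j.1).isSelfAdjoint_minusCurrent) _ _)
    (fun t ht => (hb (j.1, ⟨t, ht⟩)).trans (mul_mono_right (by linarith) hw.le)) j.2.2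
  rw [h0, groundProj_conjExp (hGs _) (hH' _ _)] at this
  refine this.trans ?_
  have h3 : (j.2 : ℝ) ≤ 2 * π := j.2.2.2
  calc _ ≤ 4 / γ * (4 * ((C + 1) * wt k (n j.1))) * (2 * π) := mul_mono_left h3
    _ = _ := by ring

/-- The expectation value of an observable at the lower line does not change under the flux
insertion. -/
theorem rapid_tr_transport (hγ : 0 < γ) (hW : IsFilterFunction γ W) (s : Systems)
    (hS : IsStrips S lm lp) (hr : RΦ + Rq ≤ r + 1) (hg : IsFluxGapped γ p q Φ S lm r)
    {M : Family n} (hM : Near (sdists lm) M) :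
    Rapid (fun j : ι × Set.Icc 0 (2 * π) => n j.1) (fun j => ‖tr (ℙ (hamiltonian (Φ j.1)) *
          conjExp (-j.2) (fluxGen W (q j.1) (Φ j.1) (S j.1) (lm j.1) r) (M j.1)) -
        tr (ℙ (hamiltonian (Φ j.1)) * M j.1)‖) := by
  let J := ι × Set.Icc 0 (2 * π)
  let H' : ∀ i, ℝ → Obs (n i) := fun i t => plusTwist (q i) (Φ i) (S i) (lm i) r (-t)
  let G := fun i => fluxGen W (q i) (Φ i) (S i) (lm i) r
  let P := fun i => ℙ (hamiltonian (Φ i))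
  let Kp : ∀ i, ℝ → Obs (n i) := fun i t =>
    quasiAdiabatic W (H' i t) (plusCurrent (q i) (Φ i) (S i) (lm i) r (-t))
  let Km : ∀ i, ℝ → Obs (n i) := fun i t =>
    quasiAdiabatic W (H' i t) (minusCurrent (q i) (Φ i) (S i) (lm i) r)
  let K := fun i => minusGen W (q i) (Φ i) (S i) (lm i) r
  have hGs : ∀ i, IsSelfAdjoint (G i) := fun i => isSelfAdjoint_fluxGen (s i)
  have hH' : ∀ i t, IsSelfAdjoint (H' i t) := fun i t => (s i).isSelfAdjoint_plusTwist _
  have hg0 := hg.gapped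
  have hMp : PolyBdd (fun j : J => n j.1) fun j => ‖M j.1‖ := hM.poly.comp Prod.fst
  have hKpoly : PolyBdd n fun i => ‖K i‖ := by
    have := (qfield_minusGen (S := S) (lm := lm) (r := r) hW s).sum_poly
    simpa only [sum_minusGenField hW s] using this
  have hGp : PolyBdd (fun j : J => n j.1) fun j => ‖G j.1‖ :=
    (hKpoly.norm_sub (polyBdd_charge s S)).comp Prod.fst
  have hfar : Rapid (fun j : J => n j.1) (fun j => ‖cm (M j.1) (Kp j.1 j.2)‖) := by
    have h1 := (qfield_plusGen (n := fun j : J => n j.1) (S := fun j : J => S j.1) (lm := fun j : J => lm j.1)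
      (r := r) hW (fun j : J => s j.1) (fun j : J => -(j.2 : ℝ))).near_sum (D := fun j : J => sdist (lp j.1))
      (fun j => isLip_sdist _) (support_plusGen (n := fun j : J => n j.1) (fun j => s j.1)
        (fun j => hS j.1) hr _)
    simp only [sum_plusGenField (n := fun j : J => n j.1) hW (fun j => s j.1)] at h1
    exact (hM.comp Prod.fst).rapid_cm h1 (separated_lines fun j => hS j.1)
  have hnear : Rapid (fun j : J => n j.1) (fun j => ‖cm (M j.1) (K j.1 - Km j.1 j.2)‖) := by
    have h1 := rapidEq_minusGen (n := fun j : J => n j.1) (r := r) hW (fun j => s j.1)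
      (fun j => hS j.1) hr (fun j => -(j.2 : ℝ))
    refine (Rapid.mul_poly h1 ((PolyBdd.const 2).mul hMp)).mono fun j => ?_
    exact (norm_cm_le _ _).trans (le_of_eq (mul_comm _ _))
  -- At each flux the generator is decomposed into an operator preserving the twisted ground states,
  -- which drops out by cyclicity, the small difference `K - Km`, and the generator at the upper
  -- line, which nearly commutes with `M`.
  have hbar : Rapid (fun j : J => n j.1)
      (fun j => ‖tr (ℙ (H' j.1 j.2) * cm (M j.1) (G j.1))‖) := by
    refine ((hfar.add hnear).const_mul (Nat.cast_nonneg p)).mono fun j => ?_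
    have h1 := (hg j.1 j.2 j.2.2).commute_quasiAdiabatic_sub hγ hW (hH' j.1 j.2)
      ((s j.1).isSelfAdjoint_charge (S j.1))
    have e0 := cm_charge_plusTwist (q j.1) (Φ j.1) (S j.1) (lm j.1) r (-j.2)
    have e1 : quasiAdiabatic W (H' j.1 j.2) (I • cm (charge (q j.1) (S j.1)) (H' j.1 j.2)) =
        Km j.1 j.2 + Kp j.1 j.2 := by
      simp only [H', Km, Kp]
      rw [e0, quasiAdiabatic_add hW.integrable (hH' j.1 j.2)]
    have e2 : G j.1 = (quasiAdiabatic W (H' j.1 j.2)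
        (I • cm (charge (q j.1) (S j.1)) (H' j.1 j.2)) - charge (q j.1) (S j.1)) +
          ((K j.1 - Km j.1 j.2) - Kp j.1 j.2) := by
      rw [e1]; simp only [G, fluxGen, K]; abel
    rw [e2, cm_add, mul_add, tr_add, tr_mul_cm_of_commute h1, zero_add]
    refine (norm_tr_groundProj_mul_le (hg j.1 j.2 j.2.2) _).trans (mul_mono_left ?_)
    rw [cm_sub, add_comm]
    exact norm_sub_le _ _
  have hproj := rapid_groundProj_transport hγ hW s hS hr hg
  -- The projection at zero flux is replaced by the transported twisted one; the conjugation then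
  -- cancels inside the trace and leaves the previous estimate.
  have hF' : Rapid (fun j : J => n j.1) (fun j => ‖tr (P j.1 *
      (I • conjExp (-j.2) (G j.1) (cm (M j.1) (G j.1))))‖) := by
    have h1 := hproj.mul_poly (((PolyBdd.const 2).mul hMp).mul hGp)
    refine (hbar.add (h1.const_mul (c := 2 * p) (by positivity))).mono fun j => ?_
    rw [mul_smul_comm, tr_smul, norm_mul, norm_I, one_mul]
    have h2 := norm_tr_groundProj_sub_le (hg0 j.1) ((hg j.1 j.2 j.2.2).conjExp (hGs j.1)
      (hH' j.1 j.2) (-j.2)) (conjExp (-j.2) (G j.1) (cm (M j.1) (G j.1)))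
    rw [groundProj_conjExp (hGs _) (hH' _ _), ← conjExp_mul, tr_conjExp] at h2
    have h3 := norm_le_norm_add_norm_sub' (tr (P j.1 * conjExp (-j.2) (G j.1) (cm (M j.1) (G j.1))))
      (tr (ℙ (H' j.1 j.2) * cm (M j.1) (G j.1)))
    refine h3.trans (add_le_add le_rfl (h2.trans ?_))
    refine mul_mono_left ?_
    rw [norm_sub_rev]
    refine mul_mono_left ?_
    exact (norm_conjExp_le _ (hGs _) _).trans (norm_cm_le _ _)
  have := Rapid.of_hasDerivWithinAt (n := n) (E := fun _ => ℂ) (T := 2 * π)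
    (F := fun i t => tr (P i * conjExp (-t) (G i) (M i)))
    (F' := fun i t => tr (P i * (I • conjExp (-t) (G i) (cm (M i) (G i)))))
    (fun i t _ => (hasDerivAt_tr_conjExp (P i) (G i) (M i) t).hasDerivWithinAt) hF'
  simpa only [neg_zero, conjExp_zero_time] using this

end Families

/-! ### Kubo's formula -/

section Single

variable {L : ℕ} [NeZero L]

theorem tr_star (A : Obs L) : tr (star A) = star (tr A) := by
  let b := stdOrthonormalBasis ℂ (Fock L)
  rw [tr, tr, LinearMap.trace_eq_sum_inner _ b, LinearMap.trace_eq_sum_inner _ b, star_sum]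
  refine sum_congr rfl fun j _ => ?_
  change inner ℂ (b j) (star A (b j)) = star (inner ℂ (b j) (A (b j)))
  rw [inner_star_right, star_def, inner_conj_symm]

theorem tr_groundProj_mul_mul (H A B : Obs L) : tr (ℙ H * (A * B)) =
    tr (ℙ H * A * ℙ H * B) +
      tr (ℙ H * A * (1 - ℙ H) * ((1 - ℙ H) * B * ℙ H)) := by
  have e : tr (ℙ H * A * (1 - ℙ H) * ((1 - ℙ H) * B * ℙ H)) =
      tr (ℙ H * A * (1 - ℙ H) * B) := by
    rw [tr_mul_comm]
    simp only [mul_assoc]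
    rw [← mul_assoc (ℙ H) (ℙ H), groundProj_mul_self, tr_mul_comm]
    simp only [mul_assoc]
    rw [tr_mul_comm]
    simp only [mul_assoc]
    rw [tr_mul_comm]
    simp only [mul_assoc]
    rw [← mul_assoc (1 - ℙ H) (1 - ℙ H), one_sub_groundProj_mul_self,
      tr_mul_comm (ℙ H)]
    simp only [mul_assoc]
  rw [e, ← tr_add, ← add_mul, ← mul_add, add_sub_cancel, mul_one, mul_assoc]

/-- Kubo's formula in terms of the quasi-adiabatic generators. -/
theorem IsGapped.tr_cm_quasiAdiabatic {γ : ℝ} {p : ℕ} {W : ℝ → ℝ} {H : Obs L} (hg : IsGapped γ p H)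
    (hγ : 0 < γ) (hW : IsFilterFunction γ W) (hH : IsSelfAdjoint H) {A B : Obs L}
    (hA : IsSelfAdjoint A) (hB : IsSelfAdjoint B) :
    I * tr (ℙ H * cm (quasiAdiabatic W H B) (quasiAdiabatic W H A)) =
      ((2 * (tr (ℙ H * A * reducedResolvent H * reducedResolvent H * B)).im : ℝ) : ℂ) := by
  have key : ∀ {A B : Obs L}, IsSelfAdjoint A → IsSelfAdjoint B →
      tr (ℙ H * (quasiAdiabatic W H A * quasiAdiabatic W H B)) =
        tr (ℙ H * quasiAdiabatic W H A * ℙ H * quasiAdiabatic W H B) +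
          tr (ℙ H * A * reducedResolvent H * reducedResolvent H * B) := by
    intro A B hA hB
    have hR := isSelfAdjoint_reducedResolvent hH
    have hP := isSelfAdjoint_groundProj H
    have e1 := hg.proj_mul_quasiAdiabatic_mul hγ hW hH A
    have e2 : (1 - ℙ H) * quasiAdiabatic W H B * ℙ H =
        I • (reducedResolvent H * B * ℙ H) := by
      have h := congrArg star (hg.proj_mul_quasiAdiabatic_mul hγ hW hH B)
      simp only [star_mul, star_sub, star_one, star_neg, star_smul, hP.star_eq, hR.star_eq, hB.star_eq,
        (isSelfAdjoint_quasiAdiabatic (W := W) hH hB).star_eq, star_def, conj_I,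
        neg_smul, neg_neg] at h
      simpa only [mul_assoc] using h
    rw [tr_groundProj_mul_mul, e1, e2]
    congr 1
    rw [neg_mul, smul_mul_assoc, mul_smul_comm, smul_smul, I_mul_I, neg_one_smul, neg_neg,
      tr_mul_comm]
    simp only [mul_assoc]
    rw [← mul_assoc (ℙ H) (ℙ H), groundProj_mul_self, tr_mul_comm]
    simp only [mul_assoc]
    rw [tr_mul_comm]
    simp only [mul_assoc]
  -- The block diagonal contributions are symmetric in the two generators and cancel in the
  -- commutator. The remaining two are complex conjugates of each other, which produces the
  -- imaginary part.
  have hcyc : tr (ℙ H * quasiAdiabatic W H B * ℙ H * quasiAdiabatic W H A) =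
      tr (ℙ H * quasiAdiabatic W H A * ℙ H * quasiAdiabatic W H B) := by
    rw [mul_assoc, tr_mul_comm, mul_assoc]
    simp only [mul_assoc]
  have hstar : tr (ℙ H * B * reducedResolvent H * reducedResolvent H * A) =
      star (tr (ℙ H * A * reducedResolvent H * reducedResolvent H * B)) := by
    rw [← tr_star]
    simp only [star_mul, (isSelfAdjoint_groundProj H).star_eq, hA.star_eq, hB.star_eq,
      (isSelfAdjoint_reducedResolvent hH).star_eq]
    rw [mul_assoc, mul_assoc, mul_assoc, tr_mul_comm]
    simp only [mul_assoc]
  rw [cm, mul_sub, tr_sub, key hB hA, key hA hB, hcyc, hstar]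
  generalize tr (ℙ H * A * reducedResolvent H * reducedResolvent H * B) = z
  apply Complex.ext <;> simp <;> ring

end Single

section Families

variable {ι : Type} {n : ι → ℕ} [∀ i, NeZero (n i)] {Rq RΦ r p : ℕ} {mq mΦ γ : ℝ} {W φ : ℝ → ℝ}
  {q Φ : Terms n} {S lm lp N nm np : Regions n}

local notation "Systems" => LocalSystems Rq RΦ mq mΦ q Φ

theorem near_minusGen (hW : IsFilterFunction γ W) (s : Systems) (hS : IsStrips S lm lp) :
    Near (sdists lm) (fun i =>
      minusGen W (q i) (Φ i) (S i) (lm i) r) := by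
  have := (qfield_minusGen (S := S) (lm := lm) (r := r) hW s).near_sum (D := sdists lm)
    isLip_sdists (support_minusGen s hS)
  simpa only [sum_minusGenField hW s] using this

theorem near_plusGen (hW : IsFilterFunction γ W) (s : Systems) (hS : IsStrips S lm lp)
    (hr : RΦ + Rq ≤ r + 1) : Near (sdists lp) (fun i =>
      plusGen W (q i) (Φ i) (S i) (lm i) r) := by
  have := (qfield_plusGen (S := S) (lm := lm) (r := r) hW s fun _ => 0).near_sum
    (D := sdists lp) isLip_sdists (support_plusGen s hS hr _)
  simpa only [sum_plusGenField hW s, plusTwist_zero] using this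

theorem near_leftGen (hW : IsFilterFunction γ W) (s : Systems) :
    Near (fun i => sdist (closer (nm i) (np i))) (fun i =>
      ∑ x, restr (fun i => closer (nm i) (np i)) (minusGenField W q Φ S lm r) i x) :=
  ((qfield_minusGen hW s).restr _).near_sum isLip_sdists
    ⟨0, fun i x hx => (sdist_eq_zero (mem_of_restr_ne_zero hx).1).le⟩

/-- The charge in a strip, dressed such that it preserves the ground state space. -/
theorem IsGapped.commute_dressed {L : ℕ} [NeZero L] {q Φ : Region L → Obs L}
    {S l : Region L} (hg : IsGapped γ p (hamiltonian Φ)) (hγ : 0 < γ)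
    (hW : IsFilterFunction γ W) (s : LocalSystem Rq RΦ mq mΦ q Φ) :
    Commute (charge q S - minusGen W q Φ S l r -
      plusGen W q Φ S l r) (ℙ (hamiltonian Φ)) := by
  have h := hg.commute_quasiAdiabatic_sub hγ hW s.isSelfAdjoint_hamiltonian (s.isSelfAdjoint_charge S)
  rw [cm_charge_hamiltonian q Φ S l r, quasiAdiabatic_add hW.integrable s.isSelfAdjoint_hamiltonian] at h
  have := h.neg_left
  rwa [neg_sub, ← sub_sub] at this

/-- The transported charge is given by Kubo's formula. -/
theorem rapid_tr_transportMinus (hγ : 0 < γ) (hW : IsFilterFunction γ W) (s : Systems)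
    (hS : IsStrips S lm lp) (hN : IsStrips N nm np) (hr : RΦ + Rq ≤ r + 1)
    (hg : IsFluxGapped γ p q Φ S lm r) :
    Rapid n (fun i => ‖tr (ℙ (hamiltonian (Φ i)) * transportMinus W q Φ S lm N nm np r i) -
      ((2 * π * (2 * (tr (ℙ (hamiltonian (Φ i)) *
        minusCurrent (q i) (Φ i) (S i) (lm i) r * reducedResolvent (hamiltonian (Φ i)) *
        reducedResolvent (hamiltonian (Φ i)) *
        minusCurrent (q i) (Φ i) (N i) (nm i) r)).im) : ℝ) : ℂ)‖) := by
  let J := ι × Set.Icc 0 (2 * π)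
  let G := fun i => fluxGen W (q i) (Φ i) (S i) (lm i) r
  let Gl := fun i => ∑ x, leftField W q Φ S lm nm np r i x
  let Kl := fun i => ∑ x, restr (fun i => closer (nm i) (np i)) (minusGenField W q Φ S lm r) i x
  let Kr := fun i => ∑ x, rightField W q Φ S lm nm np r i x
  let Q := fun i => charge (q i) (N i)
  let P := fun i => ℙ (hamiltonian (Φ i))
  let M := fun i => cm (Q i) (Gl i)
  let K := fun i => minusGen W (q i) (Φ i) (S i) (lm i) r
  let Nm := fun i => minusGen W (q i) (Φ i) (N i) (nm i) r
  let Np := fun i => plusGen W (q i) (Φ i) (N i) (nm i) r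
  have hg0 := hg.gapped
  have hMl : ∀ i, M i = cm (Q i) (Kl i) := fun i => by
    simp only [M, Gl]
    rw [sum_left, cm_sub, cm_eq_zero.2 ((s i).commute_charge _ _), sub_zero]
  have hMn : Near (sdists nm) M := near_cm_charge_left hW s hN
  have hMs : Near (sdists lm) M := by
    obtain ⟨c, hc⟩ := support_minusGen (W := W) (r := r) s hS
    have := ((qfield_minusGen (S := S) (lm := lm) (r := r) hW s).restr
      (fun i => closer (nm i) (np i))).near_cm (sfield_charge (S := N) s).qfield
      (D := sdists lm) isLip_sdists
      ⟨c, fun i x hx => hc i x (mem_of_restr_ne_zero hx).2⟩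
    simp only [sum_gather_charge] at this
    rw [show M = fun i => cm (Q i) (Kl i) from funext hMl]
    exact this.cm_swap
  have h1 := hMn.rapid_conj_left (S := S) (lm := lm) (r := r) hW s hN
  have h2 := rapid_tr_transport hγ hW s hS hr hg hMs
  -- `M` is localized near both lines. Being near `nm`, it does not distinguish the left generator
  -- from the full one; being near `lm`, its expectation is invariant under the flow of the latter.
  -- So the transported charge grows linearly.
  have hF' : Rapid (fun j : J => n j.1) (fun j => ‖tr (P j.1 * (I •
      conjExp (-j.2) (Gl j.1) (M j.1))) - I * tr (P j.1 * M j.1)‖) := by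
    refine ((h1.const_mul (Nat.cast_nonneg p)).add h2).mono fun j => ?_
    rw [mul_smul_comm, tr_smul, ← mul_sub, norm_mul, norm_I, one_mul]
    have e := norm_tr_groundProj_mul_le (hg0 j.1) (conjExp (-j.2) (Gl j.1) (M j.1) -
      conjExp (-j.2) (G j.1) (M j.1))
    rw [mul_sub, tr_sub] at e
    exact (norm_sub_le_norm_sub_add_norm_sub _ _ _).trans (add_le_add e le_rfl)
  have h3 := Rapid.of_hasDerivWithinAt (n := n) (E := fun _ => ℂ) (T := 2 * π)
    (F := fun i t => tr (P i * conjExp (-t) (Gl i) (Q i)) - (t : ℂ) * (I * tr (P i * M i)))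
    (F' := fun i t => tr (P i * (I • conjExp (-t) (Gl i) (M i))) - I * tr (P i * M i))
    (fun i t _ => by
      have d2 := (ofRealCLM.hasDerivAt (x := t)).mul_const (I * tr (P i * M i))
      refine ((hasDerivAt_tr_conjExp (P i) (Gl i) (Q i) t).sub d2).hasDerivWithinAt.congr_deriv ?_
      simp [M]) hF'
  have h4 := h3.comp (fun i : ι => ((i, ⟨2 * π, Real.two_pi_pos.le, le_rfl⟩) : J))
  -- The doubly dressed charge preserves the ground states, so the charge may be traded for its two
  -- dressings in the expectation. The dressing at `np` nearly commutes with `Kl`, and the one at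
  -- `nm` with `Kr`, which completes `Kl` to `K`.
  have h5 : Rapid n (fun i => ‖tr (P i * M i) - tr (P i * cm (Nm i) (K i))‖) := by
    have a1 : Rapid n (fun i => ‖cm (Np i) (Kl i)‖) :=
      (near_plusGen hW s hN hr).rapid_cm (near_leftGen hW s) (separated_closer hN)
    have a2 : Rapid n (fun i => ‖cm (Nm i) (Kr i)‖) :=
      (near_minusGen hW s hN).rapid_cm (near_right hW s) (separated_closer fun i => (hN i).symm)
    refine ((a1.add a2).const_mul (Nat.cast_nonneg p)).mono fun i => ?_
    have c1 := (hg0 i).commute_dressed (S := N i) (l := nm i) (r := r) hγ hW (s i)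
    have e1 : K i = Kl i + Kr i := by
      simp only [K, Kl, Kr, rightField]
      rw [sum_restr_add, sum_minusGenField hW s]
    have e2 : M i - cm (Nm i) (K i) = (cm (Np i) (Kl i) - cm (Nm i) (Kr i)) -
        cm (Kl i) (Q i - Nm i - Np i) := by
      rw [hMl, e1]; simp only [cm]; noncomm_ring
    rw [← tr_sub, ← mul_sub, e2, mul_sub, tr_sub, tr_mul_cm_of_commute c1, sub_zero]
    exact (norm_tr_groundProj_mul_le (hg0 i) _).trans (mul_mono_left (norm_sub_le _ _))
  refine (h4.add (h5.const_mul Real.two_pi_pos.le)).mono fun i => ?_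
  have e3 := (hg0 i).tr_cm_quasiAdiabatic hγ hW (s i).isSelfAdjoint_hamiltonian
    ((s i).isSelfAdjoint_minusCurrent (S := S i) (l := lm i) (r := r))
    ((s i).isSelfAdjoint_minusCurrent (S := N i) (l := nm i) (r := r))
  rw [ofReal_mul, ← e3, transportMinus, mul_sub, tr_sub]
  have e4 : ∀ a b c d : ℂ, a - b - ((2 * π : ℝ) : ℂ) * (I * d) =
      (a - ((2 * π : ℝ) : ℂ) * (I * c)) - (b - ((0 : ℝ) : ℂ) * (I * c)) +
        ((2 * π : ℝ) : ℂ) * (I * (c - d)) := fun a b c d => by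
    push_cast; ring
  rw [e4 _ _ (tr (P i * M i)) _]
  refine (norm_add_le _ _).trans (add_le_add (le_of_eq ?_) (le_of_eq ?_))
  · simp only [neg_zero, conjExp_zero_time]
    rfl
  · rw [norm_mul, norm_mul, norm_I, one_mul, norm_real, Real.norm_eq_abs,
      abs_of_pos Real.two_pi_pos]

end Families

/-! ### Energy estimates for operators at two distant lines -/

section Single

variable {L : ℕ} [NeZero L] {γ : ℝ} {p : ℕ} {H : Obs L}

theorem norm_mul_mul_le_of_le_one {A B : Obs L} (hA : ‖A‖ ≤ 1) (hB : ‖B‖ ≤ 1) (X : Obs L) :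
    ‖A * X * B‖ ≤ ‖X‖ := (norm_mul_le_of_le_one hB).trans (norm_mul_le_of_le_one' hA)

theorem norm_star_conj_sub_le {A : Obs L} (hA : star A * A = 1) (X : Obs L) :
    ‖star A * X * A - X‖ ≤ ‖cm X A‖ := by
  have e : star A * X * A - X = star A * cm X A := by
    rw [cm, mul_sub, ← mul_assoc, ← mul_assoc, hA, one_mul]
  rw [e]
  exact norm_mul_le_of_le_one' (by rw [norm_star]; exact norm_le_one_of_unitary hA)

theorem norm_excitation_le (hH : IsSelfAdjoint H) : ‖excitation H‖ ≤ 2 * ‖H‖ := by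
  have h1 : ‖groundEnergy H‖ ≤ ‖H‖ := spectrum.norm_le_norm_of_mem (groundEnergy_mem hH)
  refine (norm_sub_le _ _).trans ?_
  rw [norm_smul, norm_real]
  have h2 : ‖(1 : Obs L)‖ ≤ 1 := ContinuousLinearMap.norm_id_le
  have := mul_le_mul h1 h2 (norm_nonneg _) (norm_nonneg _)
  linarith

theorem norm_cm_groundProj_le (X : Obs L) : ‖cm X (ℙ H)‖ ≤
    ‖(1 - ℙ H) * X * ℙ H‖ + ‖(1 - ℙ H) * star X * ℙ H‖ := by
  have hP := (isSelfAdjoint_groundProj H).star_eq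
  have e : cm X (ℙ H) = (1 - ℙ H) * X * ℙ H -
      star ((1 - ℙ H) * star X * ℙ H) := by
    simp only [star_mul, star_sub, star_one, star_star, hP, cm]
    noncomm_ring
  rw [e]
  refine (norm_sub_le _ _).trans ?_
  rw [norm_star]

theorem norm_cm_star_le {A : Obs L} (hA : star A * A = 1) (hA' : A * star A = 1) (B : Obs L) :
    ‖cm (star A) B‖ ≤ ‖cm A B‖ := by
  have e : cm (star A) B = -(star A * cm A B * star A) := by
    simp only [cm, mul_sub, sub_mul]
    rw [← mul_assoc (star A) A B, hA, one_mul, ← mul_assoc (star A) B A, mul_assoc _ A (star A), hA',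
      mul_one]
    abel
  rw [e, norm_neg]
  have h1 : ‖star A‖ ≤ 1 := by rw [norm_star]; exact norm_le_one_of_unitary hA
  exact norm_mul_mul_le_of_le_one h1 h1 _

/-- A unitary which is localized away from a part of the Hamiltonian approximately preserves the ground
state space, if its product with a unitary localized away from the other part does. -/
theorem IsGapped.norm_sq_le_of_mul (hg : IsGapped γ p H) (hγ : 0 < γ) (hH : IsSelfAdjoint H)
    {Ha Hb A B Z : Obs L} (hab : H = Ha + Hb) (hA : star A * A = 1) (hA' : A * star A = 1)
    (hB : star B * B = 1) (hZ : Commute Z (ℙ H)) :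
    ‖(1 - ℙ H) * A * ℙ H‖ ^ 2 ≤ γ⁻¹ * (2 * ‖cm Hb A‖ + 2 * ‖cm Ha B‖ +
      2 * ‖Ha‖ * ‖cm A B‖ + 2 * ‖H‖ * ‖A * B - Z‖) := by
  refine (hg.norm_sq_le hγ hH A B).trans (mul_mono_left ?_ (inv_nonneg.2 hγ.le))
  have hPe : excitation H * ℙ H = 0 := excitation_mul_groundProj H
  set P := ℙ H with hP
  set e := excitation H with he
  have nA : ‖A‖ ≤ 1 := norm_le_one_of_unitary hA
  have nB : ‖B‖ ≤ 1 := norm_le_one_of_unitary hB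
  have nA' : ‖star A‖ ≤ 1 := by rwa [norm_star]
  have nB' : ‖star B‖ ≤ 1 := by rwa [norm_star]
  have nP : ‖P‖ ≤ 1 := norm_groundProj_le H
  -- The energies added by the two unitaries separately sum up to the energy added by their product,
  -- up to the listed errors: `A` hardly affects `Hb`, `B` hardly affects `Ha`, and the two nearly
  -- commute. In the ground states the product adds almost no energy.
  have e1 : star A * e * A + star B * e * B - e - star B * (star A * e * A) * B =
      (star A * Hb * A - Hb) + (star B * Ha * B - Ha) -
        (star B * (star A * Ha * A) * B - star A * Ha * A) - star B * (star A * Hb * A - Hb) * B := by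
    have c1 : star A * e * A = star A * Ha * A + star A * Hb * A - (groundEnergy H : ℂ) • 1 := by
      simp only [he, excitation, hab, mul_sub, sub_mul, mul_add, add_mul, mul_smul_comm, smul_mul_assoc,
        mul_one, hA]
    have c2 : star B * e * B = star B * Ha * B + star B * Hb * B - (groundEnergy H : ℂ) • 1 := by
      simp only [he, excitation, hab, mul_sub, sub_mul, mul_add, add_mul, mul_smul_comm, smul_mul_assoc,
        mul_one, hB]
    have c3 : e = Ha + Hb - (groundEnergy H : ℂ) • 1 := by rw [he, excitation, ← hab]
    rw [c1, c2, c3]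
    simp only [mul_sub, sub_mul, mul_add, add_mul, mul_smul_comm, smul_mul_assoc, mul_one, hB]
    abel
  have b1 := norm_star_conj_sub_le hA Hb
  have b2 := norm_star_conj_sub_le hB Ha
  have b3 := norm_star_conj_sub_le hB (star A * Ha * A)
  have b4 : ‖star B * (star A * Hb * A - Hb) * B‖ ≤ ‖cm Hb A‖ :=
    (norm_mul_mul_le_of_le_one nB' nB _).trans b1
  have b5 : ‖cm (star A * Ha * A) B‖ ≤ ‖cm Ha B‖ + 2 * ‖Ha‖ * ‖cm A B‖ := by
    have c1 : cm (star A * Ha * A) B =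
        star A * (Ha * cm A B) + star A * cm Ha B * A + cm (star A) B * (Ha * A) := by
      simp only [cm]; noncomm_ring
    rw [c1]
    have d1 : ‖star A * (Ha * cm A B)‖ ≤ ‖Ha‖ * ‖cm A B‖ :=
      (norm_mul_le_of_le_one' nA').trans (norm_mul_le _ _)
    have d2 : ‖star A * cm Ha B * A‖ ≤ ‖cm Ha B‖ := norm_mul_mul_le_of_le_one nA' nA _
    have d3 : ‖cm (star A) B * (Ha * A)‖ ≤ ‖cm A B‖ * ‖Ha‖ :=
      (norm_mul_le _ _).trans (mul_le_mul (norm_cm_star_le hA hA' B) (norm_mul_le_of_le_one nA)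
        (norm_nonneg _) (norm_nonneg _))
    refine (norm_add₃_le).trans ?_
    linarith
  have hΔ : ‖star A * e * A + star B * e * B - e - star B * (star A * e * A) * B‖ ≤
      2 * ‖cm Hb A‖ + 2 * ‖cm Ha B‖ + 2 * ‖Ha‖ * ‖cm A B‖ := by
    rw [e1]
    refine (norm_sub_le _ _).trans ?_
    have := norm_sub_le ((star A * Hb * A - Hb) + (star B * Ha * B - Ha))
      (star B * (star A * Ha * A) * B - star A * Ha * A)
    have := norm_add_le (star A * Hb * A - Hb) (star B * Ha * B - Ha)
    linarith
  have hZ' : ‖P * (star B * (star A * e * A) * B) * P‖ ≤ 2 * ‖H‖ * ‖A * B - Z‖ := by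
    have c1 : P * (star B * (star A * e * A) * B) * P =
        P * (star B * star A) * (e * ((A * B - Z) * P)) := by
      have : e * (Z * P) = 0 := by rw [hZ.eq, ← mul_assoc, hPe, zero_mul]
      rw [sub_mul, mul_sub, this, sub_zero]
      simp only [mul_assoc]
    rw [c1]
    have n1 : ‖P * (star B * star A)‖ ≤ 1 :=
      (norm_mul_le_of_le_one' nP).trans ((norm_mul_le_of_le_one' nB').trans nA')
    refine (norm_mul_le_of_le_one' n1).trans ((norm_mul_le _ _).trans ?_)
    exact mul_le_mul (norm_excitation_le hH) (norm_mul_le_of_le_one nP) (norm_nonneg _) (by positivity)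
  have e2 : P * (star A * e * A + star B * e * B) * P =
      P * (star A * e * A + star B * e * B - e - star B * (star A * e * A) * B) * P +
        P * (star B * (star A * e * A) * B) * P := by
    have : P * e * P = 0 := by rw [mul_assoc, hPe, mul_zero]
    simp only [mul_add, add_mul, mul_sub, sub_mul, this]
    abel
  rw [e2]
  refine (norm_add_le _ _).trans (add_le_add ((norm_mul_mul_le_of_le_one nP nP _).trans hΔ) hZ')

/-- The additive version of `IsGapped.norm_sq_le_of_mul`. -/
theorem IsGapped.norm_sq_le_of_add (hg : IsGapped γ p H) (hγ : 0 < γ) (hH : IsSelfAdjoint H)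
    {Ha Hb X Y : Obs L} (hab : H = Ha + Hb) (hX : IsSelfAdjoint X) (hY : IsSelfAdjoint Y) :
    ‖(1 - ℙ H) * X * ℙ H‖ ^ 2 ≤ γ⁻¹ * (2 * ‖X‖ * ‖cm Ha Y‖ +
      2 * ‖cm X Hb‖ * ‖Y‖ + 2 * ‖Hb‖ * ‖cm X Y‖ +
        ‖X + Y‖ * (2 * ‖H‖ * ‖cm (X + Y) (ℙ H)‖)) := by
  refine (hg.norm_sq_le hγ hH X Y).trans (mul_mono_left ?_ (inv_nonneg.2 hγ.le))
  have hPe : excitation H * ℙ H = 0 := excitation_mul_groundProj H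
  have hPe' : ℙ H * excitation H = 0 := groundProj_mul_excitation hH
  have hcm : cm H Y = cm (excitation H) Y := (cm_excitation H Y).symm
  have nP : ‖ℙ H‖ ≤ 1 := norm_groundProj_le H
  have ne := norm_excitation_le hH
  set P := ℙ H with hP
  set e := excitation H with he
  rw [hX.star_eq, hY.star_eq]
  -- Completing the square: the mixed terms form a double commutator because the excitation operator
  -- annihilates ground states on either side. That double commutator is small when `X` and `Y` are
  -- localized away from each other.
  have e1 : P * (X * e * X + Y * e * Y) * P =
      P * (X + Y) * (e * cm (X + Y) P) - P * cm X (cm H Y) * P := by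
    have c1 : e * cm (X + Y) P = e * (X + Y) * P := by
      rw [cm, mul_sub, ← mul_assoc, ← mul_assoc, hPe, zero_mul, sub_zero]
    have c2 : P * cm X (cm H Y) * P = P * (X * e * Y + Y * e * X) * P := by
      rw [hcm]
      have d1 : P * cm X (cm e Y) * P = P * (X * e * Y + Y * e * X) * P -
          P * X * Y * (e * P) - (P * e) * Y * X * P := by
        simp only [cm]; noncomm_ring
      rw [d1, hPe, hPe', mul_zero, sub_zero, zero_mul, zero_mul, zero_mul, sub_zero]
    rw [c1, c2]; noncomm_ring
  have b1 : ‖cm X (cm H Y)‖ ≤ 2 * ‖X‖ * ‖cm Ha Y‖ + 2 * ‖cm X Hb‖ * ‖Y‖ + 2 * ‖Hb‖ * ‖cm X Y‖ := by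
    have c1 : cm X (cm H Y) = cm X (cm Ha Y) + cm (cm X Hb) Y + cm Hb (cm X Y) := by
      rw [hab]; simp only [cm]; noncomm_ring
    rw [c1]
    exact norm_add₃_le.trans (add_le_add (add_le_add (norm_cm_le _ _) (norm_cm_le _ _))
      (norm_cm_le _ _))
  have b2 : ‖P * (X + Y) * (e * cm (X + Y) P)‖ ≤ ‖X + Y‖ * (2 * ‖H‖ * ‖cm (X + Y) P‖) :=
    (norm_mul_le _ _).trans (mul_le_mul (norm_mul_le_of_le_one' nP)
      ((norm_mul_le _ _).trans (mul_mono_right ne)) (norm_nonneg _) (norm_nonneg _))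
  rw [e1]
  have b3 := norm_mul_mul_le_of_le_one nP nP (cm X (cm H Y))
  have := norm_sub_le (P * (X + Y) * (e * cm (X + Y) P)) (P * cm X (cm H Y) * P)
  linarith

/-- Two cocycles of the same perturbation agree if the two dynamics agree on it. -/
theorem norm_cocycle_sub_le {A A' B : Obs L} (hA : IsSelfAdjoint A) (hA' : IsSelfAdjoint A')
    (hB : IsSelfAdjoint B) {T M : ℝ} (hT : 0 ≤ T)
    (h : ∀ t ∈ Set.Icc 0 T, ‖conjExp t A B - conjExp t A' B‖ ≤ M) :
    ‖expI T (A + B) * expI (-T) A - expI T (A' + B) * expI (-T) A'‖ ≤ M * T := by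
  let f : ℝ → Obs L := fun t => expI t (A + B) * expI (-t) A
  let g : ℝ → Obs L := fun t => expI t A' * expI (-t) (A' + B)
  have hf : ∀ t, HasDerivAt f (I • (f t * conjExp t A B)) t := fun t => by
    refine ((hasDerivAt_expI' t (A + B)).mul (hasDerivAt_expI_neg t A)).congr_deriv ?_
    have e : f t * conjExp t A B = expI t (A + B) * B * expI (-t) A := by
      simp only [f, conjExp]
      rw [mul_assoc (expI t (A + B)), ← mul_assoc (expI (-t) A), ← mul_assoc (expI (-t) A),
        expI_neg_mul_self, one_mul, mul_assoc]
    rw [e]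
    simp only [mul_add, add_mul, smul_mul_assoc, mul_smul_comm, mul_neg, smul_add, mul_assoc]
    abel
  have hg : ∀ t, HasDerivAt g (-(I • (conjExp t A' B * g t))) t := fun t => by
    refine ((hasDerivAt_expI' t A').mul (hasDerivAt_expI_neg t (A' + B))).congr_deriv ?_
    have e : conjExp t A' B * g t = expI t A' * B * expI (-t) (A' + B) := by
      simp only [g, conjExp]
      rw [mul_assoc _ (expI (-t) A'), ← mul_assoc (expI (-t) A') (expI t A'), expI_neg_mul_self,
        one_mul]
    rw [e]
    simp only [mul_add, add_mul, smul_mul_assoc, mul_smul_comm, mul_neg, smul_add, neg_add, mul_assoc]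
    abel
  have nf : ∀ t, ‖f t‖ ≤ 1 := fun t =>
    (norm_mul_le_of_le_one (norm_expI_le _ hA)).trans (norm_expI_le _ (hA.add hB))
  have ng : ∀ t, ‖g t‖ ≤ 1 := fun t =>
    (norm_mul_le_of_le_one (norm_expI_le _ (hA'.add hB))).trans (norm_expI_le _ hA')
  have hd : ∀ t ∈ Set.Icc 0 T, HasDerivWithinAt (fun t => f t * g t)
      (I • (f t * (conjExp t A B - conjExp t A' B) * g t)) (Set.Icc 0 T) t := fun t _ => by
    refine ((hf t).mul (hg t)).hasDerivWithinAt.congr_deriv ?_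
    simp only [smul_mul_assoc, mul_neg, mul_smul_comm, mul_sub, sub_mul, smul_sub, mul_assoc]
    abel
  have h1 := norm_image_sub_le_of_norm_deriv_le_segment' hd (C := M) (fun t ht => by
    rw [norm_smul, norm_I, one_mul]
    exact (norm_mul_mul_le_of_le_one (nf t) (ng t) _).trans (h t (Set.Ico_subset_Icc_self ht))) T
    (Set.right_mem_Icc.2 hT)
  have e0 : f 0 * g 0 = 1 := by simp [f, g, expI_zero]
  rw [e0, sub_zero] at h1
  have e1 : expI T (A + B) * expI (-T) A - expI T (A' + B) * expI (-T) A' =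
      (f T * g T - 1) * (expI T (A' + B) * expI (-T) A') := by
    have : g T * (expI T (A' + B) * expI (-T) A') = 1 := by
      simp only [g]
      rw [mul_assoc, ← mul_assoc (expI (-T) (A' + B)), expI_neg_mul_self, one_mul, expI_mul_neg_self]
    rw [sub_mul, mul_assoc, this, mul_one, one_mul]
  rw [e1]
  exact (norm_mul_le_of_le_one ((norm_mul_le_of_le_one (norm_expI_le _ hA')).trans
    (norm_expI_le _ (hA'.add hB)))).trans h1

theorem norm_expI_sub_le {A B : Obs L} (hA : IsSelfAdjoint A) (hB : IsSelfAdjoint B) {T : ℝ}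
    (hT : 0 ≤ T) : ‖expI T A - expI T B‖ ≤ ‖A - B‖ * T := by
  have hd : ∀ t ∈ Set.Icc 0 T, HasDerivWithinAt (fun t => expI t A * expI (-t) B)
      (I • (expI t A * (A - B) * expI (-t) B)) (Set.Icc 0 T) t := fun t _ => by
    refine ((hasDerivAt_expI' t A).mul (hasDerivAt_expI_neg t B)).hasDerivWithinAt.congr_deriv ?_
    simp only [smul_mul_assoc, mul_neg, mul_smul_comm, mul_sub, sub_mul, smul_sub, mul_assoc]
    abel
  have h1 := norm_image_sub_le_of_norm_deriv_le_segment' hd (C := ‖A - B‖) (fun t ht => by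
    rw [norm_smul, norm_I, one_mul]
    exact norm_mul_mul_le_of_le_one (norm_expI_le _ hA) (norm_expI_le _ hB) _) T
    (Set.right_mem_Icc.2 hT)
  rw [neg_zero, expI_zero, expI_zero, one_mul, sub_zero] at h1
  have e1 : expI T A - expI T B = (expI T A * expI (-T) B - 1) * expI T B := by
    rw [sub_mul, mul_assoc, expI_neg_mul_self, mul_one, one_mul]
  rw [e1]
  exact (norm_mul_le_of_le_one (norm_expI_le _ hB)).trans h1

end Single

/-! ### Dressed charges and their exponentials -/

section Dressed

variable {L : ℕ} [NeZero L] (W : ℝ → ℝ) (q Φ : Region L → Obs L) (S l : Region L) (r : ℕ)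

/-- The charge in a strip, dressed at the lower line. -/
def dressedMinus : Obs L := charge q S - minusGen W q Φ S l r

/-- The charge in a strip, dressed at the upper line. -/
def dressedPlus : Obs L := charge q S - plusGen W q Φ S l r

/-- The charge in a strip, dressed at both lines. -/
def dressedCharge : Obs L :=
  charge q S - minusGen W q Φ S l r -
    plusGen W q Φ S l r

variable {W q Φ S l r} {Rq RΦ : ℕ} {mq mΦ : ℝ}

local notation "System" => LocalSystem Rq RΦ mq mΦ q Φ

theorem LocalSystem.isSelfAdjoint_minusGen (s : System) :
    IsSelfAdjoint (minusGen W q Φ S l r) :=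
  isSelfAdjoint_quasiAdiabatic s.isSelfAdjoint_hamiltonian s.isSelfAdjoint_minusCurrent

theorem LocalSystem.isSelfAdjoint_plusGen (s : System) :
    IsSelfAdjoint (plusGen W q Φ S l r) :=
  isSelfAdjoint_quasiAdiabatic s.isSelfAdjoint_hamiltonian (s.isSelfAdjoint_plusCurrent 0)

theorem LocalSystem.isSelfAdjoint_dressedMinus (s : System) :
    IsSelfAdjoint (dressedMinus W q Φ S l r) := (s.isSelfAdjoint_charge S).sub s.isSelfAdjoint_minusGen

theorem LocalSystem.isSelfAdjoint_dressedPlus (s : System) :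
    IsSelfAdjoint (dressedPlus W q Φ S l r) := (s.isSelfAdjoint_charge S).sub s.isSelfAdjoint_plusGen

theorem LocalSystem.isSelfAdjoint_dressedCharge (s : System) :
    IsSelfAdjoint (dressedCharge W q Φ S l r) :=
  ((s.isSelfAdjoint_charge S).sub s.isSelfAdjoint_minusGen).sub s.isSelfAdjoint_plusGen

theorem LocalSystem.expI_neg_charge (s : System) (S : Region L) :
    expI (-(2 * π)) (charge q S) = 1 := by
  have h' := expI_mul_neg_self (2 * π) (charge q S)
  rwa [s.expI_charge S, one_mul] at h'

end Dressed

section Families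

variable {ι : Type} {n : ι → ℕ} [∀ i, NeZero (n i)] {Rq RΦ r p : ℕ} {mq mΦ γ : ℝ} {W φ : ℝ → ℝ}
  {q Φ : Terms n} {S lm lp N nm np : Regions n}

local notation "Systems" => LocalSystems Rq RΦ mq mΦ q Φ

/-- The field of the charge dressed at the lower line. -/
def dressedField (W : ℝ → ℝ) (q Φ : Terms n)
    (N nm : Regions n) (r : ℕ) (i : ι) (x : Torus (n i)) : Obs (n i) :=
  gather (fun X => if X ⊆ N i then q i X else 0) x - minusGenField W q Φ N nm r i x

theorem qfield_dressed (hW : IsFilterFunction γ W) (s : Systems) :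
    QField (dressedField W q Φ N nm r) :=
  (sfield_charge s).qfield.sub (qfield_minusGen hW s)

theorem sum_dressed (hW : IsFilterFunction γ W) (s : Systems) (i : ι) :
    ∑ x, dressedField W q Φ N nm r i x = dressedMinus W (q i) (Φ i) (N i) (nm i) r := by
  simp only [dressedField]
  rw [sum_sub_distrib, sum_gather_charge, sum_minusGenField hW s, dressedMinus]

/-- The exponential of the bare charge is 1, so that of the dressed charge is a cocycle of the
dressing and lives where the dressing does. -/
theorem near_expI_dressedMinus (hW : IsFilterFunction γ W) (s : Systems) (hN : IsStrips N nm np) :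
    Near (sdists nm)
      (fun i => expI (2 * π) (dressedMinus W (q i) (Φ i) (N i) (nm i) r)) := by
  have := Near.cocycle (D := sdists nm) (Q := fun i => charge (q i) (N i))
    isLip_sdists (qfield_dressed (N := N) (nm := nm) (r := r) hW s)
    (fun i => by rw [sum_dressed hW s]; exact (s i).isSelfAdjoint_dressedMinus)
    (fun i => (s i).isSelfAdjoint_charge _) (fun i => (s i).charge_mem_univ _) (by
      simp only [sum_dressed hW s, dressedMinus, sub_sub_cancel_left]
      exact (near_minusGen hW s hN).neg)
    (T := 2 * π) (t := fun _ => 2 * π) (fun _ => (abs_of_pos Real.two_pi_pos).le)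
  simpa only [sum_dressed hW s, (s _).expI_neg_charge, mul_one] using this

theorem near_expI_dressedPlus (hW : IsFilterFunction γ W) (s : Systems) (hN : IsStrips N nm np)
    (hr : RΦ + Rq ≤ r + 1) : Near (sdists np)
      (fun i => expI (2 * π) (dressedPlus W (q i) (Φ i) (N i) (nm i) r)) := by
  have hK := (sfield_charge (S := N) s).qfield.sub
    (qfield_plusGen (S := N) (lm := nm) (r := r) hW s fun _ => 0)
  have hsum : ∀ i, ∑ x, (gather (fun X => if X ⊆ N i then q i X else 0) x -
      plusGenField W q Φ N nm r (fun _ => 0) i x) = dressedPlus W (q i) (Φ i) (N i) (nm i) r := fun i => by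
    rw [sum_sub_distrib, sum_gather_charge, sum_plusGenField hW s, dressedPlus, plusTwist_zero]
  have := Near.cocycle (D := sdists np) (Q := fun i => charge (q i) (N i))
    isLip_sdists hK (fun i => by rw [hsum]; exact (s i).isSelfAdjoint_dressedPlus)
    (fun i => (s i).isSelfAdjoint_charge _) (fun i => (s i).charge_mem_univ _) (by
      simp only [hsum, dressedPlus, sub_sub_cancel_left]
      exact (near_plusGen hW s hN hr).neg)
    (T := 2 * π) (t := fun _ => 2 * π) (fun _ => (abs_of_pos Real.two_pi_pos).le)
  simpa only [hsum, (s _).expI_neg_charge, mul_one] using this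

/-- Cocycles of a localized perturbation do not depend on the dynamics far away. -/
theorem Near.rapid_cocycle_sub {D D' : Distance n} {A B : Family n}
    {K : Density n} (hB : Near D B) (hBs : ∀ i, IsSelfAdjoint (B i))
    (hD : ∀ i, IsLip (D i)) (hK : QField K) (hs : ∀ i, IsSelfAdjoint (∑ x, K i x)) (hA : Near D' A)
    (hAs : ∀ i, IsSelfAdjoint (A i)) (hsep : Separated D D') {T : ℝ} (hT : 0 ≤ T) :
    RapidEq (fun i => expI T (∑ x, K i x + B i) * expI (-T) (∑ x, K i x))
      (fun i => expI T (∑ x, K i x + A i + B i) * expI (-T) (∑ x, K i x + A i)) := by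
  have h := (hB.comp (J := ι × Set.Icc 0 T) Prod.fst).rapid_conj_sub (fun j => hD j.1)
    (hK.comp Prod.fst) (fun j => hs j.1) (hA.comp Prod.fst) (fun j => hAs j.1) (by
      obtain ⟨c, hc⟩ := hsep
      exact ⟨c, fun j y => hc j.1 y⟩) (T := T) (t := fun j => (j.2 : ℝ))
      (fun j => by rw [abs_of_nonneg j.2.2.1]; exact j.2.2.2)
  intro k
  obtain ⟨C, hC, hb⟩ := h k
  refine ⟨C * T, by positivity, fun i => ?_⟩
  have := norm_cocycle_sub_le (hs i) ((hs i).add (hAs i)) (hBs i) hT (M := C * wt k (n i))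
    (fun t ht => hb (i, ⟨t, ht⟩))
  exact this.trans (le_of_eq (by ring))

/-- The cocycle of the lower dressing is the same whether or not the upper dressing is part of the
dynamics. With the bare exponential equal to 1 this becomes a factorization of the doubly dressed
exponential. -/
theorem rapidEq_expI_dressed (hW : IsFilterFunction γ W) (s : Systems) (hN : IsStrips N nm np)
    (hr : RΦ + Rq ≤ r + 1) :
    RapidEq (fun i => expI (2 * π) (dressedMinus W (q i) (Φ i) (N i) (nm i) r) *
        expI (2 * π) (dressedPlus W (q i) (Φ i) (N i) (nm i) r))
      (fun i => expI (2 * π) (dressedCharge W (q i) (Φ i) (N i) (nm i) r)) := by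
  have h := Near.rapid_cocycle_sub (near_minusGen (r := r) hW s hN).neg
    (fun i => (s i).isSelfAdjoint_minusGen.neg) isLip_sdists
    (sfield_charge (S := N) s).qfield
    (fun i => by rw [sum_gather_charge]; exact (s i).isSelfAdjoint_charge _)
    (near_plusGen (r := r) hW s hN hr).neg (fun i => (s i).isSelfAdjoint_plusGen.neg)
    (separated_lines hN) Real.two_pi_pos.le
  simp only [sum_gather_charge, (s _).expI_neg_charge, mul_one] at h
  refine Rapid.mono h fun i => ?_
  beta_reduce
  set Q := charge (q i) (N i)
  set A := minusGen W (q i) (Φ i) (N i) (nm i) r with hA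
  set B := plusGen W (q i) (Φ i) (N i) (nm i) r with hB
  have e1 : dressedMinus W (q i) (Φ i) (N i) (nm i) r = Q + -A := by rw [dressedMinus, sub_eq_add_neg]
  have e2 : dressedPlus W (q i) (Φ i) (N i) (nm i) r = Q + -B := by rw [dressedPlus, sub_eq_add_neg]
  have e3 : dressedCharge W (q i) (Φ i) (N i) (nm i) r = Q + -B + -A := by rw [dressedCharge]; abel
  have e4 : ∀ X Y Z : Obs (n i), Z * Y = 1 → X * Y - expI (2 * π) (Q + -B + -A) =
      (X - expI (2 * π) (Q + -B + -A) * Z) * Y := fun X Y Z h => by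
    rw [sub_mul, mul_assoc _ Z Y, h, mul_one]
  rw [e1, e2, e3, e4 _ _ _ (expI_neg_mul_self (2 * π) (Q + -B))]
  refine norm_mul_le_of_le_one (norm_expI_le _ ?_)
  exact ((s i).isSelfAdjoint_charge _).add (s i).isSelfAdjoint_plusGen.neg

theorem near_hamiltonian_left (s : Systems) : Near (fun i => sdist (closer (nm i) (np i)))
      (fun i => ∑ x, restr (fun i => closer (nm i) (np i)) (fun i => gather (Φ i)) i x) :=
  ((sfield_hamiltonian s).qfield.restr _).near_sum isLip_sdists
    ⟨0, fun i x hx => (sdist_eq_zero (mem_of_restr_ne_zero hx).1).le⟩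

theorem near_hamiltonian_right (s : Systems) : Near (fun i => sdist (closer (np i) (nm i)))
      (fun i => ∑ x, restr (fun i => (closer (nm i) (np i))ᶜ) (fun i => gather (Φ i)) i x) :=
  ((sfield_hamiltonian s).qfield.restr _).near_sum isLip_sdists
    ⟨0, fun i x hx => (sdist_eq_zero (mem_closer_of_not_mem
      (mem_compl.1 (mem_of_restr_ne_zero hx).1))).le⟩

theorem hamiltonian_eq_left_add_right (Y : Regions n) (i : ι) : hamiltonian (Φ i) =
    ∑ x, restr Y (fun i => gather (Φ i)) i x +
      ∑ x, restr (fun i => (Y i)ᶜ) (fun i => gather (Φ i)) i x := by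
  rw [sum_restr_add, hamiltonian_eq_sum]

/-- Unitaries localized at the two lines preserve the ground state space if their product does. -/
theorem rapid_offdiag_of_mul (hγ : 0 < γ) (s : Systems)
    (hN : IsStrips N nm np) (hg : ∀ i, IsGapped γ p (hamiltonian (Φ i)))
    {A B Z : Family n} (hA : Near (sdists nm) A) (hB : Near (sdists np) B)
    (hA1 : ∀ i, star (A i) * A i = 1) (hA2 : ∀ i, A i * star (A i) = 1)
    (hB1 : ∀ i, star (B i) * B i = 1) (hZ : RapidEq (fun i => A i * B i) Z)
    (hZc : ∀ i, Commute (Z i) (ℙ (hamiltonian (Φ i)))) :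
    Rapid n (fun i => ‖(1 - ℙ (hamiltonian (Φ i))) * A i * ℙ (hamiltonian (Φ i))‖) := by
  have hHp : PolyBdd n fun i => ‖hamiltonian (Φ i)‖ := by
    have := (sfield_hamiltonian s).qfield.sum_poly
    simpa only [← hamiltonian_eq_sum] using this
  have hl := near_hamiltonian_left (nm := nm) (np := np) s
  have hrt := near_hamiltonian_right (nm := nm) (np := np) s
  have r1 := hrt.rapid_cm hA (separated_closer fun i => (hN i).symm).symm
  have r2 := hl.rapid_cm hB (separated_closer hN).symm
  have r3 := hA.rapid_cm hB (separated_lines hN)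
  have h := ((((r1.const_mul two_pos.le).add (r2.const_mul two_pos.le)).add
    (r3.mul_poly ((PolyBdd.const 2).mul hl.poly))).add
    (Rapid.mul_poly hZ ((PolyBdd.const 2).mul hHp))).const_mul (inv_nonneg.2 hγ.le)
  refine Rapid.of_sq h fun i => ?_
  refine ((hg i).norm_sq_le_of_mul hγ (s i).isSelfAdjoint_hamiltonian
    (hamiltonian_eq_left_add_right (fun i => closer (nm i) (np i)) i) (hA1 i) (hA2 i) (hB1 i)
    (hZc i)).trans (le_of_eq ?_)
  ring

/-- The product of the two edge unitaries preserves the ground states, so by the energy estimate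
each does. The estimate controls one off-diagonal block only, so it is applied to the adjoint as
well. -/
theorem rapid_cm_expI_dressedMinus (hγ : 0 < γ) (hW : IsFilterFunction γ W)
    (s : Systems) (hN : IsStrips N nm np)
    (hr : RΦ + Rq ≤ r + 1) (hg : ∀ i, IsGapped γ p (hamiltonian (Φ i))) :
    Rapid n (fun i => ‖cm (expI (2 * π) (dressedMinus W (q i) (Φ i) (N i) (nm i) r))
      (ℙ (hamiltonian (Φ i)))‖) := by
  have hA := near_expI_dressedMinus (r := r) hW s hN
  have hB := near_expI_dressedPlus (r := r) hW s hN hr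
  have hZ := rapidEq_expI_dressed (r := r) hW s hN hr
  have sA : ∀ i, IsSelfAdjoint (dressedMinus W (q i) (Φ i) (N i) (nm i) r) := fun i =>
    (s i).isSelfAdjoint_dressedMinus
  have sB : ∀ i, IsSelfAdjoint (dressedPlus W (q i) (Φ i) (N i) (nm i) r) := fun i =>
    (s i).isSelfAdjoint_dressedPlus
  have hc : ∀ i t, Commute (expI t (dressedCharge W (q i) (Φ i) (N i) (nm i) r))
      (ℙ (hamiltonian (Φ i))) := fun i t =>
    (Commute.expI_right ((hg i).commute_dressed hγ hW (s i)).symm t).symm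
  have h1 := rapid_offdiag_of_mul hγ s hN hg hA hB (fun i => star_expI_mul (sA i) _)
    (fun i => expI_mul_star (sA i) _) (fun i => star_expI_mul (sB i) _) hZ (fun i => hc i _)
  have hZ' := ((hA.star.rapidEq_mul_comm hB.star (separated_lines hN)).trans
    ((RapidEq.of_eq fun i => (star_mul _ _).symm).trans hZ.star))
  have h2 := rapid_offdiag_of_mul hγ s hN hg hA.star hB.star
    (fun i => by rw [star_star]; exact expI_mul_star (sA i) _)
    (fun i => by rw [star_star]; exact star_expI_mul (sA i) _)
    (fun i => by rw [star_star]; exact expI_mul_star (sB i) _) hZ'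
    (fun i => by rw [star_expI _ (s i).isSelfAdjoint_dressedCharge]; exact hc i _)
  exact (h1.add h2).mono fun i => norm_cm_groundProj_le _

end Families

/-! ### Integrality of the transported charge -/

section Single

variable {L : ℕ} [NeZero L]

theorem norm_cm_expI_le {G P : Obs L} (hG : IsSelfAdjoint G) (t : ℝ) :
    ‖cm (expI t G) P‖ ≤ ‖conjExp (-t) G P - P‖ := by
  have e : cm (expI t G) P = -(expI t G * (conjExp (-t) G P - P)) := by
    rw [conjExp, neg_neg, mul_sub, ← mul_assoc, ← mul_assoc, expI_mul_neg_self, one_mul, cm]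
    abel
  rw [e, norm_neg]
  exact norm_mul_le_of_le_one' (norm_expI_le _ hG)

theorem norm_cm_conjExp_le {G A P : Obs L} (hG : IsSelfAdjoint G) (h : Commute A P) (t : ℝ) :
    ‖cm (conjExp t G A) P‖ ≤ 2 * ‖A‖ * ‖conjExp t G P - P‖ := by
  have e : cm (conjExp t G A) P = -cm (conjExp t G A) (conjExp t G P - P) := by
    rw [cm_sub, cm_eq_zero.2 (commute_conjExp h t G)]; abel
  rw [e, norm_neg]
  refine (norm_cm_le _ _).trans (mul_mono_right ?_)
  exact mul_mono_left (norm_conjExp_le _ hG _)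

/-- The part of an operator that preserves a subspace and its complement. -/
def blockDiag (P X : Obs L) : Obs L := P * X * P + (1 - P) * X * (1 - P)

theorem commute_blockDiag (H X : Obs L) : Commute (blockDiag (ℙ H) X) (ℙ H) := by
  have h1 := one_sub_mul_groundProj H
  have h2 := groundProj_mul_one_sub H
  have h3 := groundProj_mul_self H
  rw [Commute, SemiconjBy, blockDiag, add_mul, mul_add, mul_assoc, mul_assoc ((1 - ℙ H) * X),
    h1, h3, mul_zero, add_zero, mul_assoc (1 - ℙ H), ← mul_assoc (ℙ H) (1 - ℙ H),
    h2, zero_mul, add_zero, mul_assoc, ← mul_assoc (ℙ H) (ℙ H), h3]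

theorem tr_blockDiag (H X : Obs L) :
    tr (ℙ H * blockDiag (ℙ H) X) = tr (ℙ H * X) := by
  have h2 := groundProj_mul_one_sub H
  have h3 := groundProj_mul_self H
  rw [blockDiag, mul_add, mul_assoc (1 - ℙ H), ← mul_assoc (ℙ H) (1 - ℙ H),
    h2, zero_mul, add_zero, mul_assoc, ← mul_assoc (ℙ H) (ℙ H), h3, ← mul_assoc,
    tr_mul_comm, ← mul_assoc, h3]

theorem norm_sub_blockDiag_le (H X : Obs L) :
    ‖X - blockDiag (ℙ H) X‖ ≤ 2 * ‖cm X (ℙ H)‖ := by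
  have n1 := norm_groundProj_le H
  have n2 := norm_one_sub_groundProj_le H
  have h1 := one_sub_mul_groundProj H
  have h2 := groundProj_mul_one_sub H
  have h3 := groundProj_mul_self H
  set P := ℙ H
  have e : X - blockDiag P X = (1 - P) * cm X P * P - P * cm X P * (1 - P) := by
    have a1 : (1 - P) * cm X P * P = (1 - P) * X * P := by
      rw [cm, mul_sub, sub_mul, mul_assoc, mul_assoc X P P, h3, ← mul_assoc (1 - P) P X, h1, zero_mul,
        zero_mul, sub_zero, ← mul_assoc]
    have a2 : P * cm X P * (1 - P) = -(P * X * (1 - P)) := by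
      rw [cm, mul_sub P (X * P), sub_mul (P * (X * P)), mul_assoc P (X * P), mul_assoc X P (1 - P), h2,
        mul_zero, mul_zero, zero_sub, ← mul_assoc P P X, h3]
    rw [a1, a2, blockDiag]; noncomm_ring
  rw [e]
  refine (norm_sub_le _ _).trans ?_
  have b1 := norm_mul_mul_le_of_le_one n2 n1 (cm X P)
  have b2 := norm_mul_mul_le_of_le_one n1 n2 (cm X P)
  linarith

theorem isSelfAdjoint_blockDiag {H X : Obs L} (hX : IsSelfAdjoint X) :
    IsSelfAdjoint (blockDiag (ℙ H) X) := by
  have hP := (isSelfAdjoint_groundProj H).star_eq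
  rw [IsSelfAdjoint, blockDiag]
  simp only [star_add, star_mul, star_sub, star_one, hP, hX.star_eq, mul_assoc]

theorem norm_swap_le {A B X P : Obs L} (hA : ‖A‖ ≤ 1) (hB : ‖B‖ ≤ 1) :
    ‖A * (P * X) * B - A * (X * P) * B‖ ≤ ‖cm X P‖ := by
  have e : A * (P * X) * B - A * (X * P) * B = -(A * cm X P * B) := by rw [cm]; noncomm_ring
  rw [e, norm_neg]
  exact norm_mul_mul_le_of_le_one hA hB _

/-- The right side is $2|\sin\pi y|$ with $|y|\le1/2$ the distance to the nearest integer, and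
Jordan's inequality applies. -/
theorem four_mul_abs_sub_round_le (x : ℝ) :
    4 * |x - round x| ≤ ‖cexp (I * ((2 * π : ℝ) : ℂ) * (x : ℂ)) - 1‖ := by
  set y := x - round x with hy
  have hyle : |y| ≤ 1 / 2 := abs_sub_round x
  have e1 : cexp (I * ((2 * π : ℝ) : ℂ) * (x : ℂ)) = cexp (I * ((2 * π * y : ℝ) : ℂ)) := by
    rw [exp_eq_exp_iff_exists_int]
    refine ⟨round x, ?_⟩
    rw [hy]; push_cast; ring
  have e2 : ‖cexp (I * ((2 * π * y : ℝ) : ℂ)) - 1‖ =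
      ‖2 * Real.sin (2 * π * y / 2)‖ := norm_exp_I_mul_ofReal_sub_one _
  rw [e1, e2, norm_mul, Real.norm_eq_abs, Real.norm_eq_abs, abs_of_pos (by norm_num : (0 : ℝ) < 2)]
  have e3 : 2 * π * y / 2 = π * y := by ring
  rw [e3, Real.abs_sin_eq_sin_abs_of_abs_le_pi, abs_mul, abs_of_pos Real.pi_pos]
  · have := Real.mul_le_sin (x := π * |y|) (by positivity) (by nlinarith [Real.pi_pos])
    have e4 : 2 / π * (π * |y|) = 2 * |y| := by field_simp
    rw [e4] at this
    linarith
  · rw [abs_mul, abs_of_pos Real.pi_pos]; nlinarith [Real.pi_pos]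

theorem norm_sub_round_le (z : ℂ) (m : ℤ) : ‖z - (round z.re : ℤ)‖ ≤ 2 * ‖z - (m : ℂ)‖ := by
  have h1 : |z.re - round z.re| ≤ ‖z - (m : ℂ)‖ := by
    refine (round_le z.re m).trans ?_
    have := abs_re_le_norm (z - (m : ℂ))
    simpa using this
  have h2 : |z.im| ≤ ‖z - (m : ℂ)‖ := by
    have := abs_im_le_norm (z - (m : ℂ))
    simpa using this
  have h3 := norm_le_abs_re_add_abs_im (z - ((round z.re : ℤ) : ℂ))
  have h4 : (z - ((round z.re : ℤ) : ℂ)).re = z.re - round z.re := by simp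
  have h5 : (z - ((round z.re : ℤ) : ℂ)).im = z.im := by simp
  rw [h4, h5] at h3
  linarith

end Single

section Families

variable {ι : Type} {n : ι → ℕ} [∀ i, NeZero (n i)] {γ : ℝ} {p : ℕ}

/-- The group commutator of unitaries that preserve the ground state space has determinant one on
it. -/
theorem rapid_detOn_groupCommutator {H V A : Family n} (hg : ∀ i, IsGapped γ p (H i))
    (hV : ∀ i, star (V i) * V i = 1) (hV' : ∀ i, V i * star (V i) = 1)
    (hA : ∀ i, star (A i) * A i = 1) (hA' : ∀ i, A i * star (A i) = 1)
    (cV : Rapid n fun i => ‖cm (V i) (ℙ (H i))‖)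
    (cA : Rapid n fun i => ‖cm (A i) (ℙ (H i))‖) :
    Rapid n (fun i => ‖detOn (groundSpace (H i)) (star (V i) * A i * V i * star (A i)) - 1‖) := by
  let P := fun i => ℙ (H i)
  let d := fun i => detOn (groundSpace (H i))
  have nP : ∀ i, ‖P i‖ ≤ 1 := fun i => norm_groundProj_le _
  have nV : ∀ i, ‖V i‖ ≤ 1 := fun i => norm_le_one_of_unitary (hV i)
  have nA : ∀ i, ‖A i‖ ≤ 1 := fun i => norm_le_one_of_unitary (hA i)
  have nV' : ∀ i, ‖star (V i)‖ ≤ 1 := fun i => by rw [norm_star]; exact nV i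
  have nA' : ∀ i, ‖star (A i)‖ ≤ 1 := fun i => by rw [norm_star]; exact nA i
  have cV' : Rapid n fun i => ‖cm (star (V i)) (P i)‖ := cV.mono fun i => norm_cm_star_le (hV i) (hV' i) _
  have cA' : Rapid n fun i => ‖cm (star (A i)) (P i)‖ := cA.mono fun i => norm_cm_star_le (hA i) (hA' i) _
  have n2 : ∀ {L : ℕ} [NeZero L] {X Y : Obs L}, ‖X‖ ≤ 1 → ‖Y‖ ≤ 1 → ‖X * Y‖ ≤ 1 := fun hX hY =>
    (norm_mul_le_of_le_one hY).trans hX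
  -- Since the factors nearly commute with the projection, it can be inserted between them, after
  -- which the determinant is exactly multiplicative.
  have key : ∀ X₁ X₂ X₃ X₄ : ∀ i, Obs (n i), (∀ i, ‖X₁ i‖ ≤ 1) → (∀ i, ‖X₂ i‖ ≤ 1) →
      (∀ i, ‖X₃ i‖ ≤ 1) → (∀ i, ‖X₄ i‖ ≤ 1) → (Rapid n fun i => ‖cm (X₁ i) (P i)‖) →
      (Rapid n fun i => ‖cm (X₂ i) (P i)‖) → (Rapid n fun i => ‖cm (X₃ i) (P i)‖) →
      Rapid n fun i => ‖d i (X₁ i * X₂ i * X₃ i * X₄ i) -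
        d i (X₁ i) * d i (X₂ i) *
          d i (X₃ i) * d i (X₄ i)‖ := by
    intro X₁ X₂ X₃ X₄ h₁ h₂ h₃ h₄ c₁ c₂ c₃
    have hPP : ∀ i, P i * P i = P i := fun i => groundProj_mul_self _
    have s1 : RapidEq (fun i => P i * (X₁ i * X₂ i * X₃ i * X₄ i))
        (fun i => X₁ i * P i * (X₂ i * X₃ i * X₄ i)) := c₁.mono fun i => by
      have := norm_swap_le (A := 1) (B := X₂ i * X₃ i * X₄ i) (X := X₁ i) (P := P i)
        ContinuousLinearMap.norm_id_le (n2 (n2 (h₂ i) (h₃ i)) (h₄ i))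
      simpa only [one_mul, mul_assoc] using this
    have s2 : RapidEq (fun i => X₁ i * P i * (X₂ i * X₃ i * X₄ i))
        (fun i => X₁ i * P i * X₂ i * P i * (X₃ i * X₄ i)) := c₂.mono fun i => by
      have := norm_swap_le (A := X₁ i * P i) (B := X₃ i * X₄ i) (X := X₂ i) (P := P i)
        (n2 (h₁ i) (nP i)) (n2 (h₃ i) (h₄ i))
      rw [← mul_assoc (X₁ i * P i) (P i), mul_assoc (X₁ i) (P i) (P i), hPP] at this
      simpa only [mul_assoc] using this
    have s3 : RapidEq (fun i => X₁ i * P i * X₂ i * P i * (X₃ i * X₄ i))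
        (fun i => X₁ i * P i * X₂ i * P i * X₃ i * P i * X₄ i) := c₃.mono fun i => by
      have := norm_swap_le (A := X₁ i * P i * X₂ i * P i) (B := X₄ i) (X := X₃ i) (P := P i)
        (n2 (n2 (n2 (h₁ i) (nP i)) (h₂ i)) (nP i)) (h₄ i)
      rw [← mul_assoc (X₁ i * P i * X₂ i * P i) (P i), mul_assoc (X₁ i * P i * X₂ i) (P i) (P i),
        hPP] at this
      simpa only [mul_assoc] using this
    have hd := RapidEq.detOn hg ((s1.trans s2).trans s3)
      ((PolyBdd.const 1).mono fun i => n2 (nP i) (n2 (n2 (n2 (h₁ i) (h₂ i)) (h₃ i)) (h₄ i)))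
      ((PolyBdd.const 1).mono fun i => n2 (n2 (n2 (n2 (n2 (n2 (h₁ i) (nP i)) (h₂ i)) (nP i)) (h₃ i))
        (nP i)) (h₄ i))
    refine hd.mono fun i => le_of_eq ?_
    have e1 : d i (P i * (X₁ i * X₂ i * X₃ i * X₄ i)) =
        d i (X₁ i * X₂ i * X₃ i * X₄ i) := detOn_proj_mul _ _
    have e2 : d i (X₁ i * P i * X₂ i * P i * X₃ i * P i * X₄ i) =
        d i (X₁ i) * d i (X₂ i) * d i (X₃ i) * d i (X₄ i) := by
      simp only [d, P, groundProj, detOn_mul]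
    rw [← e1, ← e2]
  have k1 := key (fun i => star (V i)) A V (fun i => star (A i)) nV' nA nV nA' cV' cA cV
  -- The determinants are numbers, so their order is irrelevant. In the rearranged order the product
  -- of the operators is 1.
  have k2 := key (fun i => star (V i)) V A (fun i => star (A i)) nV' nV nA nA' cV' cV cA
  refine (k1.add k2).mono fun i => ?_
  have e : star (V i) * V i * A i * star (A i) = 1 := by rw [hV, one_mul, hA']
  rw [e, show d i 1 = 1 from detOn_one _, norm_sub_rev (1 : ℂ)]
  refine (norm_sub_le_norm_sub_add_norm_sub _ (d i (star (V i)) * d i (A i) * d i (V i) *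
    d i (star (A i))) _).trans (add_le_add le_rfl (le_of_eq ?_))
  congr 2
  ring

variable {Rq RΦ r : ℕ} {mq mΦ : ℝ} {W φ : ℝ → ℝ}
  {q Φ : Terms n} {S lm lp N nm np : Regions n}

local notation "Systems" => LocalSystems Rq RΦ mq mΦ q Φ

/-- After a full flux quantum the twisted Hamiltonian is the original one again, so the transported
projection returns to itself. -/
theorem rapid_groundProj_flux (hγ : 0 < γ) (hW : IsFilterFunction γ W) (s : Systems)
    (hS : IsStrips S lm lp) (hr : RΦ + Rq ≤ r + 1) (hg : IsFluxGapped γ p q Φ S lm r) :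
    Rapid n (fun i => ‖conjExp (-(2 * π)) (fluxGen W (q i) (Φ i) (S i) (lm i) r)
      (ℙ (hamiltonian (Φ i))) - ℙ (hamiltonian (Φ i))‖) := by
  have := (rapid_groundProj_transport hγ hW s hS hr hg).comp
    (fun i : ι => ((i, ⟨2 * π, Real.two_pi_pos.le, le_rfl⟩) : ι × Set.Icc 0 (2 * π)))
  simpa only [(s _).plusTwist_two_pi] using this

/-- The change of the dressed charge at the lower line under the flux insertion on the left. -/
def dressedTransport (W : ℝ → ℝ) (q Φ : Terms n)
    (S lm N nm np : Regions n) (r : ℕ) (i : ι) : Obs (n i) :=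
  conjExp (-(2 * π)) (∑ x, leftField W q Φ S lm nm np r i x)
    (dressedMinus W (q i) (Φ i) (N i) (nm i) r) - dressedMinus W (q i) (Φ i) (N i) (nm i) r

theorem isSelfAdjoint_dressedTransport (s : Systems) (i : ι) :
    IsSelfAdjoint (dressedTransport W q Φ S lm N nm np r i) :=
  (isSelfAdjoint_conjExp _ (isSelfAdjoint_left s i) (s i).isSelfAdjoint_dressedMinus).sub
    (s i).isSelfAdjoint_dressedMinus

theorem dressedMinus_mem (hW : IsFilterFunction γ W) (s : Systems) (i : ι) :
    dressedMinus W (q i) (Φ i) (N i) (nm i) r ∈ evenAlgebra univ := by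
  rw [← sum_dressed hW s]; exact (qfield_dressed hW s).sum_even i

theorem near_cm_dressed_left (hW : IsFilterFunction γ W) (s : Systems) (hN : IsStrips N nm np) :
    Near (sdists nm) (fun i => cm (dressedMinus W (q i) (Φ i) (N i) (nm i) r)
      (∑ x, leftField W q Φ S lm nm np r i x)) := by
  have h2 := (qfield_minusGen (S := N) (lm := nm) (r := r) hW s).near_cm
    (qfield_left (S := S) (lm := lm) (nm := nm) (np := np) (r := r) hW s)
    (D := sdists nm) isLip_sdists (support_minusGen s hN)
  simp only [sum_minusGenField hW s] at h2
  have := (near_cm_charge_left (S := S) (lm := lm) (r := r) hW s hN).sub h2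
  simp only [dressedMinus, sub_cm]
  exact this

theorem near_cm_dressed_right (hW : IsFilterFunction γ W) (s : Systems) (hN : IsStrips N nm np) :
    Near (sdists np) (fun i => cm (dressedMinus W (q i) (Φ i) (N i) (nm i) r)
      (∑ x, rightField W q Φ S lm nm np r i x)) := by
  have hK := near_minusGen (r := r) hW s hN
  have hR := near_right (S := S) (lm := lm) (nm := nm) (np := np) (r := r) hW s
  have h2 := Near.of_rapid_sdist (fun i => sub_mem (mul_mem (hK.even i) (hR.even i))
    (mul_mem (hR.even i) (hK.even i))) (hK.rapid_cm hR (separated_closer fun i => (hN i).symm)) np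
  have := (near_cm_charge_right (S := S) (lm := lm) (r := r) hW s hN).sub h2
  simp only [dressedMinus, sub_cm]
  exact this

theorem near_dressedTransport (hW : IsFilterFunction γ W) (s : Systems) (hN : IsStrips N nm np) :
    Near (sdists nm) (dressedTransport W q Φ S lm N nm np r) :=
  Near.conj_sub_self isLip_sdists (qfield_left hW s) (isSelfAdjoint_left s)
    (dressedMinus_mem hW s) (near_cm_dressed_left hW s hN) Real.two_pi_pos.le

theorem polyBdd_dressedCharge (hW : IsFilterFunction γ W) (s : Systems) (hN : IsStrips N nm np)
    (hr : RΦ + Rq ≤ r + 1) : PolyBdd n (fun i => ‖dressedCharge W (q i) (Φ i) (N i) (nm i) r‖) :=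
  ((polyBdd_charge s N).norm_sub (near_minusGen hW s hN).poly).norm_sub (near_plusGen hW s hN hr).poly

/-- The dressed transport operator preserves the ground state space. -/
theorem rapid_cm_dressedTransport (hγ : 0 < γ) (hW : IsFilterFunction γ W) (s : Systems)
    (hS : IsStrips S lm lp) (hN : IsStrips N nm np) (hr : RΦ + Rq ≤ r + 1)
    (hg : IsFluxGapped γ p q Φ S lm r) :
    Rapid n (fun i => ‖cm (dressedTransport W q Φ S lm N nm np r i)
      (ℙ (hamiltonian (Φ i)))‖) := by
  let G := fun i => fluxGen W (q i) (Φ i) (S i) (lm i) r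
  let Gl := fun i => ∑ x, leftField W q Φ S lm nm np r i x
  let Dm := fun i => dressedMinus W (q i) (Φ i) (N i) (nm i) r
  let Np := fun i => plusGen W (q i) (Φ i) (N i) (nm i) r
  let X : ∀ i, Obs (n i) := dressedTransport W q Φ S lm N nm np r
  let Y := fun i => (conjExp (-(2 * π)) (G i) (Dm i) - conjExp (-(2 * π)) (Gl i) (Dm i)) -
      (conjExp (-(2 * π)) (G i) (Np i) - Np i)
  let Z := fun i => dressedCharge W (q i) (Φ i) (N i) (nm i) r
  have hg0 := hg.gapped
  have hGs : ∀ i, IsSelfAdjoint (G i) := fun i => isSelfAdjoint_fluxGen (s i)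
  have hql := qfield_left (S := S) (lm := lm) (nm := nm) (np := np) (r := r) hW s
  have hqr := qfield_right (S := S) (lm := lm) (nm := nm) (np := np) (r := r) hW s
  have hX : Near (sdists nm) X := near_dressedTransport hW s hN
  have hXs : ∀ i, IsSelfAdjoint (X i) := isSelfAdjoint_dressedTransport s
  have hNp : Near (sdists np) Np := near_plusGen hW s hN hr
  have hsum : ∀ i, ∑ x, (leftField W q Φ S lm nm np r i x + rightField W q Φ S lm nm np r i x) = G i :=
    fun i => by rw [sum_add_distrib, sum_left_add_right hW s]
  have hY : Near (sdists np) Y := by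
    have h1 := Near.conj_sub_conj (D := sdists nm) (D' := sdists np)
      isLip_sdists isLip_sdists (fun i => sdist_le_size _) hql
      (isSelfAdjoint_left s) hqr (isSelfAdjoint_right s) (near_right hW s)
      (separated_closer fun i => (hN i).symm) (dressedMinus_mem (r := r) hW s)
      (near_cm_dressed_left hW s hN) (near_cm_dressed_right hW s hN) Real.two_pi_pos.le
    simp only [sum_left_add_right hW s] at h1
    have h2 := hNp.conj isLip_sdists (hql.add hqr) (fun i => by rw [hsum]; exact hGs i)
      (T := 2 * π) (t := fun _ => -(2 * π)) (fun _ => by rw [abs_neg, abs_of_pos Real.two_pi_pos])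
    simp only [hsum] at h2
    exact h1.sub (h2.sub hNp)
  have hYs : ∀ i, IsSelfAdjoint (Y i) := fun i =>
    ((isSelfAdjoint_conjExp _ (hGs i) (s i).isSelfAdjoint_dressedMinus).sub
      (isSelfAdjoint_conjExp _ (isSelfAdjoint_left s i) (s i).isSelfAdjoint_dressedMinus)).sub
      ((isSelfAdjoint_conjExp _ (hGs i) (s i).isSelfAdjoint_plusGen).sub (s i).isSelfAdjoint_plusGen)
  -- `X` and `Y` are the contributions of the two lines to the change of the doubly dressed charge.
  -- Both that charge and the flux insertion preserve the ground states, hence so does the sum, and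
  -- the energy estimate passes this on to `X`.
  have hXY : ∀ i, X i + Y i = conjExp (-(2 * π)) (G i) (Z i) - Z i := fun i => by
    have e : Z i = Dm i - Np i := rfl
    rw [e, conjExp_sub]
    simp only [X, Y, dressedTransport, Dm, Gl]
    abel
  have hZc : ∀ i, Commute (Z i) (ℙ (hamiltonian (Φ i))) := fun i =>
    (hg0 i).commute_dressed hγ hW (s i)
  have hZp : PolyBdd n fun i => ‖Z i‖ := polyBdd_dressedCharge hW s hN hr
  have hXYc : Rapid n fun i => ‖cm (X i + Y i) (ℙ (hamiltonian (Φ i)))‖ := by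
    refine ((rapid_groundProj_flux hγ hW s hS hr hg).mul_poly
      ((PolyBdd.const 2).mul hZp)).mono fun i => ?_
    rw [hXY, sub_cm, cm_eq_zero.2 (hZc i), sub_zero]
    exact (norm_cm_conjExp_le (hGs i) (hZc i) _).trans (le_of_eq (mul_comm _ _))
  have hHp : PolyBdd n fun i => ‖hamiltonian (Φ i)‖ := by
    have := (sfield_hamiltonian s).qfield.sum_poly
    simpa only [← hamiltonian_eq_sum] using this
  have hl := near_hamiltonian_left (nm := nm) (np := np) s
  have hrt := near_hamiltonian_right (nm := nm) (np := np) s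
  have r1 := hl.rapid_cm hY (separated_closer hN).symm
  have r2 := hX.rapid_cm hrt (separated_closer fun i => (hN i).symm)
  have r3 := hX.rapid_cm hY (separated_lines hN)
  have hoff : Rapid n (fun i => ‖(1 - ℙ (hamiltonian (Φ i))) * X i *
      ℙ (hamiltonian (Φ i))‖) := by
    have h := ((((r1.mul_poly ((PolyBdd.const 2).mul hX.poly)).add
      (r2.mul_poly ((PolyBdd.const 2).mul hY.poly))).add (r3.mul_poly ((PolyBdd.const 2).mul hrt.poly))).add
      (hXYc.mul_poly (((PolyBdd.const 2).mul hHp).mul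
        (hX.poly.norm_add hY.poly)))).const_mul (inv_nonneg.2 hγ.le)
    refine Rapid.of_sq h fun i => ?_
    refine ((hg0 i).norm_sq_le_of_add hγ (s i).isSelfAdjoint_hamiltonian
      (hamiltonian_eq_left_add_right (fun i => closer (nm i) (np i)) i) (hXs i) (hYs i)).trans
      (le_of_eq ?_)
    ring
  refine (hoff.const_mul two_pos.le).mono fun i => ?_
  have := norm_cm_groundProj_le (H := hamiltonian (Φ i)) (X i)
  rw [(hXs i).star_eq] at this
  linarith

/-- The two operators differ by the change of the dressing at `nm`. There the left flow agrees with
the full one, which preserves the ground state projection and hence the expectation. -/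
theorem rapid_tr_dressedTransport (hγ : 0 < γ) (hW : IsFilterFunction γ W) (s : Systems)
    (hS : IsStrips S lm lp) (hN : IsStrips N nm np) (hr : RΦ + Rq ≤ r + 1)
    (hg : IsFluxGapped γ p q Φ S lm r) :
    Rapid n (fun i => ‖tr (ℙ (hamiltonian (Φ i)) * transportMinus W q Φ S lm N nm np r i) -
      tr (ℙ (hamiltonian (Φ i)) * dressedTransport W q Φ S lm N nm np r i)‖) := by
  let G := fun i => fluxGen W (q i) (Φ i) (S i) (lm i) r
  let Gl := fun i => ∑ x, leftField W q Φ S lm nm np r i x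
  let Nm := fun i => minusGen W (q i) (Φ i) (N i) (nm i) r
  have hg0 := hg.gapped
  have hGs : ∀ i, IsSelfAdjoint (G i) := fun i => isSelfAdjoint_fluxGen (s i)
  have hNm : Near (sdists nm) Nm := near_minusGen hW s hN
  have h1 := (hNm.rapid_conj_left (S := S) (lm := lm) (r := r) hW s hN).comp
    (fun i : ι => ((i, ⟨2 * π, Real.two_pi_pos.le, le_rfl⟩) : ι × Set.Icc 0 (2 * π)))
  have h2 := (rapid_groundProj_flux hγ hW s hS hr hg).mul_poly hNm.poly
  refine ((h1.const_mul (Nat.cast_nonneg p)).add (h2.const_mul (c := 2 * p) (by positivity))).mono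
    fun i => ?_
  set P := ℙ (hamiltonian (Φ i)) with hP
  have e1 : tr (P * transportMinus W q Φ S lm N nm np r i) -
      tr (P * dressedTransport W q Φ S lm N nm np r i) =
      tr (P * (conjExp (-(2 * π)) (Gl i) (Nm i) - conjExp (-(2 * π)) (G i) (Nm i))) +
        (tr (P * conjExp (-(2 * π)) (G i) (Nm i)) - tr (P * Nm i)) := by
    rw [mul_sub, tr_sub, sub_add_sub_cancel, ← tr_sub, ← mul_sub, ← tr_sub, ← mul_sub]
    congr 2
    simp only [transportMinus, dressedTransport, dressedMinus, conjExp_sub, Gl, Nm]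
    abel
  rw [e1]
  refine (norm_add_le _ _).trans (add_le_add (norm_tr_groundProj_mul_le (hg0 i) _) ?_)
  have h3 := norm_tr_groundProj_sub_le (hg0 i) ((hg0 i).conjExp (hGs i)
    (s i).isSelfAdjoint_hamiltonian (-(2 * π))) (conjExp (-(2 * π)) (G i) (Nm i))
  rw [groundProj_conjExp (hGs i) (s i).isSelfAdjoint_hamiltonian, ← conjExp_mul, tr_conjExp,
    norm_sub_rev P] at h3
  refine h3.trans (mul_mono_left ?_)
  exact mul_mono_left (norm_conjExp_le _ (hGs i) _)

/-- The transported charge is an integer. -/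
theorem rapid_tr_transportMinus_sub_round (hγ : 0 < γ) (hW : IsFilterFunction γ W) (s : Systems)
    (hS : IsStrips S lm lp) (hN : IsStrips N nm np) (hr : RΦ + Rq ≤ r + 1)
    (hg : IsFluxGapped γ p q Φ S lm r) :
    ∃ m : ι → ℤ, Rapid n (fun i => ‖tr (ℙ (hamiltonian (Φ i)) *
      transportMinus W q Φ S lm N nm np r i) - (m i : ℂ)‖) := by
  let P := fun i => ℙ (hamiltonian (Φ i))
  let G := fun i => fluxGen W (q i) (Φ i) (S i) (lm i) r
  let Gl := fun i => ∑ x, leftField W q Φ S lm nm np r i x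
  let Dm := fun i => dressedMinus W (q i) (Φ i) (N i) (nm i) r
  let Dc := fun i => dressedCharge W (q i) (Φ i) (N i) (nm i) r
  let A := fun i => expI (2 * π) (Dm i)
  let X : ∀ i, Obs (n i) := dressedTransport W q Φ S lm N nm np r
  let B := fun i => blockDiag (P i) (X i)
  have hg0 := hg.gapped
  have hGs : ∀ i, IsSelfAdjoint (G i) := fun i => isSelfAdjoint_fluxGen (s i)
  have hDms : ∀ i, IsSelfAdjoint (Dm i) := fun i => (s i).isSelfAdjoint_dressedMinus
  have hDcs : ∀ i, IsSelfAdjoint (Dc i) := fun i => (s i).isSelfAdjoint_dressedCharge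
  have hXs : ∀ i, IsSelfAdjoint (X i) := isSelfAdjoint_dressedTransport s
  have hBs : ∀ i, IsSelfAdjoint (B i) := fun i => isSelfAdjoint_blockDiag (hXs i)
  have hBc : ∀ i, Commute (B i) (P i) := fun i => commute_blockDiag _ _
  have hDcc : ∀ i, Commute (Dc i) (P i) := fun i => (hg0 i).commute_dressed hγ hW (s i)
  have n2 : ∀ {L : ℕ} [NeZero L] {X Y : Obs L}, ‖X‖ ≤ 1 → ‖Y‖ ≤ 1 → ‖X * Y‖ ≤ 1 := fun hX hY =>
    (norm_mul_le_of_le_one hY).trans hX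
  -- Replacing `X` by its block diagonal part costs little and yields exponents that commute with
  -- the projection exactly, as needed for computing the determinant.
  have c1 : RapidEq (fun i => expI (2 * π) (Dc i + B i) * expI (-(2 * π)) (Dc i))
      (fun i => expI (2 * π) (Dc i + X i) * expI (-(2 * π)) (Dc i)) := by
    refine ((rapid_cm_dressedTransport hγ hW s hS hN hr hg).const_mul
      (c := 2 * (2 * π)) (by have := Real.pi_pos; positivity)).mono fun i => ?_
    rw [← sub_mul]
    refine (norm_mul_le_of_le_one (norm_expI_le _ (hDcs i))).trans ((norm_expI_sub_le
      ((hDcs i).add (hBs i)) ((hDcs i).add (hXs i)) Real.two_pi_pos.le).trans ?_)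
    rw [add_sub_add_left_eq_sub, norm_sub_rev]
    have := mul_mono_right (norm_sub_blockDiag_le (hamiltonian (Φ i)) (X i)) Real.two_pi_pos.le
    refine this.trans (le_of_eq ?_)
    ring
  -- The charge dressed at one line does not preserve the ground states, the doubly dressed one
  -- does. The cocycle of `X` does not see the dressing at the distant line.
  have c2 : RapidEq (fun i => expI (2 * π) (Dm i + X i) * expI (-(2 * π)) (Dm i))
      (fun i => expI (2 * π) (Dc i + X i) * expI (-(2 * π)) (Dc i)) := by
    have := (near_dressedTransport (S := S) (lm := lm) (r := r) hW s hN).rapid_cocycle_sub hXs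
      isLip_sdists (qfield_dressed (N := N) (nm := nm) (r := r) hW s)
      (fun i => by rw [sum_dressed hW s]; exact hDms i)
      (near_plusGen (r := r) hW s hN hr).neg (fun i => (s i).isSelfAdjoint_plusGen.neg)
      (separated_lines hN) Real.two_pi_pos.le
    simp only [sum_dressed hW s, ← sub_eq_add_neg] at this
    exact this
  -- `Dm + X` is the transported `Dm`, so its exponential is the transported `A`. Being localized at
  -- `nm`, `A` may be transported by the full flux insertion instead.
  have c3 : RapidEq (fun i => expI (2 * π) (Dm i + X i) * expI (-(2 * π)) (Dm i))
      (fun i => star (expI (2 * π) (G i)) * A i * expI (2 * π) (G i) * star (A i)) := by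
    have h := ((near_expI_dressedMinus (r := r) hW s hN).rapid_conj_left (S := S) (lm := lm) (r := r)
      hW s hN).comp (fun i : ι => ((i, ⟨2 * π, Real.two_pi_pos.le, le_rfl⟩) : ι × Set.Icc 0 (2 * π)))
    refine h.mono fun i => ?_
    have e1 : Dm i + X i = conjExp (-(2 * π)) (Gl i) (Dm i) := by
      simp only [X, dressedTransport, Dm, Gl]; abel
    have e2 : star (A i) = expI (-(2 * π)) (Dm i) := star_expI _ (hDms i)
    beta_reduce
    rw [e1, expI_conjExp, e2, ← conjExp_eq_star (hGs i), ← sub_mul]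
    exact norm_mul_le_of_le_one (norm_expI_le _ (hDms i))
  have hdet := RapidEq.detOn hg0 (c1.trans (c2.symm.trans c3))
    ((PolyBdd.const 1).mono fun i => n2 (norm_expI_le _ ((hDcs i).add (hBs i)))
      (norm_expI_le _ (hDcs i)))
    ((PolyBdd.const 1).mono fun i => n2 (n2 (n2 (by rw [norm_star]; exact norm_expI_le _ (hGs i))
      (norm_expI_le _ (hDms i))) (norm_expI_le _ (hGs i)))
      (by rw [norm_star]; exact norm_expI_le _ (hDms i)))
  have hone := rapid_detOn_groupCommutator hg0 (V := fun i => expI (2 * π) (G i)) (A := A)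
    (fun i => star_expI_mul (hGs i) _) (fun i => expI_mul_star (hGs i) _)
    (fun i => star_expI_mul (hDms i) _) (fun i => expI_mul_star (hDms i) _)
    ((rapid_groundProj_flux hγ hW s hS hr hg).mono fun i => norm_cm_expI_le (hGs i) _)
    (rapid_cm_expI_dressedMinus hγ hW s hN hr hg0)
  -- Both exponents preserve the ground states, so the determinant is the exponential of the
  -- difference of their traces; the contribution of `Dc` cancels.
  have hexp : ∀ i, detOn (groundSpace (hamiltonian (Φ i)))
      (expI (2 * π) (Dc i + B i) * expI (-(2 * π)) (Dc i)) =
      cexp (I * ((2 * π : ℝ) : ℂ) * tr (P i * X i)) := fun i => by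
    have hc : Commute (Dc i + B i) (P i) := (hDcc i).add_left (hBc i)
    rw [detOn_mul_of_commute _ (Commute.expI_right hc.symm _).symm, detOn_expI _ ((hDcs i).add (hBs i)) hc,
      detOn_expI _ (hDcs i) (hDcc i), ← exp_add]
    congr 1
    change I * ((2 * π : ℝ) : ℂ) * tr (P i * (Dc i + B i)) +
      I * ((-(2 * π) : ℝ) : ℂ) * tr (P i * Dc i) = _
    rw [mul_add, tr_add, ← tr_blockDiag (hamiltonian (Φ i)) (X i)]
    push_cast
    ring
  refine ⟨fun i => round (tr (P i * X i)).re, ?_⟩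
  refine ((rapid_tr_dressedTransport hγ hW s hS hN hr hg).add (hdet.add hone)).mono fun i => ?_
  refine (norm_sub_le_norm_sub_add_norm_sub _ (tr (P i * X i)) _).trans (add_le_add le_rfl ?_)
  have him : (tr (P i * X i)).im = 0 := tr_groundProj_im (hXs i)
  have hre : ((tr (P i * X i)).re : ℂ) = tr (P i * X i) := Complex.ext (by simp) (by simp [him])
  have h4 := four_mul_abs_sub_round_le (tr (P i * X i)).re
  rw [hre, ← hexp] at h4
  have h5 : ‖tr (P i * X i) - ((round (tr (P i * X i)).re : ℤ) : ℂ)‖ =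
      |(tr (P i * X i)).re - round (tr (P i * X i)).re| := by
    rw [← Real.norm_eq_abs, ← norm_real]
    congr 1
    push_cast
    rw [hre]
  have h6 := norm_sub_le_norm_sub_add_norm_sub (detOn (groundSpace (hamiltonian (Φ i)))
      (expI (2 * π) (Dc i + B i) * expI (-(2 * π)) (Dc i)))
    (detOn (groundSpace (hamiltonian (Φ i)))
      (star (expI (2 * π) (G i)) * A i * expI (2 * π) (G i) * star (A i))) 1
  rw [h5]
  have := abs_nonneg ((tr (P i * X i)).re - round (tr (P i * X i)).re)
  linarith

end Families

/-! ### Application to the Hall geometry -/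

section

/-- The even sizes beyond `L₀`. -/
def LargeSize (L₀ : ℕ) : Type := {i : EvenSize // L₀ < i.1}

theorem Rapid.isRapidlySmall {L₀ : ℕ} {f : ∀ (L : ℕ) [NeZero L], ℝ}
    (h0 : ∀ (L : ℕ) [NeZero L], 0 ≤ f L)
    (h : Rapid (ι := LargeSize L₀) (fun i => i.1.1) (fun i => f i.1.1)) : IsRapidlySmall L₀ f := by
  intro k
  obtain ⟨C, hC, hb⟩ := h k
  refine ⟨C, fun L _ hL hL₀ => ?_⟩
  have hL' : (0 : ℝ) < L := by exact_mod_cast Nat.pos_of_ne_zero (NeZero.ne L)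
  rw [abs_of_nonneg (h0 L), div_eq_mul_inv]
  refine (hb ⟨⟨L, NeZero.ne L, hL⟩, hL₀⟩).trans (mul_mono_left ?_ hC)
  exact inv_anti₀ (by positivity) (pow_le_pow_left₀ hL'.le (by linarith) k)

theorem IsExtensive.range_of_ne_zero {R : ℕ} {Ψ : ∀ (L : ℕ) [NeZero L], Region L → Obs L}
    (h : IsExtensive R Ψ) {L : ℕ} [NeZero L] (hL : Even L) {X : Region L} (hX : Ψ L X ≠ 0) :
    ∀ x ∈ X, ∀ y ∈ X, gdist x y ≤ R := fun x hx y hy => by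
  by_contra hc
  exact hX (h.finiteRange L hL X ⟨x, hx, y, hy, not_le.1 hc⟩)

theorem IsCharge.exists_localSystem {q Φ : ∀ (L : ℕ) [NeZero L], Region L → Obs L} {Rq RΦ : ℕ}
    (hq : IsCharge Rq q) (hΦ : IsExtensive RΦ Φ) (hcons : IsChargeConserving q Φ) :
    ∃ mq mΦ : ℝ, ∀ i : EvenSize, LocalSystem Rq RΦ mq mΦ (q i.1) (Φ i.1) := by
  obtain ⟨mq, hmq⟩ := hq.bounded
  obtain ⟨mΦ, hmΦ⟩ := hΦ.bounded
  exact ⟨mq, mΦ, fun i => {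
    charge_selfAdjoint := hq.selfAdjoint i.1 i.2.2
    charge_mem := hq.supported i.1 i.2.2
    charge_range := fun X => hq.toIsExtensive.range_of_ne_zero i.2.2
    charge_bdd := hmq i.1 i.2.2
    integral := hq.integral i.1 i.2.2
    comm := hq.commute i.1 i.2.2
    selfAdjoint := hΦ.selfAdjoint i.1 i.2.2
    mem := hΦ.supported i.1 i.2.2
    range := fun X => hΦ.range_of_ne_zero i.2.2
    bdd := hmΦ i.1 i.2.2
    conserved := hcons i.1 i.2.2 }⟩

theorem twistHamiltonian_zero {L : ℕ} [NeZero L] (q Φ : Region L → Obs L)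
    (S l : Region L) (r : ℕ) : twistHamiltonian q Φ S l r 0 = hamiltonian Φ := by
  simp only [twistHamiltonian, twistTerm, conjExp_zero_time, ite_self, hamiltonian]

/-- For `p = 0` the normalization divides by zero, but then traces against the ground state
projection vanish as well. -/
theorem IsGapped.mul_hallConductance {L : ℕ} [NeZero L] {γ : ℝ} {p r : ℕ}
    {q Φ : Region L → Obs L} (hg : IsGapped γ p (hamiltonian Φ)) :
    p * hallConductance q Φ r = 2 * (tr (ℙ (hamiltonian Φ) *
      minusCurrent q Φ (eta L) (etaMinus L) r * reducedResolvent (hamiltonian Φ) *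
      reducedResolvent (hamiltonian Φ) * minusCurrent q Φ (nu L) (nuMinus L) r)).im := by
  rw [hallConductance, current_eq, current_eq, hg.1]
  rcases Nat.eq_zero_or_pos p with rfl | hp
  · have h := norm_tr_groundProj_mul_le hg (minusCurrent q Φ (eta L) (etaMinus L) r *
      reducedResolvent (hamiltonian Φ) * reducedResolvent (hamiltonian Φ) *
      minusCurrent q Φ (nu L) (nuMinus L) r)
    rw [Nat.cast_zero, zero_mul, norm_le_zero_iff] at h
    simp only [mul_assoc] at h ⊢
    rw [h]
    simp
  · have : (p : ℝ) ≠ 0 := by exact_mod_cast hp.ne'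
    field_simp

/-- The part of the charge transport across the line `nuMinus`. -/
def hallTransport (W : ℝ → ℝ) (q Φ : ∀ (L : ℕ) [NeZero L], Region L → Obs L) (r : ℕ)
    (L : ℕ) [NeZero L] : Obs L :=
  transportMinus (ι := Unit) (n := fun _ => L) W (fun _ => q L) (fun _ => Φ L) (fun _ => eta L)
    (fun _ => etaMinus L) (fun _ => nu L) (fun _ => nuMinus L) (fun _ => nuPlus L) r ()

section

variable {q Φ : ∀ (L : ℕ) [NeZero L], Region L → Obs L} {Rq RΦ r p L₀ : ℕ} {mq mΦ γ : ℝ}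
  {W φ : ℝ → ℝ} {U : ∀ (L : ℕ) [NeZero L], ℝ → Obs L}

theorem near_hallTransport (hW : IsFilterFunction γ W)
    (s : ∀ i : EvenSize, LocalSystem Rq RΦ mq mΦ (q i.1) (Φ i.1)) :
    Near (ι := EvenSize) (n := fun i => i.1) (fun i => sdist (nuMinus i.1))
      (fun i => hallTransport W q Φ r i.1) :=
  near_transportMinus (ι := EvenSize) (n := fun i => i.1) (S := fun i => eta i.1) (lm := fun i => etaMinus i.1)
    (r := r) hW s fun i => isStrip_nu i.2.2

theorem near_sub_hallTransport (hW : IsFilterFunction γ W) (hφ : IsDriving φ)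
    (s : ∀ i : EvenSize, LocalSystem Rq RΦ mq mΦ (q i.1) (Φ i.1)) (hr : RΦ + Rq ≤ r + 1)
    (hU : ∀ (L : ℕ) [NeZero L], Even L →
      IsParallelTransport (q L) (Φ L) (eta L) (etaMinus L) r W φ (U L)) :
    Near (ι := EvenSize) (n := fun i => i.1) (fun i => sdist (nuPlus i.1))
      (fun i => star (U i.1 1) * charge (q i.1) (nu i.1) * U i.1 1 - charge (q i.1) (nu i.1) -
        hallTransport W q Φ r i.1) :=
  near_transportPlus (ι := EvenSize) (n := fun i => i.1) (nm := fun i => nuMinus i.1) hW hφ s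
    (fun i => isStrip_eta i.2.2) (fun i => isStrip_nu i.2.2) hr fun i => hU i.1 i.2.2

theorem isTransportSplitting_hallTransport (hW : IsFilterFunction γ W) (hφ : IsDriving φ)
    (s : ∀ i : EvenSize, LocalSystem Rq RΦ mq mΦ (q i.1) (Φ i.1)) (hr : RΦ + Rq ≤ r + 1)
    (hU : ∀ (L : ℕ) [NeZero L], Even L →
      IsParallelTransport (q L) (Φ L) (eta L) (etaMinus L) r W φ (U L)) :
    IsTransportSplitting
      (fun L _ => star (U L 1) * charge (q L) (nu L) * U L 1 - charge (q L) (nu L))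
      (fun L _ => hallTransport W q Φ r L)
      (fun L _ => star (U L 1) * charge (q L) (nu L) * U L 1 - charge (q L) (nu L) -
        hallTransport W q Φ r L) where
  add := fun L _ _ => (add_sub_cancel _ _).symm
  minus := isAlmostSupported_of_near (fun L _ hL => (isStrip_nu hL).minus_nonempty)
    (near_hallTransport hW s)
  plus := isAlmostSupported_of_near (fun L _ hL => (isStrip_nu hL).plus_nonempty)
    (near_sub_hallTransport hW hφ s hr hU)
  traceless := fun L _ _ => tr_transportMinus _

theorem rapid_tr_hallTransport (hγ : 0 < γ) (hW : IsFilterFunction γ W) (hφ : IsDriving φ)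
    (s : ∀ i : EvenSize, LocalSystem Rq RΦ mq mΦ (q i.1) (Φ i.1)) (hr : RΦ + Rq ≤ r + 1)
    (hgap : ∀ (L : ℕ) [NeZero L], Even L → L₀ < L → ∀ s ∈ Set.Icc (0 : ℝ) 1,
      IsGapped γ p (twistHamiltonian (q L) (Φ L) (eta L) (etaMinus L) r (φ s))) :
    Rapid (ι := LargeSize L₀) (fun i => i.1.1) (fun i =>
      ‖tr (ℙ (hamiltonian (Φ i.1.1)) * hallTransport W q Φ r i.1.1) -
        ((2 * π * p * hallConductance (q i.1.1) (Φ i.1.1) r : ℝ) : ℂ)‖) ∧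
    ∃ m : LargeSize L₀ → ℤ, Rapid (ι := LargeSize L₀) (fun i => i.1.1) (fun i =>
      ‖tr (ℙ (hamiltonian (Φ i.1.1)) * hallTransport W q Φ r i.1.1) - (m i : ℂ)‖) := by
  have hg : ∀ i : LargeSize L₀, ∀ t ∈ Set.Icc 0 (2 * π),
      IsGapped γ p (plusTwist (q i.1.1) (Φ i.1.1) (eta i.1.1) (etaMinus i.1.1) r (-t)) :=
    fun i t ht => (s i.1).isGapped_plusTwist hφ (hgap i.1.1 i.1.2.2 i.2) ht
  have hg0 := IsFluxGapped.gapped (n := fun i : LargeSize L₀ => i.1.1) hg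
  have hS : ∀ i : LargeSize L₀, IsStrip (eta i.1.1) (etaMinus i.1.1) (etaPlus i.1.1) :=
    fun i => isStrip_eta i.1.2.2
  have hN : ∀ i : LargeSize L₀, IsStrip (nu i.1.1) (nuMinus i.1.1) (nuPlus i.1.1) :=
    fun i => isStrip_nu i.1.2.2
  have s' : ∀ i : LargeSize L₀, LocalSystem Rq RΦ mq mΦ (q i.1.1) (Φ i.1.1) := fun i => s i.1
  refine ⟨?_, rapid_tr_transportMinus_sub_round (ι := LargeSize L₀) (n := fun i => i.1.1)
    hγ hW s' hS hN hr hg⟩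
  have h := rapid_tr_transportMinus (ι := LargeSize L₀) (n := fun i => i.1.1) hγ hW s' hS hN hr hg
  refine h.mono fun i => le_of_eq ?_
  rw [mul_assoc (2 * π), (hg0 i).mul_hallConductance]
  rfl

end

end

end HallPump

end

open HallPump in
theorem mainTheorem2
    (q Φ : ∀ (L : ℕ) [NeZero L], Finset (Torus L) → Obs L)
    (Rq RΦ r : ℕ)
    (hq : IsCharge Rq q)
    (hΦ : IsExtensive RΦ Φ)
    (hcons : IsChargeConserving q Φ)
    (hr : RΦ + Rq ≤ r + 1)
    (φ : ℝ → ℝ) (hφ : IsDriving φ)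
    (γ : ℝ) (hγ : 0 < γ) (p L₀ : ℕ)
    (hgap : ∀ (L : ℕ) [NeZero L], Even L → L₀ < L → ∀ s ∈ Set.Icc (0 : ℝ) 1,
      IsGapped γ p (twistHamiltonian (q L) (Φ L) (eta L) (etaMinus L) r (φ s)))
    (W : ℝ → ℝ) (hW : IsFilterFunction γ W)
    (U : ∀ (L : ℕ) [NeZero L], ℝ → Obs L)
    (hU : ∀ (L : ℕ) [NeZero L], Even L →
      IsParallelTransport (q L) (Φ L) (eta L) (etaMinus L) r W φ (U L)) :
    IsRapidlySmall L₀ (fun L _ =>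
      ‖U L 1 - expI (2 * Real.pi)
        (twistAntitwistGenMinus (q L) (Φ L) (eta L) (etaMinus L) r W 0 - charge (q L) (eta L))‖) ∧
    (∃ Tm Tp : ∀ (L : ℕ) [NeZero L], Obs L,
      IsTransportSplitting
        (fun L _ => star (U L 1) * charge (q L) (nu L) * U L 1 - charge (q L) (nu L)) Tm Tp) ∧
    ∀ Tm Tp : ∀ (L : ℕ) [NeZero L], Obs L,
      IsTransportSplitting
        (fun L _ => star (U L 1) * charge (q L) (nu L) * U L 1 - charge (q L) (nu L)) Tm Tp →
      IsRapidlySmall L₀ (fun L _ =>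
        ‖tr (groundProj (hamiltonian (Φ L)) * Tm L) -
          ((2 * Real.pi * p * hallConductance (q L) (Φ L) r : ℝ) : ℂ)‖) ∧
      ∃ n : ∀ (L : ℕ) [NeZero L], ℤ, IsRapidlySmall L₀ (fun L _ =>
        ‖tr (groundProj (hamiltonian (Φ L)) * Tm L) - ((n L : ℤ) : ℂ)‖) := by
  obtain ⟨mq, mΦ, sys⟩ := hq.exists_localSystem hΦ hcons
  have hsplit := isTransportSplitting_hallTransport hW hφ sys hr hU
  refine ⟨?_, ⟨_, _, hsplit⟩, fun Tm Tp hT => ?_⟩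
  · refine Rapid.isRapidlySmall (fun L _ => norm_nonneg _) ?_
    have h := RapidEq.comp (rapidEq_parallel (ι := EvenSize) (n := fun i => i.1) hW hφ sys
      (fun i => isStrip_eta i.2.2) hr fun i => hU i.1 i.2.2) (fun i : LargeSize L₀ => i.1)
    simp only [twistAntitwistGenMinus_zero]
    exact h
  -- Both claims are known for the constructed splitting. They carry over to an arbitrary one by
  -- uniqueness, at the cost of a factor equal to the rank of the projection.
  · have hsub := (rapid_splitting_sub hT hsplit (near_hallTransport hW sys).poly
      (near_sub_hallTransport hW hφ sys hr hU).poly).comp (fun i : LargeSize L₀ => i.1)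
    obtain ⟨hall, m, hm⟩ := rapid_tr_hallTransport hγ hW hφ sys hr hgap
    have hdiff : ∀ i : LargeSize L₀, ‖tr (groundProj (hamiltonian (Φ i.1.1)) * Tm i.1.1) -
        tr (groundProj (hamiltonian (Φ i.1.1)) * hallTransport W q Φ r i.1.1)‖ ≤
          p * ‖Tm i.1.1 - hallTransport W q Φ r i.1.1‖ := fun i => by
      have hg := hgap i.1.1 i.1.2.2 i.2 0 ⟨le_rfl, zero_le_one⟩
      rw [hφ.zero, twistHamiltonian_zero] at hg
      rw [← tr_sub, ← mul_sub]
      exact norm_tr_groundProj_mul_le hg _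
    have hsub' := hsub.const_mul (Nat.cast_nonneg (α := ℝ) p)
    refine ⟨Rapid.isRapidlySmall (fun L _ => norm_nonneg _) ((hsub'.add hall).mono fun i => ?_),
      -- The integers found above exist only for even sizes beyond `L₀`. Rounding the trace itself
      -- defines one for every size and at most doubles the error.
      fun L _ => round (tr (groundProj (hamiltonian (Φ L)) * Tm L)).re,
      Rapid.isRapidlySmall (fun L _ => norm_nonneg _)
        (((hsub'.add hm).const_mul zero_le_two).mono fun i => ?_)⟩
    · exact (norm_sub_le_norm_sub_add_norm_sub _ _ _).trans (add_le_add (hdiff i) le_rfl)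
    · refine (norm_sub_round_le _ (m i)).trans (mul_le_mul_of_nonneg_left ?_ zero_le_two)
      exact (norm_sub_le_norm_sub_add_norm_sub _ _ _).trans (add_le_add (hdiff i) le_rfl)
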